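/- **Setting.** Let $\Pi=(0,1)\times\mathbb R$ with points $(x,y)$, and consider $$\mathcal D\begin{pmatrix}u\\v\end{pmatrix}+\delta\mathcal P\begin{pmatrix}u\\v\end{pmatrix}=\omega\begin{pmatrix}u\\v\end{pmatrix}\ \text{in }\Pi,\qquad u(0,y)=0,\quad v(1,y)=0,\qquad \mathcal D=\begin{pmatrix}0&-i\partial_x+\partial_y\\-i\partial_x-\partial_y&0\end{pmatrix},\tag{1}$$ where $\delta\in\mathbb R$ and $\mathcal P$ is a real continuous function on $\overline\Pi$ with $|\mathcal P|\le1$ and $\mathcal P(x,y)=0$ for $|y|>R_0$ ($R_0>0$). Derivatives are understood in the sense of distributions and boundary values in the sense of traces (Green's formula). For $s\in\mathbb R$ let $\mathcal H[s]$ be the space of $w=(u,v)$ satisfying the boundary conditions with $e^{s|y|}w,\ e^{s|y|}\mathcal Dw\in L^2(\Pi)$. For $\gamma>0$ put $\mathcal H^\pm_\gamma=\mathcal H[\pm\gamma]$, and $\mathcal H_0=\mathcal H[0]$. A *trapped mode* is a non-trivial solution of (1) in $\mathcal H_0$. **Energies.** For $j\ge1$ let $\kappa_j$ be the point of $[(j-1)\pi,j\pi)$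 where $\kappa^{-2}\sin^2\kappa$ (equal to $1$ at $\kappa=0$) is maximal, and let $\omega_j>0$ be given by $\omega_j^{-2}$ = this maximum. Fix $N\ge2$ and let $\omega=\omega_\varepsilon$ with $\omega_\varepsilon^{-1}=\omega_N^{-1}+\varepsilon$, $\varepsilon>0$. **Waves.** Put $w[j,\lambda,\kappa](x,y)=e^{-i\lambda y}\big(\sin\kappa x,\ (-1)^{j+1}i\sin\kappa(x-1)\big)$ and $q(w,\tilde w)=-\int_0^1\big(u\overline{\tilde v}-v\overline{\tilde u}\big)(x,0)\,dx$ for $w=(u,v)$, $\tilde w=(\tilde u,\tilde v)$. * For $j<N$ let $\kappa_j^+\in((j-1)\pi,\kappa_j)$ (for $j\ge2$ only) and $\kappa_j^-\in(\kappa_j,j\pi)$ be the solutions of $\kappa^{-1}\sin\kappa=(-1)^{j+1}\omega^{-1}$, $\lambda_j^\pm=\kappa_j^\pm\cot\kappa_j^\pm$, and $\mathbf w_j^\pm=\sqrt{\omega/|\lambda_j^\pm-1|}\;w[j,\lambda_j^\pm,\kappa_j^\pm]$. * Let $\kappa(\lambda)=\sqrt{\omega^2-\lambda^2}$ and $g(\lambda)=\sin\kappa(\lambda)/\kappa(\lambda)$.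 For small $a>0$ and then small $\varepsilon>0$ the disc $|\lambda-1|\le a$ contains exactly two solutions of $g(\lambda)=(-1)^{N+1}\omega^{-1}$, namely $\lambda_+$ with $\Im\lambda_+>0$ and $\lambda_-=\overline{\lambda_+}$. Put $w_N^\pm=w[N,\lambda_\pm,\kappa(\lambda_\pm)]$, $\gamma_\pm=1/g'(\lambda_\pm)$, $$\mathbf w^{\varepsilon+}=\gamma_+w_N^++\gamma_-w_N^-,\qquad \mathbf w^{\varepsilon-}=\gamma_+(\lambda_+-1)w_N^++\gamma_-(\lambda_--1)w_N^-,\qquad \alpha_\varepsilon=\frac{iq(\mathbf w^{\varepsilon+},\mathbf w^{\varepsilon+})}{-iq(\mathbf w^{\varepsilon+},\mathbf w^{\varepsilon-})},$$ $$\mathbf w_N^+=\frac{\mathbf w^{\varepsilon+}+\alpha_\varepsilon\mathbf w^{\varepsilon-}}{N_1},\qquad \mathbf w_N^-=\frac{\mathbf w^{\varepsilon+}}{N_2},\qquad N_1,N_2>0\ \text{ such that }\ q(\mathbf w_N^\pm,\mathbf w_N^\pm)=\pm i.$$ Let $\alpha_1=\gamma_+(1+\alpha_\varepsilon(\lambda_+-1))/N_1$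 and $\alpha_2=\gamma_+/N_2$ be the coefficients of $w_N^+$ in $\mathbf w_N^+$ and $\mathbf w_N^-$, and $d(\varepsilon)=\alpha_1/\alpha_2$. **Scattering matrix.** Let $\chi_\pm$ be real smooth functions of $y$ with $\chi_\pm(y)=1$, $\chi_\mp(y)=0$ for $\pm y>R_0$. For the $2N-1$ channels $(k,\tau)\in\{(1,-),(2,\pm),\dots,(N,\pm)\}$ put $V_k^{\pm}=\chi_\pm\mathbf w_k^\pm$ and $W_k^{\mp}=\chi_\pm\mathbf w_k^\mp$. A $(2N-1)\times(2N-1)$ matrix $\mathbf S=(\mathbf S_{k\tau}^{j\theta})$ is the *augmented scattering matrix* if for every channel $(k,\tau)$ problem (1) has a solution $z_k^\tau\in\mathcal H_\gamma^-$ with $$z_k^\tau-V_k^\tau-\sum_{(j,\theta)}\mathbf S_{k\tau}^{j\theta}W_j^\theta\in\mathcal H^+_\gamma .$$ $\mathbf S_{\dagger\dagger}$ is its $2\times2$ block for the channels $(N,+),(N,-)$, and $\Upsilon=\begin{pmatrix}0&1\\1&0\end{pmatrix}$. **Theorem.** Let $N\ge2$. There are $a>0$ and $\gamma_0>0$ such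 that for every $\gamma\in(0,\gamma_0]$ there are $\varepsilon_0,\delta_0>0$ with the following property. For every $\varepsilon\in(0,\varepsilon_0]$ the roots $\lambda_\pm$ above exist in the disc $|\lambda-1|\le a$, and $|d(\varepsilon)|=1$. Moreover, for all $R_0$, $\mathcal P$, $\chi_\pm$ as above and all real $\delta$ with $|\delta|\le\delta_0$, the augmented scattering matrix $\mathbf S=\mathbf S(\varepsilon,\delta)$ exists and is unique, and problem (1) with $\omega=\omega_\varepsilon$ has a trapped mode if and only if the matrix $\mathbf S_{\dagger\dagger}+d(\varepsilon)\Upsilon$ is degenerate, i.e. $\det(\mathbf S_{\dagger\dagger}+d(\varepsilon)\Upsilon)=0$. -/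

import Mathlib

open Set Filter Topology MeasureTheory

noncomputable section

namespace ZigzagRibbon

/-! ### The strip, weighted spaces and the Dirac operator -/

/-- The unit strip `Π = (0,1) × ℝ`; a point is written `p = (x, y)`. -/
def strip : Set (ℝ × ℝ) := Ioo (0 : ℝ) 1 ×ˢ univ

/-- Vector functions `w = (u, v)`; only their values on the strip matter. -/
abbrev Field2 := ℝ × ℝ → ℂ × ℂ

/-- Partial derivative in `x`. -/
def dx (φ : ℝ × ℝ → ℂ) (p : ℝ × ℝ) : ℂ := fderiv ℝ φ p (1, 0)

/-- Partial derivative in `y`. -/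
def dy (φ : ℝ × ℝ → ℂ) (p : ℝ × ℝ) : ℂ := fderiv ℝ φ p (0, 1)

/-- `DiracEq w f`: the function `w = (u, v)` satisfies `𝒟 w = f` in the strip, that is
`(-i∂ₓ + ∂_y) v = f₁` and `(-i∂ₓ - ∂_y) u = f₂` in the sense of distributions, together with the
boundary conditions `v(1, y) = 0` and `u(0, y) = 0` in the sense of traces.
The trace conditions are expressed by Green's formula: in the equation for `v` the test functions
vanish near the side `x = 0` but not necessarily at `x = 1`, and in the equation for `u` they
vanish near the side `x = 1` but not necessarily at `x = 0`. -/
def DiracEq (w f : Field2) : Prop :=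
  (∀ φ : ℝ × ℝ → ℂ, ContDiff ℝ (⊤ : ℕ∞) φ → HasCompactSupport φ → tsupport φ ⊆ {p | 0 < p.1} →
    ∫ p in strip, (w p).2 * (-Complex.I * dx φ p + dy φ p) = -∫ p in strip, (f p).1 * φ p) ∧
  (∀ φ : ℝ × ℝ → ℂ, ContDiff ℝ (⊤ : ℕ∞) φ → HasCompactSupport φ → tsupport φ ⊆ {p | p.1 < 1} →
    ∫ p in strip, (w p).1 * (-Complex.I * dx φ p - dy φ p) = -∫ p in strip, (f p).2 * φ p)

/-- The weighted space of all `f` with `e^{s|y|} f ∈ L²(Π)`. -/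
def MemL (s : ℝ) (f : Field2) : Prop :=
  MemLp (fun p => Real.exp (s * |p.2|) • f p) 2 (volume.restrict strip)

/-- The space `ℋ` with weight `e^{s|y|}`: `w` and `𝒟 w` are in the weighted `L²` space and `w`
satisfies the boundary conditions. The values `s = γ`, `s = -γ`, `s = 0` give
`ℋ_γ⁺`, `ℋ_γ⁻` and `ℋ₀` (the domain of the self-adjoint operator `𝒟`). -/
def MemH (s : ℝ) (w : Field2) : Prop :=
  MemL s w ∧ ∃ f : Field2, MemL s f ∧ DiracEq w f

/-- `w` solves `𝒟 w + δ 𝒫 w = ω w` with the boundary conditions. -/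
def SolvesDirac (ω δ : ℝ) (P : ℝ × ℝ → ℝ) (w : Field2) : Prop :=
  DiracEq w (fun p => ((ω - δ * P p : ℝ) : ℂ) • w p)

/-- A trapped mode: a nontrivial solution in `ℋ₀`. -/
def IsTrappedMode (ω δ : ℝ) (P : ℝ × ℝ → ℝ) (w : Field2) : Prop :=
  MemH 0 w ∧ SolvesDirac ω δ P w ∧ ¬ (w =ᵐ[volume.restrict strip] 0)

/-- Admissible potentials: real, continuous on the closed strip, supported in `|y| ≤ R₀`,
bounded by `1`. -/
structure IsPotential (R₀ : ℝ) (P : ℝ × ℝ → ℝ) : Prop where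
  continuousOn : ContinuousOn P (Icc (0 : ℝ) 1 ×ˢ univ)
  support : ∀ p ∈ Icc (0 : ℝ) 1 ×ˢ (univ : Set ℝ), R₀ < |p.2| → P p = 0
  bound : ∀ p ∈ strip, |P p| ≤ 1

/-! ### Thresholds -/

/-- The interval `[(j-1)π, jπ)`. -/
def band (j : ℕ) : Set ℝ := Ico (((j : ℝ) - 1) * Real.pi) ((j : ℝ) * Real.pi)

/-- `κ_j`: the (unique) point of `[(j-1)π, jπ)` at which `κ⁻² sin² κ` attains its maximum. -/
def kappaThr (j : ℕ) : ℝ :=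
  sSup {κ | κ ∈ band j ∧ IsMaxOn (fun t => Real.sinc t ^ 2) (band j) κ}

/-- The threshold `ω_j`, given by `ω_j⁻² = κ_j⁻² sin² κ_j`. -/
def omegaThr (j : ℕ) : ℝ := |Real.sinc (kappaThr j)|⁻¹

/-- The energy `ω_ε`, given by `ω_ε⁻¹ = ω_N⁻¹ + ε`. -/
def omegaEps (N : ℕ) (ε : ℝ) : ℝ := ((omegaThr N)⁻¹ + ε)⁻¹

/-! ### Waves of the unperturbed problem

A sign `±` is a Boolean, `true` standing for `+` and `false` for `-`. -/

/-- `e^{-iλy} (sin κx, (-1)^{j+1} i sin κ(x-1))`. -/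
def expWave (j : ℕ) (lam κ : ℂ) : Field2 := fun p =>
  Complex.exp (-Complex.I * lam * p.2) •
    (Complex.sin (κ * p.1), (-1) ^ (j + 1) * Complex.I * Complex.sin (κ * ((p.1 : ℂ) - 1)))

/-- `κ_j^±`: the (unique) solution of `κ⁻¹ sin κ = (-1)^{j+1} ω⁻¹` in `((j-1)π, κ_j)` for the
sign `+` and in `(κ_j, jπ)` for the sign `-`. -/
def kappaOsc (ω : ℝ) (j : ℕ) : Bool → ℝ
  | true => sInf {κ | ((j : ℝ) - 1) * Real.pi < κ ∧ κ < kappaThr j ∧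
      Real.sinc κ = (-1) ^ (j + 1) / ω}
  | false => sSup {κ | kappaThr j < κ ∧ κ < (j : ℝ) * Real.pi ∧
      Real.sinc κ = (-1) ^ (j + 1) / ω}

/-- `λ_j^± = κ_j^± cot κ_j^±`. -/
def lamOsc (ω : ℝ) (j : ℕ) (τ : Bool) : ℝ :=
  kappaOsc ω j τ * (Real.cos (kappaOsc ω j τ) / Real.sin (kappaOsc ω j τ))

/-- The normalized oscillatory wave `𝐰_j^±`, `j < N`. -/
def oscWave (ω : ℝ) (j : ℕ) (τ : Bool) : Field2 :=
  ((√ω / √|lamOsc ω j τ - 1| : ℝ) : ℂ) • expWave j (lamOsc ω j τ) (kappaOsc ω j τ)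

/-- `κ(λ) = √(ω_ε² - λ²)`, principal branch. -/
def kappaOf (N : ℕ) (ε : ℝ) (lam : ℂ) : ℂ :=
  ((omegaEps N ε : ℂ) ^ 2 - lam ^ 2) ^ (1 / 2 : ℂ)

/-- `g(λ, ε) = sin κ(λ) / κ(λ)` (an entire function of `λ`, with the value `1` where
`κ(λ) = 0`). -/
def gFun (N : ℕ) (ε : ℝ) (lam : ℂ) : ℂ :=
  if kappaOf N ε lam = 0 then 1 else Complex.sin (kappaOf N ε lam) / kappaOf N ε lam

/-- `lam` is the root `λ₊(ε)`, in the open upper half-plane: the closed disc of radius `a` about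
the threshold value `1` contains exactly two solutions of `g(λ, ε) = (-1)^{N+1} ω_ε⁻¹`, namely
`λ₊` and `λ₋ = conj λ₊`. -/
structure IsLambdaPlus (N : ℕ) (ε a : ℝ) (lam : ℂ) : Prop where
  im_pos : 0 < lam.im
  mem_disc : ‖lam - 1‖ ≤ a
  roots : ∀ z : ℂ, ‖z - 1‖ ≤ a →
    (gFun N ε z = (-1) ^ (N + 1) / (omegaEps N ε : ℂ) ↔ z = lam ∨ z = (starRingEnd ℂ) lam)

/-- The wave `w_N` with the wave vector `lam`. -/
def thrWave (N : ℕ) (ε : ℝ) (lam : ℂ) : Field2 := expWave N lam (kappaOf N ε lam)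

/-- `(∂g/∂λ (λ, ε))⁻¹`. -/
def gammaCoef (N : ℕ) (ε : ℝ) (lam : ℂ) : ℂ := (deriv (gFun N ε) lam)⁻¹

/-- `γ₊ w_N⁺ + γ₋ w_N⁻`, where `lam = λ₊`. -/
def waveEpsPlus (N : ℕ) (ε : ℝ) (lam : ℂ) : Field2 :=
  gammaCoef N ε lam • thrWave N ε lam +
    gammaCoef N ε ((starRingEnd ℂ) lam) • thrWave N ε ((starRingEnd ℂ) lam)

/-- `γ₊ (λ₊ - 1) w_N⁺ + γ₋ (λ₋ - 1) w_N⁻`, where `lam = λ₊`. -/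
def waveEpsMinus (N : ℕ) (ε : ℝ) (lam : ℂ) : Field2 :=
  (gammaCoef N ε lam * (lam - 1)) • thrWave N ε lam +
    (gammaCoef N ε ((starRingEnd ℂ) lam) * ((starRingEnd ℂ) lam - 1)) •
      thrWave N ε ((starRingEnd ℂ) lam)

/-- The symplectic form `q(w, w') = -∫₀¹ (u conj v' - v conj u') dx`, taken at `y = 0`
(for solutions of the unperturbed problem it does not depend on `y`). -/
def qForm (w w' : Field2) : ℂ :=
  -∫ x in (0 : ℝ)..1, ((w (x, 0)).1 * (starRingEnd ℂ) (w' (x, 0)).2 -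
    (w (x, 0)).2 * (starRingEnd ℂ) (w' (x, 0)).1)

/-- `α_ε = a^ε / b^ε`. -/
def alphaEps (N : ℕ) (ε : ℝ) (lam : ℂ) : ℂ :=
  (Complex.I * qForm (waveEpsPlus N ε lam) (waveEpsPlus N ε lam)) /
    (-Complex.I * qForm (waveEpsPlus N ε lam) (waveEpsMinus N ε lam))

/-- The normalizing factor `N₁^ε > 0`, determined by `q(𝐰_N⁺, 𝐰_N⁺) = i`. -/
def norm1 (N : ℕ) (ε : ℝ) (lam : ℂ) : ℝ :=
  √(-Complex.I * qForm (waveEpsPlus N ε lam + alphaEps N ε lam • waveEpsMinus N ε lam)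
    (waveEpsPlus N ε lam + alphaEps N ε lam • waveEpsMinus N ε lam)).re

/-- The normalizing factor `N₂^ε > 0`, determined by `q(𝐰_N⁻, 𝐰_N⁻) = -i`. -/
def norm2 (N : ℕ) (ε : ℝ) (lam : ℂ) : ℝ :=
  √(Complex.I * qForm (waveEpsPlus N ε lam) (waveEpsPlus N ε lam)).re

/-- The threshold waves `𝐰_N^±`. -/
def thrWaveNormalized (N : ℕ) (ε : ℝ) (lam : ℂ) : Bool → Field2
  | true => ((norm1 N ε lam : ℂ)⁻¹) •
      (waveEpsPlus N ε lam + alphaEps N ε lam • waveEpsMinus N ε lam)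
  | false => ((norm2 N ε lam : ℂ)⁻¹) • waveEpsPlus N ε lam

/-- The coefficient of `w_N⁺` in `𝐰_N⁺`. -/
def alpha1 (N : ℕ) (ε : ℝ) (lam : ℂ) : ℂ :=
  gammaCoef N ε lam * (1 + alphaEps N ε lam * (lam - 1)) / (norm1 N ε lam : ℂ)

/-- The coefficient of `w_N⁺` in `𝐰_N⁻`. -/
def alpha2 (N : ℕ) (ε : ℝ) (lam : ℂ) : ℂ := gammaCoef N ε lam / (norm2 N ε lam : ℂ)

/-- `d(ε) = α₁ / α₂`. -/
def dCoef (N : ℕ) (ε : ℝ) (lam : ℂ) : ℂ := alpha1 N ε lam / alpha2 N ε lam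

/-! ### The augmented scattering matrix -/

/-- The channels `(1,-), (2,±), …, (N,±)`. -/
abbrev Channel (N : ℕ) : Type :=
  {c : ℕ × Bool // c ∈ (Finset.Icc 1 N ×ˢ (Finset.univ : Finset Bool)).erase (1, true)}

/-- The wave `𝐰_k^τ` of the channel `(k, τ)` at the energy `ω_ε`. -/
def channelWave (N : ℕ) (ε : ℝ) (lam : ℂ) (c : Channel N) : Field2 :=
  if c.1.1 = N then thrWaveNormalized N ε lam c.1.2 else oscWave (omegaEps N ε) c.1.1 c.1.2

/-- The cutoffs `χ₊ = χ true` and `χ₋ = χ false`: smooth, `χ_±(y) = 1` and `χ_∓(y) = 0`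
for `±y > R₀`. -/
structure IsCutoffPair (R₀ : ℝ) (χ : Bool → ℝ → ℝ) : Prop where
  smooth : ∀ τ, ContDiff ℝ (⊤ : ℕ∞) (χ τ)
  plus_right : ∀ y, R₀ < y → χ true y = 1
  minus_right : ∀ y, R₀ < y → χ false y = 0
  plus_left : ∀ y, y < -R₀ → χ true y = 0
  minus_left : ∀ y, y < -R₀ → χ false y = 1

/-- The incoming waves `V_k^± = χ_± 𝐰_k^±`. -/
def waveV (N : ℕ) (ε : ℝ) (lam : ℂ) (χ : Bool → ℝ → ℝ) (c : Channel N) : Field2 :=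
  fun p => (χ c.1.2 p.2 : ℂ) • channelWave N ε lam c p

/-- The outgoing waves `W_k^∓ = χ_± 𝐰_k^∓`. -/
def waveW (N : ℕ) (ε : ℝ) (lam : ℂ) (χ : Bool → ℝ → ℝ) (c : Channel N) : Field2 :=
  fun p => (χ (!c.1.2) p.2 : ℂ) • channelWave N ε lam c p

/-- `S` is the matrix of the coefficients in `z_k^τ = V_k^τ + ∑ S_{kτ}^{jθ} W_j^θ + z̃_k^τ` with
`z_k^τ` in the kernel of `𝒟 + δ𝒫 - ω_ε : ℋ_γ⁻ → ℒ_γ⁻` and `z̃_k^τ ∈ ℋ_γ⁺`, for every channel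
`(k, τ)` (row index) and all channels `(j, θ)` (column index). -/
def IsScatteringMatrix (N : ℕ) (ε : ℝ) (lam : ℂ) (γ δ : ℝ) (P : ℝ × ℝ → ℝ)
    (χ : Bool → ℝ → ℝ) (S : Matrix (Channel N) (Channel N) ℂ) : Prop :=
  ∀ c : Channel N, ∃ z r : Field2,
    MemH (-γ) z ∧ SolvesDirac (omegaEps N ε) δ P z ∧ MemH γ r ∧
    z = waveV N ε lam χ c + ∑ c' : Channel N, S c c' • waveW N ε lam χ c' + r

/-- The channels `(N, +)` and `(N, -)`, in this order. -/
def daggerChannel {N : ℕ} (hN : 2 ≤ N) (i : Fin 2) : Channel N :=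
  ⟨(N, ![true, false] i), by
    rw [Finset.mem_erase, Finset.mem_product, Finset.mem_Icc]
    refine ⟨fun h => ?_, ⟨by omega, le_refl N⟩, Finset.mem_univ _⟩
    have h1 : N = 1 := congrArg Prod.fst h
    omega⟩

/-- The block `S_††`. -/
def daggerBlock {N : ℕ} (hN : 2 ≤ N) (S : Matrix (Channel N) (Channel N) ℂ) :
    Matrix (Fin 2) (Fin 2) ℂ :=
  S.submatrix (daggerChannel hN) (daggerChannel hN)

/-- The swap matrix `Υ`. -/
def swapMatrix : Matrix (Fin 2) (Fin 2) ℂ := !![0, 1; 1, 0]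

end ZigzagRibbon

end

/-!
Solvability in weighted spaces. After the Fourier transform along the ribbon on the line
`Im λ = ∓s`, the problem without potential becomes a two-point problem on the cross-section, with
a resolvent bounded by the inverse of the characteristic function `charFun`. At the energies just
below and at the threshold this function has no zero on the lines `Im λ = ±γ`: compactness
(`exists_nearThreshold`) leaves as zeros near the real axis only the real `λ_j^±` with `j < N` and
the pair `λ_±`, which merges into `1` at the threshold. So the bounds `LineBound` hold uniformly
in `ε`, by compactness again (`exists_lineBound_threshold`), and Plancherel's theorem carries them
to weak solutions. They absorb a small potential, and give uniqueness in the space with weight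
`e^{γy}` (`LineBound.ae_eq_zero`) and, by duality, existence (`LineBound.exists_solution`).

Asymptotics. The flux form `q` is constant along the ribbon where the potential vanishes
(`exists_qY_const`). For fixed `ε` the resolvent stays bounded on all lines `|Im λ| ≤ γ` once the
fluxes against the modes are added to the right hand side, so a field whose fluxes vanish can be
moved from the weight `-γ` to `γ` in small steps (`LineBound.memX_step`). Subtracting the waves
with the measured fluxes as coefficients, one finds that a solution of at most the growth
`e^{γ|y|}` is at each end a combination of the waves and a remainder in the decaying space
(`exists_asym`). The total flux through a distant cross-section is the same at both ends, so
incoming and outgoing amplitudes have the same norm (`flux_conservation`). Hence the map to the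
incoming amplitudes is injective, by counting dimensions bijective, and the matrix `S` exists, is
unique and preserves the norm.

Trapped modes. A trapped mode is a solution whose combinations of waves at the two ends are square
integrable (`exists_trapped_iff`), that is, contain no oscillatory mode and no exponential growing
towards that end (`ModeFrame.memLp_end_iff`). The first condition removes all channels but
`(N, ±)`. The waves of these are `α_i w_N⁺ + conj α_i w_N⁻`, and since `|d| = 1` the second
condition says at both ends that the outgoing amplitudes are `-d` times the swapped incoming ones.
By conservation of the norm nothing is left for the other outgoing channels, and the conditions
amount to the degeneracy of `S_†† + d Υ` (`exists_amplitude_iff`). That `|d| = 1` follows from the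
fluxes `Re (α_1² ρ) = 1/2`, `Re (α_2² ρ) = -1/2`, `Re (α_1 α_2 ρ) = 0` of the threshold waves,
with `ρ = (λ_+ - 1) / ω` (`ThresholdCoefs.norm_dCoef`).

The roots `λ_±`. At `κ_N` the function `sin κ / κ` has a nondegenerate extremum; its deviation from
the extreme value is the square of a local coordinate up to a factor, so a level just beyond that
value is taken at exactly two conjugate nonreal points (`exists_threshold_roots`), which give
`λ_±` (`exists_isLambdaPlus`).
-/

open Set Filter Topology MeasureTheory
open scoped ComplexConjugate Real
open Complex (I norm_real conj_ofReal conj_conj real_smul ofReal_ne_zero conj_im I_sq)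
open Real (exp sinc norm_eq_abs sinc_of_ne_zero pi_pos sqrt_nonneg)
open ENNReal (ofReal ofReal_ne_top)
open Matrix (vecMul)
noncomputable section
namespace ZigzagRibbon

/-! ### The boundary value problem on the cross-section -/

/-- For a fixed wave vector `lam`, the functions `u`, `v` of the transversal variable solve
`(-i∂ₓ - iλ) v - ω u = F₁`, `(-i∂ₓ + iλ) u - ω v = F₂` with `u(0) = 0`, `v(1) = 0`. -/
structure CrossSection (ω : ℝ) (lam : ℂ) (u v F₁ F₂ : ℝ → ℂ) : Prop where
  hu : ∀ x, HasDerivAt u (lam * u x + I * ω * v x + I * F₂ x) x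
  hv : ∀ x, HasDerivAt v (-lam * v x + I * ω * u x + I * F₁ x) x
  u0 : u 0 = 0
  v1 : v 1 = 0
  c₁ : Continuous F₁
  c₂ : Continuous F₂

namespace CrossSection

variable {ω : ℝ} {lam : ℂ} {u v F₁ F₂ : ℝ → ℂ}

lemma cu (h : CrossSection ω lam u v F₁ F₂) : Continuous u :=
  continuous_iff_continuousAt.2 fun x => (h.hu x).continuousAt

lemma cv (h : CrossSection ω lam u v F₁ F₂) : Continuous v :=
  continuous_iff_continuousAt.2 fun x => (h.hv x).continuousAt

end CrossSection

/-- The squared `L²(0,1)` norm of a pair. -/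
def sqNorm (u v : ℝ → ℂ) : ℝ := ∫ x in (0 : ℝ)..1, (‖u x‖ ^ 2 + ‖v x‖ ^ 2)

lemma sqNorm_nonneg (u v : ℝ → ℂ) : 0 ≤ sqNorm u v :=
  intervalIntegral.integral_nonneg zero_le_one fun x _ => by positivity

lemma threshold_coef {ω ξ s : ℝ} (hω : 1 < ω) (hξ : 2 * ω ≤ |ξ|) (hs : s = 1 ∨ s = -1)
    (hsξ : s * ξ = |ξ|) : |ξ| * ((ω - 1) / 2) + |ξ - ω ^ 2| ≤ s * ω * (ξ - 1) := by
  rcases hs with rfl | rfl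
  · rw [one_mul] at hsξ
    rw [← hsξ] at hξ ⊢
    rcases abs_cases (ξ - ω ^ 2) with ⟨hp, -⟩ | ⟨hp, -⟩ <;> rw [hp] <;> nlinarith
  · rw [← hsξ] at hξ ⊢
    rw [abs_of_neg (by nlinarith)]
    nlinarith

/-- Resolvent bound for real wave vectors outside the range of the propagating ones: an energy
identity for `(1 - x) (ω (|u|² + |v|²) + 2λ Im (u v̄)) - ω |v|²`, which vanishes at both ends,
is corrected by a multiple of the one for `Im (u v̄)`. -/
lemma crossSection_bound_real {ω ξ : ℝ} {u v F₁ F₂ : ℝ → ℂ} (hω : 1 < ω)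
    (hξ : 2 * ω ≤ |ξ|) (h : CrossSection ω (ξ : ℂ) u v F₁ F₂) :
    sqNorm u v ≤ 16 / (ω - 1) ^ 2 * sqNorm F₁ F₂ := by
  have cu := h.cu
  have cv := h.cv
  have c₁ := h.c₁
  have c₂ := h.c₂
  obtain ⟨s, hs, hsξ⟩ : ∃ s : ℝ, (s = 1 ∨ s = -1) ∧ s * ξ = |ξ| := by
    rcases le_total 0 ξ with h0 | h0
    · exact ⟨1, Or.inl rfl, by rw [abs_of_nonneg h0]; ring⟩
    · exact ⟨-1, Or.inr rfl, by rw [abs_of_nonpos h0]; ring⟩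
  have hsabs : |s| = 1 := by rcases hs with rfl | rfl <;> norm_num
  have hω1 : 0 < ω - 1 := by linarith
  let X := fun t => (u t * conj (v t)).im
  let N := fun t => ‖u t‖ ^ 2 + ‖v t‖ ^ 2
  let A := fun t => (F₁ t * conj (v t)).im
  let D := fun t => (F₂ t * conj (u t)).im
  let C := fun t => (F₂ t * conj (v t) - u t * conj (F₁ t)).re
  let E := fun t => 2 * ω * (t * A t - (1 - t) * D t) + ξ * ((1 - 2 * t) * C t)
  let G' := fun t => s * ω * (ξ - 1) * N t - 2 * s * (ξ - ω ^ 2) * X t + s * E t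
  have hG : ∀ t, HasDerivAt (fun t => s * ((1 - t) * (ω * N t + 2 * ξ * X t) - ω * ‖v t‖ ^ 2)
      - s * ξ * X t) (G' t) t := by
    intro t
    have hX : HasDerivAt X _ t :=
      Complex.imCLM.hasFDerivAt.comp_hasDerivAt t ((h.hu t).mul (h.hv t).star)
    have hV := (h.hv t).norm_sq
    have h1 : HasDerivAt (fun t : ℝ => 1 - t) (-1) t := by
      simpa using (hasDerivAt_id t).const_sub 1
    refine ((((h1.mul ((((h.hu t).norm_sq.add hV).const_mul ω).add (hX.const_mul (2 * ξ)))).sub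
      (hV.const_mul ω)).const_mul s).sub (hX.const_mul (s * ξ))).congr_deriv ?_
    simp [G', E, A, D, C, X, N, Complex.inner, ← Complex.normSq_eq_norm_sq, Complex.normSq_apply]
    ring
  have hcG : Continuous G' := by
    simp only [G', E, A, D, C, X, N]
    fun_prop
  have hint : ∫ t in (0 : ℝ)..1, G' t = 0 := by
    rw [intervalIntegral.integral_eq_sub_of_hasDerivAt (fun t _ => hG t)
      (hcG.intervalIntegrable _ _)]
    simp [X, N, h.u0, h.v1]
  have hpt : ∀ t ∈ Icc (0 : ℝ) 1, |ξ| * ((ω - 1) / 4 * N t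
      - 4 / (ω - 1) * (‖F₁ t‖ ^ 2 + ‖F₂ t‖ ^ 2)) ≤ G' t := by
    intro t ht
    have im_le : ∀ z w : ℂ, |(z * conj w).im| ≤ ‖z‖ * ‖w‖ := fun z w => by
      simpa using Complex.abs_im_le_norm (z * conj w)
    have hX : 2 * |X t| ≤ N t := by
      nlinarith [sq_nonneg (‖u t‖ - ‖v t‖), im_le (u t) (v t)]
    have hC : |C t| ≤ ‖F₂ t‖ * ‖v t‖ + ‖u t‖ * ‖F₁ t‖ := by
      refine (Complex.abs_re_le_norm _).trans ((norm_sub_le _ _).trans_eq ?_)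
      simp
    have hE : |E t| ≤ |ξ| * ((‖F₁ t‖ + ‖F₂ t‖) * (‖u t‖ + ‖v t‖)) := by
      have w1 : |t * A t - (1 - t) * D t| ≤ |A t| + |D t| := by
        refine (abs_sub _ _).trans ?_
        rw [abs_mul, abs_mul, abs_of_nonneg ht.1, abs_of_nonneg (sub_nonneg.2 ht.2)]
        nlinarith [abs_nonneg (A t), abs_nonneg (D t), ht.1, ht.2]
      have w2 : |(1 - 2 * t) * C t| ≤ |C t| := by
        rw [abs_mul]
        exact mul_le_of_le_one_left (abs_nonneg _) (abs_le.2 ⟨by linarith [ht.2], by linarith [ht.1]⟩)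
      refine (abs_add_le _ _).trans ?_
      rw [abs_mul, abs_mul ξ, abs_of_pos (by linarith : 0 < 2 * ω)]
      have w3 := mul_le_mul hξ (w1.trans (add_le_add (im_le (F₁ t) (v t)) (im_le (F₂ t) (u t))))
        (abs_nonneg _) (abs_nonneg ξ)
      have w4 := mul_le_mul_of_nonneg_left (w2.trans hC) (abs_nonneg ξ)
      linarith
    have hmain : 2 * s * (ξ - ω ^ 2) * X t ≤ |ξ - ω ^ 2| * N t := by
      refine (le_abs_self _).trans ?_
      rw [abs_mul, abs_mul, abs_mul, hsabs, abs_two]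
      linarith [mul_le_mul_of_nonneg_left hX (abs_nonneg (ξ - ω ^ 2))]
    have hyoung : (‖F₁ t‖ + ‖F₂ t‖) * (‖u t‖ + ‖v t‖) ≤ (ω - 1) / 4 * N t +
        4 / (ω - 1) * (‖F₁ t‖ ^ 2 + ‖F₂ t‖ ^ 2) := by
      have h3 : ∀ f m : ℝ, f * m ≤ (ω - 1) / 8 * m ^ 2 + 2 / (ω - 1) * f ^ 2 := fun f m => by
        have : (ω - 1) / 8 * m ^ 2 + 2 / (ω - 1) * f ^ 2 - f * m
            = (1 / (8 * (ω - 1))) * ((ω - 1) * m - 4 * f) ^ 2 := by field_simp; ring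
        have h4 : 0 ≤ (1 / (8 * (ω - 1))) * ((ω - 1) * m - 4 * f) ^ 2 := by positivity
        linarith
      have sq : ∀ p q : ℝ, (p + q) ^ 2 ≤ 2 * (p ^ 2 + q ^ 2) := fun p q => by
        nlinarith [sq_nonneg (p - q)]
      refine (h3 _ _).trans ((add_le_add (mul_le_mul_of_nonneg_left (sq ‖u t‖ ‖v t‖) (by positivity))
        (mul_le_mul_of_nonneg_left (sq ‖F₁ t‖ ‖F₂ t‖) (by positivity))).trans_eq ?_)
      ring
    have hsE := neg_abs_le (s * E t)
    rw [abs_mul, hsabs, one_mul] at hsE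
    have := mul_le_mul_of_nonneg_left hyoung (abs_nonneg ξ)
    have := mul_le_mul_of_nonneg_right (threshold_coef hω hξ hs hsξ)
      (by positivity : 0 ≤ ‖u t‖ ^ 2 + ‖v t‖ ^ 2)
    simp only [G', N] at *
    linarith
  have hI := (intervalIntegral.integral_mono_on zero_le_one
    (Continuous.intervalIntegrable (by fun_prop) _ _) (hcG.intervalIntegrable _ _) hpt).trans_eq hint
  rw [intervalIntegral.integral_const_mul, intervalIntegral.integral_sub
    (Continuous.intervalIntegrable (by fun_prop) _ _)
    (Continuous.intervalIntegrable (by fun_prop) _ _),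
    intervalIntegral.integral_const_mul, intervalIntegral.integral_const_mul] at hI
  have h6 := nonpos_of_mul_nonpos_right hI (by linarith : 0 < |ξ|)
  change (ω - 1) / 4 * sqNorm u v - 4 / (ω - 1) * sqNorm F₁ F₂ ≤ 0 at h6
  calc sqNorm u v = 4 / (ω - 1) * ((ω - 1) / 4 * sqNorm u v) := by field_simp
    _ ≤ 4 / (ω - 1) * (4 / (ω - 1) * sqNorm F₁ F₂) :=
      mul_le_mul_of_nonneg_left (by linarith) (by positivity)
    _ = _ := by field_simp; ring

/-- The previous bound persists for wave vectors with a small imaginary part. -/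
lemma crossSection_bound_far {ω : ℝ} {lam : ℂ} {u v F₁ F₂ : ℝ → ℂ} (hω : 1 < ω)
    (hre : 2 * ω ≤ |lam.re|) (him : |lam.im| ≤ (ω - 1) / 40)
    (h : CrossSection ω lam u v F₁ F₂) :
    sqNorm u v ≤ 64 / (ω - 1) ^ 2 * sqNorm F₁ F₂ := by
  have cu := h.cu
  have cv := h.cv
  have c₁ := h.c₁
  have c₂ := h.c₂
  have hlam : lam = (lam.re : ℂ) + lam.im * I := (Complex.re_add_im lam).symm
  set s := lam.im
  set ξ := lam.re
  have h' : CrossSection ω (ξ : ℂ) u v (fun x => F₁ x - s * v x) (fun x => F₂ x + s * u x) := by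
    refine ⟨fun x => (h.hu x).congr_deriv ?_, fun x => (h.hv x).congr_deriv ?_, h.u0, h.v1,
      by fun_prop, by fun_prop⟩ <;>
    · rw [hlam]; ring
  have hb := crossSection_bound_real hω hre h'
  have h1 : sqNorm (fun x => F₁ x - s * v x) (fun x => F₂ x + s * u x)
      ≤ 2 * sqNorm F₁ F₂ + 2 * s ^ 2 * sqNorm u v := by
    unfold sqNorm
    rw [← intervalIntegral.integral_const_mul, ← intervalIntegral.integral_const_mul,
      ← intervalIntegral.integral_add (Continuous.intervalIntegrable (by fun_prop) _ _)
      (Continuous.intervalIntegrable (by fun_prop) _ _)]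
    refine intervalIntegral.integral_mono_on zero_le_one (Continuous.intervalIntegrable
      (by fun_prop) _ _) (Continuous.intervalIntegrable (by fun_prop) _ _) fun x _ => ?_
    have e : ∀ z w : ℂ, ‖z + s * w‖ ^ 2 ≤ 2 * ‖z‖ ^ 2 + 2 * s ^ 2 * ‖w‖ ^ 2 := fun z w => by
      have := pow_le_pow_left₀ (norm_nonneg _) (norm_add_le z (s * w)) 2
      rw [norm_mul, norm_real, norm_eq_abs] at this
      rw [← sq_abs s]
      nlinarith [sq_nonneg (‖z‖ - |s| * ‖w‖)]
    have e1 := e (F₁ x) (-v x)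
    rw [mul_neg, ← sub_eq_add_neg, norm_neg] at e1
    linarith [e (F₂ x) (u x)]
  have hω1 : 0 < ω - 1 := by linarith
  have hs : s ^ 2 ≤ ((ω - 1) / 40) ^ 2 := by
    rw [← sq_abs]; exact pow_le_pow_left₀ (abs_nonneg s) him 2
  have h2 : 16 / (ω - 1) ^ 2 * (2 * s ^ 2) ≤ 1 / 2 := by
    rw [div_mul_eq_mul_div, div_le_iff₀ (by positivity)]
    nlinarith
  have h3 := hb.trans (mul_le_mul_of_nonneg_left h1 (by positivity : 0 ≤ 16 / (ω - 1) ^ 2))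
  have h4 : 64 / (ω - 1) ^ 2 = 4 * (16 / (ω - 1) ^ 2) := by ring
  rw [h4]
  nlinarith [sqNorm_nonneg u v]

/-- The Lebesgue measure on the strip. -/
notation "μS" => (volume.restrict strip : Measure (ℝ × ℝ))

/-- The entire function `sin κ / κ`. -/
def csinc (κ : ℂ) : ℂ := if κ = 0 then 1 else Complex.sin κ / κ

/-- `sin (κ t) / κ`, the solution of `S'' = -κ² S` with `S(0) = 0`, `S'(0) = 1`. -/
def sinOver (κ : ℂ) (t : ℝ) : ℂ := if κ = 0 then (t : ℂ) else Complex.sin (κ * t) / κ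

/-- `cos (κ t)`. -/
def cosAt (κ : ℂ) (t : ℝ) : ℂ := Complex.cos (κ * t)

lemma hasDerivAt_sinOver (κ : ℂ) (t : ℝ) : HasDerivAt (sinOver κ) (cosAt κ t) t := by
  unfold sinOver cosAt
  by_cases h : κ = 0
  · simp only [h, if_true]
    simpa using (hasDerivAt_id t).ofReal_comp
  · simp only [h, if_false]
    have h1 : HasDerivAt (fun s : ℝ => κ * (s : ℂ)) κ t := by
      simpa using ((hasDerivAt_id t).ofReal_comp).const_mul κ
    have := ((Complex.hasDerivAt_sin (κ * t)).comp t h1).div_const κ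
    refine this.congr_deriv ?_
    field_simp

lemma hasDerivAt_cosAt (κ : ℂ) (t : ℝ) : HasDerivAt (cosAt κ) (-κ ^ 2 * sinOver κ t) t := by
  have h1 : HasDerivAt (fun s : ℝ => κ * (s : ℂ)) κ t := by
    simpa using ((hasDerivAt_id t).ofReal_comp).const_mul κ
  have := (Complex.hasDerivAt_cos (κ * t)).comp t h1
  refine this.congr_deriv ?_
  unfold sinOver
  by_cases h : κ = 0
  · simp [h]
  · simp only [h, if_false]; field_simp

lemma continuous_sinOver (κ : ℂ) : Continuous (sinOver κ) :=
  continuous_iff_continuousAt.2 fun x => (hasDerivAt_sinOver κ x).continuousAt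

lemma continuous_cosAt (κ : ℂ) : Continuous (cosAt κ) :=
  continuous_iff_continuousAt.2 fun x => (hasDerivAt_cosAt κ x).continuousAt

lemma sinOver_zero (κ : ℂ) : sinOver κ 0 = 0 := by simp [sinOver]

lemma cosAt_zero (κ : ℂ) : cosAt κ 0 = 1 := by simp [cosAt]

lemma sinOver_one (κ : ℂ) : sinOver κ 1 = csinc κ := by simp [sinOver, csinc]

lemma norm_cos_le_exp (z : ℂ) : ‖Complex.cos z‖ ≤ exp ‖z‖ := by
  rw [Complex.cos]
  have h1 : ‖Complex.exp (z * I)‖ ≤ exp ‖z‖ := by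
    simpa using Complex.norm_exp_le_exp_norm (z * I)
  have h2 : ‖Complex.exp (-z * I)‖ ≤ exp ‖z‖ := by
    simpa using Complex.norm_exp_le_exp_norm (-z * I)
  rw [norm_div]
  have := norm_add_le (Complex.exp (z * I)) (Complex.exp (-z * I))
  simp only [Complex.norm_ofNat]
  linarith

lemma norm_cosAt_le {κ : ℂ} {B : ℝ} (hκ : ‖κ‖ ≤ B) {t : ℝ} (ht : t ∈ Icc (0 : ℝ) 1) :
    ‖cosAt κ t‖ ≤ exp B := by
  refine (norm_cos_le_exp _).trans (Real.exp_le_exp.2 ?_)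
  rw [norm_mul, norm_real, Real.norm_of_nonneg ht.1]
  nlinarith [norm_nonneg κ, ht.1, ht.2]

lemma norm_sinOver_le {κ : ℂ} {B : ℝ} (hκ : ‖κ‖ ≤ B) {t : ℝ} (ht : t ∈ Icc (0 : ℝ) 1) :
    ‖sinOver κ t‖ ≤ exp B := by
  have := (convex_Icc (0 : ℝ) 1).norm_image_sub_le_of_norm_hasDerivWithin_le
    (fun x _ => (hasDerivAt_sinOver κ x).hasDerivWithinAt)
    (fun x hx => norm_cosAt_le hκ hx) (left_mem_Icc.2 zero_le_one) ht
  rw [sinOver_zero, sub_zero, sub_zero, Real.norm_of_nonneg ht.1] at this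
  nlinarith [Real.exp_pos B, ht.1, ht.2]

/-- The first component of the solution with initial value `(0, 1)`. -/
def fundU (ω : ℝ) (κ : ℂ) (x : ℝ) : ℂ := I * ω * sinOver κ x

/-- The second component of the solution with initial value `(0, 1)`. -/
def fundV (lam κ : ℂ) (x : ℝ) : ℂ := cosAt κ x - lam * sinOver κ x

/-- The characteristic function, whose zeros are the wave vectors. -/
def charFun (lam κ : ℂ) : ℂ := Complex.cos κ - lam * csinc κ

lemma fundV_one (lam κ : ℂ) : fundV lam κ 1 = charFun lam κ := by
  simp [fundV, charFun, sinOver_one, cosAt]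

/-- Duhamel's formula, as an estimate. -/
lemma duhamel {ω B : ℝ} {lam κ : ℂ} {u v F₁ F₂ : ℝ → ℂ} (h : CrossSection ω lam u v F₁ F₂)
    (hκ : κ ^ 2 + lam ^ 2 = (ω : ℂ) ^ 2) (hκB : ‖κ‖ ≤ B) (hlB : ‖lam‖ ≤ B) (hωB : |ω| ≤ B)
    {x : ℝ} (hx : x ∈ Icc (0 : ℝ) 1) :
    ‖u x - v 0 * fundU ω κ x‖ ≤
        (1 + B) * exp B * ∫ t in (0 : ℝ)..1, (‖F₁ t‖ + ‖F₂ t‖) ∧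
      ‖v x - v 0 * fundV lam κ x‖ ≤
        (1 + B) * exp B * ∫ t in (0 : ℝ)..1, (‖F₁ t‖ + ‖F₂ t‖) := by
  have c₁ := h.c₁
  have c₂ := h.c₂
  have cS := continuous_sinOver κ
  have cC := continuous_cosAt κ
  have hB : 0 ≤ B := (norm_nonneg _).trans hκB
  set D := (1 + B) * exp B with hD
  have D0 : 0 ≤ D := by positivity
  have hS : ∀ t, HasDerivAt (fun t => sinOver κ (x - t)) (-cosAt κ (x - t)) t := fun t =>
    (hasDerivAt_sinOver κ (x - t)).comp_const_sub x t
  have hC : ∀ t, HasDerivAt (fun t => cosAt κ (x - t)) (κ ^ 2 * sinOver κ (x - t)) t :=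
    fun t => ((hasDerivAt_cosAt κ (x - t)).comp_const_sub x t).congr_deriv (by ring)
  -- pairing with a solution `(p, q)` of the adjoint system
  have main : ∀ p q : ℝ → ℂ, Continuous p → Continuous q →
      (∀ t, HasDerivAt p (-(lam * p t) - I * ω * q t) t) →
      (∀ t, HasDerivAt q (lam * q t - I * ω * p t) t) →
      (∀ t ∈ Icc 0 x, ‖p t‖ ≤ D ∧ ‖q t‖ ≤ D) →
      ‖p x * u x + q x * v x - q 0 * v 0‖ ≤ D * ∫ t in (0 : ℝ)..1, (‖F₁ t‖ + ‖F₂ t‖) := by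
    intro p q cp cq hp hq hb
    have hd : ∀ t, HasDerivAt (fun t => p t * u t + q t * v t)
        (p t * (I * F₂ t) + q t * (I * F₁ t)) t := fun t =>
      (((hp t).mul (h.hu t)).add ((hq t).mul (h.hv t))).congr_deriv (by ring)
    have hi := intervalIntegral.integral_eq_sub_of_hasDerivAt (a := 0) (b := x)
      (fun t _ => hd t) (Continuous.intervalIntegrable (by fun_prop) _ _)
    rw [h.u0, mul_zero, zero_add] at hi
    rw [← hi]
    have hc : Continuous fun t => D * (‖F₁ t‖ + ‖F₂ t‖) := by fun_prop
    refine (intervalIntegral.norm_integral_le_of_norm_le hx.1 (.of_forall fun t ht => ?_)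
      (hc.intervalIntegrable _ _)).trans ((intervalIntegral.integral_mono_interval le_rfl hx.1 hx.2
        (.of_forall fun t => by simp only [Pi.zero_apply]; positivity)
        (hc.intervalIntegrable _ _)).trans_eq (intervalIntegral.integral_const_mul _ _))
    obtain ⟨h1, h2⟩ := hb t ⟨ht.1.le, ht.2⟩
    refine (norm_add_le _ _).trans ?_
    rw [norm_mul, norm_mul (q t), norm_mul I, norm_mul I, Complex.norm_I, one_mul, one_mul, mul_add,
      add_comm]
    gcongr
  have bS : ∀ t ∈ Icc (0 : ℝ) x, ‖sinOver κ (x - t)‖ ≤ exp B := fun t ht =>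
    norm_sinOver_le hκB ⟨by linarith [ht.2], by linarith [ht.1, hx.2]⟩
  have bC : ∀ t ∈ Icc (0 : ℝ) x, ‖cosAt κ (x - t)‖ ≤ exp B := fun t ht =>
    norm_cosAt_le hκB ⟨by linarith [ht.2], by linarith [ht.1, hx.2]⟩
  have bW : ∀ t ∈ Icc (0 : ℝ) x, ‖I * ω * sinOver κ (x - t)‖ ≤ D := by
    intro t ht
    rw [norm_mul, norm_mul, Complex.norm_I, one_mul, norm_real, norm_eq_abs]
    exact mul_le_mul (by linarith) (bS t ht) (norm_nonneg _) (by positivity)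
  have bV : ∀ t ∈ Icc (0 : ℝ) x, ∀ z : ℂ, ‖z‖ ≤ B →
      ‖cosAt κ (x - t) + z * sinOver κ (x - t)‖ ≤ D := by
    intro t ht z hz
    refine (norm_add_le _ _).trans ?_
    rw [norm_mul, hD, add_mul, one_mul]
    have := bS t ht
    have := bC t ht
    gcongr
  constructor
  · have := main (fun t => cosAt κ (x - t) + lam * sinOver κ (x - t))
      (fun t => I * ω * sinOver κ (x - t)) (by fun_prop) (by fun_prop)
      (fun t => ((hC t).add ((hS t).const_mul lam)).congr_deriv (by
        linear_combination sinOver κ (x - t) * hκ + (ω : ℂ) ^ 2 * sinOver κ (x - t) * I_sq))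
      (fun t => ((hS t).const_mul (I * ω)).congr_deriv (by ring))
      fun t ht => ⟨bV t ht lam hlB, bW t ht⟩
    convert this using 2
    simp [fundU, sinOver_zero, cosAt_zero, mul_comm]
  · have := main (fun t => I * ω * sinOver κ (x - t))
      (fun t => cosAt κ (x - t) + -lam * sinOver κ (x - t)) (by fun_prop) (by fun_prop)
      (fun t => ((hS t).const_mul (I * ω)).congr_deriv (by ring))
      (fun t => ((hC t).add ((hS t).const_mul (-lam))).congr_deriv (by
        linear_combination sinOver κ (x - t) * hκ + (ω : ℂ) ^ 2 * sinOver κ (x - t) * I_sq))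
      fun t ht => ⟨bW t ht, bV t ht (-lam) (by rwa [norm_neg])⟩
    convert this using 2
    simp [fundV, sinOver_zero, cosAt_zero]
    ring

/-- The functional `∫₀¹ (u a + v b)`. -/
def pairing (a b u v : ℝ → ℂ) : ℂ := ∫ x in (0 : ℝ)..1, (u x * a x + v x * b x)

lemma norm_pairing_le {a b u v : ℝ → ℂ} {A M : ℝ} (hM : 0 ≤ M)
    (ha : ∀ x ∈ Icc (0 : ℝ) 1, ‖a x‖ ≤ A) (hb : ∀ x ∈ Icc (0 : ℝ) 1, ‖b x‖ ≤ A)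
    (hu : ∀ x ∈ Icc (0 : ℝ) 1, ‖u x‖ ≤ M) (hv : ∀ x ∈ Icc (0 : ℝ) 1, ‖v x‖ ≤ M) :
    ‖pairing a b u v‖ ≤ 2 * A * M := by
  have := intervalIntegral.norm_integral_le_of_norm_le_const (a := (0 : ℝ)) (b := 1)
    (f := fun x => u x * a x + v x * b x) (C := 2 * A * M) ?_
  · simpa [pairing] using this
  · intro x hx
    rw [uIoc_of_le zero_le_one] at hx
    have hx' : x ∈ Icc (0 : ℝ) 1 := ⟨hx.1.le, hx.2⟩
    refine (norm_add_le _ _).trans ?_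
    rw [norm_mul, norm_mul]
    have h1 := ha x hx'
    have h2 := hb x hx'
    have h3 := hu x hx'
    have h4 := hv x hx'
    calc _ ≤ M * A + M * A := by gcongr
      _ = _ := by ring

lemma sq_integral_norm_le {F₁ F₂ : ℝ → ℂ} (c₁ : Continuous F₁) (c₂ : Continuous F₂) :
    (∫ t in (0 : ℝ)..1, (‖F₁ t‖ + ‖F₂ t‖)) ^ 2 ≤ 2 * sqNorm F₁ F₂ := by
  set G := ∫ t in (0 : ℝ)..1, (‖F₁ t‖ + ‖F₂ t‖)
  have h0 : 0 ≤ ∫ t in (0 : ℝ)..1, (2 * (‖F₁ t‖ ^ 2 + ‖F₂ t‖ ^ 2)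
      - 2 * G * (‖F₁ t‖ + ‖F₂ t‖) + G ^ 2) := by
    refine intervalIntegral.integral_nonneg zero_le_one fun t _ => ?_
    nlinarith [sq_nonneg (‖F₁ t‖ - ‖F₂ t‖), sq_nonneg (‖F₁ t‖ + ‖F₂ t‖ - G)]
  rw [intervalIntegral.integral_add, intervalIntegral.integral_sub,
    intervalIntegral.integral_const_mul, intervalIntegral.integral_const_mul] at h0
  · change 0 ≤ 2 * sqNorm F₁ F₂ - 2 * G * G + _ at h0
    simp at h0
    nlinarith
  all_goals apply Continuous.intervalIntegrable; fun_prop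

/-- Resolvent bound on a bounded set of wave vectors, for solutions modulo finitely many
functionals: it suffices that the characteristic function and the functionals of the fundamental
solution do not vanish simultaneously. -/
lemma crossSection_bound_near {ι : Type*} [Fintype ι] {B A c : ℝ} (hA : 0 ≤ A) (hc : 0 < c) :
    ∃ K : ℝ, 0 ≤ K ∧ ∀ (ω : ℝ) (lam κ : ℂ) (a b : ι → ℝ → ℂ),
      κ ^ 2 + lam ^ 2 = (ω : ℂ) ^ 2 → ‖κ‖ ≤ B → ‖lam‖ ≤ B → |ω| ≤ B →
      (∀ i, Continuous (a i)) → (∀ i, Continuous (b i)) →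
      (∀ i, ∀ x ∈ Icc (0 : ℝ) 1, ‖a i x‖ ≤ A) → (∀ i, ∀ x ∈ Icc (0 : ℝ) 1, ‖b i x‖ ≤ A) →
      c ≤ ‖charFun lam κ‖ + ∑ i, ‖pairing (a i) (b i) (fundU ω κ) (fundV lam κ)‖ →
      ∀ u v F₁ F₂, CrossSection ω lam u v F₁ F₂ →
        sqNorm u v ≤ K * (sqNorm F₁ F₂ + ∑ i, ‖pairing (a i) (b i) u v‖ ^ 2) := by
  rcases lt_or_ge B 0 with hB | hB
  · exact ⟨0, le_rfl, fun ω lam κ a b _ hκ => absurd hκ (by linarith [norm_nonneg κ])⟩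
  set D := (1 + B) * exp B with hD
  have hD0 : 0 ≤ D := by positivity
  set n := (Fintype.card ι : ℝ)
  have hn : 0 ≤ n := by positivity
  set E := D * ((1 + 2 * A * n) * D) / c + D with hE
  have hE0 : 0 ≤ E := by positivity
  refine ⟨4 * (2 * E ^ 2 + n * (D / c) ^ 2), by positivity, ?_⟩
  intro ω lam κ a b hκ hκB hlB hωB ca cb ha hb hcl u v F₁ F₂ h
  set G := ∫ t in (0 : ℝ)..1, (‖F₁ t‖ + ‖F₂ t‖) with hG
  have hG0 : 0 ≤ G := intervalIntegral.integral_nonneg zero_le_one fun t _ => by positivity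
  set L := ∑ i, ‖pairing (a i) (b i) u v‖ with hL
  have hL0 : 0 ≤ L := Finset.sum_nonneg fun i _ => norm_nonneg _
  have hd := fun x (hx : x ∈ Icc (0 : ℝ) 1) => duhamel h hκ hκB hlB hωB hx
  have cS := continuous_sinOver κ
  have cC := continuous_cosAt κ
  have cU : Continuous (fundU ω κ) := by unfold fundU; fun_prop
  have cV : Continuous (fundV lam κ) := by unfold fundV; fun_prop
  have cu := h.cu
  have cv := h.cv
  have h1 : ‖v 0‖ * ‖charFun lam κ‖ ≤ D * G := by
    have := (hd 1 (right_mem_Icc.2 zero_le_one)).2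
    rwa [h.v1, zero_sub, norm_neg, norm_mul, fundV_one] at this
  have h2 : ∀ i, ‖v 0‖ * ‖pairing (a i) (b i) (fundU ω κ) (fundV lam κ)‖ ≤
      ‖pairing (a i) (b i) u v‖ + 2 * A * (D * G) := by
    intro i
    have := ca i
    have := cb i
    have e : v 0 * pairing (a i) (b i) (fundU ω κ) (fundV lam κ) = pairing (a i) (b i) u v -
        pairing (a i) (b i) (fun x => u x - v 0 * fundU ω κ x)
          (fun x => v x - v 0 * fundV lam κ x) := by
      unfold pairing
      rw [← intervalIntegral.integral_const_mul, ← intervalIntegral.integral_sub]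
      · congr 1; ext x; ring
      all_goals apply Continuous.intervalIntegrable; fun_prop
    rw [← norm_mul, e]
    refine (norm_sub_le _ _).trans ?_
    have := norm_pairing_le (by positivity : 0 ≤ D * G) (ha i) (hb i)
      (fun x hx => (hd x hx).1) (fun x hx => (hd x hx).2)
    linarith
  have h3 : ‖v 0‖ * c ≤ (1 + 2 * A * n) * (D * G) + L := by
    calc ‖v 0‖ * c ≤ ‖v 0‖ * (‖charFun lam κ‖ +
          ∑ i, ‖pairing (a i) (b i) (fundU ω κ) (fundV lam κ)‖) := by gcongr
      _ = ‖v 0‖ * ‖charFun lam κ‖ +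
          ∑ i, ‖v 0‖ * ‖pairing (a i) (b i) (fundU ω κ) (fundV lam κ)‖ := by
          rw [mul_add, Finset.mul_sum]
      _ ≤ D * G + ∑ i, (‖pairing (a i) (b i) u v‖ + 2 * A * (D * G)) := by
          gcongr with i
          exact h2 i
      _ = _ := by
          rw [Finset.sum_add_distrib]
          simp only [Finset.sum_const, Finset.card_univ, nsmul_eq_mul]
          simp only [n, L]; ring
  have h4 : ‖v 0‖ ≤ ((1 + 2 * A * n) * (D * G) + L) / c := by
    rw [le_div_iff₀ hc]; exact h3
  have bU : ∀ x ∈ Icc (0 : ℝ) 1, ‖fundU ω κ x‖ ≤ D := by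
    intro x hx
    have := norm_sinOver_le hκB hx
    rw [fundU, norm_mul, norm_mul, Complex.norm_I, one_mul, norm_real, norm_eq_abs,
      hD]
    gcongr
    linarith
  have bV : ∀ x ∈ Icc (0 : ℝ) 1, ‖fundV lam κ x‖ ≤ D := by
    intro x hx
    refine (norm_sub_le _ _).trans ?_
    rw [norm_mul, hD, add_mul, one_mul]
    have := norm_sinOver_le hκB hx
    have := norm_cosAt_le hκB hx
    gcongr
  have h5 : D * (((1 + 2 * A * n) * (D * G) + L) / c) + D * G = E * G + D / c * L := by
    rw [hE]; field_simp; ring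
  have h6 : ∀ x ∈ Icc (0 : ℝ) 1, ‖u x‖ ≤ E * G + D / c * L ∧ ‖v x‖ ≤ E * G + D / c * L := by
    intro x hx
    rw [← h5]
    have e : ∀ z w : ℂ, ‖z - v 0 * w‖ ≤ D * G → ‖w‖ ≤ D →
        ‖z‖ ≤ D * (((1 + 2 * A * n) * (D * G) + L) / c) + D * G := fun z w h7 h8 => by
      have h9 := norm_le_norm_sub_add z (v 0 * w)
      rw [norm_mul] at h9
      linarith [mul_le_mul h4 h8 (norm_nonneg _) ((norm_nonneg _).trans h4)]
    exact ⟨e _ _ (hd x hx).1 (bU x hx), e _ _ (hd x hx).2 (bV x hx)⟩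
  have h7 : sqNorm u v ≤ 2 * (E * G + D / c * L) ^ 2 := by
    have : sqNorm u v ≤ ∫ x in (0 : ℝ)..1, 2 * (E * G + D / c * L) ^ 2 := by
      refine intervalIntegral.integral_mono_on zero_le_one ?_ (by simp) ?_
      · apply Continuous.intervalIntegrable; fun_prop
      · intro x hx
        have a1 := pow_le_pow_left₀ (norm_nonneg _) (h6 x hx).1 2
        have a2 := pow_le_pow_left₀ (norm_nonneg _) (h6 x hx).2 2
        linarith
    simpa using this
  have h8 : L ^ 2 ≤ n * ∑ i, ‖pairing (a i) (b i) u v‖ ^ 2 := by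
    have := sq_sum_le_card_mul_sum_sq (s := Finset.univ)
      (f := fun i => ‖pairing (a i) (b i) u v‖)
    simpa [n, L] using this
  have h9 := sq_integral_norm_le h.c₁ h.c₂
  set P := ∑ i, ‖pairing (a i) (b i) u v‖ ^ 2
  have hP : 0 ≤ P := Finset.sum_nonneg fun i _ => by positivity
  have hsn := sqNorm_nonneg F₁ F₂
  calc sqNorm u v ≤ 2 * (E * G + D / c * L) ^ 2 := h7
    _ ≤ 4 * (E ^ 2 * G ^ 2 + (D / c) ^ 2 * L ^ 2) := by
        nlinarith [sq_nonneg (E * G - D / c * L)]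
    _ ≤ 4 * (E ^ 2 * (2 * sqNorm F₁ F₂) + (D / c) ^ 2 * (n * P)) := by gcongr
    _ ≤ _ := by
        have q1 : 0 ≤ E ^ 2 * P := by positivity
        have q2 : 0 ≤ n * (D / c) ^ 2 * sqNorm F₁ F₂ := by positivity
        nlinarith

/-! ### Smooth compactly supported functions on the plane -/

/-- Smooth functions with compact support on the plane. -/
structure IsTest (φ : ℝ × ℝ → ℂ) : Prop where
  smooth : ContDiff ℝ (⊤ : ℕ∞) φ
  supp : HasCompactSupport φ

lemma hasDerivAt_fst {φ : ℝ × ℝ → ℂ} (h : ContDiff ℝ 1 φ) (x y : ℝ) :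
    HasDerivAt (fun t => φ (t, y)) (dx φ (x, y)) x := by
  exact (h.differentiable one_ne_zero (x, y)).hasFDerivAt.comp_hasDerivAt x
    ((hasDerivAt_id x).prodMk (hasDerivAt_const x y))

lemma hasDerivAt_snd {φ : ℝ × ℝ → ℂ} (h : ContDiff ℝ 1 φ) (x y : ℝ) :
    HasDerivAt (fun t => φ (x, t)) (dy φ (x, y)) y := by
  exact (h.differentiable one_ne_zero (x, y)).hasFDerivAt.comp_hasDerivAt y
    ((hasDerivAt_const y x).prodMk (hasDerivAt_id y))

namespace IsTest

variable {φ ψ : ℝ × ℝ → ℂ}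

lemma c1 (h : IsTest φ) : ContDiff ℝ 1 φ := h.smooth.of_le (by exact_mod_cast le_top)

lemma cont (h : IsTest φ) : Continuous φ := h.smooth.continuous

lemma dx (h : IsTest φ) : IsTest (dx φ) where
  smooth := (h.smooth.fderiv_right (m := (⊤ : ℕ∞)) (by simp)).clm_apply contDiff_const
  supp := h.supp.fderiv_apply (𝕜 := ℝ) _

lemma dy (h : IsTest φ) : IsTest (dy φ) where
  smooth := (h.smooth.fderiv_right (m := (⊤ : ℕ∞)) (by simp)).clm_apply contDiff_const
  supp := h.supp.fderiv_apply (𝕜 := ℝ) _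

lemma swap (h : IsTest φ) : IsTest (fun p => φ p.swap) where
  smooth := h.smooth.comp (contDiff_snd.prodMk contDiff_fst)
  supp := h.supp.comp_homeomorph (Homeomorph.prodComm ℝ ℝ)

lemma add (h : IsTest φ) (h' : IsTest ψ) : IsTest (fun p => φ p + ψ p) :=
  ⟨h.smooth.add h'.smooth, h.supp.add h'.supp⟩

lemma const_mul (h : IsTest φ) (c : ℂ) : IsTest (fun p => c * φ p) :=
  ⟨contDiff_const.mul h.smooth, h.supp.mul_left⟩

lemma sub (h : IsTest φ) (h' : IsTest ψ) : IsTest (fun p => φ p - ψ p) := by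
  simpa [sub_eq_add_neg] using h.add (h'.const_mul (-1))

lemma eq_zero {y : ℝ} (hy : y ∉ Prod.snd '' tsupport φ) (x : ℝ) : φ (x, y) = 0 :=
  by_contra fun hne => hy ⟨(x, y), subset_tsupport _ hne, rfl⟩

lemma slice (h : IsTest φ) (x : ℝ) : HasCompactSupport (fun y => φ (x, y)) :=
  .intro (h.supp.isCompact.image continuous_snd) fun _ hy => eq_zero hy x

lemma slice_smooth (h : IsTest φ) (x : ℝ) : ContDiff ℝ (⊤ : ℕ∞) (fun y => φ (x, y)) :=
  h.smooth.comp (contDiff_const.prodMk contDiff_id)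

lemma bdd (h : IsTest φ) : ∃ M, 0 ≤ M ∧ ∀ p, ‖φ p‖ ≤ M := by
  obtain ⟨M, hM⟩ := h.supp.exists_bound_of_continuous h.cont
  exact ⟨M, (norm_nonneg _).trans (hM 0), hM⟩

end IsTest

section conj_mul

variable {φ : ℝ × ℝ → ℂ} {ψ : ℝ → ℝ}

lemma IsTest.conj (h : IsTest φ) : IsTest fun p => conj (φ p) :=
  ⟨Complex.conjCLE.contDiff.comp h.smooth, h.supp.comp_left (g := starRingEnd ℂ) (map_zero _)⟩

lemma dx_conj (h : IsTest φ) (p : ℝ × ℝ) :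
    dx (fun p => conj (φ p)) p = conj (dx φ p) :=
  (hasDerivAt_fst h.conj.c1 p.1 p.2).unique (hasDerivAt_fst h.c1 p.1 p.2).star

lemma dy_conj (h : IsTest φ) (p : ℝ × ℝ) :
    dy (fun p => conj (φ p)) p = conj (dy φ p) :=
  (hasDerivAt_snd h.conj.c1 p.1 p.2).unique (hasDerivAt_snd h.c1 p.1 p.2).star

lemma IsTest.mulY (h : IsTest φ) (hψ : ContDiff ℝ (⊤ : ℕ∞) ψ) :
    IsTest fun p => (ψ p.2 : ℂ) * φ p :=
  ⟨(Complex.ofRealCLM.contDiff.comp (hψ.comp contDiff_snd)).mul h.smooth, h.supp.mul_left⟩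

lemma dx_mulY (h : IsTest φ) (hψ : ContDiff ℝ (⊤ : ℕ∞) ψ) (p : ℝ × ℝ) :
    dx (fun p => (ψ p.2 : ℂ) * φ p) p = ψ p.2 * dx φ p :=
  (hasDerivAt_fst (h.mulY hψ).c1 p.1 p.2).unique 
    ((hasDerivAt_fst h.c1 p.1 p.2).const_mul (ψ p.2 : ℂ))

lemma dy_mulY (h : IsTest φ) (hψ : ContDiff ℝ (⊤ : ℕ∞) ψ) (p : ℝ × ℝ) :
    dy (fun p => (ψ p.2 : ℂ) * φ p) p = deriv ψ p.2 * φ p + ψ p.2 * dy φ p :=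
  (hasDerivAt_snd (h.mulY hψ).c1 p.1 p.2).unique
    ((hψ.differentiable (by simp) p.2).hasDerivAt.ofReal_comp.mul (hasDerivAt_snd h.c1 p.1 p.2))

end conj_mul

lemma tsupport_conj {φ : ℝ × ℝ → ℂ} : tsupport (fun p => conj (φ p)) ⊆ tsupport φ :=
  closure_mono fun p hp => by simpa using hp

lemma tsupport_mulY {g φ : ℝ × ℝ → ℂ} : tsupport (fun p => g p * φ p) ⊆ tsupport φ :=
  closure_mono (Function.support_mul_subset_right _ _)

/-- Differentiation of a parametric integral of a compactly supported smooth function. -/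
lemma IsTest.hasDerivAt_integral {φ : ℝ × ℝ → ℂ} (h : IsTest φ) {μ : Measure ℝ}
    [IsLocallyFiniteMeasure μ] {g : ℝ → ℂ} (hg : Continuous g) (x : ℝ) :
    HasDerivAt (fun x => ∫ y, φ (x, y) * g y ∂μ) (∫ y, ZigzagRibbon.dx φ (x, y) * g y ∂μ) x := by
  obtain ⟨M, hM0, hM⟩ := h.dx.bdd
  set K := Prod.snd '' tsupport (ZigzagRibbon.dx φ)
  have hK : IsCompact K := h.dx.supp.isCompact.image continuous_snd
  have hslice : ∀ x, Integrable (fun y => φ (x, y) * g y) μ := fun x =>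
    Continuous.integrable_of_hasCompactSupport (by have := h.cont; fun_prop) ((h.slice x).mul_right)
  refine (hasDerivAt_integral_of_dominated_loc_of_deriv_le (F := fun x y => φ (x, y) * g y)
    (F' := fun x y => ZigzagRibbon.dx φ (x, y) * g y)
    (bound := K.indicator fun y => M * ‖g y‖) univ_mem ?_ (hslice x) ?_ ?_ ?_ ?_).2
  · exact .of_forall fun x => (hslice x).aestronglyMeasurable
  · have := h.dx.cont
    exact Continuous.aestronglyMeasurable (by fun_prop)
  · refine .of_forall fun y x _ => ?_
    by_cases hy : y ∈ K
    · rw [indicator_of_mem hy, norm_mul]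
      gcongr
      exact hM _
    · rw [indicator_of_notMem hy]
      simp [IsTest.eq_zero hy]
  · refine (integrable_indicator_iff hK.measurableSet).2 ?_
    exact (Continuous.continuousOn (by fun_prop)).integrableOn_compact hK
  · exact .of_forall fun y x _ => (hasDerivAt_fst h.c1 x y).mul_const (g y)

/-- Integrating a test function against a continuous function in one variable gives a smooth
function of the other. -/
lemma IsTest.contDiff_integral {φ : ℝ × ℝ → ℂ} (h : IsTest φ) {μ : Measure ℝ}
    [IsLocallyFiniteMeasure μ] {g : ℝ → ℂ} (hg : Continuous g) :
    ContDiff ℝ (⊤ : ℕ∞) (fun x => ∫ y, φ (x, y) * g y ∂μ) := by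
  rw [contDiff_infty]
  intro n
  induction n generalizing φ with
  | zero =>
    exact contDiff_zero.2 (continuous_iff_continuousAt.2
      fun x => (h.hasDerivAt_integral hg x).continuousAt)
  | succ n ih =>
    push_cast
    rw [contDiff_succ_iff_deriv]
    refine ⟨fun x => (h.hasDerivAt_integral hg x).differentiableAt, by simp, ?_⟩
    have : deriv (fun x => ∫ y, φ (x, y) * g y ∂μ) =
        fun x => ∫ y, ZigzagRibbon.dx φ (x, y) * g y ∂μ :=
      funext fun x => (h.hasDerivAt_integral hg x).deriv
    rw [this]
    exact ih h.dx

/-! ### The partial Fourier transform along the ribbon -/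

/-- The kernel of the Fourier transform. -/
def fker (ξ y : ℝ) : ℂ := Complex.exp (((-2 * π * y * ξ : ℝ) : ℂ) * I)

lemma continuous_fker : Continuous fun p : ℝ × ℝ => fker p.1 p.2 := by
  unfold fker
  fun_prop

/-- The Fourier transform in the second variable. -/
def ft (φ : ℝ × ℝ → ℂ) (x ξ : ℝ) : ℂ :=
  ∫ y, φ (x, y) * fker ξ y

lemma fourier_eq_integral (f : ℝ → ℂ) (ξ : ℝ) :
    FourierTransform.fourier f ξ = ∫ y, f y * fker ξ y := by
  rw [Real.fourier_real_eq_integral_exp_smul]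
  simp [fker, mul_comm]

/-- Plancherel's theorem for a smooth compactly supported function of one variable. -/
lemma plancherel {f : ℝ → ℂ} (hf : ContDiff ℝ (⊤ : ℕ∞) f) (hs : HasCompactSupport f) :
    ∫⁻ ξ, ‖∫ y, f y * fker ξ y‖ₑ ^ 2 = ∫⁻ y, ‖f y‖ₑ ^ 2 := by
  have h := SchwartzMap.integral_norm_sq_fourier (hs.toSchwartzMap hf)
  have conv : ∀ g : SchwartzMap ℝ ℂ, ∫⁻ ξ, ‖g ξ‖ₑ ^ 2 = ofReal (∫ ξ, ‖g ξ‖ ^ 2) := by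
    intro g
    rw [ofReal_integral_eq_lintegral_ofReal]
    · congr 1; ext ξ
      rw [ENNReal.ofReal_pow (norm_nonneg _), ofReal_norm]
    · exact (g.memLp 2 volume).integrable_norm_pow (by norm_num)
    · exact .of_forall fun ξ => by positivity
  have h1 := conv (FourierTransform.fourier (hs.toSchwartzMap hf))
  rw [h, ← conv, SchwartzMap.fourier_coe] at h1
  simpa only [fourier_eq_integral, HasCompactSupport.toSchwartzMap_toFun] using h1

lemma plancherel_slice {φ : ℝ × ℝ → ℂ} (h : IsTest φ) (x : ℝ) :
    ∫⁻ ξ, ‖ft φ x ξ‖ₑ ^ 2 = ∫⁻ y, ‖φ (x, y)‖ₑ ^ 2 :=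
  plancherel (h.slice_smooth x) (h.slice x)

lemma IsTest.hasDerivAt_ft {φ : ℝ × ℝ → ℂ} (h : IsTest φ) (ξ x : ℝ) :
    HasDerivAt (fun x => ft φ x ξ) (ft (ZigzagRibbon.dx φ) x ξ) x :=
  h.hasDerivAt_integral (continuous_fker.comp (by fun_prop : Continuous fun y : ℝ => (ξ, y))) x

lemma IsTest.ft_dy {φ : ℝ × ℝ → ℂ} (h : IsTest φ) (x ξ : ℝ) :
    ft (ZigzagRibbon.dy φ) x ξ = 2 * π * I * ξ * ft φ x ξ := by
  have hd : deriv (fun y => φ (x, y)) = fun y => ZigzagRibbon.dy φ (x, y) :=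
    funext fun y => (hasDerivAt_snd h.c1 x y).deriv
  have i1 : Integrable (fun y => φ (x, y)) :=
    (h.slice_smooth x).continuous.integrable_of_hasCompactSupport (h.slice x)
  have i2 : Integrable (fun y => ZigzagRibbon.dy φ (x, y)) :=
    (h.dy.slice_smooth x).continuous.integrable_of_hasCompactSupport (h.dy.slice x)
  have := congrFun (Real.fourier_deriv i1 ((h.slice_smooth x).differentiable (by simp))
    (by rw [hd]; exact i2)) ξ
  rw [hd] at this
  simp only [fourier_eq_integral, smul_eq_mul] at this
  exact this

lemma IsTest.continuous_ft {φ : ℝ × ℝ → ℂ} (h : IsTest φ) :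
    Continuous (fun p : ℝ × ℝ => ft φ p.1 p.2) := by
  have hK : IsCompact (Prod.snd '' tsupport φ) := h.supp.isCompact.image continuous_snd
  have hφ := h.cont
  have := continuous_parametric_integral_of_continuous (μ := (volume : Measure ℝ))
    (f := fun (p : ℝ × ℝ) (y : ℝ) =>
      φ (p.1, y) * fker p.2 y)
    (by simp only [Function.uncurry_def, fker]; fun_prop) hK
  convert! this using 2 with p
  unfold ft
  refine (setIntegral_eq_integral_of_forall_compl_eq_zero fun y hy => ?_).symm
  simp [IsTest.eq_zero hy]

lemma IsTest.continuous_ft_left {φ : ℝ × ℝ → ℂ} (h : IsTest φ) (ξ : ℝ) :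
    Continuous fun x => ft φ x ξ := h.continuous_ft.comp (by fun_prop : Continuous fun x => (x, ξ))

lemma IsTest.integrable_slice {φ : ℝ × ℝ → ℂ} (h : IsTest φ) (x ξ : ℝ) :
    Integrable fun y => φ (x, y) * fker ξ y := by
  have := h.cont
  unfold fker
  exact Continuous.integrable_of_hasCompactSupport (by fun_prop) ((h.slice x).mul_right)

lemma ft_add {φ ψ : ℝ × ℝ → ℂ} (h : IsTest φ) (h' : IsTest ψ) (x ξ : ℝ) :
    ft (fun p => φ p + ψ p) x ξ = ft φ x ξ + ft ψ x ξ := by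
  unfold ft
  rw [← integral_add (h.integrable_slice x ξ) (h'.integrable_slice x ξ)]
  simp only [add_mul]

lemma ft_const_mul (φ : ℝ × ℝ → ℂ) (c : ℂ) (x ξ : ℝ) :
    ft (fun p => c * φ p) x ξ = c * ft φ x ξ := by
  unfold ft
  rw [← integral_const_mul]
  simp only [mul_assoc]

lemma ft_sub {φ ψ : ℝ × ℝ → ℂ} (h : IsTest φ) (h' : IsTest ψ) (x ξ : ℝ) :
    ft (fun p => φ p - ψ p) x ξ = ft φ x ξ - ft ψ x ξ := by
  unfold ft
  rw [← integral_sub (h.integrable_slice x ξ) (h'.integrable_slice x ξ)]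
  simp only [sub_mul]

/-! ### The resolvent estimate for test functions -/

/-- First component of `(𝒟 - ω - s M)(a, b)`, where `M (u, v) = (v, -u)`; this is the operator
`𝒟 - ω` conjugated by the weight `e^{sy}`. -/
def twist₁ (ω s : ℝ) (a b : ℝ × ℝ → ℂ) (p : ℝ × ℝ) : ℂ :=
  -I * dx b p + dy b p - ω * a p - s * b p

/-- Second component of `(𝒟 - ω - s M)(a, b)`. -/
def twist₂ (ω s : ℝ) (a b : ℝ × ℝ → ℂ) (p : ℝ × ℝ) : ℂ :=
  -I * dx a p - dy a p - ω * b p + s * a p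

lemma IsTest.twist₁ {a b : ℝ × ℝ → ℂ} (ha : IsTest a) (hb : IsTest b) (ω s : ℝ) :
    IsTest (twist₁ ω s a b) :=
  (((hb.dx.const_mul _).add hb.dy).sub (ha.const_mul _)).sub (hb.const_mul _)

lemma IsTest.twist₂ {a b : ℝ × ℝ → ℂ} (ha : IsTest a) (hb : IsTest b) (ω s : ℝ) :
    IsTest (twist₂ ω s a b) :=
  (((ha.dx.const_mul _).sub ha.dy).sub (hb.const_mul _)).add (ha.const_mul _)

/-- On the Fourier side the twisted operator acts as the cross-section problem with the wave
vector `-2πξ - is`. -/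
lemma crossSection_ft {a b : ℝ × ℝ → ℂ} (ha : IsTest a) (hb : IsTest b)
    (ha0 : ∀ y, a (0, y) = 0) (hb1 : ∀ y, b (1, y) = 0) (ω s ξ : ℝ) :
    CrossSection ω (-(2 * π * ξ : ℝ) - s * I)
      (fun x => ft a x ξ) (fun x => ft b x ξ)
      (fun x => ft (twist₁ ω s a b) x ξ) (fun x => ft (twist₂ ω s a b) x ξ) := by
  have e1 : ∀ x, ft (twist₁ ω s a b) x ξ = -I * ft (dx b) x ξ
      + 2 * π * I * ξ * ft b x ξ - ω * ft a x ξ - s * ft b x ξ := by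
    intro x
    unfold twist₁
    rw [ft_sub (((hb.dx.const_mul _).add hb.dy).sub (ha.const_mul _)) (hb.const_mul _),
      ft_sub ((hb.dx.const_mul _).add hb.dy) (ha.const_mul _),
      ft_add (hb.dx.const_mul _) hb.dy, ft_const_mul, ft_const_mul, ft_const_mul, hb.ft_dy]
  have e2 : ∀ x, ft (twist₂ ω s a b) x ξ = -I * ft (dx a) x ξ
      - 2 * π * I * ξ * ft a x ξ - ω * ft b x ξ + s * ft a x ξ := by
    intro x
    unfold twist₂
    rw [ft_add (((ha.dx.const_mul _).sub ha.dy).sub (hb.const_mul _)) (ha.const_mul _),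
      ft_sub ((ha.dx.const_mul _).sub ha.dy) (hb.const_mul _),
      ft_sub (ha.dx.const_mul _) ha.dy, ft_const_mul, ft_const_mul, ft_const_mul, ha.ft_dy]
  have hI := I_sq
  refine ⟨fun x => (ha.hasDerivAt_ft ξ x).congr_deriv ?_,
    fun x => (hb.hasDerivAt_ft ξ x).congr_deriv ?_, by simp [ft, ha0], by simp [ft, hb1],
    (ha.twist₁ hb ω s).continuous_ft_left ξ,
    (ha.twist₂ hb ω s).continuous_ft_left ξ⟩
  · rw [e2]
    push_cast
    linear_combination (ft (dx a) x ξ + 2 * π * ξ * ft a x ξ) * hI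
  · rw [e1]
    push_cast
    linear_combination (ft (dx b) x ξ - 2 * π * ξ * ft b x ξ) * hI

/-- The cross-section problem at energy `ω` has a resolvent bounded by `K`, modulo the functionals
`pairing (α i) (β i)`, on the line `Im λ = -s`. -/
structure LineBound {ι : Type*} [Fintype ι] (ω s K : ℝ) (α β : ι → ℝ → ℂ) : Prop where
  nonneg : 0 ≤ K
  cont_left : ∀ i, Continuous (α i)
  cont_right : ∀ i, Continuous (β i)
  bound : ∀ (lam : ℂ), lam.im = -s → ∀ u v F₁ F₂, CrossSection ω lam u v F₁ F₂ →
    sqNorm u v ≤ K * (sqNorm F₁ F₂ + ∑ i, ‖pairing (α i) (β i) u v‖ ^ 2)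

lemma lintegral_strip {f : ℝ × ℝ → ENNReal} (hf : Measurable f) :
    ∫⁻ p in strip, f p = ∫⁻ x in Ioo (0 : ℝ) 1, ∫⁻ y, f (x, y) := by
  rw [strip, Measure.volume_eq_prod, ← Measure.prod_restrict, Measure.restrict_univ,
    lintegral_prod _ hf.aemeasurable]

lemma ofReal_sqNorm {u v : ℝ → ℂ} (hu : Continuous u) (hv : Continuous v) :
    ofReal (sqNorm u v) = ∫⁻ x in Ioo (0 : ℝ) 1, (‖u x‖ₑ ^ 2 + ‖v x‖ₑ ^ 2) := by
  unfold sqNorm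
  rw [intervalIntegral.integral_of_le zero_le_one, integral_Ioc_eq_integral_Ioo,
    ofReal_integral_eq_lintegral_ofReal]
  · congr 1; ext x
    rw [ENNReal.ofReal_add (by positivity) (by positivity), ENNReal.ofReal_pow (norm_nonneg _),
      ENNReal.ofReal_pow (norm_nonneg _), ofReal_norm, ofReal_norm]
  · exact (Continuous.integrableOn_Icc (by fun_prop)).mono_set Ioo_subset_Icc_self
  · exact .of_forall fun x => by positivity

/-- The squared `L²` norm over the strip of a pair of test functions, computed on the Fourier
side. -/
lemma lintegral_strip_eq_ft {a b : ℝ × ℝ → ℂ} (ha : IsTest a) (hb : IsTest b) :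
    ∫⁻ p in strip, (‖a p‖ₑ ^ 2 + ‖b p‖ₑ ^ 2) =
      ∫⁻ ξ : ℝ, ofReal (sqNorm (fun x => ft a x ξ) (fun x => ft b x ξ)) := by
  have ca := ha.cont
  have cb := hb.cont
  have ma : Measurable fun p : ℝ × ℝ => ‖ft a p.1 p.2‖ₑ ^ 2 :=
    ha.continuous_ft.enorm.measurable.pow_const 2
  have mb : Measurable fun p : ℝ × ℝ => ‖ft b p.1 p.2‖ₑ ^ 2 :=
    hb.continuous_ft.enorm.measurable.pow_const 2
  rw [lintegral_strip (f := fun p => ‖a p‖ₑ ^ 2 + ‖b p‖ₑ ^ 2)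
    ((ca.enorm.measurable.pow_const 2).add (cb.enorm.measurable.pow_const 2))]
  simp_rw [ofReal_sqNorm (ha.continuous_ft_left _) (hb.continuous_ft_left _)]
  have hm : Measurable (Function.uncurry fun x ξ => ‖ft a x ξ‖ₑ ^ 2 + ‖ft b x ξ‖ₑ ^ 2) :=
    ma.add mb
  rw [← lintegral_lintegral_swap (f := fun x ξ => ‖ft a x ξ‖ₑ ^ 2 + ‖ft b x ξ‖ₑ ^ 2)
    hm.aemeasurable]
  refine lintegral_congr fun x => ?_
  have m1 : Measurable fun y => ‖a (x, y)‖ₑ ^ 2 :=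
    (by fun_prop : Continuous fun y => a (x, y)).enorm.measurable.pow_const 2
  have c2 : Continuous fun ξ => ft a x ξ :=
    ha.continuous_ft.comp (by fun_prop : Continuous fun ξ : ℝ => (x, ξ))
  have m2 : Measurable fun ξ => ‖ft a x ξ‖ₑ ^ 2 := c2.enorm.measurable.pow_const 2
  rw [lintegral_add_left m1, lintegral_add_left m2, plancherel_slice ha, plancherel_slice hb]

/-- Plancherel's theorem for functionals on the cross-section. -/
lemma pairing_ft {a b : ℝ × ℝ → ℂ} (ha : IsTest a) (hb : IsTest b) {α β : ℝ → ℂ}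
    (hα : Continuous α) (hβ : Continuous β) :
    ∫⁻ ξ : ℝ, ‖pairing α β (fun x => ft a x ξ) (fun x => ft b x ξ)‖ₑ ^ 2 =
      ∫⁻ y : ℝ, ‖pairing α β (fun x => a (x, y)) (fun x => b (x, y))‖ₑ ^ 2 := by
  have ca := ha.cont
  have cb := hb.cont
  set h : ℝ → ℂ := fun y => pairing α β (fun x => a (x, y)) (fun x => b (x, y))
  have split : ∀ {u v : ℝ → ℂ}, Continuous u → Continuous v → pairing α β u v =
      (∫ x in Ioc (0 : ℝ) 1, u x * α x) + ∫ x in Ioc (0 : ℝ) 1, v x * β x := by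
    intro u v _ _
    rw [pairing, intervalIntegral.integral_of_le zero_le_one, integral_add] <;>
      exact (Continuous.integrableOn_Icc (by fun_prop)).mono_set Ioc_subset_Icc_self
  have hsplit : ∀ y, h y = (∫ x in Ioc (0 : ℝ) 1, a (x, y) * α x) +
      ∫ x in Ioc (0 : ℝ) 1, b (x, y) * β x := fun y => split (by fun_prop) (by fun_prop)
  have hsm : ContDiff ℝ (⊤ : ℕ∞) h := by
    have := (ha.swap.contDiff_integral (μ := volume.restrict (Ioc 0 1)) hα).add
      (hb.swap.contDiff_integral (μ := volume.restrict (Ioc 0 1)) hβ)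
    rwa [show h = _ from funext hsplit]
  have hcs : HasCompactSupport h := by
    refine HasCompactSupport.intro ((ha.supp.isCompact.image continuous_snd).union
      (hb.supp.isCompact.image continuous_snd)) fun y hy => ?_
    rw [mem_union, not_or] at hy
    simp [h, pairing, IsTest.eq_zero hy.1, IsTest.eq_zero hy.2]
  rw [← plancherel hsm hcs]
  refine lintegral_congr fun ξ => ?_
  congr 2
  set E : ℝ → ℂ := fker ξ
  have cE : Continuous E := by unfold E fker; fun_prop
  have fub : ∀ {φ : ℝ × ℝ → ℂ} {g : ℝ → ℂ}, IsTest φ → Continuous g →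
      ∫ x in Ioc (0 : ℝ) 1, ft φ x ξ * g x = ∫ y, (∫ x in Ioc (0 : ℝ) 1, φ (x, y) * g x) * E y ∧
      Integrable (fun y => (∫ x in Ioc (0 : ℝ) 1, φ (x, y) * g x) * E y) := by
    intro φ g hφ hg
    have cφ := hφ.cont
    have hi : Integrable (fun p : ℝ × ℝ => φ p * g p.1 * E p.2)
        ((volume.restrict (Ioc (0 : ℝ) 1)).prod volume) := by
      refine Continuous.integrable_of_hasCompactSupport (by fun_prop) ?_
      exact hφ.supp.mul_right.mul_right
    constructor
    · simp only [ft, ← integral_mul_const]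
      have := integral_integral_swap (f := fun x y => φ (x, y) * g x * E y) hi
      refine Eq.trans ?_ this
      refine integral_congr_ae (.of_forall fun x => ?_)
      refine integral_congr_ae (.of_forall fun y => ?_)
      simp only [E]; ring
    · have := hi.integral_prod_right
      refine this.congr (.of_forall fun y => ?_)
      simp only [integral_mul_const]
  rw [split (ha.continuous_ft_left ξ) (hb.continuous_ft_left ξ), (fub ha hα).1, (fub hb hβ).1,
    ← integral_add (fub ha hα).2 (fub hb hβ).2]
  simp only [hsplit, add_mul, E]

/-- The resolvent estimate for test functions, by Plancherel's theorem. -/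
lemma LineBound.test_bound {ι : Type*} [Fintype ι] {ω s K : ℝ} {α β : ι → ℝ → ℂ}
    (hL : LineBound ω s K α β) {a b : ℝ × ℝ → ℂ} (ha : IsTest a) (hb : IsTest b)
    (ha0 : ∀ y, a (0, y) = 0) (hb1 : ∀ y, b (1, y) = 0) :
    ∫⁻ p in strip, (‖a p‖ₑ ^ 2 + ‖b p‖ₑ ^ 2) ≤ ofReal K *
      ((∫⁻ p in strip, (‖twist₁ ω s a b p‖ₑ ^ 2 + ‖twist₂ ω s a b p‖ₑ ^ 2)) +
        ∑ i, ∫⁻ y, ‖pairing (α i) (β i) (fun x => a (x, y)) (fun x => b (x, y))‖ₑ ^ 2) := by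
  rw [lintegral_strip_eq_ft ha hb, lintegral_strip_eq_ft (ha.twist₁ hb ω s) (ha.twist₂ hb ω s)]
  simp_rw [← pairing_ft ha hb (hL.cont_left _) (hL.cont_right _)]
  have cpair : ∀ i, Continuous fun ξ =>
      pairing (α i) (β i) (fun x => ft a x ξ) (fun x => ft b x ξ) := by
    intro i
    have := hL.cont_left i
    have := hL.cont_right i
    have h1 := ha.continuous_ft
    have h2 := hb.continuous_ft
    refine intervalIntegral.continuous_parametric_intervalIntegral_of_continuous'
      (f := fun ξ x => ft a x ξ * α i x + ft b x ξ * β i x) ?_ 0 1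
    have h3 : Continuous fun q : ℝ × ℝ => ft a q.2 q.1 := h1.comp continuous_swap
    have h4 : Continuous fun q : ℝ × ℝ => ft b q.2 q.1 := h2.comp continuous_swap
    simp only [Function.uncurry_def]
    fun_prop
  rw [← lintegral_finsetSum _ fun i _ => (cpair i).enorm.measurable.pow_const 2,
    ← lintegral_add_right, ← lintegral_const_mul' _ _ ofReal_ne_top]
  · refine lintegral_mono fun ξ => ?_
    have := hL.bound _ (by simp) _ _ _ _ (crossSection_ft ha hb ha0 hb1 ω s ξ)
    refine (ENNReal.ofReal_le_ofReal this).trans ?_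
    rw [ENNReal.ofReal_mul hL.nonneg, ENNReal.ofReal_add (sqNorm_nonneg _ _)
      (Finset.sum_nonneg fun i _ => by positivity),
      ENNReal.ofReal_sum_of_nonneg fun i _ => by positivity]
    simp_rw [ENNReal.ofReal_pow (norm_nonneg _), ofReal_norm]
    exact le_rfl
  · exact Finset.measurable_sum _ fun i _ => (cpair i).enorm.measurable.pow_const 2

/-! ### Mollification in `L²` -/

lemma eLpNorm_two_sq {α E : Type*} [MeasurableSpace α] [NormedAddCommGroup E] (f : α → E)
    (μ : Measure α) : eLpNorm f 2 μ ^ 2 = ∫⁻ x, ‖f x‖ₑ ^ 2 ∂μ := by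
  have := eLpNorm_nnreal_pow_eq_lintegral (f := f) (μ := μ) (p := 2) (by norm_num)
  simpa only [NNReal.coe_ofNat, ENNReal.coe_ofNat, ENNReal.rpow_ofNat] using this

lemma eLpNorm_two_le_iff {α E : Type*} [MeasurableSpace α] [NormedAddCommGroup E] {f : α → E}
    {μ : Measure α} {C : ENNReal} : eLpNorm f 2 μ ≤ C ↔ ∫⁻ x, ‖f x‖ₑ ^ 2 ∂μ ≤ C ^ 2 := by
  rw [← eLpNorm_two_sq, ENNReal.pow_le_pow_left_iff two_ne_zero]

/-- Translations are continuous in `L²(ℝ²)`. -/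
lemma eLpNorm_translate_le {g : ℝ × ℝ → ℂ} (hg : MemLp g 2 volume) {ε : ENNReal} (hε : ε ≠ 0) :
    ∃ ρ : ℝ, 0 < ρ ∧ ∀ q : ℝ × ℝ, ‖q‖ < ρ → eLpNorm (fun p => g (p - q) - g p) 2 volume ≤ ε := by
  let T : ℝ × ℝ → C(ℝ × ℝ, ℝ × ℝ) := fun q => ⟨fun p => p - q, by fun_prop⟩
  have hT : Continuous T := by
    have : Continuous (Function.uncurry fun (q p : ℝ × ℝ) => p - q) := by
      simp only [Function.uncurry_def]; fun_prop
    exact ContinuousMap.continuous_of_continuous_uncurry T this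
  have hm : ∀ q, MeasurePreserving (T q) (volume : Measure (ℝ × ℝ)) volume := fun q =>
    measurePreserving_sub_right volume q
  have hm0 : MeasurePreserving (T 0) (volume : Measure (ℝ × ℝ)) volume := hm 0
  have h := Filter.Tendsto.compMeasurePreservingLp (p := 2)
    (tendsto_const_nhds (x := hg.toLp g) (f := 𝓝 (0 : ℝ × ℝ)))
    (hT.tendsto 0) hm (hm 0) (by norm_num)
  rw [EMetric.tendsto_nhds] at h
  obtain ⟨ρ, hρ, hb⟩ := Metric.eventually_nhds_iff.1 (h ε (pos_iff_ne_zero.2 hε))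
  refine ⟨ρ, hρ, fun q hq => ?_⟩
  have := (hb (by simpa [dist_zero_right] using hq : dist q 0 < ρ)).le
  rw [Lp.edist_def] at this
  refine le_trans (le_of_eq (eLpNorm_congr_ae ?_)) this
  have e1 := Lp.coeFn_compMeasurePreserving (hg.toLp g) (hm q)
  have e2 := Lp.coeFn_compMeasurePreserving (hg.toLp g) (hm 0)
  have e3 := hg.coeFn_toLp
  have e4 : (hg.toLp g) ∘ T q =ᵐ[volume] g ∘ T q :=
    (hm q).quasiMeasurePreserving.ae_eq_comp e3
  filter_upwards [e1, e2, e3, e4] with p h1 h2 h3 h4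
  rw [Pi.sub_apply, h1, h2, h4]
  simp only [Function.comp_apply, T, ContinuousMap.coe_mk, sub_zero]
  rw [h3]

/-- Averaging over small translations is close to the identity in `L²`. -/
lemma eLpNorm_average_sub_le {g : ℝ × ℝ → ℂ} (hg : MemLp g 2 volume) {η : ℝ × ℝ → ℝ}
    (hη : Continuous η) (hs : HasCompactSupport η) (h0 : ∀ q, 0 ≤ η q) (h1 : ∫ q, η q = 1)
    {ε : ENNReal}
    (hε : ∀ q, η q ≠ 0 → eLpNorm (fun p => g (p - q) - g p) 2 volume ≤ ε) :
    eLpNorm (fun p => (∫ t, g t * (η (p - t) : ℂ)) - g p) 2 volume ≤ ε := by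
  have hηi : Integrable η := hη.integrable_of_hasCompactSupport hs
  set ν : Measure (ℝ × ℝ) := volume.withDensity fun q => ofReal (η q) with hν
  have hmη : Measurable fun q => ofReal (η q) := (ENNReal.continuous_ofReal.comp hη).measurable
  have hprob : IsProbabilityMeasure ν := by
    constructor
    rw [hν, withDensity_apply _ MeasurableSet.univ, Measure.restrict_univ,
      ← ofReal_integral_eq_lintegral_ofReal hηi (.of_forall h0), h1,
      ENNReal.ofReal_one]
  have hac : ν ≪ volume := withDensity_absolutelyContinuous _ _
  have hgm := hg.aestronglyMeasurable
  have hgl : LocallyIntegrable g := hg.locallyIntegrable (by norm_num)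
  have hshift : ∀ p : ℝ × ℝ, AEStronglyMeasurable (fun q => g (p - q)) volume := fun p =>
    hgm.comp_quasiMeasurePreserving (quasiMeasurePreserving_sub_left volume p)
  have hpt : ∀ p, ‖(∫ t, g t * (η (p - t) : ℂ)) - g p‖ₑ ^ 2 ≤ ∫⁻ q, ‖g (p - q) - g p‖ₑ ^ 2 ∂ν := by
    intro p
    have e1 : (∫ t, g t * (η (p - t) : ℂ)) = ∫ q, g (p - q) * (η q : ℂ) := by
      have := integral_sub_left_eq_self (fun t => g t * (η (p - t) : ℂ)) volume p
      rw [← this]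
      simp
    have i1 : Integrable fun q => g (p - q) * (η q : ℂ) := by
      have hsc : HasCompactSupport fun q => (η q : ℂ) := hs.comp_left (g := Complex.ofReal) rfl
      have := (hsc.convolutionExists_right (ContinuousLinearMap.mul ℝ ℂ) hgl
        (by fun_prop)) p
      have h3 := (integrable_comp_sub_left
        (fun t => g t * (η (p - t) : ℂ)) (μ := volume) p).2 this
      simpa using h3
    have i2 : Integrable fun q => g p * (η q : ℂ) := hηi.ofReal.const_mul _
    have e2 : (∫ t, g t * (η (p - t) : ℂ)) - g p = ∫ q, (g (p - q) - g p) * (η q : ℂ) := by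
      have : g p = ∫ q, g p * (η q : ℂ) := by
        have h2 : ∫ q, (η q : ℂ) = 1 := by rw [integral_complex_ofReal, h1]; simp
        rw [integral_const_mul, h2, mul_one]
      rw [e1]
      conv_lhs => rw [this]
      rw [← integral_sub i1 i2]
      simp only [sub_mul]
    have e3 : ‖(∫ t, g t * (η (p - t) : ℂ)) - g p‖ₑ ≤ eLpNorm (fun q => g (p - q) - g p) 1 ν := by
      rw [e2, eLpNorm_one_eq_lintegral_enorm, hν,
        lintegral_withDensity_eq_lintegral_mul₀ hmη.aemeasurable]
      · refine (enorm_integral_le_lintegral_enorm _).trans (le_of_eq ?_)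
        refine lintegral_congr fun q => ?_
        rw [enorm_mul, Pi.mul_apply, mul_comm]
        congr 1
        rw [← ofReal_norm, norm_real, Real.norm_of_nonneg (h0 q)]
      · exact ((hshift p).sub aestronglyMeasurable_const).enorm
    have e4 := eLpNorm_le_eLpNorm_of_exponent_le (μ := ν) (p := 1) (q := 2) (by norm_num)
      (((hshift p).sub aestronglyMeasurable_const).mono_ac hac :
        AEStronglyMeasurable (fun q => g (p - q) - g p) ν)
    calc _ ≤ eLpNorm (fun q => g (p - q) - g p) 2 ν ^ 2 := by
          gcongr; exact e3.trans e4
      _ = _ := eLpNorm_two_sq _ _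
  rw [eLpNorm_two_le_iff]
  calc _ ≤ ∫⁻ p, ∫⁻ q, ‖g (p - q) - g p‖ₑ ^ 2 ∂ν := lintegral_mono hpt
    _ = ∫⁻ q, (∫⁻ p, ‖g (p - q) - g p‖ₑ ^ 2) ∂ν := by
        refine lintegral_lintegral_swap ?_
        have m1 : AEStronglyMeasurable (fun z : (ℝ × ℝ) × (ℝ × ℝ) => g (z.1 - z.2))
            (volume.prod volume) :=
          hgm.comp_quasiMeasurePreserving (quasiMeasurePreserving_sub volume volume)
        have m2 : AEStronglyMeasurable (fun z : (ℝ × ℝ) × (ℝ × ℝ) => g z.1)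
            (volume.prod volume) := hgm.comp_fst
        have m3 := ((m1.sub m2).mono_ac (Measure.AbsolutelyContinuous.prod
          (Measure.AbsolutelyContinuous.refl _) hac)).enorm.pow_const 2
        exact m3
    _ ≤ ∫⁻ q, ε ^ 2 ∂ν := by
        refine lintegral_mono_ae ?_
        have : ∀ᵐ q ∂ν, η q ≠ 0 := by
          rw [hν, ae_withDensity_iff hmη]
          refine .of_forall fun q hq hη0 => hq ?_
          simp [hη0]
        filter_upwards [this] with q hq
        rw [← eLpNorm_two_sq]
        gcongr
        exact hε q hq
    _ = ε ^ 2 := by simp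

lemma measurableSet_strip : MeasurableSet strip := measurableSet_Ioo.prod MeasurableSet.univ

/-- Weak solutions of the scalar equation `(-i∂ₓ - σ∂_y) u = f`, `σ = ±1`, vanishing on the side
`σx = m` of the strip `m < σx < m + 1`, are limits of test functions supported in `σx > m`: the
extension of `u` by zero is shifted into the strip and mollified. -/
lemma exists_test_approx {σ m : ℝ} (hσ : σ = 1 ∨ σ = -1)
    (hm : ∀ p ∈ strip, m < σ * p.1 ∧ σ * p.1 < m + 1) {u f : ℝ × ℝ → ℂ} (hu : MemLp u 2 μS)
    (hf : MemLp f 2 μS) {R : ℝ} (hR : ∀ p, R < |p.2| → u p = 0)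
    (h : ∀ φ : ℝ × ℝ → ℂ, ContDiff ℝ (⊤ : ℕ∞) φ → HasCompactSupport φ →
      tsupport φ ⊆ {p | σ * p.1 < m + 1} →
      ∫ p in strip, u p * (-I * dx φ p - σ * dy φ p) = -∫ p in strip, f p * φ p)
    {ε : ENNReal} (hε : ε ≠ 0) :
    ∃ a, IsTest a ∧ tsupport a ⊆ {p | m < σ * p.1} ∧
      eLpNorm (fun p => a p - u p) 2 μS ≤ ε ∧
      eLpNorm (fun p => (-I * dx a p - σ * dy a p) - f p) 2 μS ≤ ε := by
  set U := strip.indicator u with hU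
  set F := strip.indicator f
  have hUL : MemLp U 2 volume := (memLp_indicator_iff_restrict measurableSet_strip).2 hu
  have hFL : MemLp F 2 volume := (memLp_indicator_iff_restrict measurableSet_strip).2 hf
  obtain ⟨ρ₁, hρ₁, ht₁⟩ := eLpNorm_translate_le hUL hε
  obtain ⟨ρ₂, hρ₂, ht₂⟩ := eLpNorm_translate_le hFL hε
  set r := min ρ₁ ρ₂ / 2 with hr
  have hr0 : 0 < r := by positivity
  let bump : ContDiffBump ((σ * r, 0) : ℝ × ℝ) := ⟨r / 4, r / 2, by positivity, by linarith⟩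
  set η : ℝ × ℝ → ℝ := bump.normed volume with hη
  have sη : HasCompactSupport η := bump.hasCompactSupport_normed
  have suppη : ∀ q, η q ≠ 0 → ‖q - (σ * r, 0)‖ < r / 2 := by
    intro q hq
    have : q ∈ Function.support η := hq
    rwa [hη, bump.support_normed_eq, mem_ball_iff_norm] at this
  have normη : ∀ q, η q ≠ 0 → ‖q‖ < min ρ₁ ρ₂ := by
    intro q hq
    have h2 : ‖((σ * r, 0) : ℝ × ℝ)‖ = r := by
      rcases hσ with rfl | rfl <;> simp [Prod.norm_def, abs_of_pos hr0, hr0.le]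
    linarith [suppη q hq, norm_le_norm_sub_add q (σ * r, 0)]
  have fstη : ∀ q, η q ≠ 0 → r / 2 < σ * q.1 := by
    intro q hq
    have h1 := (norm_fst_le _).trans_lt (suppη q hq)
    simp only [Prod.fst_sub, norm_eq_abs, abs_lt] at h1
    rcases hσ with rfl | rfl <;> linarith [h1.1, h1.2]
  set ηc : ℝ × ℝ → ℂ := fun q => (η q : ℂ) with hηc
  have smηc : ContDiff ℝ (⊤ : ℕ∞) ηc := Complex.ofRealCLM.contDiff.comp bump.contDiff_normed
  have sηc : HasCompactSupport ηc := sη.comp_left (g := Complex.ofReal) rfl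
  have c1ηc : ContDiff ℝ 1 ηc := smηc.of_le (by exact_mod_cast le_top)
  set L := ContinuousLinearMap.mul ℝ ℂ
  have hUl : LocallyIntegrable U := hUL.locallyIntegrable (by norm_num)
  set a : ℝ × ℝ → ℂ := MeasureTheory.convolution U ηc L volume
  have haf : ∀ p, a p = ∫ t, U t * ηc (p - t) := fun p => rfl
  have hUs : HasCompactSupport U := by
    refine HasCompactSupport.intro (K := Icc (0 : ℝ) 1 ×ˢ Icc (-R) R)
      (isCompact_Icc.prod isCompact_Icc) fun p hp => indicator_apply_eq_zero.2 fun hps => hR p ?_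
    by_contra! hcon
    exact hp ⟨⟨hps.1.1.le, hps.1.2.le⟩, abs_le.1 hcon⟩
  have hat : IsTest a := ⟨sηc.contDiff_convolution_right L hUl smηc, hUs.convolution L sηc⟩
  have hd : ∀ (p v : ℝ × ℝ), fderiv ℝ a p v = ∫ t, U t * fderiv ℝ ηc (p - t) v := by
    intro p v
    rw [(sηc.hasFDerivAt_convolution_right L hUl c1ηc p).fderiv,
      convolution_precompR_apply L hUl (sηc.fderiv ℝ) (c1ηc.continuous_fderiv one_ne_zero)]
    rfl
  have key : ∀ p ∈ strip, -I * dx a p - σ * dy a p = ∫ t, F t * ηc (p - t) := by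
    intro p hp
    set φ : ℝ × ℝ → ℂ := fun t => ηc (p - t) with hφ
    have tφ : tsupport φ ⊆ {q | σ * q.1 < m + 1} := by
      have : tsupport φ ⊆ {q | σ * q.1 ≤ σ * p.1 - r / 2} := by
        refine closure_minimal (fun q hq => ?_) (isClosed_le (by fun_prop) (by fun_prop))
        have := fstη (p - q) fun h0 => hq (by simp [hφ, hηc, h0])
        simp only [Prod.fst_sub] at this
        simp only [mem_ofPred_eq]; linarith
      refine this.trans fun q hq => ?_
      simp only [mem_ofPred_eq] at hq ⊢
      linarith [(hm p hp).2]
    have dφ : ∀ t v, fderiv ℝ φ t v = -fderiv ℝ ηc (p - t) v := by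
      intro t v
      have h2 := ((c1ηc.differentiable one_ne_zero (p - t)).hasFDerivAt).comp t
        ((hasFDerivAt_id t).const_sub p)
      change fderiv ℝ (ηc ∘ fun t => p - t) t v = _
      rw [h2.fderiv]
      simp
    have hw := h φ (smηc.comp (by fun_prop)) (sηc.comp_homeomorph (Homeomorph.subLeft p)) tφ
    have ind : ∀ w g : ℝ × ℝ → ℂ, ∫ t in strip, w t * g t = ∫ t, strip.indicator w t * g t := by
      intro w g
      rw [← integral_indicator measurableSet_strip]
      congr 1; ext t
      by_cases ht : t ∈ strip <;> simp [ht]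
    rw [ind, ind, ← neg_eq_iff_eq_neg] at hw
    have iU : ∀ v, Integrable fun t => U t * fderiv ℝ ηc (p - t) v := by
      intro v
      have hc : HasCompactSupport fun q => fderiv ℝ ηc q v := sηc.fderiv_apply (𝕜 := ℝ) v
      exact (hc.convolutionExists_right L hUl
        ((c1ηc.continuous_fderiv one_ne_zero).clm_apply continuous_const)) p
    simp only [dx, dy] at hw ⊢
    rw [hd, hd, ← integral_const_mul, ← integral_const_mul,
      ← integral_sub ((iU _).const_mul _) ((iU _).const_mul _), ← hw, ← integral_neg]
    refine integral_congr_ae (.of_forall fun t => ?_)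
    simp only [dφ]
    ring
  have close : ∀ {g k : ℝ × ℝ → ℂ}, MemLp (strip.indicator g) 2 volume →
      (∀ q, η q ≠ 0 → eLpNorm (fun p => strip.indicator g (p - q) - strip.indicator g p) 2
        volume ≤ ε) → (∀ p ∈ strip, k p = ∫ t, strip.indicator g t * ηc (p - t)) →
      eLpNorm (fun p => k p - g p) 2 μS ≤ ε := by
    intro g k hg ht hk
    refine le_trans (le_of_eq (eLpNorm_congr_ae ?_))
      ((eLpNorm_mono_measure _ (Measure.restrict_le_self (s := strip))).trans
        (eLpNorm_average_sub_le hg bump.continuous_normed sη bump.nonneg_normed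
          bump.integral_normed ht))
    filter_upwards [ae_restrict_mem measurableSet_strip] with p hp
    rw [hk p hp, indicator_of_mem hp]
  refine ⟨a, hat, ?_, close hUL (fun q hq => ht₁ q ((normη q hq).trans_le (min_le_left _ _)))
    fun p _ => haf p, close hFL (fun q hq => ht₂ q ((normη q hq).trans_le (min_le_right _ _))) key⟩
  have : tsupport a ⊆ {q | m + r / 2 ≤ σ * q.1} := by
    refine closure_minimal (fun q hq => ?_) (isClosed_le (by fun_prop) (by fun_prop))
    by_contra! hcon
    refine hq (integral_eq_zero_of_ae (.of_forall fun t => ?_))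
    by_cases hts : t ∈ strip
    · have : η (q - t) = 0 := by
        by_contra h0
        have := fstη _ h0
        simp only [Prod.fst_sub, mem_ofPred_eq, not_le] at *
        linarith [(hm t hts).1]
      simp [L, hηc, this]
    · simp [hU, hts]
  refine this.trans fun q hq => ?_
  simp only [mem_ofPred_eq] at hq ⊢
  linarith

/-! ### Weak solutions -/

/-- The matrix `M (u, v) = (v, -u)` multiplying `∂_y` in the Dirac operator. -/
def Mop (w : Field2) : Field2 := fun p => ((w p).2, -(w p).1)

/-- The Dirac operator applied to a smooth pair. -/
def diracOp (a b : ℝ × ℝ → ℂ) : Field2 := fun p =>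
  (-I * dx b p + dy b p, -I * dx a p - dy a p)

/-- Pairs of test functions satisfying the boundary conditions in the strong sense that the
components vanish near the respective sides. -/
structure IsTestPair (a b : ℝ × ℝ → ℂ) : Prop where
  fst : IsTest a
  snd : IsTest b
  left : tsupport a ⊆ {p | 0 < p.1}
  right : tsupport b ⊆ {p | p.1 < 1}

lemma eLpNorm_pair_le {μ : Measure (ℝ × ℝ)} {a b : ℝ × ℝ → ℂ} (ha : AEStronglyMeasurable a μ)
    (hb : AEStronglyMeasurable b μ) :
    eLpNorm (fun p => (a p, b p)) 2 μ ≤ eLpNorm a 2 μ + eLpNorm b 2 μ := by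
  have h1 : eLpNorm (fun p => (a p, b p)) 2 μ ≤ eLpNorm (fun p => ‖a p‖ + ‖b p‖) 2 μ := by
    refine eLpNorm_mono fun p => ?_
    rw [Real.norm_of_nonneg (by positivity), Prod.norm_def]
    exact max_le_add_of_nonneg (norm_nonneg _) (norm_nonneg _)
  refine h1.trans ((eLpNorm_add_le ha.norm hb.norm (by norm_num)).trans ?_)
  rw [eLpNorm_norm, eLpNorm_norm]

lemma norm_Mop (w : Field2) (p : ℝ × ℝ) : ‖Mop w p‖ = ‖w p‖ := by
  simp [Mop, Prod.norm_def, max_comm]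

lemma aesm_Mop {μ : Measure (ℝ × ℝ)} {w : Field2} (h : AEStronglyMeasurable w μ) :
    AEStronglyMeasurable (Mop w) μ :=
  (continuous_snd.comp_aestronglyMeasurable h).prodMk
    (continuous_fst.comp_aestronglyMeasurable h).neg

lemma memLp_Mop {μ : Measure (ℝ × ℝ)} {w : Field2} (h : MemLp w 2 μ) : MemLp (Mop w) 2 μ :=
  h.of_le (aesm_Mop h.aestronglyMeasurable) (.of_forall fun p => (norm_Mop w p).le)

/-- A weak solution in `L²` of compact support along the ribbon is approximated, in the graph
norm, by test pairs. -/
lemma exists_testPair_approx {w f : Field2} (hw : MemLp w 2 μS)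
    (hf : MemLp f 2 μS) {R : ℝ} (hR : ∀ p, R < |p.2| → w p = 0)
    (h : DiracEq w f) {ε : ENNReal} (hε : ε ≠ 0) :
    ∃ a b, IsTestPair a b ∧
      eLpNorm (fun p => (a p, b p) - w p) 2 μS ≤ ε ∧
      eLpNorm (fun p => diracOp a b p - f p) 2 μS ≤ ε := by
  have hε2 : ε / 2 ≠ 0 := by simp [hε]
  obtain ⟨a, ha, sa, ea, fa⟩ := exists_test_approx (σ := 1) (m := 0) (.inl rfl)
    (fun p hp => by simpa using hp.1) hw.fst hf.snd (R := R) (fun p hp => by rw [hR p hp]; rfl)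
    (fun φ h1 h2 h3 => by simpa using h.2 φ h1 h2 (by simpa using h3)) hε2
  obtain ⟨b, hb, sb, eb, fb⟩ := exists_test_approx (σ := -1) (m := -1) (.inr rfl)
    (fun p hp => by simpa using hp.1.symm) hw.snd hf.fst (R := R)
    (fun p hp => by rw [hR p hp]; rfl)
    (fun φ h1 h2 h3 => by simpa using h.1 φ h1 h2 (by simpa using h3)) hε2
  have e2 : ∀ {g k : ℝ × ℝ → ℂ}, AEStronglyMeasurable g μS → AEStronglyMeasurable k μS →
      eLpNorm g 2 μS ≤ ε / 2 → eLpNorm k 2 μS ≤ ε / 2 → eLpNorm (fun p => (g p, k p)) 2 μS ≤ ε :=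
    fun hg hk h1 h2 => (eLpNorm_pair_le hg hk).trans
      ((add_le_add h1 h2).trans_eq (ENNReal.add_halves ε))
  refine ⟨a, b, ⟨ha, hb, by simpa using sa, by simpa using sb⟩,
    e2 (ha.cont.aestronglyMeasurable.sub hw.fst.aestronglyMeasurable)
      (hb.cont.aestronglyMeasurable.sub hw.snd.aestronglyMeasurable) ea eb,
    e2 (((hb.dx.const_mul (-I)).add hb.dy).cont.aestronglyMeasurable.sub
        hf.fst.aestronglyMeasurable)
      (((ha.dx.const_mul (-I)).sub ha.dy).cont.aestronglyMeasurable.sub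
        hf.snd.aestronglyMeasurable) (by simpa [diracOp] using fb)
      (by simpa [diracOp] using fa)⟩

/-- The functional `pairing α β` applied on the cross-section at height `y`. -/
def pairY (α β : ℝ → ℂ) (w : Field2) (y : ℝ) : ℂ :=
  pairing α β (fun x => (w (x, y)).1) (fun x => (w (x, y)).2)

lemma strip_measure :
    (μS : Measure (ℝ × ℝ)) = (volume.restrict (Ioo (0 : ℝ) 1)).prod volume := by
  rw [strip, Measure.volume_eq_prod, ← Measure.prod_restrict, Measure.restrict_univ]

lemma pairY_eq (α β : ℝ → ℂ) (w : Field2) (y : ℝ) : pairY α β w y =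
    ∫ x in Ioo (0 : ℝ) 1, ((w (x, y)).1 * α x + (w (x, y)).2 * β x) := by
  rw [pairY, pairing, intervalIntegral.integral_of_le zero_le_one, integral_Ioc_eq_integral_Ioo]

lemma aesm_pairY_integrand {α β : ℝ → ℂ} (hα : Continuous α) (hβ : Continuous β) {w : Field2}
    (hw : AEStronglyMeasurable w μS) :
    AEStronglyMeasurable (fun p : ℝ × ℝ => (w p).1 * α p.1 + (w p).2 * β p.1)
      ((volume.restrict (Ioo (0 : ℝ) 1)).prod volume) := by
  rw [← strip_measure]
  have h1 : Continuous fun p : ℝ × ℝ => α p.1 := by fun_prop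
  have h2 : Continuous fun p : ℝ × ℝ => β p.1 := by fun_prop
  exact ((continuous_fst.comp_aestronglyMeasurable hw).mul h1.aestronglyMeasurable).add
    ((continuous_snd.comp_aestronglyMeasurable hw).mul h2.aestronglyMeasurable)

lemma aesm_pairY {α β : ℝ → ℂ} (hα : Continuous α) (hβ : Continuous β) {w : Field2}
    (hw : AEStronglyMeasurable w μS) :
    AEStronglyMeasurable (pairY α β w) volume := by
  have := (aesm_pairY_integrand hα hβ hw).prod_swap.integral_prod_right'
  refine this.congr (.of_forall fun y => ?_)
  rw [pairY_eq]; rfl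

lemma enorm_pairY_sq_le {α β : ℝ → ℂ} {A : ℝ} (hA : 0 ≤ A)
    (ha : ∀ x ∈ Icc (0 : ℝ) 1, ‖α x‖ ≤ A) (hb : ∀ x ∈ Icc (0 : ℝ) 1, ‖β x‖ ≤ A)
    {w : Field2} {y : ℝ}
    (hw : AEStronglyMeasurable (fun x => w (x, y)) (volume.restrict (Ioo (0 : ℝ) 1))) :
    ‖pairY α β w y‖ₑ ^ 2 ≤ ofReal (2 * A) ^ 2 * ∫⁻ x in Ioo (0 : ℝ) 1, ‖w (x, y)‖ₑ ^ 2 := by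
  have : IsProbabilityMeasure (volume.restrict (Ioo (0 : ℝ) 1)) := ⟨by simp⟩
  rw [← eLpNorm_two_sq, ← mul_pow, pairY_eq]
  gcongr
  have e4 := eLpNorm_le_eLpNorm_of_exponent_le (p := 1) (q := 2) (by norm_num) hw
  refine le_trans ?_ (mul_le_mul_right e4 _)
  rw [eLpNorm_one_eq_lintegral_enorm, ← lintegral_const_mul' _ _ ofReal_ne_top]
  refine (enorm_integral_le_lintegral_enorm _).trans ?_
  refine setLIntegral_mono' measurableSet_Ioo fun x hx => ?_
  have hx' : x ∈ Icc (0 : ℝ) 1 := ⟨hx.1.le, hx.2.le⟩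
  rw [← ofReal_norm, ← ofReal_norm, ← ENNReal.ofReal_mul (by positivity)]
  refine ENNReal.ofReal_le_ofReal ((norm_add_le _ _).trans ?_)
  rw [norm_mul, norm_mul]
  have h1 := ha x hx'
  have h2 := hb x hx'
  have h3 := norm_fst_le (w (x, y))
  have h4 := norm_snd_le (w (x, y))
  calc _ ≤ ‖w (x, y)‖ * A + ‖w (x, y)‖ * A := by gcongr
    _ = _ := by ring

lemma eLpNorm_pairY_le {α β : ℝ → ℂ} {A : ℝ} (hA : 0 ≤ A)
    (ha : ∀ x ∈ Icc (0 : ℝ) 1, ‖α x‖ ≤ A) (hb : ∀ x ∈ Icc (0 : ℝ) 1, ‖β x‖ ≤ A)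
    {w : Field2} (hw : AEStronglyMeasurable w μS) :
    eLpNorm (pairY α β w) 2 volume ≤
      ofReal (2 * A) * eLpNorm w 2 μS := by
  rw [eLpNorm_two_le_iff, mul_pow, eLpNorm_two_sq]
  rw [strip_measure] at hw ⊢
  rw [lintegral_prod_symm _ (hw.enorm.pow_const 2), ← lintegral_const_mul' _ _ (by finiteness)]
  refine lintegral_mono_ae ?_
  have := hw.prod_swap.prodMk_left
  filter_upwards [this] with y hy
  exact enorm_pairY_sq_le hA ha hb hy

lemma pairY_sub_ae {α β : ℝ → ℂ} (hα : Continuous α) (hβ : Continuous β) {w w' : Field2}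
    (hw : MemLp w 2 μS) (hw' : MemLp w' 2 μS) :
    pairY α β (fun p => w p - w' p) =ᵐ[volume] fun y => pairY α β w y - pairY α β w' y := by
  have key : ∀ {g : Field2}, MemLp g 2 μS → ∀ᵐ y : ℝ,
      Integrable (fun x => (g (x, y)).1 * α x + (g (x, y)).2 * β x)
        (volume.restrict (Ioo (0 : ℝ) 1)) := by
    intro g hg
    rw [strip_measure] at hg
    have h1 := hg.aestronglyMeasurable.prod_swap.prodMk_left
    have h2 : ∀ᵐ y : ℝ, ∫⁻ x in Ioo (0 : ℝ) 1, ‖g (x, y)‖ₑ ^ 2 < ⊤ := by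
      have h3 : ∫⁻ y, ∫⁻ x in Ioo (0 : ℝ) 1, ‖g (x, y)‖ₑ ^ 2 < ⊤ := by
        rw [← lintegral_prod_symm _ (hg.aestronglyMeasurable.enorm.pow_const 2),
          ← eLpNorm_two_sq]
        exact ENNReal.pow_lt_top hg.2
      have h4 : AEMeasurable (fun y => ∫⁻ x in Ioo (0 : ℝ) 1, ‖g (x, y)‖ₑ ^ 2) volume :=
        (hg.aestronglyMeasurable.prod_swap.enorm.pow_const 2).lintegral_prod_right'
      exact ae_lt_top' h4 h3.ne
    filter_upwards [h1, h2] with y h1 h2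
    have : IsFiniteMeasure (volume.restrict (Ioo (0 : ℝ) 1)) := ⟨by simp⟩
    have m : MemLp (fun x => g (x, y)) 2 (volume.restrict (Ioo (0 : ℝ) 1)) := by
      refine ⟨h1, ?_⟩
      rw [← eLpNorm_two_sq] at h2
      by_contra hcon
      rw [not_lt, top_le_iff] at hcon
      simp [hcon] at h2
    have i := m.integrable (by norm_num)
    obtain ⟨A, hA⟩ := isCompact_Icc.exists_bound_of_continuousOn (s := Icc (0 : ℝ) 1)
      hα.continuousOn
    obtain ⟨B, hB⟩ := isCompact_Icc.exists_bound_of_continuousOn (s := Icc (0 : ℝ) 1)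
      hβ.continuousOn
    refine (i.fst.mul_bdd (c := A) hα.aestronglyMeasurable ?_).add
      (i.snd.mul_bdd (c := B) hβ.aestronglyMeasurable ?_)
    · filter_upwards [ae_restrict_mem measurableSet_Ioo] with x hx using hA x ⟨hx.1.le, hx.2.le⟩
    · filter_upwards [ae_restrict_mem measurableSet_Ioo] with x hx using hB x ⟨hx.1.le, hx.2.le⟩
  filter_upwards [key hw, key hw'] with y h1 h2
  rw [pairY_eq, pairY_eq, pairY_eq, ← integral_sub h1 h2]
  congr 1; ext x
  simp only [Prod.fst_sub, Prod.snd_sub]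
  ring

/-! ### Weak solutions: cutoffs, and norm estimates from bounds on the symbol -/

/-- Square integrability on bounded pieces of the strip. -/
def LocL2 (w : Field2) : Prop :=
  ∀ R : ℝ, MemLp w 2 (volume.restrict (strip ∩ {p | |p.2| ≤ R}))

/-- The one-sided weighted space: `e^{sy} w` is square integrable on the strip. -/
def MemX (s : ℝ) (w : Field2) : Prop :=
  MemLp (fun p => exp (s * p.2) • w p) 2 μS

lemma measurableSet_window (R : ℝ) : MeasurableSet {p : ℝ × ℝ | |p.2| ≤ R} :=
  (isClosed_le (by fun_prop) continuous_const).measurableSet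

lemma memLp_bdd_smul {μ : Measure (ℝ × ℝ)} {w : Field2} (hw : MemLp w 2 μ) {g : ℝ × ℝ → ℝ}
    (hg : AEStronglyMeasurable g μ) {B : ℝ} (hB : ∀ᵐ p ∂μ, |g p| ≤ B) :
    MemLp (fun p => g p • w p) 2 μ := by
  refine hw.of_le_mul (c := B) (hg.smul hw.aestronglyMeasurable) ?_
  filter_upwards [hB] with p hp
  rw [norm_smul, norm_eq_abs]
  gcongr

lemma window_le (R : ℝ) : volume.restrict (strip ∩ {p : ℝ × ℝ | |p.2| ≤ R}) ≤ μS :=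
  Measure.restrict_mono inter_subset_left le_rfl

lemma LocL2.smulY {w : Field2} (hw : LocL2 w) {ψ : ℝ → ℝ} (hψ : Continuous ψ) :
    LocL2 (fun p => ψ p.2 • w p) := by
  intro R
  obtain ⟨B, hB⟩ := (isCompact_Icc (a := -R) (b := R)).exists_bound_of_continuousOn hψ.continuousOn
  refine memLp_bdd_smul (hw R) (hψ.comp continuous_snd).aestronglyMeasurable (B := B) ?_
  filter_upwards [ae_restrict_mem (measurableSet_strip.inter (measurableSet_window R))] with p hp
  exact hB p.2 (abs_le.1 hp.2)

lemma LocL2.add {w w' : Field2} (h : LocL2 w) (h' : LocL2 w') : LocL2 (fun p => w p + w' p) :=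
  fun R => (h R).add (h' R)

lemma LocL2.sub {w w' : Field2} (h : LocL2 w) (h' : LocL2 w') : LocL2 (fun p => w p - w' p) :=
  fun R => (h R).sub (h' R)

lemma LocL2.const_smul {w : Field2} (h : LocL2 w) (c : ℂ) : LocL2 (fun p => c • w p) :=
  fun R => (h R).const_smul c

lemma LocL2.mop {w : Field2} (h : LocL2 w) : LocL2 (Mop w) := fun R => memLp_Mop (h R)

lemma LocL2.aesm {w : Field2} (h : LocL2 w) :
    AEStronglyMeasurable w μS := by
  have : strip = ⋃ n : ℕ, strip ∩ {p | |p.2| ≤ (n : ℝ)} := by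
    rw [← inter_iUnion]
    refine (inter_eq_left.2 fun p _ => ?_).symm
    obtain ⟨n, hn⟩ := exists_nat_ge |p.2|
    exact mem_iUnion.2 ⟨n, hn⟩
  rw [this, aestronglyMeasurable_iUnion_iff]
  exact fun n => (h n).aestronglyMeasurable

lemma locL2_of_memLp_exp {f : ℝ → ℝ} (hf : Continuous f) {w : Field2}
    (h : MemLp (fun p => exp (f p.2) • w p) 2 μS) : LocL2 w := by
  have h1 : LocL2 (fun p => exp (f p.2) • w p) := fun R => h.mono_measure (window_le R)
  simpa only [smul_smul, ← Real.exp_add, neg_add_cancel, Real.exp_zero, one_smul] using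
    h1.smulY (ψ := fun y => exp (-f y)) (by fun_prop)

lemma memLp_exp_mono {f g : ℝ → ℝ} (hf : Continuous f) (hg : Continuous g) (hle : ∀ y, g y ≤ f y)
    {w : Field2} (h : MemLp (fun p => exp (f p.2) • w p) 2 μS) :
    MemLp (fun p => exp (g p.2) • w p) 2 μS := by
  refine h.of_le ((locL2_of_memLp_exp hf h).smulY (ψ := fun y => exp (g y)) (by fun_prop)).aesm
    (.of_forall fun p => ?_)
  rw [norm_smul, norm_smul, norm_eq_abs, norm_eq_abs, Real.abs_exp, Real.abs_exp]
  gcongr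
  exact hle _

lemma locL2_of_memX {s : ℝ} {w : Field2} (h : MemX s w) : LocL2 w :=
  locL2_of_memLp_exp (by fun_prop) h

lemma integrable_of_window {f : ℝ × ℝ → ℂ} {R : ℝ}
    (h : Integrable f (volume.restrict (strip ∩ {p | |p.2| ≤ R}))) (hR : ∀ p, R < |p.2| → f p = 0) :
    Integrable f μS :=
  IntegrableOn.of_forall_sdiff_eq_zero h measurableSet_strip fun p hp =>
    hR p (not_le.1 fun h' => hp.2 ⟨hp.1, h'⟩)

lemma memX_zero_of_window {w : Field2} (h : LocL2 w) {R : ℝ} (hR : ∀ p, R < |p.2| → w p = 0) :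
    MemLp w 2 μS := by
  have h1 := h R
  rw [inter_comm, ← Measure.restrict_restrict (measurableSet_window R),
    ← memLp_indicator_iff_restrict (measurableSet_window R)] at h1
  refine h1.ae_eq (.of_forall fun p => ?_)
  by_cases hp : |p.2| ≤ R
  · rw [indicator_of_mem (by exact hp)]
  · rw [indicator_of_notMem (by exact hp), hR p (not_le.1 hp)]

lemma LocL2.integrable_mul {w : Field2} (hw : LocL2 w) {g : ℝ × ℝ → ℂ} (hg : Continuous g)
    (cg : HasCompactSupport g) :
    Integrable (fun p => (w p).1 * g p) μS ∧
      Integrable (fun p => (w p).2 * g p) μS := by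
  obtain ⟨R, hR⟩ := cg.isCompact.isBounded.subset_closedBall (0 : ℝ × ℝ)
  have gz : ∀ p : ℝ × ℝ, R < |p.2| → g p = 0 := by
    intro p hp
    by_contra hne
    have := hR (subset_tsupport g hne)
    rw [mem_closedBall_zero_iff] at this
    have h2 : ‖p.2‖ ≤ ‖p‖ := norm_snd_le p
    rw [norm_eq_abs] at h2
    linarith
  have hg2 : MemLp g 2 (volume.restrict (strip ∩ {p | |p.2| ≤ R})) :=
    (hg.memLp_of_hasCompactSupport cg).mono_measure Measure.restrict_le_self
  have key : ∀ h : ℝ × ℝ → ℂ, MemLp h 2 (volume.restrict (strip ∩ {p | |p.2| ≤ R})) →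
      Integrable (fun p => h p * g p) μS := fun h hh =>
    integrable_of_window (hh.integrable_mul hg2) fun p hp => by rw [gz p hp, mul_zero]
  exact ⟨key _ (hw R).fst, key _ (hw R).snd⟩

/-- One component of the weak form of the Dirac equation: `u` solves `D u = f` weakly against test
functions supported in `Ω`. -/
def WeakEq (D : (ℝ × ℝ → ℂ) → ℝ × ℝ → ℂ) (Ω : Set (ℝ × ℝ)) (u f : ℝ × ℝ → ℂ) : Prop :=
  ∀ φ : ℝ × ℝ → ℂ, ContDiff ℝ (⊤ : ℕ∞) φ → HasCompactSupport φ → tsupport φ ⊆ Ω →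
    ∫ p in strip, u p * D φ p = -∫ p in strip, f p * φ p

lemma WeakEq.congr {D : (ℝ × ℝ → ℂ) → ℝ × ℝ → ℂ} {Ω : Set (ℝ × ℝ)} {u f u' f' : ℝ × ℝ → ℂ}
    (h : WeakEq D Ω u f) (hu : u =ᵐ[μS] u') (hf : f =ᵐ[μS] f') : WeakEq D Ω u' f' :=
  fun φ a b c => ((integral_congr_ae (hu.mono fun p hp => by rw [hp])).symm.trans
    (h φ a b c)).trans (congrArg Neg.neg (integral_congr_ae (hf.mono fun p hp => by simp only [hp])))

lemma WeakEq.const_smul {D : (ℝ × ℝ → ℂ) → ℝ × ℝ → ℂ} {Ω : Set (ℝ × ℝ)} {u f : ℝ × ℝ → ℂ}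
    (h : WeakEq D Ω u f) (k : ℂ) : WeakEq D Ω (fun p => k * u p) (fun p => k * f p) := by
  intro φ a b c
  simp only [mul_assoc, integral_const_mul]
  rw [h φ a b c, mul_neg]

lemma DiracEq.congr {w f w' f' : Field2} (h : DiracEq w f)
    (hw : w =ᵐ[μS] w') (hf : f =ᵐ[μS] f') : DiracEq w' f' :=
  ⟨WeakEq.congr h.1 (hw.fun_comp Prod.snd) (hf.fun_comp Prod.fst),
    WeakEq.congr h.2 (hw.fun_comp Prod.fst) (hf.fun_comp Prod.snd)⟩

lemma IsTest.diracTest₁ {φ : ℝ × ℝ → ℂ} (h : IsTest φ) :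
    IsTest (fun p => -I * ZigzagRibbon.dx φ p + ZigzagRibbon.dy φ p) :=
  (h.dx.const_mul _).add h.dy

lemma IsTest.diracTest₂ {φ : ℝ × ℝ → ℂ} (h : IsTest φ) :
    IsTest (fun p => -I * ZigzagRibbon.dx φ p - ZigzagRibbon.dy φ p) :=
  (h.dx.const_mul _).sub h.dy

/-- Functions that can be integrated over the strip against test functions. -/
def TestIntegrable (u : ℝ × ℝ → ℂ) : Prop := ∀ g, IsTest g → Integrable (fun p => u p * g p) μS

lemma LocL2.testIntegrable {w : Field2} (h : LocL2 w) :
    TestIntegrable (fun p => (w p).1) ∧ TestIntegrable (fun p => (w p).2) :=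
  ⟨fun _ t => (h.integrable_mul t.cont t.supp).1, fun _ t => (h.integrable_mul t.cont t.supp).2⟩

lemma WeakEq.add {D : (ℝ × ℝ → ℂ) → ℝ × ℝ → ℂ} (hD : ∀ φ, IsTest φ → IsTest (D φ))
    {Ω : Set (ℝ × ℝ)} {u f u' f' : ℝ × ℝ → ℂ} (h : WeakEq D Ω u f) (h' : WeakEq D Ω u' f')
    (lu : TestIntegrable u) (lf : TestIntegrable f) (lu' : TestIntegrable u')
    (lf' : TestIntegrable f') : WeakEq D Ω (fun p => u p + u' p) (fun p => f p + f' p) := by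
  intro φ a b c
  simp only [add_mul]
  rw [integral_add (lu _ (hD _ ⟨a, b⟩)) (lu' _ (hD _ ⟨a, b⟩)),
    integral_add (lf _ ⟨a, b⟩) (lf' _ ⟨a, b⟩), h φ a b c, h' φ a b c, neg_add]

lemma DiracEq.add {w f w' f' : Field2} (h : DiracEq w f) (h' : DiracEq w' f')
    (lw : LocL2 w) (lf : LocL2 f) (lw' : LocL2 w') (lf' : LocL2 f') :
    DiracEq (fun p => w p + w' p) (fun p => f p + f' p) :=
  ⟨WeakEq.add (fun _ => IsTest.diracTest₁) h.1 h'.1 lw.testIntegrable.2 lf.testIntegrable.1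
      lw'.testIntegrable.2 lf'.testIntegrable.1,
    WeakEq.add (fun _ => IsTest.diracTest₂) h.2 h'.2 lw.testIntegrable.1 lf.testIntegrable.2
      lw'.testIntegrable.1 lf'.testIntegrable.2⟩

lemma DiracEq.const_smul {w f : Field2} (h : DiracEq w f) (k : ℂ) :
    DiracEq (fun p => k • w p) (fun p => k • f p) :=
  ⟨WeakEq.const_smul h.1 k, WeakEq.const_smul h.2 k⟩

lemma diracEq_zero : DiracEq (fun _ => 0) (fun _ => 0) := by
  refine ⟨fun φ a b c => ?_, fun φ a b c => ?_⟩ <;> simp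

lemma DiracEq.sub {w f w' f' : Field2} (h : DiracEq w f) (h' : DiracEq w' f')
    (lw : LocL2 w) (lf : LocL2 f) (lw' : LocL2 w') (lf' : LocL2 f') :
    DiracEq (fun p => w p - w' p) (fun p => f p - f' p) := by
  have := h.add (h'.const_smul (-1)) lw lf (lw'.const_smul _) (lf'.const_smul _)
  simpa only [neg_one_smul, ← sub_eq_add_neg] using this

lemma LocL2.sum {ι : Type*} {s : Finset ι} {w : ι → Field2} (h : ∀ i ∈ s, LocL2 (w i)) :
    LocL2 (fun p => ∑ i ∈ s, w i p) := fun R => memLp_finsetSum s fun i hi => h i hi R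

lemma DiracEq.sum {ι : Type*} {s : Finset ι} {w f : ι → Field2}
    (h : ∀ i ∈ s, DiracEq (w i) (f i)) (lw : ∀ i ∈ s, LocL2 (w i)) (lf : ∀ i ∈ s, LocL2 (f i)) :
    DiracEq (fun p => ∑ i ∈ s, w i p) (fun p => ∑ i ∈ s, f i p) := by
  classical
  induction s using Finset.induction_on with
  | empty => simpa using diracEq_zero
  | insert i s hi ih =>
    have h0 := Finset.mem_insert_self i s
    have h1 : ∀ j ∈ s, j ∈ insert i s := fun j hj => Finset.mem_insert_of_mem hj
    simp only [Finset.sum_insert hi]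
    exact (h i h0).add (ih (fun j hj => h j (h1 j hj)) (fun j hj => lw j (h1 j hj))
      fun j hj => lf j (h1 j hj)) (lw i h0) (lf i h0)
      (LocL2.sum fun j hj => lw j (h1 j hj)) (LocL2.sum fun j hj => lf j (h1 j hj))

/-- The Leibniz rule for a cutoff along the ribbon, for an operator `D = -i∂ₓ ± ∂_y`. -/
lemma WeakEq.cutoff {D : (ℝ × ℝ → ℂ) → ℝ × ℝ → ℂ} (hD : ∀ φ, IsTest φ → IsTest (D φ)) {σ : ℂ}
    (hσ : ∀ φ p, D φ p = -I * dx φ p + σ * dy φ p) {Ω : Set (ℝ × ℝ)} {u f : ℝ × ℝ → ℂ}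
    (h : WeakEq D Ω u f) {ψ : ℝ → ℝ} (hψ : ContDiff ℝ (⊤ : ℕ∞) ψ)
    (lu : TestIntegrable fun p => ψ p.2 • u p) (lu' : TestIntegrable fun p => deriv ψ p.2 • (σ * u p))
    (lf : TestIntegrable fun p => ψ p.2 • f p) :
    WeakEq D Ω (fun p => ψ p.2 • u p) (fun p => ψ p.2 • f p + deriv ψ p.2 • (σ * u p)) := by
  intro φ a b c
  simp only [real_smul] at lu lu' lf ⊢
  have t : IsTest φ := ⟨a, b⟩
  have t' := t.mulY hψ
  have h1 := h _ t'.smooth t'.supp (tsupport_mulY.trans c)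
  have e1 : ∀ p, u p * D (fun p => (ψ p.2 : ℂ) * φ p) p =
      ψ p.2 * u p * D φ p + deriv ψ p.2 * (σ * u p) * φ p := fun p => by
    rw [hσ, hσ, dx_mulY t hψ, dy_mulY t hψ]; ring
  have e2 : ∀ p, f p * ((ψ p.2 : ℂ) * φ p) = ψ p.2 * f p * φ p := fun p => by ring
  simp only [e1, e2] at h1
  rw [integral_add (lu _ (hD _ t)) (lu' _ t)] at h1
  simp only [add_mul]
  rw [integral_add (lf _ t) (lu' _ t)]
  linear_combination h1

lemma DiracEq.cutoff {w f : Field2} (h : DiracEq w f) (lw : LocL2 w) (lf : LocL2 f)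
    {ψ : ℝ → ℝ} (hψ : ContDiff ℝ (⊤ : ℕ∞) ψ) :
    DiracEq (fun p => ψ p.2 • w p) (fun p => ψ p.2 • f p + deriv ψ p.2 • Mop w p) := by
  have l1 := (lw.smulY hψ.continuous).testIntegrable
  have l2 := (lw.mop.smulY (hψ.continuous_deriv (by norm_cast))).testIntegrable
  have l3 := (lf.smulY hψ.continuous).testIntegrable
  have h1 := WeakEq.cutoff (σ := 1) (fun _ => IsTest.diracTest₁) (by simp) h.1 hψ l1.2
    (by simp only [one_mul]; exact l2.1) l3.1
  have h2 := WeakEq.cutoff (σ := -1) (fun _ => IsTest.diracTest₂) (fun _ _ => by ring) h.2 hψ l1.1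
    (by simp only [neg_one_mul]; exact l2.2) l3.2
  simp only [one_mul, neg_one_mul] at h1 h2
  exact ⟨h1, h2⟩

lemma eLpNorm_diff_bound {μ : Measure (ℝ × ℝ)} {g h : Field2} (hg : AEStronglyMeasurable g μ)
    (hh : AEStronglyMeasurable h μ) :
    eLpNorm g 2 μ ≤ eLpNorm (fun p => g p - h p) 2 μ + eLpNorm h 2 μ := by
  have := eLpNorm_add_le (p := 2) (hg.sub hh) hh (by norm_num)
  rwa [sub_add_cancel] at this

lemma MemLp.prodMk' {μ : Measure (ℝ × ℝ)} {a b : ℝ × ℝ → ℂ} (ha : MemLp a 2 μ)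
    (hb : MemLp b 2 μ) : MemLp (fun p => (a p, b p)) 2 μ :=
  ⟨ha.aestronglyMeasurable.prodMk hb.aestronglyMeasurable,
    (eLpNorm_pair_le ha.aestronglyMeasurable hb.aestronglyMeasurable).trans_lt
      (ENNReal.add_lt_top.2 ⟨ha.eLpNorm_lt_top, hb.eLpNorm_lt_top⟩)⟩

lemma aesm_residual {μ : Measure (ℝ × ℝ)} {w f : Field2} (hw : AEStronglyMeasurable w μ)
    (hf : AEStronglyMeasurable f μ) (c d : ℂ) :
    AEStronglyMeasurable (fun p => f p - c • w p - d • Mop w p) μ :=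
  (hf.sub (hw.const_smul c)).sub ((aesm_Mop hw).const_smul d)

lemma eLpNorm_residual_le {μ : Measure (ℝ × ℝ)} {w f : Field2} (hw : AEStronglyMeasurable w μ)
    (hf : AEStronglyMeasurable f μ) (c d : ℂ) :
    eLpNorm (fun p => f p - c • w p - d • Mop w p) 2 μ ≤
      eLpNorm f 2 μ + (‖c‖ₑ + ‖d‖ₑ) * eLpNorm w 2 μ := by
  have h1 := eLpNorm_sub_le (p := 2) (hf.sub (hw.const_smul c)) ((aesm_Mop hw).const_smul d)
    (by norm_num)
  have h2 := eLpNorm_sub_le (p := 2) hf (hw.const_smul c) (by norm_num)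
  have h3 : eLpNorm (Mop w) 2 μ = eLpNorm w 2 μ :=
    eLpNorm_congr_norm_ae (.of_forall fun p => norm_Mop w p)
  rw [eLpNorm_const_smul, h3] at h1
  rw [eLpNorm_const_smul] at h2
  calc _ ≤ _ := h1
    _ ≤ _ := add_le_add_left h2 _
    _ = _ := by ring

lemma IsTestPair.memLp {a b : ℝ × ℝ → ℂ} (h : IsTestPair a b) {μ : Measure (ℝ × ℝ)}
    [IsFiniteMeasureOnCompacts μ] :
    MemLp (fun p => (a p, b p)) 2 μ :=
  MemLp.prodMk' (h.fst.cont.memLp_of_hasCompactSupport h.fst.supp)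
    (h.snd.cont.memLp_of_hasCompactSupport h.snd.supp)

lemma IsTestPair.memLp_diracOp {a b : ℝ × ℝ → ℂ} (h : IsTestPair a b) {μ : Measure (ℝ × ℝ)}
    [IsFiniteMeasureOnCompacts μ] :
    MemLp (diracOp a b) 2 μ :=
  MemLp.prodMk' (h.snd.diracTest₁.cont.memLp_of_hasCompactSupport h.snd.diracTest₁.supp)
    (h.fst.diracTest₂.cont.memLp_of_hasCompactSupport h.fst.diracTest₂.supp)

/-- The symbol bound, for test pairs, in terms of norms. -/
lemma LineBound.testPair_bound {ι : Type*} [Fintype ι] {ω s K : ℝ} {α β : ι → ℝ → ℂ}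
    (hL : LineBound ω s K α β) {a b : ℝ × ℝ → ℂ} (h : IsTestPair a b) :
    eLpNorm (fun p => (a p, b p)) 2 μS ≤ ofReal √(2 * K) *
      (eLpNorm (fun p => diracOp a b p - (ω : ℂ) • (a p, b p) -
          (s : ℂ) • Mop (fun p => (a p, b p)) p) 2 μS +
        ∑ i, eLpNorm (pairY (α i) (β i) (fun p => (a p, b p))) 2 volume) := by
  have main := hL.test_bound h.fst h.snd
    (fun y => by_contra fun hne => by simpa using h.left (subset_tsupport a hne))
    (fun y => by_contra fun hne => by simpa using h.right (subset_tsupport b hne))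
  rw [eLpNorm_two_le_iff, mul_pow]
  have sq : ofReal √(2 * K) ^ 2 = 2 * ofReal K := by
    rw [← ENNReal.ofReal_pow (sqrt_nonneg _), Real.sq_sqrt (mul_nonneg two_pos.le hL.nonneg),
      ENNReal.ofReal_mul (by norm_num)]
    simp
  have emax : ∀ z : ℂ × ℂ, ‖z‖ₑ = ‖z.1‖ₑ ⊔ ‖z.2‖ₑ := fun z => by
    simp only [← ofReal_norm, Prod.norm_def]
    exact ENNReal.ofReal_max _ _
  have pairsq : ∀ z : ℂ × ℂ, ‖z‖ₑ ^ 2 ≤ ‖z.1‖ₑ ^ 2 + ‖z.2‖ₑ ^ 2 := by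
    intro z
    rw [emax]
    rcases le_total ‖z.1‖ₑ ‖z.2‖ₑ with h | h
    · rw [sup_eq_right.2 h]; exact le_add_self
    · rw [sup_eq_left.2 h]; exact le_self_add
  have sqpair : ∀ z : ℂ × ℂ, ‖z.1‖ₑ ^ 2 + ‖z.2‖ₑ ^ 2 ≤ 2 * ‖z‖ₑ ^ 2 := by
    intro z
    rw [two_mul, emax]
    gcongr
    · exact le_sup_left
    · exact le_sup_right
  refine (lintegral_mono fun p => pairsq _).trans (main.trans ?_)
  rw [sq]
  set T : Field2 := fun p => diracOp a b p - (ω : ℂ) • (a p, b p) -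
    (s : ℂ) • Mop (fun p => (a p, b p)) p with hT
  have e1 : ∫⁻ p in strip, (‖twist₁ ω s a b p‖ₑ ^ 2 + ‖twist₂ ω s a b p‖ₑ ^ 2) ≤
      2 * eLpNorm T 2 μS ^ 2 := by
    rw [eLpNorm_two_sq, ← lintegral_const_mul' _ _ (by finiteness)]
    refine lintegral_mono fun p => ?_
    rw [show twist₁ ω s a b p = (T p).1 by simp [T, twist₁, diracOp, Mop],
      show twist₂ ω s a b p = (T p).2 by simp [T, twist₂, diracOp, Mop]]
    exact sqpair _
  have e2 : ∀ i, ∫⁻ y, ‖pairing (α i) (β i) (fun x => a (x, y)) (fun x => b (x, y))‖ₑ ^ 2 =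
      eLpNorm (pairY (α i) (β i) (fun p => (a p, b p))) 2 volume ^ 2 :=
    fun i => (eLpNorm_two_sq _ _).symm
  simp only [e2]
  have e3 : ∑ i, eLpNorm (pairY (α i) (β i) (fun p => (a p, b p))) 2 volume ^ 2 ≤
      (∑ i, eLpNorm (pairY (α i) (β i) (fun p => (a p, b p))) 2 volume) ^ 2 :=
    Finset.sum_sq_le_sq_sum_of_nonneg fun _ _ => zero_le
  set X := eLpNorm T 2 μS
  set Y := ∑ i, eLpNorm (pairY (α i) (β i) (fun p => (a p, b p))) 2 volume
  calc _ ≤ ofReal K * (2 * X ^ 2 + Y ^ 2) := by gcongr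
    _ ≤ ofReal K * (2 * X ^ 2 + 2 * Y ^ 2 + 4 * X * Y) := by
        refine mul_le_mul_right ?_ _
        calc _ ≤ (2 * X ^ 2 + Y ^ 2) + (Y ^ 2 + 4 * X * Y) := le_self_add
          _ = 2 * X ^ 2 + 2 * Y ^ 2 + 4 * X * Y := by ring
    _ = _ := by ring

/-- The symbol bound for weak solutions of compact support along the ribbon. -/
lemma LineBound.weak_bound {ι : Type*} [Fintype ι] {ω s K : ℝ} {α β : ι → ℝ → ℂ}
    (hL : LineBound ω s K α β) {w f : Field2} (hw : MemLp w 2 μS)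
    (hf : MemLp f 2 μS) {R : ℝ} (hR : ∀ p, R < |p.2| → w p = 0)
    (h : DiracEq w f) :
    eLpNorm w 2 μS ≤ ofReal √(2 * K) *
      (eLpNorm (fun p => f p - (ω : ℂ) • w p - (s : ℂ) • Mop w p) 2 μS +
        ∑ i, eLpNorm (pairY (α i) (β i) w) 2 volume) := by
  have hA : ∀ i, ∃ A : ℝ, 0 ≤ A ∧ (∀ x ∈ Icc (0 : ℝ) 1, ‖α i x‖ ≤ A) ∧
      ∀ x ∈ Icc (0 : ℝ) 1, ‖β i x‖ ≤ A := by
    intro i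
    obtain ⟨A, hA⟩ := isCompact_Icc.exists_bound_of_continuousOn (s := Icc (0 : ℝ) 1)
      (hL.cont_left i).continuousOn
    obtain ⟨B, hB⟩ := isCompact_Icc.exists_bound_of_continuousOn (s := Icc (0 : ℝ) 1)
      (hL.cont_right i).continuousOn
    have h0 : (0 : ℝ) ∈ Icc (0 : ℝ) 1 := by simp
    exact ⟨max A B, le_max_of_le_left ((norm_nonneg _).trans (hA 0 h0)),
      fun x hx => (hA x hx).trans (le_max_left _ _), fun x hx => (hB x hx).trans (le_max_right _ _)⟩
  choose A A0 hA hB using hA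
  set C := ofReal √(2 * K)
  set X := eLpNorm (fun p => f p - (ω : ℂ) • w p - (s : ℂ) • Mop w p) 2 μS
  set Y := ∑ i, eLpNorm (pairY (α i) (β i) w) 2 volume
  -- the approximation error enters with this finite factor
  set D : ENNReal := 1 + C * ((1 + ‖(ω : ℂ)‖ₑ + ‖(s : ℂ)‖ₑ) + ∑ i, ofReal (2 * A i)) with hD
  have D0 : D ≠ 0 := by simp [D]
  have Dt : D ≠ ⊤ := by
    simp only [D, C]
    refine ENNReal.add_ne_top.2 ⟨by simp, ENNReal.mul_ne_top ofReal_ne_top ?_⟩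
    refine ENNReal.add_ne_top.2 ⟨by simp, ?_⟩
    exact ENNReal.sum_ne_top.2 fun i _ => ofReal_ne_top
  refine ENNReal.le_of_forall_pos_le_add fun e he _ => ?_
  obtain ⟨a, b, t, e1, e2⟩ := exists_testPair_approx hw hf hR h (ε := (e : ENNReal) / D)
    (ENNReal.div_pos (by simpa using he.ne') Dt).ne'
  set η := (e : ENNReal) / D with hη
  have ηD : η * D = e := ENNReal.div_mul_cancel D0 Dt
  set φ : Field2 := fun p => (a p, b p) with hφ
  have mφ : MemLp φ 2 μS := t.memLp
  have mop : MemLp (diracOp a b) 2 μS := t.memLp_diracOp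
  have e1' : eLpNorm (fun p => w p - φ p) 2 μS ≤ η := by
    refine le_trans (le_of_eq ?_) e1
    rw [← eLpNorm_neg]
    congr 1; ext p <;> simp [φ]
  have s1 := eLpNorm_diff_bound hw.1 mφ.1
  have s2 := hL.testPair_bound t
  have s3 : eLpNorm (fun p => diracOp a b p - (ω : ℂ) • φ p - (s : ℂ) • Mop φ p) 2
      μS ≤ X + (1 + ‖(ω : ℂ)‖ₑ + ‖(s : ℂ)‖ₑ) * η := by
    have r1 := eLpNorm_diff_bound (aesm_residual mφ.1 mop.1 ω s) (aesm_residual hw.1 hf.1 ω s)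
    have r2 := eLpNorm_residual_le (mφ.1.sub hw.1) (mop.1.sub hf.1) (ω : ℂ) (s : ℂ)
    have r3 : (fun p => diracOp a b p - (ω : ℂ) • φ p - (s : ℂ) • Mop φ p -
        (f p - (ω : ℂ) • w p - (s : ℂ) • Mop w p)) =
        fun p => (diracOp a b - f) p - (ω : ℂ) • (φ - w) p - (s : ℂ) • Mop (φ - w) p := by
      ext p <;> simp [Mop] <;> ring
    rw [r3] at r1
    refine r1.trans ?_
    rw [add_comm X]
    gcongr
    refine r2.trans ?_
    rw [add_assoc 1, add_mul 1, one_mul]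
    gcongr
    · exact e2
    · exact e1
  have s4 : ∀ i, eLpNorm (pairY (α i) (β i) φ) 2 volume ≤
      eLpNorm (pairY (α i) (β i) w) 2 volume + ofReal (2 * A i) * η := by
    intro i
    have r1 := pairY_sub_ae (hL.cont_left i) (hL.cont_right i) hw mφ
    have r2 := eLpNorm_pairY_le (A0 i) (hA i) (hB i) (hw.1.sub mφ.1)
    have r3 := eLpNorm_sub_le (p := 2) (aesm_pairY (hL.cont_left i) (hL.cont_right i) hw.1)
      (aesm_pairY (hL.cont_left i) (hL.cont_right i) (hw.1.sub mφ.1)) (by norm_num)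
    refine le_trans (le_of_eq ?_) (r3.trans ?_)
    · refine eLpNorm_congr_ae ?_
      filter_upwards [r1] with y hy
      have : pairY (α i) (β i) (w - φ) y = pairY (α i) (β i) w y - pairY (α i) (β i) φ y := hy
      simp only [Pi.sub_apply, this]
      ring
    · gcongr
      exact r2.trans (by gcongr; exact e1')
  calc eLpNorm w 2 μS
      ≤ η + C * ((X + (1 + ‖(ω : ℂ)‖ₑ + ‖(s : ℂ)‖ₑ) * η) +
          ∑ i, (eLpNorm (pairY (α i) (β i) w) 2 volume + ofReal (2 * A i) * η)) := by
        refine s1.trans (add_le_add e1' (s2.trans ?_))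
        gcongr with i
        exact s4 i
    _ = C * (X + Y) + η * D := by
        rw [Finset.sum_add_distrib, ← Finset.sum_mul]
        ring
    _ = _ := by rw [ηD]

lemma LocL2.memLp_smulY {w : Field2} (hw : LocL2 w) {ψ : ℝ → ℝ} (hψ : Continuous ψ) {R : ℝ}
    (hR : ∀ y, R < |y| → ψ y = 0) :
    MemLp (fun p => ψ p.2 • w p) 2 μS :=
  memX_zero_of_window (hw.smulY hψ) (R := R) fun p hp => by rw [hR _ hp, zero_smul]

lemma pairY_smulY (α β : ℝ → ℂ) (ψ : ℝ → ℝ) (w : Field2) (y : ℝ) :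
    pairY α β (fun p => ψ p.2 • w p) y = ψ y * pairY α β w y := by
  rw [pairY_eq, pairY_eq, ← integral_const_mul]
  congr 1; ext x
  simp only [Prod.smul_fst, Prod.smul_snd, real_smul]
  ring

/-- A smooth plateau function equal to `1` on `[-1, 1]` and vanishing off `[-2, 2]`. -/
lemma exists_plateau : ∃ χ : ℝ → ℝ, ∃ B : ℝ, ContDiff ℝ (⊤ : ℕ∞) χ ∧ (∀ y, |χ y| ≤ 1) ∧
    (∀ y, |y| ≤ 1 → χ y = 1) ∧ (∀ y, 2 < |y| → χ y = 0) ∧ 0 ≤ B ∧ ∀ y, |deriv χ y| ≤ B := by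
  let f : ContDiffBump (0 : ℝ) := ⟨1, 2, by norm_num, by norm_num⟩
  have cd : ContDiff ℝ (⊤ : ℕ∞) f := f.contDiff
  have cc : Continuous (deriv f) := cd.continuous_deriv (by norm_cast)
  obtain ⟨B, hB⟩ := cc.bounded_above_of_compact_support f.hasCompactSupport.deriv
  refine ⟨f, B, cd, fun y => ?_, fun y hy => ?_, fun y hy => ?_, ?_, fun y => hB y⟩
  · rw [abs_of_nonneg f.nonneg]; exact f.le_one
  · exact f.one_of_mem_closedBall (by simpa using hy)
  · exact f.zero_of_le_dist (by simpa using hy.le)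
  · exact (norm_nonneg _).trans (hB 0)

/-- Fatou's lemma in `L²`. -/
lemma eLpNorm_le_of_tendsto {F : ℕ → Field2} {g : Field2} {C : ℕ → ENNReal} {c : ENNReal}
    (hF : ∀ n, AEStronglyMeasurable (F n) μS)
    (hg : ∀ p, Tendsto (fun n => F n p) atTop (𝓝 (g p))) (hC : ∀ n, eLpNorm (F n) 2 μS ≤ C n)
    (hc : Tendsto C atTop (𝓝 c)) : eLpNorm g 2 μS ≤ c :=
  (Lp.eLpNorm_lim_le_liminf_eLpNorm hF g (.of_forall hg)).trans
    ((liminf_le_liminf (.of_forall hC)).trans hc.liminf_eq.le)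

lemma deriv_eq_zero_of_eq_const {ψ : ℝ → ℝ} {s : Set ℝ} (hs : IsOpen s) {c : ℝ}
    (h : ∀ y ∈ s, ψ y = c) {y : ℝ} (hy : y ∈ s) : deriv ψ y = 0 := by
  rw [(eventuallyEq_of_mem (hs.mem_nhds hy) h : ψ =ᶠ[𝓝 y] fun _ => c).deriv_eq, deriv_const]

/-- The estimate with a smooth weight, for weak solutions on which all functionals vanish. -/
lemma LineBound.weighted_bound {ι : Type*} [Fintype ι] {ω s K : ℝ} {α β : ι → ℝ → ℂ}
    (hL : LineBound ω s K α β) {w f : Field2} (lw : LocL2 w) (lf : LocL2 f) (h : DiracEq w f)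
    (hp : ∀ i, ∀ᵐ y, pairY (α i) (β i) w y = 0) {Ψ : ℝ → ℝ} (hΨ : ContDiff ℝ (⊤ : ℕ∞) Ψ)
    (hw : MemLp (fun p => Ψ p.2 • w p) 2 μS) :
    eLpNorm (fun p => Ψ p.2 • w p) 2 μS ≤ ofReal √(2 * K) *
      eLpNorm (fun p => Ψ p.2 • (f p - (ω : ℂ) • w p) + (deriv Ψ p.2 - s * Ψ p.2) • Mop w p) 2
        μS := by
  obtain ⟨χ, B, cχ, χ1, χp, χs, B0, hB⟩ := exists_plateau
  set X : Field2 := fun p => Ψ p.2 • (f p - (ω : ℂ) • w p) + (deriv Ψ p.2 - s * Ψ p.2) • Mop w p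
    with hX
  set C := ofReal √(2 * K)
  have cΨ' : Continuous (deriv Ψ) := hΨ.continuous_deriv (by norm_cast)
  have aX : AEStronglyMeasurable X μS :=
    (((lf.sub (lw.const_smul _)).smulY hΨ.continuous).add
      (lw.mop.smulY (cΨ'.sub (continuous_const.mul hΨ.continuous)))).aesm
  have aM : AEStronglyMeasurable (fun p => Ψ p.2 • Mop w p) μS :=
    (lw.mop.smulY hΨ.continuous).aesm
  have scaled : ∀ n : ℕ, ContDiff ℝ (⊤ : ℕ∞) (fun y => χ (y / (n + 1))) := fun n =>
    cχ.comp (contDiff_id.div_const _)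
  have dχ : ∀ (n : ℕ) (y : ℝ), HasDerivAt (fun y => χ (y / (n + 1)))
      (deriv χ (y / (n + 1)) / (n + 1)) y := by
    intro n y
    have h1 : HasDerivAt χ (deriv χ (y / (n + 1))) (y / (n + 1)) :=
      ((cχ.differentiable (by simp)) _).hasDerivAt
    have h2 : HasDerivAt (fun y : ℝ => y / (n + 1)) (1 / ((n : ℝ) + 1)) y :=
      (hasDerivAt_id y).div_const _
    exact (h1.comp y h2).congr_deriv (by ring)
  have step : ∀ n : ℕ, eLpNorm (fun p => χ (p.2 / (n + 1)) • (Ψ p.2 • w p)) 2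
      μS ≤ C * (eLpNorm X 2 μS +
        ofReal (B / (n + 1)) *
          eLpNorm (fun p => Ψ p.2 • w p) 2 μS) := by
    intro n
    have n0 : (0 : ℝ) < n + 1 := by positivity
    set ψ : ℝ → ℝ := fun y => χ (y / (n + 1)) * Ψ y with hψdef
    have hψ : ContDiff ℝ (⊤ : ℕ∞) ψ := (scaled n).mul hΨ
    have dψ : ∀ y, deriv ψ y = deriv χ (y / (n + 1)) / (n + 1) * Ψ y +
        χ (y / (n + 1)) * deriv Ψ y := fun y =>
      ((dχ n y).mul ((hΨ.differentiable (by simp)) y).hasDerivAt).deriv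
    have ψz : ∀ y : ℝ, 2 * ((n : ℝ) + 1) < |y| → ψ y = 0 := fun y hy => by
      simp only [ψ]
      rw [χs, zero_mul]
      rwa [abs_div, abs_of_pos n0, lt_div_iff₀ n0]
    have dψz : ∀ y : ℝ, 2 * ((n : ℝ) + 1) < |y| → deriv ψ y = 0 := fun y hy =>
      deriv_eq_zero_of_eq_const (isOpen_lt continuous_const continuous_abs) ψz hy
    have cψ' : Continuous (deriv ψ) := hψ.continuous_deriv (by norm_cast)
    have m1 := lw.memLp_smulY hψ.continuous ψz
    have m2 := (lf.memLp_smulY hψ.continuous ψz).add (lw.mop.memLp_smulY cψ' dψz)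
    have b := hL.weak_bound m1 m2 (R := 2 * ((n : ℝ) + 1))
      (fun p hp => by rw [ψz _ hp, zero_smul]) (h.cutoff lw lf hψ)
    have pz : ∀ i, eLpNorm (pairY (α i) (β i) (fun p => ψ p.2 • w p)) 2 volume = 0 := by
      intro i
      have : pairY (α i) (β i) (fun p => ψ p.2 • w p) =ᵐ[volume] 0 := by
        filter_upwards [hp i] with y hy
        rw [pairY_smulY, hy, mul_zero]; rfl
      rw [eLpNorm_congr_ae this, eLpNorm_zero]
    simp only [pz, Finset.sum_const_zero, add_zero] at b
    have e1 : (fun p => χ (p.2 / (n + 1)) • (Ψ p.2 • w p)) = fun p : ℝ × ℝ => ψ p.2 • w p := by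
      ext p : 1; rw [smul_smul]
    rw [e1]
    refine b.trans ?_
    refine mul_le_mul_right ?_ _
    have e2 : (fun p => ψ p.2 • f p + deriv ψ p.2 • Mop w p - (ω : ℂ) • (ψ p.2 • w p) -
        (s : ℂ) • Mop (fun p => ψ p.2 • w p) p) =
        fun p => χ (p.2 / (n + 1)) • X p +
          (deriv χ (p.2 / (n + 1)) / (n + 1)) • (Ψ p.2 • Mop w p) := by
      ext p <;> simp only [dψ, X, ψ, Mop, Prod.fst_add, Prod.snd_add, Prod.fst_sub, Prod.snd_sub,
        Prod.smul_fst, Prod.smul_snd, real_smul, smul_eq_mul] <;> push_cast <;> ring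
    refine (congrArg (fun g => eLpNorm g 2 μS) e2).le.trans ?_
    have a1 : Continuous fun p : ℝ × ℝ => χ (p.2 / (n + 1)) :=
      (scaled n).continuous.comp continuous_snd
    have a2 : Continuous fun p : ℝ × ℝ => deriv χ (p.2 / (n + 1)) / (n + 1) :=
      ((cχ.continuous_deriv (by norm_cast)).comp (continuous_snd.div_const _)).div_const _
    refine (eLpNorm_add_le (a1.aestronglyMeasurable.smul aX) (a2.aestronglyMeasurable.smul aM)
      (by norm_num)).trans (add_le_add ?_ ?_)
    · refine eLpNorm_mono fun p => ?_
      change ‖χ (p.2 / (n + 1)) • X p‖ ≤ _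
      rw [norm_smul]
      exact mul_le_of_le_one_left (norm_nonneg _) (χ1 _)
    · refine eLpNorm_le_mul_eLpNorm_of_ae_le_mul (.of_forall fun p => ?_) 2
      change ‖(deriv χ (p.2 / (n + 1)) / (n + 1)) • (Ψ p.2 • Mop w p)‖ ≤ _
      rw [norm_smul, norm_smul, norm_smul, norm_Mop]
      refine mul_le_mul_of_nonneg_right ?_ (by positivity)
      rw [norm_div, norm_eq_abs, norm_eq_abs, abs_of_pos n0]
      gcongr
      exact hB _
  have t0 : Tendsto (fun n : ℕ => ofReal (B / (n + 1))) atTop (𝓝 0) := by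
    rw [← ENNReal.ofReal_zero]
    exact (ENNReal.continuous_ofReal.tendsto _).comp
      (tendsto_const_div_atTop_nhds_zero_nat B |>.comp (tendsto_add_atTop_nat 1) |>.congr
        fun n => by simp)
  have t1 := ENNReal.Tendsto.const_mul (a := C) (tendsto_const_nhds (x := eLpNorm X 2 μS) |>.add
    (ENNReal.Tendsto.mul_const t0 (.inr hw.2.ne))) (.inr ofReal_ne_top)
  rw [zero_mul, add_zero] at t1
  refine eLpNorm_le_of_tendsto (F := fun n p => χ (p.2 / (n + 1)) • (Ψ p.2 • w p))
    (fun n => (((scaled n).continuous.comp continuous_snd).aestronglyMeasurable).smul hw.1)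
    (fun p => tendsto_const_nhds.congr' ?_) step t1
  obtain ⟨m, hm⟩ := exists_nat_ge |p.2|
  filter_upwards [eventually_ge_atTop m] with n hn
  have n0 : (0 : ℝ) < n + 1 := by positivity
  rw [χp, one_smul]
  rw [abs_div, abs_of_pos n0, div_le_one n0]
  have : (m : ℝ) ≤ n := by exact_mod_cast hn
  linarith

/-- Uniqueness in a one-sided weighted space under a small bounded perturbation. -/
lemma LineBound.ae_eq_zero {ι : Type*} [Fintype ι] [IsEmpty ι] {ω s K d : ℝ} {α β : ι → ℝ → ℂ}
    (hL : LineBound ω s K α β) (hd : √(2 * K) * d < 1) {w f : Field2}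
    (lf : LocL2 f) (h : DiracEq w f) (hw : MemX s w)
    (hf : ∀ᵐ p ∂μS, ‖f p - (ω : ℂ) • w p‖ ≤ d * ‖w p‖) :
    w =ᵐ[μS] 0 := by
  have sm : ContDiff ℝ (⊤ : ℕ∞) (fun y => exp (s * y)) := by fun_prop
  have dd : ∀ y, deriv (fun y => exp (s * y)) y = s * exp (s * y) := by
    intro y
    have : HasDerivAt (fun y => exp (s * y)) (exp (s * y) * (s * 1)) y :=
      ((hasDerivAt_id y).const_mul s).exp
    rw [this.deriv]; ring
  have b := hL.weighted_bound (locL2_of_memX hw) lf h isEmptyElim sm hw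
  set X := eLpNorm (fun p => exp (s * p.2) • w p) 2 μS with hX
  have b2 : eLpNorm (fun p : ℝ × ℝ => exp (s * p.2) • (f p - (ω : ℂ) • w p) +
      (deriv (fun y => exp (s * y)) p.2 - s * exp (s * p.2)) • Mop w p) 2
      μS ≤ ofReal d * X := by
    refine eLpNorm_le_mul_eLpNorm_of_ae_le_mul ?_ 2
    filter_upwards [hf] with p hp
    rw [dd, sub_self, zero_smul, add_zero, norm_smul, norm_smul]
    calc _ ≤ ‖exp (s * p.2)‖ * (d * ‖w p‖) := by gcongr
      _ = _ := by ring
  have b3 : X ≤ ofReal (√(2 * K) * d) * X := by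
    rw [ENNReal.ofReal_mul (sqrt_nonneg _), mul_assoc]
    exact b.trans (by gcongr)
  have X0 : X = 0 := by
    by_contra hne
    have : ofReal (√(2 * K) * d) * X < 1 * X :=
      (ENNReal.mul_lt_mul_iff_left hne hw.2.ne).2 (ENNReal.ofReal_lt_one.2 hd)
    rw [one_mul] at this
    exact absurd b3 (not_le.2 this)
  rw [hX, eLpNorm_eq_zero_iff hw.1 (by norm_num)] at X0
  filter_upwards [X0] with p hp
  have := (smul_eq_zero.1 hp).resolve_left (Real.exp_pos _).ne'
  exact this

/-- One step of the change of weight: a solution on which all functionals vanish and whose right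
side lies in the space with the new weight lies in that space too, if the weights are close. -/
lemma LineBound.memX_step {ι : Type*} [Fintype ι] {ω s K η : ℝ} {α β : ι → ℝ → ℂ}
    (hL : LineBound ω s K α β) {w f : Field2} (lf : LocL2 f) (h : DiracEq w f)
    (hp : ∀ i, ∀ᵐ y, pairY (α i) (β i) w y = 0) (hw : MemX s w)
    (hη : √(2 * K) * |η| ≤ 1 / 2) (hf : MemX (s + η) (fun p => f p - (ω : ℂ) • w p)) :
    MemX (s + η) w := by
  have lw := locL2_of_memX hw
  -- bounded smooth weights, comparable with the old one, that increase to the new one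
  set c : ℕ → ℝ := fun m => 1 / ((m : ℝ) + 1)
  have c0 : ∀ m, 0 < c m := fun m => Nat.one_div_pos_of_nat
  set D : ℕ → ℝ → ℝ := fun m y => exp (-(η * y)) + c m
  have D0 : ∀ m y, 0 < D m y := fun m y => add_pos (Real.exp_pos _) (c0 m)
  set Ψ : ℕ → ℝ → ℝ := fun m y => exp (s * y) / D m y
  have Ψ0 : ∀ m y, 0 ≤ Ψ m y := fun m y => div_nonneg (Real.exp_pos _).le (D0 m y).le
  have hΨ : ∀ m, ContDiff ℝ (⊤ : ℕ∞) (Ψ m) := fun m =>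
    ContDiff.div (by fun_prop) (by fun_prop) fun y => (D0 m y).ne'
  have split : ∀ y, exp ((s + η) * y) = exp (s * y) / exp (-(η * y)) := fun y => by
    rw [← Real.exp_sub]; ring_nf
  have dΨ : ∀ m y, |deriv (Ψ m) y - s * Ψ m y| ≤ |η| * Ψ m y := by
    intro m y
    have h1 := ((hasDerivAt_id y).const_mul s).exp.div
      (((hasDerivAt_id y).const_mul η).neg.exp.add_const (c m)) (D0 m y).ne'
    have h2 : deriv (Ψ m) y - s * Ψ m y = η * (exp (-(η * y)) / D m y) * Ψ m y := by
      refine (congrArg (· - s * Ψ m y) h1.deriv).trans ?_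
      have := (D0 m y).ne'
      simp only [Ψ, id]
      change (_ * D m y - _) / D m y ^ 2 - _ = _
      field_simp
      simp [D, mul_comm]
    rw [h2, abs_mul, abs_mul, abs_of_nonneg (Ψ0 m y)]
    refine mul_le_mul_of_nonneg_right (mul_le_of_le_one_right (abs_nonneg _) ?_) (Ψ0 m y)
    rw [abs_of_nonneg (by have := D0 m y; positivity), div_le_one (D0 m y)]
    exact le_add_of_nonneg_right (c0 m).le
  set Y := eLpNorm (fun p => exp ((s + η) * p.2) • (f p - (ω : ℂ) • w p)) 2 μS
  have mem : ∀ m, MemLp (fun p => Ψ m p.2 • w p) 2 μS := by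
    intro m
    have := memLp_bdd_smul hw (g := fun p => (D m p.2)⁻¹) (B := (c m)⁻¹)
      (Continuous.inv₀ (f := fun p : ℝ × ℝ => D m p.2) (by fun_prop)
        fun p => (D0 m p.2).ne').aestronglyMeasurable
      (.of_forall fun p => by
        rw [abs_of_pos (inv_pos.2 (D0 m _))]
        exact inv_anti₀ (c0 m) (le_add_of_nonneg_left (Real.exp_pos _).le))
    refine this.ae_eq (.of_forall fun p => ?_)
    simp only [Ψ, smul_smul, div_eq_inv_mul]
  have step : ∀ m, eLpNorm (fun p => Ψ m p.2 • w p) 2 μS ≤ 2 * (ofReal √(2 * K) * Y) := by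
    intro m
    have W := hL.weighted_bound lw lf h hp (hΨ m) (mem m)
    set X := eLpNorm (fun p => Ψ m p.2 • w p) 2 μS
    have W2 : eLpNorm (fun p : ℝ × ℝ => Ψ m p.2 • (f p - (ω : ℂ) • w p) +
        (deriv (Ψ m) p.2 - s * Ψ m p.2) • Mop w p) 2 μS ≤ Y + ofReal |η| * X := by
      have a1 := ((lf.sub (lw.const_smul ω)).smulY (hΨ m).continuous).aesm
      have a2 := (lw.mop.smulY (ψ := fun y => deriv (Ψ m) y - s * Ψ m y)
        (((hΨ m).continuous_deriv (by norm_cast)).sub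
          (continuous_const.mul (hΨ m).continuous))).aesm
      refine (eLpNorm_add_le a1 a2 (by norm_num)).trans (add_le_add (eLpNorm_mono fun p => ?_)
        (eLpNorm_le_mul_eLpNorm_of_ae_le_mul (.of_forall fun p => ?_) 2))
      · rw [norm_smul, norm_smul, split, norm_eq_abs, norm_eq_abs, abs_of_nonneg (Ψ0 _ _),
          abs_of_pos (by positivity)]
        gcongr
        exact div_le_div_of_nonneg_left (Real.exp_pos _).le (Real.exp_pos _)
          (le_add_of_nonneg_right (c0 m).le)
      · rw [norm_smul, norm_smul, norm_Mop, ← mul_assoc, norm_eq_abs, norm_eq_abs,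
          abs_of_nonneg (Ψ0 _ _)]
        gcongr
        exact dΨ m _
    have W3 : X ≤ ofReal √(2 * K) * Y + X / 2 := by
      refine W.trans ((mul_le_mul_right W2 _).trans ?_)
      rw [mul_add, ← mul_assoc, ← ENNReal.ofReal_mul (sqrt_nonneg _), ENNReal.div_eq_inv_mul]
      gcongr
      refine (ENNReal.ofReal_le_ofReal hη).trans (le_of_eq ?_)
      rw [one_div, ENNReal.ofReal_inv_of_pos (by norm_num)]; norm_num
    have Xt : X / 2 ≠ ⊤ := (ENNReal.div_lt_top (mem m).2.ne (by norm_num)).ne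
    have W4 : X / 2 ≤ ofReal √(2 * K) * Y :=
      (ENNReal.add_le_add_iff_right Xt).1 (by rwa [ENNReal.add_halves])
    calc X = 2 * (X / 2) := (ENNReal.mul_div_cancel (by norm_num) (by norm_num)).symm
      _ ≤ _ := by gcongr
  refine ⟨(lw.smulY (ψ := fun y => exp ((s + η) * y)) (by fun_prop)).aesm,
    (eLpNorm_le_of_tendsto (fun m => (mem m).1) (fun p => ?_) step tendsto_const_nhds).trans_lt
      (ENNReal.mul_lt_top (by norm_num) (ENNReal.mul_lt_top ENNReal.ofReal_lt_top hf.2))⟩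
  refine Tendsto.smul_const ?_ _
  have t2 := (tendsto_const_nhds (x := exp (s * p.2))).div ((tendsto_const_nhds
    (x := exp (-(η * p.2)))).add tendsto_one_div_add_atTop_nhds_zero_nat) (by positivity)
  rwa [add_zero, ← split] at t2

/-- Change of weight: if the symbol bound holds uniformly in a range of weights, a solution on
which all functionals vanish belongs to all spaces of the range as soon as it belongs to one of
them and the right side belongs to all. -/
lemma memX_of_memX {ι : Type*} [Fintype ι] {ω γ K : ℝ} {α β : ι → ℝ → ℂ}
    (hL : ∀ s, |s| ≤ γ → LineBound ω s K α β) {w f : Field2} (lf : LocL2 f) (h : DiracEq w f)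
    (hp : ∀ i, ∀ᵐ y, pairY (α i) (β i) w y = 0) {s : ℝ} (hs : |s| ≤ γ) (hw : MemX s w)
    (hf : ∀ t, |t| ≤ γ → MemX t (fun p => f p - (ω : ℂ) • w p)) {t : ℝ} (ht : |t| ≤ γ) :
    MemX t w := by
  set c := √(2 * K) with hc
  have c0 : 0 ≤ c := sqrt_nonneg _
  set r : ℝ := 1 / (2 * (c + 1)) with hr
  have r0 : 0 < r := by positivity
  have cr : c * r ≤ 1 / 2 := by
    rw [hr, mul_one_div, div_le_div_iff₀ (by positivity) (by norm_num)]
    linarith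
  have key : ∀ n : ℕ, ∀ t : ℝ, |t| ≤ γ → |t - s| ≤ n * r → MemX t w := by
    intro n
    induction n with
    | zero =>
      intro t _ h0
      simp only [Nat.cast_zero, zero_mul, abs_nonpos_iff, sub_eq_zero] at h0
      exact h0 ▸ hw
    | succ n ih =>
      intro t ht hn
      have n0 : (0 : ℝ) < n + 1 := by positivity
      push_cast at hn
      set t' := s + (t - s) * (n / (n + 1)) with ht'
      have hθ : (n : ℝ) / (n + 1) ≤ 1 := by rw [div_le_one n0]; linarith
      have hθ0 : (0 : ℝ) ≤ n / (n + 1) := by positivity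
      have d1 : |t' - s| ≤ n * r := by
        rw [ht', add_sub_cancel_left, abs_mul, abs_of_nonneg hθ0, ← mul_div_assoc, div_le_iff₀ n0]
        calc |t - s| * n ≤ ((n + 1) * r) * n := by gcongr
          _ = _ := by ring
      have d2 : |t - t'| ≤ r := by
        have : t - t' = (t - s) / (n + 1) := by rw [ht']; field_simp; ring
        rw [this, abs_div, abs_of_pos n0, div_le_iff₀ n0]
        linarith
      have d3 : |t'| ≤ γ := by
        rw [abs_le] at *
        constructor <;> rw [ht'] <;> nlinarith
      have := (hL t' d3).memX_step lf h hp (ih t' d3 d1) (η := t - t')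
        ((mul_le_mul_of_nonneg_left d2 c0).trans cr)
        (by rw [add_sub_cancel]; exact hf t ht)
      rwa [add_sub_cancel] at this
  obtain ⟨n, hn⟩ := exists_nat_ge (|t - s| / r)
  exact key n t ht (by rwa [div_le_iff₀ r0] at hn)

/-! ### Existence of solutions by duality -/

/-- If `J` is bounded by `T` then the adjoint equation `T* z = J* G` is solvable. -/
lemma exists_dual_solution {E H : Type*} [AddCommGroup E] [Module ℂ E] [NormedAddCommGroup H]
    [InnerProductSpace ℂ H] [CompleteSpace H] (T J : E →ₗ[ℂ] H) {C : ℝ}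
    (h : ∀ φ, ‖J φ‖ ≤ C * ‖T φ‖) (G : H) : ∃ z : H, ∀ φ, inner ℂ z (T φ) = inner ℂ G (J φ) := by
  obtain ⟨g, hg⟩ := T.rangeRestrict.exists_rightInverse_of_surjective T.range_rangeRestrict
  have hg' : ∀ r : LinearMap.range T, T (g r) = r := fun r => by
    have := LinearMap.congr_fun hg r
    exact congrArg Subtype.val this
  let l : LinearMap.range T →ₗ[ℂ] ℂ := ((innerSL ℂ G).toLinearMap ∘ₗ J) ∘ₗ g
  have hl : ∀ r : LinearMap.range T, ‖l r‖ ≤ (‖G‖ * C) * ‖r‖ := by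
    intro r
    change ‖inner ℂ G (J (g r))‖ ≤ _
    refine (norm_inner_le_norm _ _).trans ?_
    have := h (g r)
    rw [hg'] at this
    rw [mul_assoc]
    exact mul_le_mul_of_nonneg_left this (norm_nonneg _)
  obtain ⟨f, hf, -⟩ := exists_extension_norm_eq (LinearMap.range T) (l.mkContinuous _ hl)
  refine ⟨(InnerProductSpace.toDual ℂ H).symm f, fun φ => ?_⟩
  rw [InnerProductSpace.toDual_symm_apply]
  have h1 := hf ⟨T φ, φ, rfl⟩
  rw [h1]
  change inner ℂ G (J (g ⟨T φ, φ, rfl⟩)) = _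
  have h2 : J (g ⟨T φ, φ, rfl⟩ - φ) = 0 := by
    have := h (g ⟨T φ, φ, rfl⟩ - φ)
    rw [map_sub T, hg', sub_self, norm_zero, mul_zero] at this
    exact norm_le_zero_iff.1 this
  rw [map_sub, sub_eq_zero] at h2
  rw [h2]

lemma memLp_toLp {w : Field2} (h : MemLp w 2 μS) : MemLp (fun p => WithLp.toLp 2 (w p)) 2 μS :=
  (WithLp.prodContinuousLinearEquiv 2 ℂ ℂ ℂ).symm.toContinuousLinearMap.comp_memLp' h

/-- A square integrable pair as an element of the Hilbert space of `ℂ²`-valued functions. -/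
def toHilb {w : Field2} (h : MemLp w 2 μS) : Lp (WithLp 2 (ℂ × ℂ)) 2 μS :=
  MemLp.toLp (fun p => WithLp.toLp 2 (w p)) (memLp_toLp h)

lemma toHilb_coe {w : Field2} (h : MemLp w 2 μS) :
    toHilb h =ᵐ[μS] fun p => WithLp.toLp 2 (w p) := MemLp.coeFn_toLp _

lemma toHilb_congr {w w' : Field2} (h : MemLp w 2 μS) (h' : MemLp w' 2 μS) (e : w = w') :
    toHilb h = toHilb h' := by subst e; rfl

lemma toHilb_add {w w' : Field2} (h : MemLp w 2 μS) (h' : MemLp w' 2 μS) :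
    toHilb (h.add h') = toHilb h + toHilb h' := rfl

lemma toHilb_smul {w : Field2} (h : MemLp w 2 μS) (c : ℂ) :
    toHilb (h.const_smul c) = c • toHilb h := rfl

lemma norm_toHilb_le {w : Field2} (h : MemLp w 2 μS) :
    ‖toHilb h‖ ≤ √2 * (eLpNorm w 2 μS).toReal := by
  rw [toHilb, Lp.norm_toLp, ← ENNReal.toReal_ofReal (sqrt_nonneg 2), ← ENNReal.toReal_mul]
  refine ENNReal.toReal_mono (ENNReal.mul_ne_top ofReal_ne_top h.2.ne) ?_
  refine eLpNorm_le_mul_eLpNorm_of_ae_le_mul (.of_forall fun p => ?_) 2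
  rw [WithLp.prod_norm_eq_of_L2]
  refine Real.sqrt_le_iff.2 ⟨by positivity, ?_⟩
  rw [mul_pow, Real.sq_sqrt (by norm_num)]
  have h1 := norm_fst_le (w p)
  have h2 := norm_snd_le (w p)
  have h3 : ‖(w p).1‖ ^ 2 ≤ ‖w p‖ ^ 2 := by gcongr
  have h4 : ‖(w p).2‖ ^ 2 ≤ ‖w p‖ ^ 2 := by gcongr
  simp only [WithLp.toLp_fst, WithLp.toLp_snd]
  linarith

lemma le_norm_toHilb {w : Field2} (h : MemLp w 2 μS) :
    (eLpNorm w 2 μS).toReal ≤ ‖toHilb h‖ := by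
  have h' := memLp_toLp h
  rw [toHilb, Lp.norm_toLp]
  refine ENNReal.toReal_mono h'.2.ne (eLpNorm_mono fun p => ?_)
  rw [WithLp.prod_norm_eq_of_L2, Prod.norm_def]
  refine max_le ?_ ?_ <;> refine Real.le_sqrt_of_sq_le ?_ <;> simp

lemma inner_toHilb {w w' : Field2} (h : MemLp w 2 μS) (h' : MemLp w' 2 μS) :
    inner ℂ (toHilb h) (toHilb h') = ∫ p in strip, ((w' p).1 * conj (w p).1 +
      (w' p).2 * conj (w p).2) := by
  rw [L2.inner_def]
  refine integral_congr_ae ?_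
  filter_upwards [toHilb_coe h, toHilb_coe h'] with p h1 h2
  rw [h1, h2, WithLp.prod_inner_apply]
  simp

lemma exists_toHilb_eq (z : Lp (WithLp 2 (ℂ × ℂ)) 2 μS) :
    ∃ w : Field2, ∃ h : MemLp w 2 μS, toHilb h = z := by
  have h := (WithLp.prodContinuousLinearEquiv 2 ℂ ℂ ℂ).toContinuousLinearMap.comp_memLp'
    (Lp.memLp z)
  refine ⟨_, h, ?_⟩
  refine Lp.ext ?_
  filter_upwards [toHilb_coe h] with p hp
  rw [hp]
  rfl

lemma IsTest.differentiableAt {φ : ℝ × ℝ → ℂ} (h : IsTest φ) (p : ℝ × ℝ) :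
    DifferentiableAt ℝ φ p := h.c1.differentiable one_ne_zero p

lemma tsupport_add_subset {φ ψ : ℝ × ℝ → ℂ} {s : Set (ℝ × ℝ)} (h : tsupport φ ⊆ s)
    (h' : tsupport ψ ⊆ s) : tsupport (φ + ψ) ⊆ s := by
  refine (closure_mono (Function.support_add φ ψ)).trans ?_
  rw [closure_union]
  exact union_subset h h'

lemma isTest_zero : IsTest (0 : ℝ × ℝ → ℂ) := ⟨contDiff_const, HasCompactSupport.zero⟩

/-- The space of test pairs. -/
def testPairs : Submodule ℂ ((ℝ × ℝ → ℂ) × (ℝ × ℝ → ℂ)) where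
  carrier := {φ | IsTestPair φ.1 φ.2}
  zero_mem' := ⟨isTest_zero, isTest_zero, by simp, by simp⟩
  add_mem' h h' := ⟨h.fst.add h'.fst, h.snd.add h'.snd, tsupport_add_subset h.left h'.left,
    tsupport_add_subset h.right h'.right⟩
  smul_mem' c _ h := ⟨h.fst.const_mul c, h.snd.const_mul c,
    (tsupport_smul_subset_right (fun _ => c) _).trans h.left,
    (tsupport_smul_subset_right (fun _ => c) _).trans h.right⟩

/-- The operator `𝒟 - ω - s M + V` on test pairs. -/
def pertOp (ω s : ℝ) (V : ℝ × ℝ → ℝ) (a b : ℝ × ℝ → ℂ) : Field2 := fun p =>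
  diracOp a b p - (ω : ℂ) • (a p, b p) - (s : ℂ) • Mop (fun p => (a p, b p)) p + V p • (a p, b p)

lemma memLp_residual {μ : Measure (ℝ × ℝ)} {w f : Field2} (hw : MemLp w 2 μ)
    (hf : MemLp f 2 μ) (c d : ℂ) : MemLp (fun p => f p - c • w p - d • Mop w p) 2 μ := by
  exact (hf.sub (hw.const_smul c)).sub ((memLp_Mop hw).const_smul d)

lemma IsTestPair.memLp_pertOp {a b : ℝ × ℝ → ℂ} (t : IsTestPair a b) (ω s : ℝ) {V : ℝ × ℝ → ℝ}
    {d : ℝ} (hV : AEStronglyMeasurable V μS) (hd : ∀ᵐ p ∂μS, |V p| ≤ d) :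
    MemLp (pertOp ω s V a b) 2 μS :=
  (memLp_residual t.memLp t.memLp_diracOp ω s).add (memLp_bdd_smul t.memLp hV hd)

/-- Bound for test pairs by the perturbed operator. -/
lemma LineBound.pertOp_bound {ι : Type*} [Fintype ι] [IsEmpty ι] {ω s K d : ℝ} {α β : ι → ℝ → ℂ}
    (hL : LineBound ω s K α β) (hd : √(2 * K) * d < 1) {V : ℝ × ℝ → ℝ}
    (hV : AEStronglyMeasurable V μS) (hVd : ∀ᵐ p ∂μS, |V p| ≤ d) {a b : ℝ × ℝ → ℂ}
    (t : IsTestPair a b) :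
    (eLpNorm (fun p => (a p, b p)) 2 μS).toReal ≤
      √(2 * K) / (1 - √(2 * K) * d) * (eLpNorm (pertOp ω s V a b) 2 μS).toReal := by
  have h1 := hL.testPair_bound t
  rw [Finset.univ_eq_empty, Finset.sum_empty, add_zero] at h1
  have mV := memLp_bdd_smul t.memLp hV hVd
  have mP := t.memLp_pertOp ω s hV hVd
  set φ : Field2 := fun p => (a p, b p) with hφ
  have h2 : eLpNorm (fun p => diracOp a b p - (ω : ℂ) • (a p, b p) -
      (s : ℂ) • Mop φ p) 2 μS ≤ eLpNorm (pertOp ω s V a b) 2 μS +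
        ofReal d * eLpNorm φ 2 μS := by
    have h3 := eLpNorm_sub_le mP.1 mV.1 (p := 2) (by norm_num)
    refine le_trans (le_of_eq ?_) (h3.trans (add_le_add_right ?_ _))
    · congr 1; ext p : 1
      simp only [pertOp, Pi.sub_apply, φ]
      abel
    · refine eLpNorm_le_mul_eLpNorm_of_ae_le_mul ?_ 2
      filter_upwards [hVd] with p hp
      rw [norm_smul, norm_eq_abs]
      gcongr
  have mφ : MemLp φ 2 μS := t.memLp
  have h4 := h1.trans (mul_le_mul_right h2 _)
  have h5 := ENNReal.toReal_mono (ENNReal.mul_ne_top ofReal_ne_top (ENNReal.add_ne_top.2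
    ⟨mP.2.ne, ENNReal.mul_ne_top ofReal_ne_top mφ.2.ne⟩)) h4
  rw [ENNReal.toReal_mul, ENNReal.toReal_add mP.2.ne
    (ENNReal.mul_ne_top ofReal_ne_top mφ.2.ne), ENNReal.toReal_mul,
    ENNReal.toReal_ofReal (sqrt_nonneg _)] at h5
  rw [div_mul_eq_mul_div, le_div_iff₀ (by linarith)]
  rcases le_or_gt 0 d with d0 | d0
  · rw [ENNReal.toReal_ofReal d0] at h5
    linarith
  · rw [ENNReal.ofReal_of_nonpos d0.le, ENNReal.toReal_zero] at h5
    have : μS = 0 := by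
      by_contra hne
      have : (ae μS).NeBot := ae_neBot.2 hne
      obtain ⟨p, hp⟩ := hVd.exists
      linarith [abs_nonneg (V p)]
    simp [this]

/-- Solvability of `(𝒟 - ω + V) ζ = F` in a one-sided weighted space, from the symbol bound for
the opposite weight. -/
lemma LineBound.exists_solution {ι : Type*} [Fintype ι] [IsEmpty ι] {ω γ K d : ℝ}
    {α β : ι → ℝ → ℂ} (hL : LineBound ω (-γ) K α β) (hd : √(2 * K) * d < 1)
    {V : ℝ × ℝ → ℝ} (hV : AEStronglyMeasurable V μS) (hVd : ∀ᵐ p ∂μS, |V p| ≤ d) {F : Field2}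
    (hF : MemX γ F) :
    ∃ ζ : Field2, MemX γ ζ ∧ DiracEq ζ (fun p => (ω - V p) • ζ p + F p) := by
  have mT : ∀ φ : testPairs, MemLp (pertOp ω (-γ) V φ.1.1 φ.1.2) 2 μS := fun φ =>
    φ.2.memLp_pertOp ω (-γ) hV hVd
  have mJ : ∀ φ : testPairs, MemLp (fun p => (φ.1.1 p, φ.1.2 p)) 2 μS := fun φ => φ.2.memLp
  let T : testPairs →ₗ[ℂ] Lp (WithLp 2 (ℂ × ℂ)) 2 μS :=
    { toFun := fun φ => toHilb (mT φ)
      map_add' := fun φ ψ => by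
        rw [← toHilb_add]
        refine toHilb_congr _ _ ?_
        have h1 := φ.2
        have h2 := ψ.2
        ext p <;>
        simp [pertOp, diracOp, Mop, dx, dy,
          fderiv_add (h1.fst.differentiableAt p) (h2.fst.differentiableAt p),
          fderiv_add (h1.snd.differentiableAt p) (h2.snd.differentiableAt p)] <;> ring
      map_smul' := fun c φ => by
        rw [RingHom.id_apply, ← toHilb_smul]
        refine toHilb_congr _ _ ?_
        have h1 := φ.2
        ext p <;>
        simp [pertOp, diracOp, Mop, dx, dy,
          fderiv_const_smul (h1.fst.differentiableAt p),
          fderiv_const_smul (h1.snd.differentiableAt p)] <;> ring }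
  let J : testPairs →ₗ[ℂ] Lp (WithLp 2 (ℂ × ℂ)) 2 μS :=
    { toFun := fun φ => toHilb (mJ φ)
      map_add' := fun φ ψ => rfl
      map_smul' := fun c φ => rfl }
  have hT : ∀ φ, T φ = toHilb (mT φ) := fun _ => rfl
  have hJ : ∀ φ, J φ = toHilb (mJ φ) := fun _ => rfl
  clear_value T J
  set C := √(2 * K) / (1 - √(2 * K) * d) with hC
  have C0 : 0 ≤ C := div_nonneg (sqrt_nonneg _) (by linarith)
  have bound : ∀ φ, ‖J φ‖ ≤ (√2 * C) * ‖T φ‖ := by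
    intro φ
    have h1 := hL.pertOp_bound hd hV hVd φ.2
    rw [hT, hJ]
    calc _ ≤ _ := norm_toHilb_le (mJ φ)
      _ ≤ √2 * (C * (eLpNorm (pertOp ω (-γ) V φ.1.1 φ.1.2) 2 μS).toReal) := by gcongr
      _ ≤ √2 * (C * ‖toHilb (mT φ)‖) := by
        gcongr
        exact le_norm_toHilb (mT φ)
      _ = _ := by ring
  obtain ⟨z', hz'⟩ := exists_dual_solution T J bound (toHilb hF)
  obtain ⟨z, mz, rfl⟩ := exists_toHilb_eq z'
  have main : ∀ a b, IsTestPair a b →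
      ∫ p in strip, ((pertOp ω (-γ) V a b p).1 * conj (z p).1 +
        (pertOp ω (-γ) V a b p).2 * conj (z p).2) =
      ∫ p in strip, (a p * conj (exp (γ * p.2) • F p).1 +
        b p * conj (exp (γ * p.2) • F p).2) := by
    intro a b t
    have h1 := hz' ⟨(a, b), t⟩
    rw [hT, hJ] at h1
    exact (inner_toHilb _ _).symm.trans (h1.trans (inner_toHilb _ _))
  set ζ : Field2 := fun p => exp (-γ * p.2) • z p with hζ
  have mζ : MemX γ ζ := by
    refine mz.ae_eq (.of_forall fun p => ?_)
    simp only [ζ, smul_smul, ← Real.exp_add]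
    rw [show γ * p.2 + -γ * p.2 = 0 by ring, Real.exp_zero, one_smul]
  have lζ := locL2_of_memX mζ
  have lF := locL2_of_memX hF
  have lV : LocL2 (fun p => (ω - V p) • ζ p) := by
    intro R
    simp only [sub_smul]
    exact ((lζ R).const_smul ω).sub (memLp_bdd_smul (lζ R) (hV.mono_measure (window_le R)) (ae_mono (window_le R) hVd))
  -- a test function is conjugated and multiplied by the weight
  have sm : ContDiff ℝ (⊤ : ℕ∞) fun y => exp (-γ * y) := by fun_prop
  have tw : ∀ {φ : ℝ × ℝ → ℂ}, IsTest φ → IsTest (fun p => (exp (-γ * p.2) : ℝ) * conj (φ p)) :=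
    fun t => t.conj.mulY sm
  have ts : ∀ {φ : ℝ × ℝ → ℂ}, tsupport (fun p => ((exp (-γ * p.2) : ℝ) : ℂ) * conj (φ p)) ⊆ tsupport φ :=
    fun {_} => tsupport_mulY.trans tsupport_conj
  have hx : ∀ {φ : ℝ × ℝ → ℂ}, IsTest φ → ∀ p, dx (fun p => ((exp (-γ * p.2) : ℝ) : ℂ) *
      conj (φ p)) p = exp (-γ * p.2) * conj (dx φ p) := fun t p => by
    rw [dx_mulY t.conj sm, dx_conj t]
  have hy : ∀ {φ : ℝ × ℝ → ℂ}, IsTest φ → ∀ p, dy (fun p => ((exp (-γ * p.2) : ℝ) : ℂ) *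
      conj (φ p)) p = exp (-γ * p.2) * (conj (dy φ p) - γ * conj (φ p)) := fun t p => by
    have h1 := ((hasDerivAt_id p.2).const_mul (-γ)).exp.deriv
    rw [dy_mulY t.conj sm, dy_conj t, show deriv (fun y => exp (-γ * y)) p.2 = _ from h1]
    push_cast
    simp only [id]
    ring
  have z0 : ∀ p, dx (0 : ℝ × ℝ → ℂ) p = 0 ∧ dy (0 : ℝ × ℝ → ℂ) p = 0 := fun p => by
    simp [dx, dy]
  have ew : ∀ p : ℝ × ℝ, ((exp (-γ * p.2) : ℝ) : ℂ) * (exp (γ * p.2) : ℝ) = 1 := by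
    intro p
    rw [← Complex.ofReal_mul, ← Real.exp_add, show -γ * p.2 + γ * p.2 = 0 by ring, Real.exp_zero,
      Complex.ofReal_one]
  have key : ∀ {φ ψ : ℝ × ℝ → ℂ}, IsTest φ → IsTest ψ → tsupport φ ⊆ {p | 0 < p.1} →
      tsupport ψ ⊆ {p | p.1 < 1} → ∫ p in strip, ((F p).1 * φ p + (F p).2 * ψ p) =
        -∫ p in strip, ((ζ p).2 * (-I * dx φ p + dy φ p) + (ζ p).1 * (-I * dx ψ p - dy ψ p) +
          (((ω - V p) • ζ p).1 * φ p + ((ω - V p) • ζ p).2 * ψ p)) := by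
    intro φ ψ t t' h h'
    have M := congrArg (starRingEnd ℂ) (main _ _ ⟨tw t, tw t', ts.trans h, ts.trans h'⟩)
    rw [← integral_conj, ← integral_conj] at M
    rw [← integral_neg]
    refine Eq.trans ?_ (M.symm.trans ?_)
    · congr 1; ext p
      simp only [map_add, map_mul, conj_conj, conj_ofReal, Prod.smul_fst, Prod.smul_snd, real_smul]
      linear_combination (-(F p).1 * φ p - (F p).2 * ψ p) * ew p
    · congr 1; ext p
      simp only [pertOp, diracOp, Mop, hx t, hy t, hx t', hy t', Prod.fst_add, Prod.snd_add,
        Prod.fst_sub, Prod.snd_sub, Prod.smul_fst, Prod.smul_snd, real_smul, smul_eq_mul, map_add,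
        map_sub, map_mul, map_neg, conj_conj, conj_ofReal, Complex.conj_I, ζ]
      push_cast
      ring
  refine ⟨ζ, mζ, fun φ h1 h2 h3 => ?_, fun φ h1 h2 h3 => ?_⟩
  · have t : IsTest φ := ⟨h1, h2⟩
    have i1 := (lζ.integrable_mul t.diracTest₁.cont t.diracTest₁.supp).2
    have i2 := (lV.integrable_mul t.cont t.supp).1
    have e1 := key t isTest_zero h3 (by simp)
    simp only [z0, Pi.zero_apply, mul_zero, add_zero, sub_zero] at e1
    rw [integral_add i1 i2] at e1
    simp only [Prod.fst_add, add_mul]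
    rw [integral_add i2 (lF.integrable_mul t.cont t.supp).1]
    linear_combination e1
  · have t : IsTest φ := ⟨h1, h2⟩
    have i1 := (lζ.integrable_mul t.diracTest₂.cont t.diracTest₂.supp).1
    have i2 := (lV.integrable_mul t.cont t.supp).2
    have e1 := key isTest_zero t (by simp) h3
    simp only [z0, Pi.zero_apply, mul_zero, zero_add, add_zero] at e1
    rw [integral_add i1 i2] at e1
    simp only [Prod.snd_add, add_mul]
    rw [integral_add i2 (lF.integrable_mul t.cont t.supp).2]
    linear_combination e1

/-! ### Green's formula and conservation of the flux -/

/-- The pointwise Hermitian product of two fields. -/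
def sesq (z z' : Field2) (p : ℝ × ℝ) : ℂ :=
  (z p).1 * conj (z' p).1 + (z p).2 * conj (z' p).2

/-- The form `q` on the cross-section at height `y`. -/
def qY (z z' : Field2) (y : ℝ) : ℂ :=
  -∫ x in (0 : ℝ)..1, ((z (x, y)).1 * conj (z' (x, y)).2 -
    (z (x, y)).2 * conj (z' (x, y)).1)

lemma qY_eq (z z' : Field2) (y : ℝ) :
    qY z z' y = ∫ x in Ioo (0 : ℝ) 1, sesq (Mop z) z' (x, y) := by
  rw [qY, intervalIntegral.integral_of_le zero_le_one, integral_Ioc_eq_integral_Ioo,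
    ← integral_neg]
  congr 1; ext x
  simp only [sesq, Mop]
  ring

/-- Green's formula against a test pair: the operator is formally self-adjoint. -/
lemma dirac_symm_test {a b : ℝ × ℝ → ℂ} (t : IsTestPair a b) {z f : Field2} (lz : LocL2 z)
    (lf : LocL2 f) (h : DiracEq z f) :
    ∫ p in strip, sesq (diracOp a b) z p = ∫ p in strip, sesq (fun p => (a p, b p)) f p := by
  have h1 := congrArg (starRingEnd ℂ)
    (h.1 _ t.fst.conj.smooth t.fst.conj.supp (tsupport_conj.trans t.left))
  have h2 := congrArg (starRingEnd ℂ)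
    (h.2 _ t.snd.conj.smooth t.snd.conj.supp (tsupport_conj.trans t.right))
  rw [map_neg, ← integral_conj, ← integral_conj] at h1 h2
  have conjInt : ∀ {g : ℝ × ℝ → ℂ}, Integrable g μS →
      Integrable (fun p => conj (g p)) μS := fun hg =>
    Complex.conjCLE.toContinuousLinearMap.integrable_comp hg
  have i1 := conjInt (lz.integrable_mul t.fst.conj.diracTest₁.cont t.fst.conj.diracTest₁.supp).2
  have i2 := conjInt (lz.integrable_mul t.snd.conj.diracTest₂.cont t.snd.conj.diracTest₂.supp).1
  have i3 := conjInt (lf.integrable_mul t.fst.conj.cont t.fst.conj.supp).1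
  have i4 := conjInt (lf.integrable_mul t.snd.conj.cont t.snd.conj.supp).2
  have e1 : ∫ p in strip, sesq (diracOp a b) z p = -(∫ p in strip, conj ((z p).2 *
      (-I * dx (fun p => conj (a p)) p +
        dy (fun p => conj (a p)) p))) - ∫ p in strip, conj ((z p).1 *
      (-I * dx (fun p => conj (b p)) p -
        dy (fun p => conj (b p)) p)) := by
    rw [← integral_neg]
    refine Eq.trans ?_ (integral_sub i1.neg i2)
    congr 1; ext p
    simp only [sesq, diracOp, dx_conj t.fst, dy_conj t.fst, dx_conj t.snd,
      dy_conj t.snd, map_add, map_sub, map_mul,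
      map_neg, conj_conj, Complex.conj_I]
    ring
  rw [e1, h1, h2, neg_neg, sub_neg_eq_add, ← integral_add i3 i4]
  congr 1; ext p
  simp only [sesq, map_mul, conj_conj]
  ring

lemma toHilb_sub {w w' : Field2} (h : MemLp w 2 μS) (h' : MemLp w' 2 μS) :
    toHilb (h.sub h') = toHilb h - toHilb h' := rfl

lemma inner_toHilb_sesq {w w' : Field2} (h : MemLp w 2 μS) (h' : MemLp w' 2 μS) :
    inner ℂ (toHilb h) (toHilb h') = ∫ p in strip, sesq w' w p := inner_toHilb h h'

/-- Symmetry of the Dirac operator, one of the fields having compact support along the ribbon. -/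
lemma dirac_symm {w f z g : Field2} (hw : MemLp w 2 μS) (hf : MemLp f 2 μS) (hz : MemLp z 2 μS)
    (hg : MemLp g 2 μS) (lz : LocL2 z) (lg : LocL2 g) {R : ℝ} (hR : ∀ p, R < |p.2| → w p = 0)
    (h : DiracEq w f) (h' : DiracEq z g) :
    ∫ p in strip, sesq f z p = ∫ p in strip, sesq w g p := by
  rw [← inner_toHilb_sesq hz hf, ← inner_toHilb_sesq hg hw]
  refine eq_of_forall_dist_le fun e he => ?_
  set D : ℝ := √2 * (‖toHilb hz‖ + ‖toHilb hg‖) + 1 with hD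
  have D0 : 0 < D := by positivity
  obtain ⟨a, b, t, e1, e2⟩ := exists_testPair_approx hw hf hR h (ε := ofReal (e / D))
    (by simpa using div_pos he D0)
  have mφ : MemLp (fun p => (a p, b p)) 2 μS := t.memLp
  have mD : MemLp (diracOp a b) 2 μS := t.memLp_diracOp
  have key : inner ℂ (toHilb hz) (toHilb mD) = inner ℂ (toHilb hg) (toHilb mφ) := by
    rw [inner_toHilb_sesq, inner_toHilb_sesq]
    exact dirac_symm_test t lz lg h'
  have n1 : ‖toHilb (mD.sub hf)‖ ≤ √2 * (e / D) :=
    (norm_toHilb_le _).trans (mul_le_mul_of_nonneg_left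
      (ENNReal.toReal_le_of_le_ofReal (by positivity) e2) (sqrt_nonneg _))
  have n2 : ‖toHilb (mφ.sub hw)‖ ≤ √2 * (e / D) :=
    (norm_toHilb_le _).trans (mul_le_mul_of_nonneg_left
      (ENNReal.toReal_le_of_le_ofReal (by positivity) e1) (sqrt_nonneg _))
  have e3 : inner ℂ (toHilb hz) (toHilb hf) - inner ℂ (toHilb hg) (toHilb hw) =
      inner ℂ (toHilb hg) (toHilb (mφ.sub hw)) - inner ℂ (toHilb hz) (toHilb (mD.sub hf)) := by
    rw [toHilb_sub mφ hw, toHilb_sub mD hf, inner_sub_right, inner_sub_right, key]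
    ring
  rw [dist_eq_norm, e3]
  calc _ ≤ ‖toHilb hg‖ * (√2 * (e / D)) + ‖toHilb hz‖ * (√2 * (e / D)) :=
        (norm_sub_le _ _).trans (add_le_add
          ((norm_inner_le_norm _ _).trans (mul_le_mul_of_nonneg_left n2 (norm_nonneg _)))
          ((norm_inner_le_norm _ _).trans (mul_le_mul_of_nonneg_left n1 (norm_nonneg _))))
    _ = (√2 * (‖toHilb hz‖ + ‖toHilb hg‖)) * (e / D) := by ring
    _ ≤ D * (e / D) := by gcongr; rw [hD]; linarith
    _ = e := by field_simp

/-- Green's formula with a cutoff `ψ(y)`. -/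
lemma green {z f z' f' : Field2} (lz : LocL2 z) (lf : LocL2 f) (lz' : LocL2 z') (lf' : LocL2 f')
    (h : DiracEq z f) (h' : DiracEq z' f') {ψ : ℝ → ℝ} (hψ : ContDiff ℝ (⊤ : ℕ∞) ψ)
    (cψ : HasCompactSupport ψ) :
    ∫ p in strip, ((ψ p.2 : ℂ) * sesq f z' p + ((deriv ψ p.2 : ℝ) : ℂ) * sesq (Mop z) z' p) =
      ∫ p in strip, (ψ p.2 : ℂ) * sesq z f' p := by
  obtain ⟨χ₀, B, cχ, χ1, χp, χs, -, -⟩ := exists_plateau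
  obtain ⟨R₀, hR₀⟩ := cψ.isCompact.isBounded.subset_closedBall (0 : ℝ)
  set R : ℝ := |R₀| + 1 with hR
  have R0 : 0 < R := by positivity
  have ψz' : ∀ y, R ≤ |y| → y ∉ tsupport ψ := by
    intro y hy hmem
    have := hR₀ hmem
    rw [mem_closedBall_zero_iff, norm_eq_abs] at this
    have := le_abs_self R₀
    linarith
  have ψz : ∀ y, R < |y| → ψ y = 0 := fun y hy => image_eq_zero_of_notMem_tsupport (ψz' y hy.le)
  have dψz : ∀ y, R < |y| → deriv ψ y = 0 := fun y hy => by
    by_contra hne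
    exact ψz' y hy.le (support_deriv_subset hne)
  set χ : ℝ → ℝ := fun y => χ₀ (y / R) with hχ
  have sχ : ContDiff ℝ (⊤ : ℕ∞) χ := cχ.comp (contDiff_id.div_const _)
  have χone : ∀ y, |y| ≤ R → χ y = 1 := fun y hy => χp _ (by
    rw [abs_div, abs_of_pos R0]; exact (div_le_one R0).2 hy)
  have χzero : ∀ y, 2 * R < |y| → χ y = 0 := fun y hy => χs _ (by
    rw [abs_div, abs_of_pos R0]; exact (lt_div_iff₀ R0).2 hy)
  have dχ1 : ∀ y, |y| < R → deriv χ y = 0 := fun y hy => deriv_eq_zero_of_eq_const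
    (isOpen_lt continuous_abs continuous_const) (fun y hy => χone y (le_of_lt hy)) hy
  have dχ2 : ∀ y, 2 * R < |y| → deriv χ y = 0 := fun y hy =>
    deriv_eq_zero_of_eq_const (isOpen_lt continuous_const continuous_abs) χzero hy
  have cdψ : Continuous (deriv ψ) := hψ.continuous_deriv (by norm_cast)
  have cdχ : Continuous (deriv χ) := sχ.continuous_deriv (by norm_cast)
  have l1 := lz'.smulY sχ.continuous
  have l2 := (lf'.smulY sχ.continuous).add (lz'.mop.smulY cdχ)
  have m1 := lz.memLp_smulY hψ.continuous ψz
  have m2 := (lf.memLp_smulY hψ.continuous ψz).add (lz.mop.memLp_smulY cdψ dψz)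
  have m3 := lz'.memLp_smulY sχ.continuous χzero
  have m4 := (lf'.memLp_smulY sχ.continuous χzero).add (lz'.mop.memLp_smulY cdχ dχ2)
  have main := dirac_symm m1 m2 m3 m4 l1 l2 (R := R) (fun p hp => by rw [ψz _ hp, zero_smul])
    (h.cutoff lz lf hψ) (h'.cutoff lz' lf' sχ)
  refine Eq.trans ?_ (main.trans ?_)
  · congr 1; ext p
    simp only [sesq, Pi.add_apply, Prod.fst_add, Prod.snd_add, Prod.smul_fst, Prod.smul_snd,
      real_smul, map_mul, conj_ofReal]
    rcases le_or_gt |p.2| R with hp | hp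
    · rw [χone _ hp]; push_cast; ring
    · rw [ψz _ hp, dψz _ hp]; push_cast; ring
  · congr 1; ext p
    simp only [sesq, Pi.add_apply, Prod.fst_add, Prod.snd_add, Prod.smul_fst, Prod.smul_snd,
      real_smul, map_mul, map_add, conj_ofReal]
    rcases lt_or_ge |p.2| R with hp | hp
    · rw [χone _ hp.le, dχ1 _ hp]; push_cast; ring
    · rw [image_eq_zero_of_notMem_tsupport (ψz' _ hp)]; push_cast; ring

/-- A locally integrable function with vanishing weak derivative on an interval is constant. -/
lemma ae_const_of_weak_deriv_zero {U : Set ℝ} (hU : IsOpen U) (oU : U.OrdConnected) {Q : ℝ → ℂ}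
    (hQ : LocallyIntegrableOn Q U) (h : ∀ ψ : ℝ → ℝ, ContDiff ℝ (⊤ : ℕ∞) ψ → HasCompactSupport ψ →
      tsupport ψ ⊆ U → ∫ y, deriv ψ y • Q y = 0) : ∃ c, ∀ᵐ y, y ∈ U → Q y = c := by
  rcases U.eq_empty_or_nonempty with rfl | ⟨u, hu⟩
  · exact ⟨0, by simp⟩
  obtain ⟨r, r0, hr⟩ := Metric.isOpen_iff.1 hU u hu
  let θ₀ : ContDiffBump u := ⟨r / 4, r / 2, by positivity, by linarith⟩
  set θ : ℝ → ℝ := θ₀.normed volume with hθ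
  have sθ : ContDiff ℝ (⊤ : ℕ∞) θ := θ₀.contDiff_normed
  have cθ : HasCompactSupport θ := θ₀.hasCompactSupport_normed
  have tθ : tsupport θ ⊆ U := by
    rw [hθ, θ₀.tsupport_normed_eq]
    exact (Metric.closedBall_subset_ball (by simp only [θ₀]; linarith)).trans hr
  have iθ : ∫ y, θ y = 1 := θ₀.integral_normed
  have intg : ∀ g : ℝ → ℝ, Continuous g → HasCompactSupport g → tsupport g ⊆ U →
      Integrable (fun y => g y • Q y) := fun g a b c => by
    have h1 := hQ.integrableOn_compact_subset c b.isCompact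
    have h2 := h1.continuousOn_smul a.continuousOn b.isCompact
    rw [← integrable_indicator_iff b.isCompact.measurableSet] at h2
    refine h2.congr (.of_forall fun y => ?_)
    by_cases hy : y ∈ tsupport g
    · rw [indicator_of_mem hy]
    · rw [indicator_of_notMem hy]
      simp only [image_eq_zero_of_notMem_tsupport hy, zero_smul]
  refine ⟨∫ y, θ y • Q y, ?_⟩
  set c := ∫ y, θ y • Q y with hc
  have loc : LocallyIntegrableOn (fun y => Q y - c) U :=
    hQ.sub ((locallyIntegrable_const c).locallyIntegrableOn U)
  have := hU.ae_eq_zero_of_integral_contDiff_smul_eq_zero loc (fun φ sφ cφ tφ => ?_)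
  · filter_upwards [this] with y hy hyU using sub_eq_zero.1 (hy hyU)
  -- the difference of `φ` and a multiple of `θ` is the derivative of a test function
  set m := ∫ y, φ y with hm
  set g : ℝ → ℝ := fun y => φ y - m * θ y with hg
  have sg : ContDiff ℝ (⊤ : ℕ∞) g := sφ.sub (contDiff_const.mul sθ)
  set K := tsupport φ ∪ tsupport θ with hK
  have cK : IsCompact K := cφ.isCompact.union cθ.isCompact
  have KU : K ⊆ U := union_subset tφ tθ
  have neK : K.Nonempty := by
    refine Nonempty.inr ?_
    by_contra hne
    rw [not_nonempty_iff_eq_empty] at hne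
    have hz : θ = 0 := tsupport_eq_empty_iff.1 hne
    rw [hz] at iθ
    simp at iθ
  set A := sInf K
  set B := sSup K
  have AK : A ∈ K := cK.sInf_mem neK
  have BK : B ∈ K := cK.sSup_mem neK
  have ABU : Icc A B ⊆ U := oU.out (KU AK) (KU BK)
  have gz : ∀ y, y ∉ Icc A B → g y = 0 := by
    intro y hy
    have hyK : y ∉ K := fun hmem => hy ⟨csInf_le cK.bddBelow hmem, le_csSup cK.bddAbove hmem⟩
    rw [hK, mem_union, not_or] at hyK
    simp only [hg, image_eq_zero_of_notMem_tsupport hyK.1, image_eq_zero_of_notMem_tsupport hyK.2]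
    simp
  have ig : Integrable g := (sφ.continuous.integrable_of_hasCompactSupport cφ).sub
    ((sθ.continuous.integrable_of_hasCompactSupport cθ).const_mul m)
  have Ig : ∫ y, g y = 0 := by
    rw [hg, integral_sub (sφ.continuous.integrable_of_hasCompactSupport cφ)
      ((sθ.continuous.integrable_of_hasCompactSupport cθ).const_mul m), integral_const_mul, iθ]
    simp [hm]
  have AB : A ≤ B := csInf_le cK.bddBelow BK
  set G : ℝ → ℝ := fun y => ∫ t in A..y, g t with hG
  have dG : ∀ y, HasDerivAt G (g y) y := fun y =>
    intervalIntegral.integral_hasDerivAt_right (sg.continuous.intervalIntegrable _ _)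
      (sg.continuous.stronglyMeasurableAtFilter _ _) sg.continuous.continuousAt
  have dG' : deriv G = g := funext fun y => (dG y).deriv
  have sG : ContDiff ℝ (⊤ : ℕ∞) G := by
    rw [contDiff_infty_iff_deriv, dG']
    exact ⟨fun y => (dG y).differentiableAt, sg⟩
  have Gz : ∀ y, y ∉ Icc A B → G y = 0 := by
    intro y hy
    rw [mem_Icc, not_and_or, not_le, not_le] at hy
    rcases hy with hy | hy
    · rw [hG]
      refine intervalIntegral.integral_zero_ae ?_
      have : ∀ᵐ t : ℝ, t ≠ A := by simp [ae_iff, measure_singleton]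
      filter_upwards [this] with t ht hmem
      rw [uIoc_of_ge hy.le] at hmem
      exact gz t fun h => ht (le_antisymm hmem.2 h.1)
    · have h1 : ∫ t in A..y, g t = ∫ t, g t := by
        rw [intervalIntegral.integral_of_le (AB.trans hy.le), ← integral_Icc_eq_integral_Ioc]
        refine setIntegral_eq_integral_of_forall_compl_eq_zero fun t ht => gz t fun h => ht ?_
        exact ⟨h.1, h.2.trans hy.le⟩
      rw [hG]; exact h1.trans Ig
  have tG : tsupport G ⊆ Icc A B := by
    refine closure_minimal (fun y hy => ?_) isClosed_Icc
    by_contra hne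
    exact hy (Gz y hne)
  have cG : HasCompactSupport G := HasCompactSupport.intro isCompact_Icc Gz
  have h0 := h G sG cG (tG.trans ABU)
  rw [dG'] at h0
  have i1 := intg φ sφ.continuous cφ tφ
  have i2 := intg θ sθ.continuous cθ tθ
  have e1 : ∫ y, g y • Q y = (∫ y, φ y • Q y) - m • c := by
    rw [hc, ← integral_smul]
    refine Eq.trans ?_ (integral_sub i1 (i2.smul m))
    congr 1; ext y : 1
    change _ = φ y • Q y - m • θ y • Q y
    simp only [hg, sub_smul, mul_smul]
  have e2 : ∫ y, φ y • (Q y - c) = (∫ y, φ y • Q y) - m • c := by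
    rw [hm, ← integral_smul_const, ← integral_sub i1
      ((sφ.continuous.integrable_of_hasCompactSupport cφ).smul_const c)]
    congr 1; ext y
    rw [smul_sub]
  rw [e2, ← e1, h0]

/-- The part of the strip over a set of heights. -/
def slab (U : Set ℝ) : Set (ℝ × ℝ) := Ioo (0 : ℝ) 1 ×ˢ U

lemma slab_measure (U : Set ℝ) : (volume.restrict (slab U) : Measure (ℝ × ℝ)) =
    (volume.restrict (Ioo (0 : ℝ) 1)).prod (volume.restrict U) := by
  rw [slab, Measure.volume_eq_prod, ← Measure.prod_restrict]

lemma slab_subset_strip (U : Set ℝ) : slab U ⊆ strip := fun _ hp => ⟨hp.1, trivial⟩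

lemma slab_le (U : Set ℝ) : volume.restrict (slab U) ≤ μS :=
  Measure.restrict_mono (slab_subset_strip U) le_rfl

lemma slab_window (R : ℝ) : slab (Icc (-R) R) = strip ∩ {p | |p.2| ≤ R} := by
  ext p
  simp only [slab, strip, mem_prod, mem_inter_iff, mem_ofPred_eq, abs_le, mem_Icc, mem_univ,
    and_true]

lemma measurableSet_slab {U : Set ℝ} (hU : MeasurableSet U) : MeasurableSet (slab U) :=
  measurableSet_Ioo.prod hU

lemma norm_sesq_le (z z' : Field2) (p : ℝ × ℝ) : ‖sesq z z' p‖ ≤ 2 * (‖z p‖ * ‖z' p‖) := by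
  have h1 := norm_fst_le (z p)
  have h2 := norm_snd_le (z p)
  have h3 := norm_fst_le (z' p)
  have h4 := norm_snd_le (z' p)
  refine (norm_add_le _ _).trans ?_
  rw [norm_mul, norm_mul, RCLike.norm_conj, RCLike.norm_conj, two_mul]
  gcongr

lemma aesm_sesq {μ : Measure (ℝ × ℝ)} {z z' : Field2} (h : AEStronglyMeasurable z μ)
    (h' : AEStronglyMeasurable z' μ) : AEStronglyMeasurable (sesq z z') μ :=
  ((continuous_fst.comp_aestronglyMeasurable h).mul
    (Complex.continuous_conj.comp_aestronglyMeasurable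
      (continuous_fst.comp_aestronglyMeasurable h'))).add
  ((continuous_snd.comp_aestronglyMeasurable h).mul
    (Complex.continuous_conj.comp_aestronglyMeasurable
      (continuous_snd.comp_aestronglyMeasurable h')))

lemma integrable_sesq {μ : Measure (ℝ × ℝ)} {z z' : Field2} (h : MemLp z 2 μ)
    (h' : MemLp z' 2 μ) : Integrable (sesq z z') μ :=
  ((h.norm.integrable_mul h'.norm).const_mul 2).mono' (aesm_sesq h.1 h'.1)
    (.of_forall fun p => norm_sesq_le z z' p)

lemma LocL2.integrable_sesq {z z' : Field2} (h : LocL2 z) (h' : LocL2 z') {g : ℝ → ℝ}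
    (hg : Continuous g) (cg : HasCompactSupport g) :
    Integrable (fun p => (g p.2 : ℂ) * sesq z z' p) μS := by
  obtain ⟨R, hR⟩ := cg.isCompact.isBounded.subset_closedBall (0 : ℝ)
  have gz : ∀ y, R < |y| → g y = 0 := fun y hy => image_eq_zero_of_notMem_tsupport fun hm => by
    have := hR hm
    rw [mem_closedBall_zero_iff, norm_eq_abs] at this
    linarith
  obtain ⟨B, hB⟩ := hg.bounded_above_of_compact_support cg
  have h1 := (ZigzagRibbon.integrable_sesq (h R) (h' R)).bdd_mul
    (f := fun p : ℝ × ℝ => (g p.2 : ℂ)) (c := B)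
    (Continuous.aestronglyMeasurable (by fun_prop))
    (.of_forall fun p => by rw [norm_real]; exact hB _)
  exact integrable_of_window h1 fun p hp => by rw [gz _ hp, Complex.ofReal_zero, zero_mul]

lemma locallyIntegrable_qY {z z' : Field2} (h : LocL2 z) (h' : LocL2 z') :
    LocallyIntegrable (qY z z') := by
  rw [locallyIntegrable_iff]
  intro K hK
  obtain ⟨R, hR⟩ := hK.isBounded.subset_closedBall (0 : ℝ)
  have hsub : K ⊆ Icc (-R) R := by
    rw [Real.closedBall_eq_Icc, zero_sub, zero_add] at hR
    exact hR
  refine IntegrableOn.mono_set ?_ hsub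
  have h1 := ZigzagRibbon.integrable_sesq (h.mop R) (h' R)
  rw [← slab_window, slab_measure] at h1
  refine h1.integral_prod_right.congr (.of_forall fun y => ?_)
  rw [qY_eq]

lemma integral_sesq_eq {z z' : Field2} (h : LocL2 z) (h' : LocL2 z') {g : ℝ → ℝ}
    (hg : Continuous g) (cg : HasCompactSupport g) :
    ∫ p in strip, (g p.2 : ℂ) * sesq (Mop z) z' p = ∫ y, g y • qY z z' y := by
  have h1 := h.mop.integrable_sesq h' hg cg
  rw [strip_measure] at h1
  rw [strip_measure, integral_prod_symm _ h1]
  congr 1; ext y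
  rw [qY_eq, real_smul, ← integral_const_mul]

/-- If the right sides of two weak solutions agree in the sense of the Hermitian product over an
interval of heights, the form `q` does not depend on the height there. -/
lemma exists_qY_const {z f z' f' : Field2} (lz : LocL2 z) (lf : LocL2 f) (lz' : LocL2 z')
    (lf' : LocL2 f') (h : DiracEq z f) (h' : DiracEq z' f') {U : Set ℝ} (hU : IsOpen U)
    (oU : U.OrdConnected) (hs : ∀ᵐ p ∂μS, p.2 ∈ U → sesq f z' p = sesq z f' p) :
    ∃ c, ∀ᵐ y, y ∈ U → qY z z' y = c := by
  refine ae_const_of_weak_deriv_zero hU oU ((locallyIntegrable_qY lz lz').locallyIntegrableOn U)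
    fun ψ sψ cψ tψ => ?_
  have cdψ : Continuous (deriv ψ) := sψ.continuous_deriv (by norm_cast)
  have e := green lz lf lz' lf' h h' sψ cψ
  rw [integral_add (lf.integrable_sesq lz' sψ.continuous cψ)
    (lz.mop.integrable_sesq lz' cdψ cψ.deriv), integral_sesq_eq lz lz' cdψ cψ.deriv] at e
  have e2 : ∫ p in strip, (ψ p.2 : ℂ) * sesq f z' p = ∫ p in strip, (ψ p.2 : ℂ) * sesq z f' p := by
    refine integral_congr_ae ?_
    filter_upwards [hs] with p hp
    by_cases hy : p.2 ∈ tsupport ψ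
    · rw [hp (tψ hy)]
    · simp only [image_eq_zero_of_notMem_tsupport hy, Complex.ofReal_zero, zero_mul]
  rw [e2] at e
  linear_combination e

lemma slice_aesm {z : Field2} {U : Set ℝ} (h : AEStronglyMeasurable z (volume.restrict (slab U))) :
    ∀ᵐ y ∂volume.restrict U,
      AEStronglyMeasurable (fun x => z (x, y)) (volume.restrict (Ioo (0 : ℝ) 1)) := by
  rw [slab_measure] at h
  exact h.prod_swap.prodMk_left

/-- The energy of the cross-sections is integrable. -/
lemma lintegral_slice_lt_top {z : Field2} {U : Set ℝ} (h : MemLp z 2 (volume.restrict (slab U))) :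
    ∫⁻ y in U, ∫⁻ x in Ioo (0 : ℝ) 1, ‖z (x, y)‖ₑ ^ 2 < ⊤ := by
  have h0 := h
  rw [slab_measure] at h
  rw [← lintegral_prod_symm _ (h.1.enorm.pow_const 2), ← slab_measure, ← eLpNorm_two_sq]
  exact ENNReal.pow_lt_top h0.2

lemma eq_zero_of_lintegral {U : Set ℝ} (vU : volume U = ⊤) {C c : ENNReal} (hC : C ≠ ⊤)
    {E : ℝ → ENNReal} (hE : ∫⁻ y in U, E y < ⊤) (h : ∀ᵐ y ∂volume.restrict U, c ≤ C * E y) :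
    c = 0 := by
  have h1 : ∫⁻ _ in U, c ≤ C * ∫⁻ y in U, E y := by
    rw [← lintegral_const_mul' _ _ hC]
    exact lintegral_mono_ae h
  rw [lintegral_const, Measure.restrict_apply_univ, vU] at h1
  by_contra hne
  rw [ENNReal.mul_top hne, top_le_iff] at h1
  exact absurd h1 (ENNReal.mul_lt_top hC.lt_top hE).ne

/-- A constant flux of a field square integrable with a weight, against a field bounded by the
inverse weight, vanishes. -/
lemma qY_const_eq_zero {z z' : Field2} {U : Set ℝ} (mU : MeasurableSet U) (vU : volume U = ⊤)
    {s C : ℝ} (hz : MemLp (fun p => exp (s * p.2) • z p) 2 (volume.restrict (slab U)))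
    (hz' : ∀ p ∈ slab U, ‖z' p‖ ≤ C * exp (s * p.2)) {c : ℂ}
    (hc : ∀ᵐ y, y ∈ U → qY z z' y = c) : c = 0 := by
  have h1 := slice_aesm hz.1
  have h2 := lintegral_slice_lt_top hz
  have P : IsProbabilityMeasure (volume.restrict (Ioo (0 : ℝ) 1)) := ⟨by simp⟩
  have key : ‖c‖ₑ ^ 2 = 0 := by
    refine eq_zero_of_lintegral vU (C := ofReal (2 * C) ^ 2) (by finiteness) h2 ?_
    filter_upwards [h1, (ae_restrict_iff' mU).2 hc, ae_restrict_mem mU] with y hy hcy hyU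
    rw [← hcy, qY_eq, ← eLpNorm_two_sq, ← mul_pow]
    gcongr
    have e4 := eLpNorm_le_eLpNorm_of_exponent_le (p := 1) (q := 2) (by norm_num) hy
    refine le_trans ?_ (mul_le_mul_right e4 _)
    rw [eLpNorm_one_eq_lintegral_enorm, ← lintegral_const_mul' _ _ ofReal_ne_top]
    refine (enorm_integral_le_lintegral_enorm _).trans ?_
    refine setLIntegral_mono' measurableSet_Ioo fun x hx => ?_
    have hb := hz' (x, y) ⟨hx, hyU⟩
    have hC : 0 ≤ C := by
      by_contra hneg
      have h3 := mul_neg_of_neg_of_pos (not_le.1 hneg) (Real.exp_pos (s * y))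
      have := (norm_nonneg _).trans hb
      simp only at this
      linarith
    rw [← ofReal_norm, ← ofReal_norm, ← ENNReal.ofReal_mul (by positivity)]
    refine ENNReal.ofReal_le_ofReal ((norm_sesq_le _ _ _).trans ?_)
    rw [norm_Mop, norm_smul, norm_eq_abs, Real.abs_exp]
    calc 2 * (‖z (x, y)‖ * ‖z' (x, y)‖)
        ≤ 2 * (‖z (x, y)‖ * (C * exp (s * y))) := by gcongr
      _ = 2 * C * (exp (s * y) * ‖z (x, y)‖) := by ring
  simpa using key

/-- The constant flux of a square integrable field vanishes. -/
lemma qY_self_const_eq_zero {z : Field2} {U : Set ℝ} (mU : MeasurableSet U) (vU : volume U = ⊤)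
    (hz : MemLp z 2 (volume.restrict (slab U))) {c : ℂ}
    (hc : ∀ᵐ y, y ∈ U → qY z z y = c) : c = 0 := by
  have h2 := lintegral_slice_lt_top hz
  have key : ‖c‖ₑ = 0 := by
    refine eq_zero_of_lintegral vU (C := 2) (by finiteness) h2 ?_
    filter_upwards [(ae_restrict_iff' mU).2 hc] with y hcy
    rw [← hcy, qY_eq, ← lintegral_const_mul' _ _ (by finiteness)]
    refine (enorm_integral_le_lintegral_enorm _).trans ?_
    refine lintegral_mono fun x => ?_
    have := norm_sesq_le (Mop z) z (x, y)
    rw [norm_Mop, ← pow_two] at this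
    rw [← ofReal_norm, ← ofReal_norm, ← ENNReal.ofReal_pow (norm_nonneg _),
      show (2 : ENNReal) = ofReal 2 by simp, ← ENNReal.ofReal_mul (by norm_num)]
    exact ENNReal.ofReal_le_ofReal this
  simpa using key

/-! ### Scattering for an abstract system of waves -/

/-- Square integrability of a field on the cross-section at height `y`. -/
def SliceL2 (z : Field2) (y : ℝ) : Prop :=
  MemLp (fun x => z (x, y)) 2 (volume.restrict (Ioo (0 : ℝ) 1))

lemma LocL2.ae_slice {z : Field2} (h : LocL2 z) : ∀ᵐ y, SliceL2 z y := by
  have key : ∀ n : ℕ, ∀ᵐ y, y ∈ Icc (-(n : ℝ)) n → SliceL2 z y := by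
    intro n
    have h1 := h n
    rw [← slab_window] at h1
    have h2 := lintegral_slice_lt_top h1
    have h3 := slice_aesm h1.1
    rw [slab_measure] at h1
    have h4 := (h1.1.prod_swap.enorm.pow_const 2).lintegral_prod_right'
    rw [← ae_restrict_iff' measurableSet_Icc]
    filter_upwards [h3, ae_lt_top' h4 h2.ne] with y h5 h6
    refine ⟨h5, ?_⟩
    change ∫⁻ x in Ioo (0 : ℝ) 1, ‖z (x, y)‖ₑ ^ 2 < ⊤ at h6
    rw [← eLpNorm_two_sq] at h6
    by_contra hcon
    rw [not_lt, top_le_iff] at hcon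
    simp [hcon] at h6
  filter_upwards [ae_all_iff.2 key] with y hy
  obtain ⟨n, hn⟩ := exists_nat_ge |y|
  exact hy n (abs_le.1 hn)

lemma sliceL2_of_continuous {z : Field2} (h : Continuous z) (y : ℝ) : SliceL2 z y := by
  have h1 : Continuous fun x => z (x, y) := h.comp (by fun_prop)
  obtain ⟨C, hC⟩ := isCompact_Icc.exists_bound_of_continuousOn (s := Icc (0 : ℝ) 1) h1.continuousOn
  refine MemLp.of_bound h1.aestronglyMeasurable C ?_
  filter_upwards [ae_restrict_mem measurableSet_Ioo] with x hx using hC x (Ioo_subset_Icc_self hx)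

lemma SliceL2.integrable {z z' : Field2} {y : ℝ} (h : SliceL2 z y) (h' : SliceL2 z' y) :
    Integrable (fun x => sesq (Mop z) z' (x, y)) (volume.restrict (Ioo (0 : ℝ) 1)) := by
  have c : ∀ {g : ℝ → ℂ}, MemLp g 2 (volume.restrict (Ioo (0 : ℝ) 1)) →
      MemLp (fun x => conj (g x)) 2 (volume.restrict (Ioo (0 : ℝ) 1)) := fun hg =>
    hg.of_le (Complex.continuous_conj.comp_aestronglyMeasurable hg.1)
      (.of_forall fun x => by rw [RCLike.norm_conj])
  have h1 : MemLp (fun x => (z (x, y)).1) 2 (volume.restrict (Ioo (0 : ℝ) 1)) := h.fst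
  have h2 : MemLp (fun x => (z (x, y)).2) 2 (volume.restrict (Ioo (0 : ℝ) 1)) := h.snd
  have h3 : MemLp (fun x => (z' (x, y)).1) 2 (volume.restrict (Ioo (0 : ℝ) 1)) := h'.fst
  have h4 : MemLp (fun x => (z' (x, y)).2) 2 (volume.restrict (Ioo (0 : ℝ) 1)) := h'.snd
  exact (h2.integrable_mul (c h3)).add (h1.neg.integrable_mul (c h4))

lemma qY_conj (z z' : Field2) (y : ℝ) : qY z' z y = -conj (qY z z' y) := by
  rw [qY_eq, qY_eq, ← integral_conj, ← integral_neg]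
  congr 1; ext x
  simp only [sesq, Mop, map_add, map_mul, conj_conj, map_neg]
  ring

lemma qY_add_left {z z' g : Field2} {y : ℝ} (h : SliceL2 z y) (h' : SliceL2 z' y)
    (hg : SliceL2 g y) : qY (fun p => z p + z' p) g y = qY z g y + qY z' g y := by
  rw [qY_eq, qY_eq, qY_eq, ← integral_add (h.integrable hg) (h'.integrable hg)]
  congr 1; ext x
  simp only [sesq, Mop, Prod.fst_add, Prod.snd_add]
  ring

lemma qY_sum_left {ι : Type*} [Fintype ι] {w : ι → Field2} {g : Field2} {y : ℝ}
    (h : ∀ c, SliceL2 (w c) y) (hg : SliceL2 g y) (a : ι → ℂ) :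
    qY (fun p => ∑ c, a c • w c p) g y = ∑ c, a c * qY (w c) g y := by
  simp only [qY_eq]
  simp only [← integral_const_mul]
  rw [← integral_finsetSum _ fun c _ => ((h c).integrable hg).const_mul (a c)]
  congr 1; ext x
  simp only [sesq, Mop, Prod.fst_sum, Prod.snd_sum, Prod.smul_fst, Prod.smul_snd, smul_eq_mul,
    Finset.sum_mul, ← Finset.sum_neg_distrib, ← Finset.sum_add_distrib]
  refine Finset.sum_congr rfl fun c _ => ?_
  ring

lemma slice_comb {ι : Type*} [Fintype ι] {w : ι → Field2} {y : ℝ} (h : ∀ c, SliceL2 (w c) y)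
    (a : ι → ℂ) : SliceL2 (fun p => ∑ c, a c • w c p) y :=
  memLp_finsetSum _ fun c _ => (h c).const_smul (a c)

/-- A finite system of waves: bounded growth below the weight `γ`, and fluxes normalized to
`± i`, the sign being given by `τ`. -/
structure WaveSystem {ι : Type} [Fintype ι] [DecidableEq ι] (ω γ : ℝ) (τ : ι → Bool)
    (w : ι → Field2) : Prop where
  cont : ∀ c, Continuous (w c)
  dirac : ∀ c, DiracEq (w c) (fun p => (ω : ℂ) • w c p)
  bound : ∃ C γ' : ℝ, 0 ≤ C ∧ 0 ≤ γ' ∧ γ' < γ ∧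
    ∀ c, ∀ p ∈ strip, ‖w c p‖ ≤ C * exp (γ' * |p.2|)
  flux : ∀ c c' y, qY (w c) (w c') y =
    if c = c' then (if τ c then I else -I) else 0

/-- The symbol bounds used for the scattering problem: without functionals on the lines with
weights `± γ`, and uniformly in `|s| ≤ γ` with functionals that are combinations of the fluxes
against the waves. -/
structure SymbolBounds {ι : Type} [Fintype ι] (ω γ K : ℝ) (w : ι → Field2) : Prop where
  plus : LineBound (ι := Empty) ω γ K isEmptyElim isEmptyElim
  minus : LineBound (ι := Empty) ω (-γ) K isEmptyElim isEmptyElim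
  all : ∃ (K' : ℝ) (α β : ι → ℝ → ℂ), (∀ s, |s| ≤ γ → LineBound ω s K' α β) ∧
    ∀ i y, ∃ t : ι → ℂ, ∀ x, α i x = ∑ c, t c * -conj (w c (x, y)).2 ∧
      β i x = ∑ c, t c * conj (w c (x, y)).1

section

variable {ι : Type} [Fintype ι] {ω γ : ℝ} {τ : ι → Bool} {w : ι → Field2}

/-- The linear combination of waves with coefficients `a`. -/
def comb (w : ι → Field2) (a : ι → ℂ) : Field2 := fun p => ∑ c, a c • w c p

lemma locL2_of_continuous {z : Field2} (h : Continuous z) : LocL2 z := by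
  intro R
  have hc : IsCompact (Icc (0 : ℝ) 1 ×ˢ Icc (-R) R) := isCompact_Icc.prod isCompact_Icc
  obtain ⟨C, hC⟩ := hc.exists_bound_of_continuousOn h.continuousOn
  have : IsFiniteMeasure (volume.restrict (strip ∩ {p : ℝ × ℝ | |p.2| ≤ R})) := by
    refine ⟨?_⟩
    rw [Measure.restrict_apply_univ]
    refine (measure_mono fun p hp => ?_).trans_lt hc.measure_lt_top
    exact ⟨⟨hp.1.1.1.le, hp.1.1.2.le⟩, abs_le.1 hp.2⟩
  refine MemLp.of_bound h.aestronglyMeasurable C ?_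
  filter_upwards [ae_restrict_mem (measurableSet_strip.inter (measurableSet_window R))] with p hp
  exact hC p ⟨⟨hp.1.1.1.le, hp.1.1.2.le⟩, abs_le.1 hp.2⟩

/-- At an end of the ribbon the field `z` is the combination of the waves with coefficients `a`,
up to a remainder decaying with the weight. -/
def Asym (w : ι → Field2) (s : ℝ) (U : Set ℝ) (z : Field2) (a : ι → ℂ) : Prop :=
  MemLp (fun p => exp (s * p.2) • (z p - comb w a p)) 2 (volume.restrict (slab U))

lemma Asym.add {s : ℝ} {U : Set ℝ} {z z' : Field2} {a a' : ι → ℂ} (h : Asym w s U z a)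
    (h' : Asym w s U z' a') : Asym w s U (fun p => z p + z' p) (a + a') := by
  refine (MemLp.add h h').ae_eq (.of_forall fun p => ?_)
  simp only [Pi.add_apply, ← smul_add, comb, add_smul, Finset.sum_add_distrib]
  congr 1; abel

lemma Asym.smul {s : ℝ} {U : Set ℝ} {z : Field2} {a : ι → ℂ} (h : Asym w s U z a) (k : ℂ) :
    Asym w s U (fun p => k • z p) (k • a) := by
  refine (MemLp.const_smul h k).ae_eq (.of_forall fun p => ?_)
  simp only [Pi.smul_apply, comb, smul_comm k, smul_sub, Finset.smul_sum, smul_eq_mul,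
    mul_smul]

lemma Asym.sum {κ : Type*} [Fintype κ] {s : ℝ} {U : Set ℝ} {z : κ → Field2} {a : κ → ι → ℂ}
    (h : ∀ k, Asym w s U (z k) (a k)) : Asym w s U (fun p => ∑ k, z k p) (∑ k, a k) := by
  refine (memLp_finsetSum Finset.univ fun k _ => h k).ae_eq (.of_forall fun p => ?_)
  simp only [comb, ← Finset.smul_sum, Finset.sum_sub_distrib, Finset.sum_apply, Finset.sum_smul]
  congr 2
  exact Finset.sum_comm

/-- The sign of the flux of a wave. -/
def fluxSign {ι : Type} (τ : ι → Bool) (c : ι) : ℂ := if τ c then I else -I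

lemma fluxSign_ne_zero {ι : Type} (τ : ι → Bool) (c : ι) : fluxSign τ c ≠ 0 := by
  unfold fluxSign
  split_ifs <;> simp

variable [DecidableEq ι]

lemma WaveSystem.loc (H : WaveSystem ω γ τ w) (c : ι) : LocL2 (w c) :=
  locL2_of_continuous (H.cont c)

lemma WaveSystem.slice (H : WaveSystem ω γ τ w) (c : ι) (y : ℝ) : SliceL2 (w c) y :=
  sliceL2_of_continuous (H.cont c) y

lemma WaveSystem.loc_comb (H : WaveSystem ω γ τ w) (a : ι → ℂ) : LocL2 (comb w a) :=
  LocL2.sum fun c _ => (H.loc c).const_smul (a c)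

lemma WaveSystem.dirac_comb (H : WaveSystem ω γ τ w) (a : ι → ℂ) :
    DiracEq (comb w a) (fun p => (ω : ℂ) • comb w a p) := by
  have := DiracEq.sum (s := Finset.univ) (fun c _ => (H.dirac c).const_smul (a c))
    (fun c _ => (H.loc c).const_smul (a c)) (fun c _ => ((H.loc c).const_smul _).const_smul (a c))
  refine this.congr (.of_forall fun p => rfl) (.of_forall fun p => ?_)
  simp only [comb, Finset.smul_sum, smul_comm (ω : ℂ)]

lemma WaveSystem.qY_comb (H : WaveSystem ω γ τ w) (a : ι → ℂ) (c : ι) (y : ℝ) :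
    qY (comb w a) (w c) y = a c * fluxSign τ c := by
  have := qY_sum_left (fun c => H.slice c y) (H.slice c y) a
  refine this.trans ?_
  simp only [H.flux, mul_ite, mul_zero, Finset.sum_ite_eq', Finset.mem_univ, if_true]
  rw [fluxSign]
  split_ifs <;> rfl

lemma qY_comb_right (H : WaveSystem ω γ τ w) {z : Field2} (a : ι → ℂ) {y : ℝ}
    (hz : SliceL2 z y) :
    qY z (comb w a) y = ∑ c, conj (a c) * qY z (w c) y := by
  rw [qY_conj (comb w a) z]
  have := qY_sum_left (fun c => H.slice c y) hz a
  change qY (comb w a) z y = _ at this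
  rw [this, map_sum, ← Finset.sum_neg_distrib]
  refine Finset.sum_congr rfl fun c _ => ?_
  rw [qY_conj (w c) z, map_mul]
  ring

/-- `IsEnd γ R s U`: the half-line `U` together with the weight `e^{sy}`, `s = ±γ`, growing along
it, for one of the two ends of the ribbon. -/
inductive IsEnd (γ R : ℝ) : ℝ → Set ℝ → Prop
  | right : IsEnd γ R γ (Ioi R)
  | left : IsEnd γ R (-γ) (Iio (-R))

lemma WaveSystem.pos (H : WaveSystem ω γ τ w) : 0 < γ :=
  H.bound.elim fun _ h => h.elim fun _ h => h.2.1.trans_lt h.2.2.1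

lemma IsEnd.isOpen {R s : ℝ} {U : Set ℝ} (h : IsEnd γ R s U) : IsOpen U := by
  cases h
  · exact isOpen_Ioi
  · exact isOpen_Iio

lemma IsEnd.ordConnected {R s : ℝ} {U : Set ℝ} (h : IsEnd γ R s U) : U.OrdConnected := by
  cases h
  · exact ordConnected_Ioi
  · exact ordConnected_Iio

lemma IsEnd.volume_eq {R s : ℝ} {U : Set ℝ} (h : IsEnd γ R s U) : volume U = ⊤ := by
  cases h
  · exact Real.volume_Ioi
  · exact Real.volume_Iio

lemma IsEnd.mul_eq {R s : ℝ} {U : Set ℝ} (h : IsEnd γ R s U) (hR : 0 < R) {y : ℝ} (hy : y ∈ U) :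
    s * y = γ * |y| := by
  cases h
  · rw [abs_of_pos (hR.trans hy)]
  · rw [abs_of_neg (lt_trans (show y < -R from hy) (by linarith))]; ring

lemma IsEnd.abs_gt {R s : ℝ} {U : Set ℝ} (h : IsEnd γ R s U) (hR : 0 < R) {y : ℝ} (hy : y ∈ U) :
    R < |y| := by
  cases h
  · rw [abs_of_pos (hR.trans hy)]; exact hy
  · have : y < -R := hy
    rw [abs_of_neg (lt_trans this (by linarith))]; linarith

lemma WaveSystem.bound_end (H : WaveSystem ω γ τ w) {R s : ℝ} {U : Set ℝ} (h : IsEnd γ R s U)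
    (hR : 0 < R) : ∃ C, ∀ c, ∀ p ∈ slab U, ‖w c p‖ ≤ C * exp (s * p.2) := by
  obtain ⟨C, γ', C0, -, hγ', hb⟩ := H.bound
  refine ⟨C, fun c p hp => (hb c p (slab_subset_strip U hp)).trans ?_⟩
  rw [h.mul_eq hR hp.2]
  gcongr

lemma memLp_exp_decay {k : ℝ} (hk : 0 < k) :
    MemLp (fun p : ℝ × ℝ => exp (-k * |p.2|)) 2 μS := by
  have h0 : AEStronglyMeasurable (fun p : ℝ × ℝ => exp (-k * |p.2|)) μS :=
    Continuous.aestronglyMeasurable (by fun_prop)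
  rw [memLp_two_iff_integrable_sq h0, strip_measure]
  have h1 : Integrable (fun y : ℝ => exp (-(2 * k) * |y|)) := by
    rw [← integrableOn_univ, ← Iic_union_Ioi (a := (0 : ℝ)), integrableOn_union]
    constructor
    · refine (integrableOn_exp_mul_Iic (show 0 < 2 * k by positivity) 0).congr_fun ?_
        measurableSet_Iic
      intro y hy
      simp only [abs_of_nonpos (mem_Iic.1 hy)]; ring_nf
    · refine (exp_neg_integrableOn_Ioi 0 (show 0 < 2 * k by positivity)).congr_fun ?_
        measurableSet_Ioi
      intro y hy
      simp only [abs_of_pos (mem_Ioi.1 hy)]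
  have h2 := (integrable_const (1 : ℝ) (μ := volume.restrict (Ioo (0 : ℝ) 1))).mul_prod h1
  refine h2.congr (.of_forall fun p => ?_)
  simp only [one_mul]
  rw [pow_two, ← Real.exp_add]
  ring_nf

/-- Combinations of waves lie in the growing weighted spaces. -/
lemma WaveSystem.memL_comb (H : WaveSystem ω γ τ w) (a : ι → ℂ) : MemL (-γ) (comb w a) := by
  obtain ⟨C, γ', C0, -, hγ', hb⟩ := H.bound
  have h1 : ∀ c, MemL (-γ) (w c) := fun c => by
    refine (memLp_exp_decay (sub_pos.2 hγ')).of_le_mul (c := C)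
      ((H.loc c).smulY (ψ := fun y => exp (-γ * |y|)) (by fun_prop)).aesm ?_
    filter_upwards [ae_restrict_mem measurableSet_strip] with p hp
    rw [norm_smul, norm_eq_abs, norm_eq_abs, Real.abs_exp, Real.abs_exp]
    calc _ ≤ exp (-γ * |p.2|) * (C * exp (γ' * |p.2|)) := by gcongr; exact hb c p hp
      _ = C * (exp (-γ * |p.2|) * exp (γ' * |p.2|)) := by ring
      _ = _ := by rw [← Real.exp_add]; ring_nf
  refine (memLp_finsetSum Finset.univ fun c _ => (h1 c).const_smul (a c)).ae_eq
    (.of_forall fun p => ?_)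
  simp only [comb, Finset.smul_sum, Pi.smul_apply, smul_comm (a _)]

end

lemma qY_sub_left {z z' g : Field2} {y : ℝ} (h : SliceL2 z y) (h' : SliceL2 z' y)
    (hg : SliceL2 g y) : qY (fun p => z p - z' p) g y = qY z g y - qY z' g y := by
  rw [qY_eq, qY_eq, qY_eq, ← integral_sub (h.integrable hg) (h'.integrable hg)]
  congr 1; ext x
  simp only [sesq, Mop, Prod.fst_sub, Prod.snd_sub]
  ring

/-- Bounded real potentials vanishing for `|y| > R`. -/
structure IsPot (R d : ℝ) (V : ℝ × ℝ → ℝ) : Prop where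
  aesm : AEStronglyMeasurable V μS
  pos : 0 < R
  support : ∀ p ∈ strip, R < |p.2| → V p = 0
  bound : ∀ᵐ p ∂μS, |V p| ≤ d

/-- Solutions of the perturbed equation without any restriction on growth. -/
structure IsKer (ω : ℝ) (V : ℝ × ℝ → ℝ) (z : Field2) : Prop where
  loc : LocL2 z
  dirac : DiracEq z (fun p => ((ω - V p : ℝ) : ℂ) • z p)

lemma IsPot.loc {R d ω : ℝ} {V : ℝ × ℝ → ℝ} (hV : IsPot R d V) {z : Field2} (hz : LocL2 z) :
    LocL2 (fun p => ((ω - V p : ℝ) : ℂ) • z p) := by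
  intro R'
  have h1 : AEStronglyMeasurable (fun p => ((ω - V p : ℝ) : ℂ)) μS :=
    Complex.continuous_ofReal.comp_aestronglyMeasurable (aestronglyMeasurable_const.sub hV.aesm)
  refine (hz R').of_le_mul (c := |ω| + d) ((h1.mono_measure (window_le R')).smul (hz R').1) ?_
  filter_upwards [ae_mono (window_le R') hV.bound] with p hp
  rw [norm_smul, norm_real, norm_eq_abs]
  gcongr
  exact (abs_sub _ _).trans (by gcongr)

section

variable {ι : Type} [Fintype ι] {ω γ R d : ℝ} {τ : ι → Bool} {w : ι → Field2} {V : ℝ × ℝ → ℝ}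

lemma IsKer.add {z z' : Field2} (hV : IsPot R d V) (h : IsKer ω V z) (h' : IsKer ω V z') :
    IsKer ω V (fun p => z p + z' p) where
  loc := h.loc.add h'.loc
  dirac := by
    simpa only [smul_add] using h.dirac.add h'.dirac h.loc (hV.loc h.loc) h'.loc (hV.loc h'.loc)

lemma IsKer.smul {z : Field2} (h : IsKer ω V z) (k : ℂ) : IsKer ω V (fun p => k • z p) where
  loc := h.loc.const_smul k
  dirac := by
    have := h.dirac.const_smul k
    simpa only [smul_comm k] using this

lemma IsKer.sum {κ : Type*} [Fintype κ] {z : κ → Field2} (hV : IsPot R d V)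
    (h : ∀ k, IsKer ω V (z k)) : IsKer ω V (fun p => ∑ k, z k p) where
  loc := LocL2.sum fun k _ => (h k).loc
  dirac := by
    have := DiracEq.sum (s := Finset.univ) (fun k _ => (h k).dirac) (fun k _ => (h k).loc)
      (fun k _ => hV.loc (h k).loc)
    simpa only [Finset.smul_sum] using this

lemma IsEnd.abs_le {s : ℝ} {U : Set ℝ} (h : IsEnd γ R s U) (hγ : 0 < γ) : |s| ≤ γ := by
  cases h
  · rw [abs_of_pos hγ]
  · rw [abs_neg, abs_of_pos hγ]

/-- A smooth cutoff to an end of the ribbon. -/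
lemma IsEnd.exists_cutoff {s : ℝ} {U : Set ℝ} (h : IsEnd γ R s U) (hR : 0 < R) :
    ∃ ψ : ℝ → ℝ, ContDiff ℝ (⊤ : ℕ∞) ψ ∧ (∀ y, y ∉ U → ψ y = 0) ∧ (∀ y, |ψ y| ≤ 1) ∧
      (∀ y ∈ U, R + 1 < |y| → ψ y = 1) ∧ ∀ y, R + 1 < |y| → deriv ψ y = 0 := by
  obtain ⟨ψ, s0, z0, b0, o0⟩ : ∃ ψ : ℝ → ℝ, ContDiff ℝ (⊤ : ℕ∞) ψ ∧ (∀ y, y ≤ R → ψ y = 0) ∧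
      (∀ y, |ψ y| ≤ 1) ∧ ∀ y, R + 1 ≤ y → ψ y = 1 := by
    refine ⟨fun y => Real.smoothTransition (y - R), Real.smoothTransition.contDiff.comp
      (contDiff_id.sub contDiff_const), fun y hy => Real.smoothTransition.zero_of_nonpos
      (by linarith), fun y => ?_, fun y hy => Real.smoothTransition.one_of_one_le (by linarith)⟩
    rw [abs_of_nonneg (Real.smoothTransition.nonneg _)]
    exact Real.smoothTransition.le_one _
  have d0 : ∀ y, R + 1 < |y| → deriv ψ y = 0 := fun y hy => by
    rcases lt_abs.1 hy with hy | hy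
    · exact deriv_eq_zero_of_eq_const isOpen_Ioi (fun t ht => o0 t (le_of_lt ht)) hy
    · exact deriv_eq_zero_of_eq_const isOpen_Iio (fun t ht => z0 t (le_of_lt ht))
        (show y < R by linarith)
  cases h
  · refine ⟨ψ, s0, fun y hy => z0 y (not_lt.1 hy), b0, fun y hy h => o0 y ?_, d0⟩
    rw [abs_of_pos (hR.trans hy)] at h
    exact h.le
  · refine ⟨fun y => ψ (-y), s0.comp contDiff_neg, fun y hy => z0 _ ?_, fun y => b0 _,
      fun y hy h => o0 _ ?_, fun y hy => ?_⟩
    · have : -R ≤ y := not_lt.1 hy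
      linarith
    · have hy' : y < -R := hy
      rw [abs_of_neg (by linarith)] at h
      exact h.le
    · rw [deriv_comp_neg, d0 _ (by rwa [abs_neg]), neg_zero]

lemma residual_rhs (hV : IsPot R d V) {s : ℝ} {U : Set ℝ} (e : IsEnd γ R s U)
    (z : Field2) (a : ι → ℂ) {p : ℝ × ℝ} (hp : p ∈ strip) (hU : p.2 ∈ U) :
    ((ω - V p : ℝ) : ℂ) • z p - (ω : ℂ) • comb w a p = (ω : ℂ) • (z p - comb w a p) := by
  rw [hV.support p hp (e.abs_gt hV.pos hU), sub_zero, smul_sub]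

variable [DecidableEq ι]

/-- The difference of a solution and a combination of waves, with its right side. -/
lemma residual_dirac (H : WaveSystem ω γ τ w) (hV : IsPot R d V) {z : Field2} (hz : IsKer ω V z)
    (a : ι → ℂ) : LocL2 (fun p => z p - comb w a p) ∧
      LocL2 (fun p => ((ω - V p : ℝ) : ℂ) • z p - (ω : ℂ) • comb w a p) ∧
      DiracEq (fun p => z p - comb w a p)
        (fun p => ((ω - V p : ℝ) : ℂ) • z p - (ω : ℂ) • comb w a p) :=
  ⟨hz.loc.sub (H.loc_comb a), (hV.loc hz.loc).sub ((H.loc_comb a).const_smul _),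
    hz.dirac.sub (H.dirac_comb a) hz.loc (hV.loc hz.loc) (H.loc_comb a)
      ((H.loc_comb a).const_smul _)⟩

/-- The fluxes of the difference against a solution of the unperturbed equation near an end do not
depend on the height there. -/
lemma residual_flux_const (H : WaveSystem ω γ τ w) (hV : IsPot R d V) {z : Field2}
    (hz : IsKer ω V z) (a : ι → ℂ) {s : ℝ} {U : Set ℝ} (e : IsEnd γ R s U) {g f : Field2}
    (lg : LocL2 g) (lf : LocL2 f) (hg : DiracEq g f)
    (hf : ∀ p ∈ strip, p.2 ∈ U → f p = (ω : ℂ) • g p) :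
    ∃ k, ∀ᵐ y, y ∈ U → qY (fun p => z p - comb w a p) g y = k := by
  obtain ⟨l1, l2, hD⟩ := residual_dirac H hV hz a
  refine exists_qY_const l1 l2 lg lf hD hg e.isOpen e.ordConnected ?_
  filter_upwards [ae_restrict_mem measurableSet_strip] with p hp hU
  simp only [sesq, residual_rhs hV e z a hp hU, hf p hp hU, Prod.smul_fst, Prod.smul_snd,
    smul_eq_mul, map_mul, conj_ofReal]
  ring

lemma residual_flux_wave_const (H : WaveSystem ω γ τ w) (hV : IsPot R d V) {z : Field2}
    (hz : IsKer ω V z) (a : ι → ℂ) {s : ℝ} {U : Set ℝ} (e : IsEnd γ R s U) (c : ι) :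
    ∃ k, ∀ᵐ y, y ∈ U → qY (fun p => z p - comb w a p) (w c) y = k :=
  residual_flux_const H hV hz a e (H.loc c) ((H.loc c).const_smul _) (H.dirac c) fun _ _ _ => rfl

/-- A solution of moderate growth is asymptotic to a combination of waves at each end. -/
lemma exists_asym {K : ℝ} (H : WaveSystem ω γ τ w) (B : SymbolBounds ω γ K w)
    (hV : IsPot R d V) {z : Field2} (hz : IsKer ω V z) (gz : MemL (-γ) z) {s : ℝ}
    {U : Set ℝ} (e : IsEnd γ R s U) : ∃ a, Asym w s U z a := by
  -- the coefficients are the normalized fluxes against the waves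
  have hk : ∀ c, ∃ k, ∀ᵐ y, y ∈ U → qY z (w c) y = k := by
    simpa [comb] using residual_flux_wave_const H hV hz 0 e
  choose k hk using hk
  set a : ι → ℂ := fun c => k c / fluxSign τ c with ha
  refine ⟨a, ?_⟩
  set r : Field2 := fun p => z p - comb w a p with hr
  obtain ⟨lr, lf, hD⟩ := residual_dirac H hV hz a
  obtain ⟨ψ, sψ, ψ0, ψ1, ψone, dψ⟩ := e.exists_cutoff hV.pos
  have cdψ : Continuous (deriv ψ) := sψ.continuous_deriv (by norm_cast)
  set f : Field2 := fun p => ((ω - V p : ℝ) : ℂ) • z p - (ω : ℂ) • comb w a p with hf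
  have hζ := hD.cutoff lr lf sψ
  have lfζ : LocL2 (fun p => ψ p.2 • f p + deriv ψ p.2 • Mop r p) :=
    (lf.smulY sψ.continuous).add (lr.mop.smulY cdψ)
  have orth : ∀ᵐ y, y ∈ U → ∀ c, qY r (w c) y = 0 := by
    filter_upwards [ae_all_iff.2 hk, hz.loc.ae_slice] with y hy hs hyU c
    have sK : SliceL2 (comb w a) y := slice_comb (fun c => H.slice c y) a
    refine (qY_sub_left hs sK (H.slice c y)).trans ?_
    rw [hy c hyU, H.qY_comb a c y, ha, div_mul_cancel₀ _ (fluxSign_ne_zero τ c), sub_self]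
  obtain ⟨K', α, β, hL, hc⟩ := B.all
  have pz : ∀ i, ∀ᵐ y, pairY (α i) (β i) (fun p => ψ p.2 • r p) y = 0 := by
    intro i
    filter_upwards [orth, lr.ae_slice] with y hy hs
    rw [pairY_smulY]
    by_cases hyU : y ∈ U
    · obtain ⟨t, ht⟩ := hc i y
      have : pairY (α i) (β i) r y = ∑ c, t c * qY r (w c) y := by
        rw [pairY_eq]
        simp only [qY_eq, ← integral_const_mul]
        rw [← integral_finsetSum _ fun c _ => (hs.integrable (H.slice c y)).const_mul (t c)]
        congr 1; ext x
        rw [(ht x).1, (ht x).2, Finset.mul_sum, Finset.mul_sum, ← Finset.sum_add_distrib]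
        refine Finset.sum_congr rfl fun c _ => ?_
        simp only [sesq, Mop]
        ring
      rw [this]
      simp [hy hyU]
    · rw [ψ0 y hyU, Complex.ofReal_zero, zero_mul]
  have gr : MemL (-γ) r := by
    refine (MemLp.sub gz (H.memL_comb a)).ae_eq (.of_forall fun p => ?_)
    simp only [Pi.sub_apply, ← smul_sub, hr]
  have wz : MemX (-s) (fun p => ψ p.2 • r p) := by
    refine gr.of_le ((lr.smulY sψ.continuous).smulY (ψ := fun y => exp (-s * y))
      (by fun_prop)).aesm (.of_forall fun p => ?_)
    rw [norm_smul, norm_smul, norm_smul, norm_eq_abs, norm_eq_abs, norm_eq_abs,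
      Real.abs_exp, Real.abs_exp]
    by_cases hU : p.2 ∈ U
    · have := e.mul_eq hV.pos hU
      rw [neg_mul, this, neg_mul]
      refine mul_le_mul_of_nonneg_left ?_ (Real.exp_pos _).le
      exact mul_le_of_le_one_left (norm_nonneg _) (ψ1 _)
    · rw [ψ0 _ hU]; simp only [abs_zero, zero_mul, mul_zero]; positivity
  have gG : ∀ t, |t| ≤ γ → MemX t (fun p => (ψ p.2 • f p + deriv ψ p.2 • Mop r p) -
      (ω : ℂ) • (ψ p.2 • r p)) := by
    intro t _
    have h1 : MemX t (fun p => deriv ψ p.2 • Mop r p) :=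
      memX_zero_of_window ((lr.mop.smulY cdψ).smulY (ψ := fun y => exp (t * y)) (by fun_prop))
        (R := R + 1) fun p hp => by simp only [dψ _ hp, zero_smul, smul_zero]
    refine h1.ae_eq ?_
    filter_upwards [ae_restrict_mem measurableSet_strip] with p hp
    by_cases hU : p.2 ∈ U
    · have : f p = (ω : ℂ) • r p := residual_rhs hV e z a hp hU
      rw [this, smul_comm (ω : ℂ)]
      congr 1; abel
    · rw [ψ0 _ hU]; simp
  have main : MemX s (fun p => ψ p.2 • r p) :=
    memX_of_memX hL lfζ hζ pz (by rw [abs_neg]; exact e.abs_le H.pos) wz gG (e.abs_le H.pos)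
  set C : Field2 := {p : ℝ × ℝ | |p.2| ≤ R + 1}.indicator (fun p => (1 - ψ p.2) •
    (exp (s * p.2) • r p)) with hC
  have mC : MemLp C 2 μS := by
    rw [hC, memLp_indicator_iff_restrict (measurableSet_window _),
      Measure.restrict_restrict (measurableSet_window _), inter_comm]
    exact (lr.smulY (ψ := fun y => exp (s * y)) (by fun_prop)).smulY
      (ψ := fun y => 1 - ψ y) (continuous_const.sub sψ.continuous) (R + 1)
  refine ((main.add mC).mono_measure (slab_le U)).ae_eq ?_
  filter_upwards [ae_restrict_mem (measurableSet_slab e.isOpen.measurableSet)] with p hp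
  simp only [Pi.add_apply]
  by_cases hw : |p.2| ≤ R + 1
  · rw [hC, indicator_of_mem (by exact hw), smul_comm (exp _), ← add_smul]
    simp [hr]
  · rw [hC, indicator_of_notMem (by exact hw), ψone _ hp.2 (not_le.1 hw)]
    simp [hr]

/-- Near an end, a field square integrable with the growing weight is square integrable. -/
lemma IsEnd.memLp {s : ℝ} {U : Set ℝ} (e : IsEnd γ R s U) (hR : 0 < R) (hγ : 0 < γ) {g : Field2}
    (lg : LocL2 g) (h : MemLp (fun p => exp (s * p.2) • g p) 2 (volume.restrict (slab U))) :
    MemLp g 2 (volume.restrict (slab U)) := by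
  refine h.of_le (lg.aesm.mono_measure (slab_le U)) ?_
  filter_upwards [ae_restrict_mem (measurableSet_slab e.isOpen.measurableSet)] with p hp
  rw [norm_smul, norm_eq_abs, Real.abs_exp, e.mul_eq hR hp.2]
  exact le_mul_of_one_le_left (norm_nonneg _) (Real.one_le_exp (by positivity))

/-- The flux of a solution in terms of its asymptotic coefficients. -/
lemma flux_of_asym (H : WaveSystem ω γ τ w) (hV : IsPot R d V)
    {z : Field2} (hz : IsKer ω V z) {s : ℝ} {U : Set ℝ} (e : IsEnd γ R s U) {a : ι → ℂ}
    (ha : Asym w s U z a) :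
    ∀ᵐ y, y ∈ U → qY z z y = ∑ c, fluxSign τ c * (‖a c‖ ^ 2 : ℝ) := by
  set r : Field2 := fun p => z p - comb w a p with hr
  obtain ⟨lr, lf, hD⟩ := residual_dirac H hV hz a
  have mU := e.isOpen.measurableSet
  obtain ⟨C, hb⟩ := H.bound_end e hV.pos
  have z1 : ∀ c, ∀ᵐ y, y ∈ U → qY r (w c) y = 0 := by
    intro c
    obtain ⟨k, hk⟩ := residual_flux_wave_const H hV hz a e c
    rwa [qY_const_eq_zero mU e.volume_eq ha (hb c) hk] at hk
  have z2 : ∀ᵐ y, y ∈ U → qY r r y = 0 := by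
    obtain ⟨k, hk⟩ := residual_flux_const H hV hz a e lr lf hD fun p => residual_rhs hV e z a
    rwa [qY_self_const_eq_zero mU e.volume_eq (e.memLp hV.pos H.pos lr ha) hk] at hk
  filter_upwards [ae_all_iff.2 z1, z2, hz.loc.ae_slice, lr.ae_slice] with y h1 h2 sz sr hyU
  have sK : SliceL2 (comb w a) y := slice_comb (fun c => H.slice c y) a
  have ez : z = fun p => r p + comb w a p := by ext p : 1; simp [hr]
  have q1 : qY (comb w a) r y = 0 := by
    rw [qY_conj r, qY_comb_right H a sr, Finset.sum_eq_zero, map_zero, neg_zero]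
    intro c _
    exact mul_eq_zero_of_right _ (h1 c hyU)
  have q2 : qY z r y = 0 := by
    have := qY_add_left sr sK sr
    rw [← ez] at this
    rw [this, h2 hyU, q1, add_zero]
  have q3 : qY r z y = 0 := by rw [qY_conj z, q2]; simp
  have q4 : ∀ c, qY z (w c) y = a c * fluxSign τ c := by
    intro c
    have := qY_add_left sr sK (H.slice c y)
    rw [← ez] at this
    rw [this, h1 c hyU, H.qY_comb, zero_add]
  have q5 : qY (comb w a) z y = ∑ c, fluxSign τ c * (‖a c‖ ^ 2 : ℝ) := by
    rw [qY_conj z, qY_comb_right H a sz, map_sum, ← Finset.sum_neg_distrib]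
    refine Finset.sum_congr rfl fun c _ => ?_
    rw [q4, map_mul, conj_conj, map_mul]
    have : conj (fluxSign τ c) = -fluxSign τ c := by
      unfold fluxSign
      split_ifs <;> simp
    rw [this]
    push_cast
    rw [← Complex.mul_conj']
    ring
  have := qY_add_left sr sK sz
  rw [← ez] at this
  rw [this, q3, q5, zero_add]

/-- Conservation of the flux between the two ends. -/
lemma flux_conservation (H : WaveSystem ω γ τ w) (hV : IsPot R d V)
    {z : Field2} (hz : IsKer ω V z) {a b : ι → ℂ} (ha : Asym w γ (Ioi R) z a)
    (hb : Asym w (-γ) (Iio (-R)) z b) :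
    ∑ c, ‖if τ c then a c else b c‖ ^ 2 = ∑ c, ‖if τ c then b c else a c‖ ^ 2 := by
  obtain ⟨k, hk⟩ := exists_qY_const hz.loc (hV.loc hz.loc) hz.loc (hV.loc hz.loc) hz.dirac
    hz.dirac isOpen_univ ordConnected_univ (.of_forall fun p _ => by
      simp only [sesq, Prod.smul_fst, Prod.smul_snd, smul_eq_mul, map_mul, conj_ofReal]
      ring)
  have at_end : ∀ {s : ℝ} {U : Set ℝ} {a : ι → ℂ}, IsEnd γ R s U → Asym w s U z a →
      k = ∑ c, fluxSign τ c * (‖a c‖ ^ 2 : ℝ) := by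
    intro s U a e h
    have h1 := flux_of_asym H hV hz e h
    have h2 : ∃ᵐ y, y ∈ U := by
      rw [frequently_ae_mem_iff, e.volume_eq]; simp
    obtain ⟨y, hyU, h3, h4⟩ := (h2.and_eventually (h1.and hk)).exists
    rw [← h4 trivial, h3 hyU]
  have E := (at_end .right ha).symm.trans (at_end .left hb)
  have key : ((∑ c, ‖if τ c then a c else b c‖ ^ 2 - ∑ c, ‖if τ c then b c else a c‖ ^ 2 : ℝ) : ℂ) =
      -I * (∑ c, fluxSign τ c * (‖a c‖ ^ 2 : ℝ) - ∑ c, fluxSign τ c * (‖b c‖ ^ 2 : ℝ)) := by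
    push_cast
    simp only [← Finset.sum_sub_distrib, Finset.mul_sum]
    refine Finset.sum_congr rfl fun c _ => ?_
    cases hc : τ c <;> simp [fluxSign, hc]
    · linear_combination (‖b c‖ ^ 2 - ‖a c‖ ^ 2 : ℂ) * I_sq
    · linear_combination (‖a c‖ ^ 2 - ‖b c‖ ^ 2 : ℂ) * I_sq
  rw [E, sub_self, mul_zero] at key
  exact sub_eq_zero.1 (Complex.ofReal_eq_zero.1 key)

/-- The coefficients are determined by the asymptotics. -/
lemma coef_eq_zero (H : WaveSystem ω γ τ w) (hR : 0 < R) {s : ℝ} {U : Set ℝ} (e : IsEnd γ R s U)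
    {a : ι → ℂ}
    (ha : MemLp (fun p => exp (s * p.2) • comb w a p) 2 (volume.restrict (slab U))) :
    a = 0 := by
  obtain ⟨C, hb⟩ := H.bound_end e hR
  ext c
  have : a c * fluxSign τ c = 0 := qY_const_eq_zero e.isOpen.measurableSet e.volume_eq ha (hb c)
    (.of_forall fun y _ => H.qY_comb a c y)
  exact (mul_eq_zero.1 this).resolve_right (fluxSign_ne_zero τ c)

end

lemma memLp_slab_iff {U : Set ℝ} (hU : MeasurableSet U) {g : Field2} :
    MemLp g 2 (volume.restrict (slab U)) ↔ MemLp ({p : ℝ × ℝ | p.2 ∈ U}.indicator g) 2 μS := by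
  have hm : MeasurableSet {p : ℝ × ℝ | p.2 ∈ U} := measurable_snd hU
  rw [memLp_indicator_iff_restrict hm, Measure.restrict_restrict hm]
  have : {p : ℝ × ℝ | p.2 ∈ U} ∩ strip = slab U := by
    ext p
    simp only [slab, strip, mem_inter_iff, mem_ofPred_eq, mem_prod, mem_univ, and_true]
    tauto
  rw [this]

/-- Membership in a weighted space from local integrability and decay at both ends. -/
lemma memL_of_ends {s R : ℝ} (hR : 0 < R) {g : Field2} (lg : LocL2 g)
    (h1 : MemLp (fun p => exp (s * p.2) • g p) 2 (volume.restrict (slab (Ioi R))))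
    (h2 : MemLp (fun p => exp (-s * p.2) • g p) 2 (volume.restrict (slab (Iio (-R))))) :
    MemL s g := by
  have h3 := (lg.smulY (ψ := fun y => exp (s * |y|)) (by fun_prop)) R
  rw [← slab_window, memLp_slab_iff measurableSet_Icc] at h3
  rw [memLp_slab_iff measurableSet_Ioi] at h1
  rw [memLp_slab_iff measurableSet_Iio] at h2
  refine ((h1.add h2).add h3).ae_eq (.of_forall fun p => ?_)
  simp only [Pi.add_apply, indicator_apply, mem_ofPred_eq, mem_Ioi, mem_Iio, mem_Icc]
  rcases lt_or_ge R p.2 with h | h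
  · rw [if_pos h, if_neg (by linarith), if_neg (by intro h'; linarith [h'.2]),
      abs_of_pos (hR.trans h)]
    simp
  · by_cases h' : p.2 < -R
    · rw [if_neg h.not_gt, if_pos h', if_neg (by intro h''; linarith [h''.1]),
        abs_of_neg (by linarith)]
      simp
    · rw [if_neg h.not_gt, if_neg h', if_pos ⟨by linarith, h⟩]
      simp

lemma MemL.at_end {t s R : ℝ} {U : Set ℝ} (e : IsEnd t R s U) (hR : 0 < R) {g : Field2}
    (h : MemL t g) : MemLp (fun p => exp (s * p.2) • g p) 2 (volume.restrict (slab U)) := by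
  refine (h.mono_measure (slab_le U)).ae_eq ?_
  filter_upwards [ae_restrict_mem (measurableSet_slab e.isOpen.measurableSet)] with p hp
  rw [e.mul_eq hR hp.2]

lemma MemL.loc {s : ℝ} {g : Field2} (h : MemL s g) : LocL2 g :=
  locL2_of_memLp_exp (f := fun y => s * |y|) (by fun_prop) h

lemma MemL.add {s : ℝ} {g g' : Field2} (h : MemL s g) (h' : MemL s g') :
    MemL s (fun p => g p + g' p) := by
  refine (MemLp.add h h').ae_eq (.of_forall fun p => ?_)
  simp only [Pi.add_apply, smul_add]

lemma MemL.const_smul {s : ℝ} {g : Field2} (h : MemL s g) (k : ℂ) :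
    MemL s (fun p => k • g p) := by
  refine (MemLp.const_smul h k).ae_eq (.of_forall fun p => ?_)
  simp only [Pi.smul_apply, smul_comm k]

lemma MemL.sum {κ : Type*} [Fintype κ] {s : ℝ} {g : κ → Field2} (h : ∀ k, MemL s (g k)) :
    MemL s (fun p => ∑ k, g k p) := by
  refine (memLp_finsetSum Finset.univ fun k _ => h k).ae_eq (.of_forall fun p => ?_)
  simp only [Finset.smul_sum]

lemma memL_of_tail {s R : ℝ} {f r : Field2} {k : ℂ} (lf : LocL2 f) (hr : MemL s r)
    (h : ∀ p ∈ strip, R < |p.2| → f p = k • r p) : MemL s f := by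
  have h1 := ((lf.sub (hr.loc.const_smul k)).smulY (ψ := fun y => exp (s * |y|))
    (by fun_prop)) R
  rw [← slab_window, memLp_slab_iff measurableSet_Icc] at h1
  refine (h1.add (hr.const_smul k)).ae_eq ?_
  filter_upwards [ae_restrict_mem measurableSet_strip] with p hp
  simp only [Pi.add_apply, indicator_apply, mem_ofPred_eq, mem_Icc]
  split_ifs with hw
  · rw [← smul_add, sub_add_cancel]
  · rw [h p hp (not_le.1 fun h' => hw (abs_le.1 h')), zero_add]

section

variable {ι : Type} [Fintype ι] {ω γ R d K : ℝ} {τ : ι → Bool} {w : ι → Field2}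
  {V : ℝ × ℝ → ℝ}

/-- `z` has incoming coefficients `x` and outgoing coefficients `y`: a wave with sign `+` comes in
on the right and goes out on the left, a wave with sign `-` conversely. -/
def IsScat (τ : ι → Bool) (w : ι → Field2) (γ R : ℝ) (z : Field2) (x y : ι → ℂ) : Prop :=
  Asym w γ (Ioi R) z (fun c => if τ c then x c else y c) ∧
    Asym w (-γ) (Iio (-R)) z (fun c => if τ c then y c else x c)

lemma isScat_of_asym {z : Field2} {a b : ι → ℂ} (ha : Asym w γ (Ioi R) z a)
    (hb : Asym w (-γ) (Iio (-R)) z b) :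
    IsScat τ w γ R z (fun c => if τ c then a c else b c) (fun c => if τ c then b c else a c) := by
  refine ⟨?_, ?_⟩ <;> [convert! ha using 2 with c; convert! hb using 2 with c] <;>
    cases hc : τ c <;> simp [hc]

lemma IsScat.smul {z : Field2} {x y : ι → ℂ} (h : IsScat τ w γ R z x y) (k : ℂ) :
    IsScat τ w γ R (fun p => k • z p) (k • x) (k • y) := by
  refine ⟨?_, ?_⟩ <;> [convert! h.1.smul k using 2 with c; convert! h.2.smul k using 2 with c] <;>
    simp only [Pi.smul_apply] <;> split_ifs <;> rfl

lemma IsScat.add {z z' : Field2} {x y x' y' : ι → ℂ} (h : IsScat τ w γ R z x y)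
    (h' : IsScat τ w γ R z' x' y') :
    IsScat τ w γ R (fun p => z p + z' p) (x + x') (y + y') := by
  refine ⟨?_, ?_⟩ <;> [convert! h.1.add h'.1 using 2 with c; convert! h.2.add h'.2 using 2 with c] <;>
    simp only [Pi.add_apply] <;> split_ifs <;> rfl

lemma IsScat.sum {κ : Type*} [Fintype κ] {z : κ → Field2} {x y : κ → ι → ℂ}
    (h : ∀ k, IsScat τ w γ R (z k) (x k) (y k)) :
    IsScat τ w γ R (fun p => ∑ k, z k p) (∑ k, x k) (∑ k, y k) := by
  refine ⟨?_, ?_⟩ <;> [convert! Asym.sum fun k => (h k).1 using 2 with c; convert! Asym.sum fun k => (h k).2 using 2 with c] <;>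
    simp only [Finset.sum_apply] <;> split_ifs <;> rfl

variable [DecidableEq ι]

lemma IsScat.norm_eq (H : WaveSystem ω γ τ w) (hV : IsPot R d V)
    {z : Field2} (hz : IsKer ω V z) {x y : ι → ℂ} (h : IsScat τ w γ R z x y) :
    ∑ c, ‖x c‖ ^ 2 = ∑ c, ‖y c‖ ^ 2 := by
  have := flux_conservation H hV hz h.1 h.2
  convert this using 3 with c _ c _ <;> split_ifs <;> rfl

lemma IsScat.out_eq_zero (H : WaveSystem ω γ τ w) (hV : IsPot R d V)
    {z : Field2} (hz : IsKer ω V z) {y : ι → ℂ} (h : IsScat τ w γ R z 0 y) : y = 0 := by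
  have h1 := h.norm_eq H hV hz
  simp only [Pi.zero_apply, norm_zero, ne_eq, OfNat.ofNat_ne_zero, not_false_eq_true, zero_pow,
    Finset.sum_const_zero] at h1
  ext c
  have := (Finset.sum_eq_zero_iff_of_nonneg fun c _ => sq_nonneg ‖y c‖).1 h1.symm c
    (Finset.mem_univ c)
  simpa using this

lemma isScat_out_unique (H : WaveSystem ω γ τ w) (hV : IsPot R d V)
    {z z' : Field2} (hz : IsKer ω V z) (hz' : IsKer ω V z') {x y y' : ι → ℂ}
    (h : IsScat τ w γ R z x y) (h' : IsScat τ w γ R z' x y') : y = y' := by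
  have h1 := h.add (h'.smul (-1))
  have h2 := hz.add hV (hz'.smul (-1))
  have h3 : x + (-1 : ℂ) • x = 0 := by simp
  rw [h3] at h1
  have := h1.out_eq_zero H hV h2
  rwa [neg_one_smul, ← sub_eq_add_neg, sub_eq_zero] at this

/-- There is a solution with any prescribed wave at the right end. -/
lemma exists_right (H : WaveSystem ω γ τ w) (B : SymbolBounds ω γ K w) (hV : IsPot R d V)
    (hd : √(2 * K) * d < 1) (c : ι) :
    ∃ z, IsKer ω V z ∧ MemL (-γ) z ∧ Asym w γ (Ioi R) z (Pi.single c 1) := by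
  have ew : comb w (Pi.single c 1) = w c := by
    ext p : 1
    simp [comb, Pi.single_apply]
  set F : Field2 := fun p => -(V p • w c p) with hF
  have lVw : LocL2 (fun p => V p • w c p) := by
    intro R'
    refine (H.loc c R').of_le_mul (c := d) ((hV.aesm.mono_measure (window_le R')).smul
      (H.loc c R').1) ?_
    filter_upwards [ae_mono (window_le R') hV.bound] with p hp
    rw [norm_smul, norm_eq_abs]
    gcongr
  have lF : LocL2 F := fun R' => (lVw R').neg
  have mF : MemX γ F := by
    have h1 := lF.smulY (ψ := fun y => exp (γ * y)) (by fun_prop)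
    have h2 := (memLp_slab_iff measurableSet_Icc).1 (by rw [slab_window]; exact h1 R)
    refine h2.ae_eq ?_
    filter_upwards [ae_restrict_mem measurableSet_strip] with p hp
    simp only [indicator_apply, mem_ofPred_eq, mem_Icc]
    split_ifs with hw
    · rfl
    · simp only [F]
      rw [hV.support p hp (not_le.1 fun h' => hw (abs_le.1 h'))]
      simp
  obtain ⟨ζ, mζ, hζ⟩ := B.minus.exists_solution hd hV.aesm hV.bound mF
  have lζ := locL2_of_memX mζ
  have l1 : LocL2 (fun p => (ω - V p) • ζ p + F p) := by
    have h1 := hV.loc (ω := ω) lζ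
    refine LocL2.add (fun R' => (h1 R').ae_eq (.of_forall fun p => ?_)) lF
    exact Complex.coe_smul _ _
  refine ⟨fun p => ζ p + w c p, ⟨lζ.add (H.loc c), ?_⟩, ?_, ?_⟩
  · refine (hζ.add (H.dirac c) lζ l1 (H.loc c) ((H.loc c).const_smul _)).congr
      (.of_forall fun p => rfl) (.of_forall fun p => ?_)
    simp only [F]
    rw [Complex.coe_smul, Complex.coe_smul, sub_smul, sub_smul, smul_add, smul_add]
    abel
  · refine MemL.add ?_ (ew ▸ H.memL_comb _)
    refine memLp_exp_mono (f := fun y => γ * y) (g := fun y => -γ * |y|) (by fun_prop)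
      (by fun_prop) (fun y => ?_) mζ
    nlinarith [neg_abs_le y, H.pos]
  · rw [Asym, ew]
    refine (mζ.mono_measure (slab_le _)).ae_eq (.of_forall fun p => ?_)
    simp only [add_sub_cancel_right]

/-- There is a solution with any prescribed incoming waves. -/
lemma exists_scat (H : WaveSystem ω γ τ w) (B : SymbolBounds ω γ K w) (hV : IsPot R d V)
    (hd : √(2 * K) * d < 1) (x : ι → ℂ) :
    ∃ z y, IsKer ω V z ∧ MemL (-γ) z ∧ IsScat τ w γ R z x y := by
  choose z hz gz az using exists_right H B hV hd
  have hb : ∀ c, ∃ b, Asym w (-γ) (Iio (-R)) (z c) b := fun c =>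
    exists_asym H B hV (hz c) (gz c) .left
  choose b hb using hb
  -- the solution with the waves `a` at the right end
  have full : ∀ a : ι → ℂ, IsKer ω V (fun p => ∑ k, a k • z k p) ∧
      MemL (-γ) (fun p => ∑ k, a k • z k p) ∧ IsScat τ w γ R (fun p => ∑ k, a k • z k p)
        (fun c => if τ c then a c else ∑ k, a k * b k c)
        (fun c => if τ c then ∑ k, a k * b k c else a c) := by
    intro a
    refine ⟨IsKer.sum hV fun k => (hz k).smul _, MemL.sum fun k => (gz k).const_smul _, ?_⟩
    have h1 := Asym.sum fun k => (az k).smul (a k)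
    have h2 := Asym.sum fun k => (hb k).smul (a k)
    have e1 : ∑ k, a k • (Pi.single k (1 : ℂ) : ι → ℂ) = a := by
      ext c
      simp [Finset.sum_apply, Pi.single_apply]
    have e2 : ∑ k, a k • b k = fun c => ∑ k, a k * b k c := by
      ext c
      simp [Finset.sum_apply]
    rw [e1] at h1
    rw [e2] at h2
    exact isScat_of_asym h1 h2
  let M : Matrix ι ι ℂ := Matrix.of fun c k => if τ c then (if k = c then 1 else 0) else b k c
  have hM : ∀ a, M.mulVecLin a = fun c => if τ c then a c else ∑ k, a k * b k c := by
    intro a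
    ext c
    simp only [Matrix.mulVecLin_apply, Matrix.mulVec, dotProduct, M, Matrix.of_apply]
    split_ifs with h
    · simp
    · exact Finset.sum_congr rfl fun k _ => mul_comm _ _
  have inj : Function.Injective M.mulVecLin := by
    rw [← LinearMap.ker_eq_bot, LinearMap.ker_eq_bot']
    intro a ha
    obtain ⟨h1, -, h3⟩ := full a
    rw [← hM a, ha] at h3
    have h4 := h3.out_eq_zero H hV h1
    ext c
    have h5 := congrFun ha c
    have h6 := congrFun h4 c
    rw [hM] at h5
    simp only [Pi.zero_apply] at h5 h6 ⊢
    cases hc : τ c <;> simp [hc] at h5 h6 <;> assumption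
  obtain ⟨a, ha⟩ := (LinearMap.injective_iff_surjective.1 inj) x
  obtain ⟨h1, h2, h3⟩ := full a
  rw [← hM a, ha] at h3
  exact ⟨_, _, h1, h2, h3⟩

/-- `S` collects the outgoing coefficients of the solutions with a single incoming wave. -/
def IsScatMatrix (ω γ R : ℝ) (τ : ι → Bool) (w : ι → Field2) (V : ℝ × ℝ → ℝ)
    (S : Matrix ι ι ℂ) : Prop :=
  ∀ c, ∃ z, IsKer ω V z ∧ MemL (-γ) z ∧ IsScat τ w γ R z (Pi.single c 1) (S c)

lemma exists_isScatMatrix (H : WaveSystem ω γ τ w) (B : SymbolBounds ω γ K w)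
    (hV : IsPot R d V) (hd : √(2 * K) * d < 1) :
    ∃ S, IsScatMatrix ω γ R τ w V S := by
  choose z y h using fun c => exists_scat H B hV hd (Pi.single c 1)
  exact ⟨y, fun c => ⟨z c, h c⟩⟩

lemma IsScatMatrix.unique (H : WaveSystem ω γ τ w) (hV : IsPot R d V)
    {S S' : Matrix ι ι ℂ} (h : IsScatMatrix ω γ R τ w V S) (h' : IsScatMatrix ω γ R τ w V S') :
    S = S' := by
  refine funext fun c => ?_
  obtain ⟨z, h1, -, h2⟩ := h c
  obtain ⟨z', h3, -, h4⟩ := h' c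
  exact isScat_out_unique H hV h1 h3 h2 h4

lemma IsScatMatrix.exists_scat {S : Matrix ι ι ℂ} (hV : IsPot R d V)
    (h : IsScatMatrix ω γ R τ w V S) (x : ι → ℂ) :
    ∃ z, IsKer ω V z ∧ MemL (-γ) z ∧ IsScat τ w γ R z x (vecMul x S) := by
  choose z h1 h2 h3 using h
  refine ⟨fun p => ∑ c, x c • z c p, IsKer.sum hV fun c => (h1 c).smul _,
    MemL.sum fun c => (h2 c).const_smul _, ?_⟩
  have := IsScat.sum fun c => (h3 c).smul (x c)
  convert this using 1
  · ext c
    simp [Finset.sum_apply, Pi.single_apply]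
  · ext c
    simp [vecMul, dotProduct, Finset.sum_apply]

/-- Conservation of energy. -/
lemma IsScatMatrix.norm_eq (H : WaveSystem ω γ τ w) (hV : IsPot R d V)
    {S : Matrix ι ι ℂ} (h : IsScatMatrix ω γ R τ w V S) (x : ι → ℂ) :
    ∑ c, ‖x c‖ ^ 2 = ∑ c, ‖vecMul x S c‖ ^ 2 := by
  obtain ⟨z, h1, -, h3⟩ := h.exists_scat hV x
  exact h3.norm_eq H hV h1

/-- Square integrable solutions exist if and only if some incoming waves and the corresponding
outgoing waves combine to square integrable fields at both ends. -/
lemma exists_trapped_iff (H : WaveSystem ω γ τ w) (B : SymbolBounds ω γ K w) (hV : IsPot R d V)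
    (hd : √(2 * K) * d < 1) {S : Matrix ι ι ℂ}
    (hS : IsScatMatrix ω γ R τ w V S) :
    (∃ z, IsKer ω V z ∧ MemL 0 z ∧ ¬ z =ᵐ[μS] 0) ↔ ∃ x : ι → ℂ, x ≠ 0 ∧
      MemLp (comb w fun c => if τ c then x c else vecMul x S c) 2
        (volume.restrict (slab (Ioi R))) ∧
      MemLp (comb w fun c => if τ c then vecMul x S c else x c) 2
        (volume.restrict (slab (Iio (-R)))) := by
  constructor
  · rintro ⟨z, hz, mz, nz⟩
    have gz : MemL (-γ) z := memLp_exp_mono (f := fun y => 0 * |y|) (g := fun y => -γ * |y|)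
      (by fun_prop) (by fun_prop) (fun y => by nlinarith [H.pos, abs_nonneg y]) mz
    obtain ⟨a, ha⟩ := exists_asym H B hV hz gz .right
    obtain ⟨b, hb⟩ := exists_asym H B hV hz gz .left
    have sc : IsScat τ w γ R z _ _ := isScat_of_asym ha hb
    set x : ι → ℂ := fun c => if τ c then a c else b c with hx
    obtain ⟨z', h1, -, h3⟩ := hS.exists_scat hV x
    have out := isScat_out_unique H hV hz h1 sc h3
    rw [out] at sc
    refine ⟨x, fun x0 => nz ?_, ?_, ?_⟩
    · rw [x0, Matrix.zero_vecMul] at sc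
      have c0 : comb w (fun c : ι => if τ c then (0 : ι → ℂ) c else (0 : ι → ℂ) c) = 0 := by
        ext p : 1; simp [comb]
      obtain ⟨s1, s2⟩ := sc
      rw [Asym, c0] at s1 s2
      have mg : MemL γ z := memL_of_ends hV.pos hz.loc (by simpa using s1) (by simpa using s2)
      have mX : MemX γ z := memLp_exp_mono (f := fun y => γ * |y|) (g := fun y => γ * y)
        (by fun_prop) (by fun_prop) (fun y => by nlinarith [H.pos, le_abs_self y]) mg
      refine B.plus.ae_eq_zero hd (hV.loc hz.loc) hz.dirac mX ?_
      filter_upwards [hV.bound] with p hp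
      rw [← sub_smul, norm_smul, ← Complex.ofReal_sub, norm_real, norm_eq_abs]
      gcongr
      rwa [sub_sub_cancel_left, abs_neg]
    · exact ((mz.mono_measure (slab_le _)).sub (IsEnd.right.memLp hV.pos H.pos
        (hz.loc.sub (H.loc_comb _)) sc.1)).ae_eq (.of_forall fun p => by simp)
    · exact ((mz.mono_measure (slab_le _)).sub (IsEnd.left.memLp hV.pos H.pos
        (hz.loc.sub (H.loc_comb _)) sc.2)).ae_eq (.of_forall fun p => by simp)
  · rintro ⟨x, x0, m1, m2⟩
    obtain ⟨z, h1, h2, h3⟩ := hS.exists_scat hV x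
    refine ⟨z, h1, ?_, fun hz => x0 ?_⟩
    · exact memL_of_ends hV.pos h1.loc
        (((IsEnd.right.memLp hV.pos H.pos (h1.loc.sub (H.loc_comb _)) h3.1).add m1).ae_eq
          (.of_forall fun p => by simp))
        (((IsEnd.left.memLp hV.pos H.pos (h1.loc.sub (H.loc_comb _)) h3.2).add m2).ae_eq
          (.of_forall fun p => by simp))
    · have zero : ∀ {s : ℝ} {U : Set ℝ} {a : ι → ℂ}, IsEnd γ R s U → Asym w s U z a → a = 0 := by
        intro s U a e h
        refine coef_eq_zero H hV.pos e ?_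
        refine (MemLp.neg h).ae_eq ?_
        filter_upwards [ae_mono (slab_le U) hz] with p hp
        simp [hp]
      have a0 := zero .right h3.1
      have b0 := zero .left h3.2
      ext c
      have h4 := congrFun a0 c
      have h5 := congrFun b0 c
      cases hc : τ c <;> simp [hc] at h4 h5 ⊢ <;> assumption

end

lemma IsPotential.isPot {R₀ δ : ℝ} {P : ℝ × ℝ → ℝ} (h : IsPotential R₀ P) (pos : 0 < R₀) :
    IsPot R₀ |δ| (fun p => δ * P p) where
  pos := pos
  aesm := by
    have h1 : AEStronglyMeasurable P (volume.restrict (Icc (0 : ℝ) 1 ×ˢ (univ : Set ℝ))) :=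
      h.continuousOn.aestronglyMeasurable (measurableSet_Icc.prod MeasurableSet.univ)
    exact (h1.mono_measure (Measure.restrict_mono
      (Set.prod_mono Ioo_subset_Icc_self le_rfl) le_rfl)).const_mul δ
  support p hp hR := by
    rw [h.support p (Set.prod_mono Ioo_subset_Icc_self le_rfl hp) hR, mul_zero]
  bound := by
    filter_upwards [ae_restrict_mem measurableSet_strip] with p hp
    rw [abs_mul]
    exact mul_le_of_le_one_right (abs_nonneg _) (h.bound p hp)

lemma IsPot.memL {R d ω s : ℝ} {V : ℝ × ℝ → ℝ} (hV : IsPot R d V) {z : Field2} (hz : MemL s z) :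
    MemL s (fun p => ((ω - V p : ℝ) : ℂ) • z p) := by
  refine MemLp.of_le_mul (c := |ω| + d) hz
    ((hV.loc hz.loc).smulY (ψ := fun y => exp (s * |y|)) (by fun_prop)).aesm ?_
  filter_upwards [hV.bound] with p hp
  rw [smul_comm, norm_smul, norm_real, norm_eq_abs]
  gcongr
  exact (abs_sub _ _).trans (by gcongr)

lemma memH_ker_iff {R d ω s : ℝ} {V : ℝ × ℝ → ℝ} (hV : IsPot R d V) {z : Field2} :
    (MemH s z ∧ DiracEq z (fun p => ((ω - V p : ℝ) : ℂ) • z p)) ↔ IsKer ω V z ∧ MemL s z :=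
  ⟨fun h => ⟨⟨h.1.1.loc, h.2⟩, h.1.1⟩, fun h => ⟨⟨h.2, _, hV.memL h.2, h.1.dirac⟩, h.1.dirac⟩⟩

/-- A trapped mode is a nonzero square integrable element of the kernel. -/
lemma isTrappedMode_iff {R₀ δ ω : ℝ} {P : ℝ × ℝ → ℝ} (h : IsPotential R₀ P) (hR : 0 < R₀)
    {z : Field2} :
    IsTrappedMode ω δ P z ↔ IsKer ω (fun p => δ * P p) z ∧ MemL 0 z ∧ ¬ z =ᵐ[μS] 0 := by
  rw [← and_assoc, ← memH_ker_iff (h.isPot hR), and_assoc]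
  exact Iff.rfl

section

variable {ι : Type} [Fintype ι] {ω γ R d : ℝ} {τ : ι → Bool} {w : ι → Field2} {V : ℝ × ℝ → ℝ}
  {χ : Bool → ℝ → ℝ}

/-- The superposition of the cut-off waves with incoming coefficients `x` and outgoing
coefficients `y`. -/
def cutWaves (τ : ι → Bool) (w : ι → Field2) (χ : Bool → ℝ → ℝ) (x y : ι → ℂ) : Field2 := fun p =>
  ∑ c, (x c • χ (τ c) p.2 • w c p + y c • χ (!τ c) p.2 • w c p)

lemma cutWaves_right (hχ : IsCutoffPair R χ) (x y : ι → ℂ) {p : ℝ × ℝ} (hp : R < p.2) :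
    cutWaves τ w χ x y p = comb w (fun c => if τ c then x c else y c) p := by
  refine Finset.sum_congr rfl fun c _ => ?_
  cases hc : τ c <;> simp [hc, hχ.plus_right _ hp, hχ.minus_right _ hp]

lemma cutWaves_left (hχ : IsCutoffPair R χ) (x y : ι → ℂ) {p : ℝ × ℝ} (hp : p.2 < -R) :
    cutWaves τ w χ x y p = comb w (fun c => if τ c then y c else x c) p := by
  refine Finset.sum_congr rfl fun c _ => ?_
  cases hc : τ c <;> simp [hc, hχ.plus_left _ hp, hχ.minus_left _ hp]

lemma IsCutoffPair.deriv_eq_zero (hχ : IsCutoffPair R χ) (t : Bool) {y : ℝ} (hy : R < |y|) :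
    deriv (χ t) y = 0 := by
  rcases lt_abs.1 hy with h | h
  · cases t
    · exact deriv_eq_zero_of_eq_const isOpen_Ioi hχ.minus_right h
    · exact deriv_eq_zero_of_eq_const isOpen_Ioi hχ.plus_right h
  · have h : y < -R := by linarith
    cases t
    · exact deriv_eq_zero_of_eq_const isOpen_Iio hχ.minus_left h
    · exact deriv_eq_zero_of_eq_const isOpen_Iio hχ.plus_left h

variable [DecidableEq ι]

/-- The scattering relation in terms of the cut-off waves. -/
lemma isScat_iff_cutWaves (H : WaveSystem ω γ τ w) (hV : IsPot R d V)
    (hχ : IsCutoffPair R χ) {z : Field2} (hz : IsKer ω V z) (x y : ι → ℂ) :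
    IsScat τ w γ R z x y ↔ ∃ r, MemH γ r ∧ z = cutWaves τ w χ x y + r := by
  have lc : ∀ t c, LocL2 (fun p => χ t p.2 • w c p) := fun t c =>
    (H.loc c).smulY (hχ.smooth t).continuous
  have lT : LocL2 (cutWaves τ w χ x y) := LocL2.sum fun c _ =>
    ((lc _ c).const_smul (x c)).add ((lc _ c).const_smul (y c))
  constructor
  · rintro ⟨h1, h2⟩
    refine ⟨fun p => z p - cutWaves τ w χ x y p, ?_, by ext p : 1; simp⟩
    have mr : MemL γ (fun p => z p - cutWaves τ w χ x y p) := by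
      refine memL_of_ends hV.pos (hz.loc.sub lT) (MemLp.ae_eq ?_ h1) (MemLp.ae_eq ?_ h2)
      · filter_upwards [ae_restrict_mem (measurableSet_slab measurableSet_Ioi)] with p hp
        rw [cutWaves_right hχ x y hp.2]
      · filter_upwards [ae_restrict_mem (measurableSet_slab measurableSet_Iio)] with p hp
        rw [cutWaves_left hχ x y hp.2]
    have lg : ∀ t c, LocL2 (fun p => χ t p.2 • (ω : ℂ) • w c p + deriv (χ t) p.2 • Mop (w c) p) :=
      fun t c => (((H.loc c).const_smul (ω : ℂ)).smulY (hχ.smooth t).continuous).add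
        ((H.loc c).mop.smulY ((hχ.smooth t).continuous_deriv (by norm_cast)))
    have dT := DiracEq.sum (s := Finset.univ) (fun c _ => DiracEq.add
      (((H.dirac c).cutoff (H.loc c) ((H.loc c).const_smul _) (hχ.smooth (τ c))).const_smul (x c))
      (((H.dirac c).cutoff (H.loc c) ((H.loc c).const_smul _) (hχ.smooth (!τ c))).const_smul (y c))
      ((lc _ c).const_smul _) ((lg _ c).const_smul _) ((lc _ c).const_smul _)
      ((lg _ c).const_smul _)) (fun c _ => ((lc _ c).const_smul _).add ((lc _ c).const_smul _))
      (fun c _ => ((lg _ c).const_smul _).add ((lg _ c).const_smul _))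
    have lf := LocL2.sum (s := Finset.univ) (fun c (_ : c ∈ Finset.univ) =>
      ((lg (τ c) c).const_smul (x c)).add ((lg (!τ c) c).const_smul (y c)))
    refine ⟨mr, _, ?_, hz.dirac.sub dT hz.loc (hV.loc hz.loc) lT lf⟩
    refine memL_of_tail (R := R) (k := (ω : ℂ)) ((hV.loc hz.loc).sub lf) mr fun p hp hpR => ?_
    simp only [hV.support p hp hpR, sub_zero, hχ.deriv_eq_zero _ hpR, zero_smul, add_zero,
      smul_sub, cutWaves, Finset.smul_sum, smul_add]
    congr 1
    refine Finset.sum_congr rfl fun c _ => ?_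
    simp only [smul_comm (ω : ℂ)]
  · rintro ⟨r, ⟨mr, -⟩, rfl⟩
    refine ⟨MemLp.ae_eq ?_ (mr.at_end .right hV.pos), MemLp.ae_eq ?_ (mr.at_end .left hV.pos)⟩
    · filter_upwards [ae_restrict_mem (measurableSet_slab measurableSet_Ioi)] with p hp
      rw [Pi.add_apply, cutWaves_right hχ x y hp.2, add_sub_cancel_left]
    · filter_upwards [ae_restrict_mem (measurableSet_slab measurableSet_Iio)] with p hp
      rw [Pi.add_apply, cutWaves_left hχ x y hp.2, add_sub_cancel_left]

end

/-- The sign of a channel. -/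
def channelSign {N : ℕ} (c : Channel N) : Bool := c.1.2

lemma isScatteringMatrix_iff {N : ℕ} {ε : ℝ} {lam : ℂ} {γ δ R₀ : ℝ} {P : ℝ × ℝ → ℝ}
    {χ : Bool → ℝ → ℝ}
    (H : WaveSystem (omegaEps N ε) γ channelSign (channelWave N ε lam))
    (hP : IsPotential R₀ P) (hχ : IsCutoffPair R₀ χ) (hR : 0 < R₀)
    (S : Matrix (Channel N) (Channel N) ℂ) :
    IsScatteringMatrix N ε lam γ δ P χ S ↔ IsScatMatrix (omegaEps N ε) γ R₀ channelSign
      (channelWave N ε lam) (fun p => δ * P p) S := by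
  have e : ∀ c : Channel N, waveV N ε lam χ c + ∑ c' : Channel N, S c c' • waveW N ε lam χ c' =
      cutWaves channelSign (channelWave N ε lam) χ (Pi.single c 1) (S c) := by
    intro c
    ext p : 1
    simp only [Pi.add_apply, Finset.sum_apply, Pi.smul_apply, waveV, waveW, cutWaves, channelSign,
      Finset.sum_add_distrib, Complex.coe_smul, Pi.single_apply, ite_smul, one_smul, zero_smul,
      Finset.sum_ite_eq', Finset.mem_univ, if_true]
  refine forall_congr' fun c => exists_congr fun z => ?_
  constructor
  · rintro ⟨r, h1, h2, h3, h4⟩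
    obtain ⟨k, m⟩ := (memH_ker_iff (hP.isPot hR)).1 ⟨h1, h2⟩
    exact ⟨k, m, (isScat_iff_cutWaves H (hP.isPot hR) hχ k _ _).2 ⟨r, h3, by rw [h4, e]⟩⟩
  · rintro ⟨k, m, h⟩
    obtain ⟨r, h3, h4⟩ := (isScat_iff_cutWaves H (hP.isPot hR) hχ k _ _).1 h
    obtain ⟨h1, h2⟩ := (memH_ker_iff (hP.isPot hR)).2 ⟨k, m⟩
    exact ⟨r, h1, h2, h3, by rw [e]; exact h4⟩

/-! ### Modes of the unperturbed problem -/

section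

variable {φ : ℝ × ℝ → ℂ} {e e' h h' : ℝ → ℂ}

lemma strip_parts_fst (hφ : IsTest φ) (ce : Continuous e) (hh : ∀ x, HasDerivAt h (h' x) x)
    (ch : Continuous h') (b0 : ∀ y, h 0 * φ (0, y) = 0) (b1 : ∀ y, h 1 * φ (1, y) = 0) :
    ∫ p in strip, e p.2 * h p.1 * dx φ p = -∫ p in strip, e p.2 * h' p.1 * φ p := by
  have c0 : Continuous h := continuous_iff_continuousAt.2 fun x => (hh x).continuousAt
  have i1 : Integrable (fun p => e p.2 * h p.1 * dx φ p) μS :=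
    (Continuous.integrable_of_hasCompactSupport (by have := hφ.dx.cont; fun_prop)
      hφ.dx.supp.mul_left).restrict
  have i2 : Integrable (fun p => e p.2 * h' p.1 * φ p) μS :=
    (Continuous.integrable_of_hasCompactSupport (by have := hφ.cont; fun_prop)
      hφ.supp.mul_left).restrict
  rw [strip_measure] at i1 i2 ⊢
  rw [integral_prod_symm _ i1, integral_prod_symm _ i2, ← integral_neg]
  congr 1; ext y
  have cφ : Continuous fun x => φ (x, y) := hφ.cont.comp (by fun_prop)
  have cdφ : Continuous fun x => dx φ (x, y) := hφ.dx.cont.comp (by fun_prop)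
  have key := intervalIntegral.integral_mul_deriv_eq_deriv_mul (a := (0 : ℝ)) (b := 1)
    (fun x _ => hh x) (fun x _ => hasDerivAt_fst hφ.c1 x y) (ch.intervalIntegrable _ _)
    (cdφ.intervalIntegrable _ _)
  rw [b0, b1, sub_zero, zero_sub] at key
  simp only [intervalIntegral.integral_of_le zero_le_one, integral_Ioc_eq_integral_Ioo] at key
  simp only [mul_assoc, integral_const_mul]
  rw [key, mul_neg]

lemma strip_parts_snd (hφ : IsTest φ) (he : ∀ y, HasDerivAt e (e' y) y) (ce : Continuous e')
    (ch : Continuous h) :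
    ∫ p in strip, e p.2 * h p.1 * dy φ p = -∫ p in strip, e' p.2 * h p.1 * φ p := by
  have c0 : Continuous e := continuous_iff_continuousAt.2 fun x => (he x).continuousAt
  have i1 : Integrable (fun p => e p.2 * h p.1 * dy φ p) μS :=
    (Continuous.integrable_of_hasCompactSupport (by have := hφ.dy.cont; fun_prop)
      hφ.dy.supp.mul_left).restrict
  have i2 : Integrable (fun p => e' p.2 * h p.1 * φ p) μS :=
    (Continuous.integrable_of_hasCompactSupport (by have := hφ.cont; fun_prop)
      hφ.supp.mul_left).restrict
  rw [strip_measure] at i1 i2 ⊢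
  rw [integral_prod _ i1, integral_prod _ i2, ← integral_neg]
  congr 1; ext x
  have cφ : Continuous fun y => φ (x, y) := hφ.cont.comp (by fun_prop)
  have cdφ : Continuous fun y => dy φ (x, y) := hφ.dy.cont.comp (by fun_prop)
  have sφ := hφ.slice x
  have sdφ := hφ.dy.slice x
  have key := integral_mul_deriv_eq_deriv_mul_of_integrable
    (u := e) (v := fun y => φ (x, y)) (fun y _ => he y) (fun y _ => hasDerivAt_snd hφ.c1 x y)
    (Continuous.integrable_of_hasCompactSupport (c0.mul cdφ) sdφ.mul_left)
    (Continuous.integrable_of_hasCompactSupport (ce.mul cφ) sφ.mul_left)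
    (Continuous.integrable_of_hasCompactSupport (c0.mul cφ) sφ.mul_left)
  have r : ∀ a b c : ℂ, a * b * c = b * (a * c) := fun a b c => by ring
  simp only [r _ (h x), integral_const_mul]
  rw [key, mul_neg]

end

/-- `(lam, κ)` is a wave vector of the `j`-th family at the energy `ω`: the conditions make
`expWave j lam κ` a solution of the unperturbed problem. -/
structure IsMode (ω : ℝ) (j : ℕ) (lam κ : ℂ) : Prop where
  sin_eq : (ω : ℂ) * Complex.sin κ = (-1) ^ (j + 1) * κ
  cos_eq : (ω : ℂ) * Complex.cos κ = (-1) ^ (j + 1) * lam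
  energy_ne : ω ≠ 0

lemma sign_mul_self (j : ℕ) : ((-1 : ℂ) ^ (j + 1)) * (-1) ^ (j + 1) = 1 := by
  rw [← mul_pow]; simp

lemma conj_sign (j : ℕ) : conj ((-1 : ℂ) ^ (j + 1)) = (-1) ^ (j + 1) := by simp

lemma IsMode.conj {ω : ℝ} {j : ℕ} {lam κ : ℂ} (h : IsMode ω j lam κ) :
    IsMode ω j (conj lam) (conj κ) where
  sin_eq := by
    have := congrArg (starRingEnd ℂ) h.sin_eq
    simpa [Complex.sin_conj] using this
  cos_eq := by
    have := congrArg (starRingEnd ℂ) h.cos_eq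
    simpa [Complex.cos_conj] using this
  energy_ne := h.energy_ne

lemma IsMode.sq_add_sq {ω : ℝ} {j : ℕ} {lam κ : ℂ} (h : IsMode ω j lam κ) :
    κ ^ 2 + lam ^ 2 = (ω : ℂ) ^ 2 := by
  have h1 := sign_mul_self j
  have h2 := Complex.sin_sq_add_cos_sq κ
  have e1 : κ = (-1) ^ (j + 1) * (ω * Complex.sin κ) := by
    rw [h.sin_eq, ← mul_assoc, h1, one_mul]
  have e2 : lam = (-1) ^ (j + 1) * (ω * Complex.cos κ) := by
    rw [h.cos_eq, ← mul_assoc, h1, one_mul]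
  calc κ ^ 2 + lam ^ 2 = ((-1) ^ (j + 1) * (ω * Complex.sin κ)) ^ 2 +
        ((-1) ^ (j + 1) * (ω * Complex.cos κ)) ^ 2 := by rw [← e1, ← e2]
    _ = ((-1) ^ (j + 1) * (-1) ^ (j + 1)) * (ω ^ 2 * (Complex.sin κ ^ 2 + Complex.cos κ ^ 2)) := by
        ring
    _ = (ω : ℂ) ^ 2 := by rw [h1, h2]; ring

/-- The first component of the transversal profile. -/
def profU (κ : ℂ) (x : ℝ) : ℂ := Complex.sin (κ * x)

/-- The second component of the transversal profile. -/
def profV (j : ℕ) (κ : ℂ) (x : ℝ) : ℂ :=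
  (-1) ^ (j + 1) * I * Complex.sin (κ * ((x : ℂ) - 1))

lemma hasDerivAt_profU (κ : ℂ) (x : ℝ) : HasDerivAt (profU κ) (κ * Complex.cos (κ * x)) x := by
  have h1 : HasDerivAt (fun s : ℝ => κ * (s : ℂ)) κ x := by
    simpa using ((hasDerivAt_id x).ofReal_comp).const_mul κ
  have := (Complex.hasDerivAt_sin (κ * x)).comp x h1
  rwa [mul_comm] at this

lemma hasDerivAt_profV (j : ℕ) (κ : ℂ) (x : ℝ) : HasDerivAt (profV j κ)
    ((-1) ^ (j + 1) * I * (κ * Complex.cos (κ * ((x : ℂ) - 1)))) x := by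
  have h1 : HasDerivAt (fun s : ℝ => κ * ((s : ℂ) - 1)) κ x := by
    simpa using (((hasDerivAt_id x).ofReal_comp).sub_const 1).const_mul κ
  have := ((Complex.hasDerivAt_sin (κ * ((x : ℂ) - 1))).comp x h1).const_mul
    ((-1) ^ (j + 1) * I)
  rwa [mul_comm (Complex.cos _)] at this

/-- The transversal profile solves the homogeneous cross-section problem. -/
lemma IsMode.crossSection {ω : ℝ} {j : ℕ} {lam κ : ℂ} (h : IsMode ω j lam κ) :
    CrossSection ω lam (profU κ) (profV j κ) 0 0 where
  hu x := by
    convert hasDerivAt_profU κ x using 1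
    have e : Complex.sin (κ * ((x : ℂ) - 1)) =
        Complex.sin (κ * x) * Complex.cos κ - Complex.cos (κ * x) * Complex.sin κ := by
      rw [mul_sub, mul_one, Complex.sin_sub]
    simp only [profU, profV, e, Pi.zero_apply, mul_zero, add_zero]
    linear_combination (-(-1) ^ (j + 1) * Complex.sin (κ * x)) * h.cos_eq +
      ((-1) ^ (j + 1) * Complex.cos (κ * x)) * h.sin_eq +
      (κ * Complex.cos (κ * x) - lam * Complex.sin (κ * x)) * sign_mul_self j +
      (ω * (-1) ^ (j + 1) * (Complex.sin (κ * x) * Complex.cos κ -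
        Complex.cos (κ * x) * Complex.sin κ)) * I_sq
  hv x := by
    convert hasDerivAt_profV j κ x using 1
    have e : Complex.sin (κ * x) = Complex.sin (κ * ((x : ℂ) - 1)) * Complex.cos κ +
        Complex.cos (κ * ((x : ℂ) - 1)) * Complex.sin κ := by
      rw [← Complex.sin_add]; congr 1; ring
    simp only [profU, profV, e, Pi.zero_apply, mul_zero, add_zero]
    linear_combination (I * Complex.sin (κ * ((x : ℂ) - 1))) * h.cos_eq +
      (I * Complex.cos (κ * ((x : ℂ) - 1))) * h.sin_eq
  u0 := by simp [profU]
  v1 := by simp [profV]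
  c₁ := continuous_const
  c₂ := continuous_const

lemma expWave_apply (j : ℕ) (lam κ : ℂ) (x y : ℝ) : expWave j lam κ (x, y) =
    (Complex.exp (-I * lam * y) * profU κ x,
      Complex.exp (-I * lam * y) * profV j κ x) := rfl

lemma hasDerivAt_expFactor (lam : ℂ) (y : ℝ) :
    HasDerivAt (fun y : ℝ => Complex.exp (-I * lam * y))
      (-I * lam * Complex.exp (-I * lam * y)) y := by
  have h1 : HasDerivAt (fun s : ℝ => -I * lam * (s : ℂ)) (-I * lam) y := by
    simpa using ((hasDerivAt_id y).ofReal_comp).const_mul (-I * lam)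
  have := (Complex.hasDerivAt_exp (-I * lam * y)).comp y h1
  rwa [mul_comm (Complex.exp _)] at this

lemma continuous_expWave (j : ℕ) (lam κ : ℂ) : Continuous (expWave j lam κ) := by
  unfold expWave
  fun_prop

lemma IsMode.diracEq {ω : ℝ} {j : ℕ} {lam κ : ℂ} (h : IsMode ω j lam κ) :
    DiracEq (expWave j lam κ) (fun p => (ω : ℂ) • expWave j lam κ p) := by
  have hc := h.crossSection
  set e : ℝ → ℂ := fun y => Complex.exp (-I * lam * y) with he
  have ce : Continuous e := by fun_prop
  have cU := hc.cu
  have cV := hc.cv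
  have hU' : ∀ x, HasDerivAt (profU κ) (lam * profU κ x + I * ω * profV j κ x) x :=
    fun x => by simpa using hc.hu x
  have hV' : ∀ x, HasDerivAt (profV j κ) (-lam * profV j κ x + I * ω * profU κ x) x :=
    fun x => by simpa using hc.hv x
  refine ⟨fun φ a b c => ?_, fun φ a b c => ?_⟩
  · have t : IsTest φ := ⟨a, b⟩
    have φ0 : ∀ y, φ (0, y) = 0 := fun y => by
      by_contra hne
      exact lt_irrefl (0 : ℝ) (c (subset_tsupport φ hne))
    have p1 := strip_parts_fst t ce hV' (by fun_prop) (fun y => by rw [φ0, mul_zero])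
      (fun y => by rw [hc.v1, zero_mul])
    have p2 := strip_parts_snd t (hasDerivAt_expFactor lam) (by fun_prop) cV
    have i : ∀ {g : ℝ × ℝ → ℂ} {k : ℝ × ℝ → ℂ}, Continuous g → IsTest k →
        Integrable (fun p => g p * k p) μS := fun cg tk =>
      (Continuous.integrable_of_hasCompactSupport (cg.mul tk.cont) tk.supp.mul_left).restrict
    calc ∫ p in strip, (expWave j lam κ p).2 * (-I * dx φ p + dy φ p)
        = -I * (∫ p in strip, e p.2 * profV j κ p.1 * dx φ p) +
            ∫ p in strip, e p.2 * profV j κ p.1 * dy φ p := by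
          rw [← integral_const_mul, ← integral_add ((i (by fun_prop) t.dx).const_mul _)
            (i (by fun_prop) t.dy)]
          congr 1; ext p
          rw [show p = (p.1, p.2) from rfl, expWave_apply]
          ring
      _ = -∫ p in strip, ((ω : ℂ) • expWave j lam κ p).1 * φ p := by
          rw [p1, p2, mul_neg, ← neg_add, ← integral_const_mul,
            ← integral_add ((i (by fun_prop) t).const_mul _) (i (by fun_prop) t)]
          congr 2; ext p
          rw [show p = (p.1, p.2) from rfl, expWave_apply]
          simp only [he, Prod.smul_fst, smul_eq_mul]
          linear_combination (-e p.2 * φ p * ω * profU κ p.1) * I_sq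
  · have t : IsTest φ := ⟨a, b⟩
    have φ1 : ∀ y, φ (1, y) = 0 := fun y => by
      by_contra hne
      exact lt_irrefl (1 : ℝ) (c (subset_tsupport φ hne))
    have p1 := strip_parts_fst t ce hU' (by fun_prop) (fun y => by rw [hc.u0, zero_mul])
      (fun y => by rw [φ1, mul_zero])
    have p2 := strip_parts_snd t (hasDerivAt_expFactor lam) (by fun_prop) cU
    have i : ∀ {g : ℝ × ℝ → ℂ} {k : ℝ × ℝ → ℂ}, Continuous g → IsTest k →
        Integrable (fun p => g p * k p) μS := fun cg tk =>
      (Continuous.integrable_of_hasCompactSupport (cg.mul tk.cont) tk.supp.mul_left).restrict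
    calc ∫ p in strip, (expWave j lam κ p).1 * (-I * dx φ p - dy φ p)
        = -I * (∫ p in strip, e p.2 * profU κ p.1 * dx φ p) -
            ∫ p in strip, e p.2 * profU κ p.1 * dy φ p := by
          rw [← integral_const_mul, ← integral_sub ((i (by fun_prop) t.dx).const_mul _)
            (i (by fun_prop) t.dy)]
          congr 1; ext p
          rw [show p = (p.1, p.2) from rfl, expWave_apply]
          ring
      _ = -∫ p in strip, ((ω : ℂ) • expWave j lam κ p).2 * φ p := by
          rw [p1, p2, mul_neg, sub_neg_eq_add, neg_add_eq_sub, ← neg_sub, ← integral_const_mul,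
            ← integral_sub ((i (by fun_prop) t).const_mul _) (i (by fun_prop) t)]
          congr 2; ext p
          rw [show p = (p.1, p.2) from rfl, expWave_apply]
          simp only [he, Prod.smul_snd, smul_eq_mul]
          linear_combination (-e p.2 * φ p * ω * profV j κ p.1) * I_sq

/-- The form `q` on profiles. -/
def qProf (j : ℕ) (κ : ℂ) (j' : ℕ) (κ' : ℂ) : ℂ :=
  -∫ x in (0 : ℝ)..1, (profU κ x * conj (profV j' κ' x) -
    profV j κ x * conj (profU κ' x))

lemma continuous_profU (κ : ℂ) : Continuous (profU κ) := by unfold profU; fun_prop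

lemma continuous_profV (j : ℕ) (κ : ℂ) : Continuous (profV j κ) := by unfold profV; fun_prop

lemma qY_expWave_eq (j j' : ℕ) (lam κ lam' κ' : ℂ) (y : ℝ) :
    qY (expWave j lam κ) (expWave j' lam' κ') y =
      Complex.exp (-I * (lam - conj lam') * y) * qProf j κ j' κ' := by
  rw [qY, qProf, mul_neg, ← intervalIntegral.integral_const_mul]
  congr 1
  refine intervalIntegral.integral_congr fun x _ => ?_
  have e1 : Complex.exp (-I * (lam - conj lam') * y) =
      Complex.exp (-I * lam * y) * conj (Complex.exp (-I * lam' * y)) := by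
    rw [← Complex.exp_conj, ← Complex.exp_add]
    congr 1
    simp only [map_mul, map_neg, Complex.conj_I, conj_ofReal]
    ring
  simp only [expWave_apply, map_mul, e1]
  ring

/-- Modes with unrelated wave vectors have no mutual flux: `(λ - conj λ') q` is the integral of a
derivative vanishing at the boundary. -/
lemma qProf_eq_zero {ω : ℝ} {j j' : ℕ} {lam κ lam' κ' : ℂ} (h : IsMode ω j lam κ)
    (h' : IsMode ω j' lam' κ') (hne : lam ≠ conj lam') : qProf j κ j' κ' = 0 := by
  have hc := h.crossSection
  have hc' := h'.crossSection
  have cj : ∀ {f : ℝ → ℂ} {f' : ℂ} {x : ℝ}, HasDerivAt f f' x →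
      HasDerivAt (fun t => conj (f t)) (conj f') x := fun hf => hf.star
  have d : ∀ x, HasDerivAt (fun x => profU κ x * conj (profV j' κ' x) +
      profV j κ x * conj (profU κ' x))
      ((lam - conj lam') * (profU κ x * conj (profV j' κ' x) -
        profV j κ x * conj (profU κ' x))) x := by
    intro x
    refine (((hc.hu x).mul (cj (hc'.hv x))).add ((hc.hv x).mul (cj (hc'.hu x)))).congr_deriv ?_
    simp only [Pi.zero_apply, mul_zero, add_zero, map_add, map_mul, map_neg, Complex.conj_I,
      conj_ofReal]
    ring
  have c1 := continuous_profU κ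
  have c2 := continuous_profV j κ
  have c3 := continuous_profU κ'
  have c4 := continuous_profV j' κ'
  have key := intervalIntegral.integral_eq_sub_of_hasDerivAt (a := (0 : ℝ)) (b := 1)
    (fun x _ => d x) (Continuous.intervalIntegrable (by fun_prop) _ _)
  rw [hc.u0, hc'.u0, hc.v1, hc'.v1, intervalIntegral.integral_const_mul] at key
  simp only [zero_mul, mul_zero, map_zero, add_zero, sub_zero] at key
  rw [qProf, (mul_eq_zero.1 key).resolve_left (sub_ne_zero.2 hne), neg_zero]

/-- The flux of a mode against its conjugate. -/
lemma qProf_conj {ω : ℝ} {j : ℕ} {lam κ : ℂ} (h : IsMode ω j lam κ) (hκ : κ ≠ 0) :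
    qProf j κ j (conj κ) = I * (lam - 1) / ω := by
  have hω : (ω : ℂ) ≠ 0 := ofReal_ne_zero.2 h.energy_ne
  have e : ∀ x : ℝ, -(profU κ x * conj (profV j (conj κ) x) -
      profV j κ x * conj (profU (conj κ) x)) =
      (-1) ^ (j + 1) * I * (Complex.cos κ - Complex.cos (κ * (2 * x - 1))) := by
    intro x
    simp only [profU, profV, map_mul, conj_sign, ← Complex.sin_conj, map_sub, conj_conj,
      conj_ofReal, map_one, Complex.conj_I]
    have e1 : Complex.cos κ = Complex.cos (κ * x) * Complex.cos (κ * (x - 1)) +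
        Complex.sin (κ * x) * Complex.sin (κ * (x - 1)) := by
      rw [← Complex.cos_sub]; congr 1; ring
    have e2 : Complex.cos (κ * (2 * x - 1)) = Complex.cos (κ * x) * Complex.cos (κ * (x - 1)) -
        Complex.sin (κ * x) * Complex.sin (κ * (x - 1)) := by
      rw [← Complex.cos_add]; congr 1; ring
    rw [e1, e2]; ring
  have d : ∀ x : ℝ, HasDerivAt (fun x : ℝ => Complex.sin (κ * (2 * x - 1)) / (2 * κ))
      (Complex.cos (κ * (2 * x - 1))) x := by
    intro x
    have h1 : HasDerivAt (fun s : ℝ => κ * (2 * (s : ℂ) - 1)) (κ * 2) x := by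
      simpa using ((((hasDerivAt_id x).ofReal_comp).const_mul 2).sub_const 1).const_mul κ
    have := ((Complex.hasDerivAt_sin (κ * (2 * x - 1))).comp x h1).div_const (2 * κ)
    refine this.congr_deriv ?_
    field_simp
  have i1 := intervalIntegral.integral_eq_sub_of_hasDerivAt (a := (0 : ℝ)) (b := 1)
    (fun x _ => d x) (Continuous.intervalIntegrable (by fun_prop) _ _)
  rw [qProf, ← intervalIntegral.integral_neg]
  simp only [e]
  rw [intervalIntegral.integral_const_mul, intervalIntegral.integral_sub (by simp)
    (Continuous.intervalIntegrable (by fun_prop) _ _), i1, intervalIntegral.integral_const]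
  have e3 : κ * (2 * ((0 : ℝ) : ℂ) - 1) = -κ := by simp
  have e4 : κ * (2 * ((1 : ℝ) : ℂ) - 1) = κ := by push_cast; ring
  rw [e3, e4, Complex.sin_neg, sub_zero, one_smul]
  rw [eq_div_iff hω]
  have h1 : Complex.sin κ * ω / κ = (-1) ^ (j + 1) := by
    rw [mul_comm, h.sin_eq, mul_div_assoc, div_self hκ, mul_one]
  have h2 := h.cos_eq
  have h3 := sign_mul_self j
  have h4 : (-1) ^ (j + 1) * I * (Complex.cos κ -
      (Complex.sin κ / (2 * κ) - -Complex.sin κ / (2 * κ))) * ω =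
      (-1) ^ (j + 1) * I * (ω * Complex.cos κ - Complex.sin κ * ω / κ) := by
    field_simp
    ring
  rw [h4, h1, h2]
  linear_combination (I * (lam - 1)) * h3

lemma norm_expFactor (lam : ℂ) (y : ℝ) :
    ‖Complex.exp (-I * lam * y)‖ = exp (lam.im * y) := by
  rw [Complex.norm_exp]
  congr 1
  simp

lemma exists_profile_bound (j : ℕ) (lam κ : ℂ) : ∃ C : ℝ, 0 ≤ C ∧ ∀ p ∈ strip,
    ‖expWave j lam κ p‖ ≤ C * exp (lam.im * p.2) := by
  obtain ⟨C₁, h1⟩ := isCompact_Icc.exists_bound_of_continuousOn (s := Icc (0 : ℝ) 1)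
    ((continuous_profU κ).prodMk (continuous_profV j κ)).continuousOn
  refine ⟨C₁, (norm_nonneg _).trans (h1 0 (by simp)), fun p hp => ?_⟩
  have e : expWave j lam κ p =
      Complex.exp (-I * lam * p.2) • (profU κ p.1, profV j κ p.1) := rfl
  rw [e, norm_smul, norm_expFactor, mul_comm]
  exact mul_le_mul_of_nonneg_right (h1 _ ⟨hp.1.1.le, hp.1.2.le⟩) (Real.exp_pos _).le

/-! ### Bounds for the cross-section problem away from wave vectors -/

lemma csinc_eq_dslope : csinc = dslope Complex.sin 0 := by
  ext κ
  by_cases h : κ = 0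
  · simp [csinc, h, (Complex.hasDerivAt_sin 0).deriv]
  · rw [csinc, if_neg h, dslope_of_ne _ h, slope_def_field]
    simp

lemma differentiable_csinc : Differentiable ℂ csinc := by
  rw [csinc_eq_dslope, ← differentiableOn_univ, Complex.differentiableOn_dslope univ_mem]
  exact Complex.differentiable_sin.differentiableOn

@[fun_prop]
lemma continuous_csinc : Continuous csinc := differentiable_csinc.continuous

lemma sinOver_eq (κ : ℂ) (t : ℝ) : sinOver κ t = t * csinc (κ * t) := by
  unfold sinOver csinc
  by_cases h : κ = 0
  · simp [h]
  · by_cases ht : t = 0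
    · simp [ht]
    · have : (t : ℂ) ≠ 0 := ofReal_ne_zero.2 ht
      rw [if_neg h, if_neg (mul_ne_zero h this)]
      field_simp

lemma continuous_charFun : Continuous fun p : ℂ × ℂ => charFun p.1 p.2 := by
  unfold charFun
  fun_prop

lemma continuous_pairing_fund {a b : ℝ → ℂ} (ha : Continuous a) (hb : Continuous b) :
    Continuous fun p : ℝ × ℂ × ℂ => pairing a b (fundU p.1 p.2.2) (fundV p.2.1 p.2.2) := by
  unfold pairing fundU fundV cosAt
  simp only [sinOver_eq]
  refine intervalIntegral.continuous_parametric_intervalIntegral_of_continuous' ?_ 0 1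
  unfold Function.uncurry
  fun_prop

/-- Uniform bounds on a family of lines and energies, provided that the characteristic function
and the functionals have no common zero there. -/
lemma exists_lineBound {ι : Type*} [Fintype ι] {T S : Set ℝ} {ω₀ γ : ℝ} (hT : IsCompact T)
    (hS : IsCompact S) (h0 : 1 < ω₀) (hT0 : ∀ ω ∈ T, ω₀ ≤ ω) (hSγ : ∀ s ∈ S, |s| ≤ γ)
    (hγ : γ ≤ (ω₀ - 1) / 40) {a b : ι → ℝ → ℂ} (ha : ∀ i, Continuous (a i))
    (hb : ∀ i, Continuous (b i))
    (hz : ∀ ω ∈ T, ∀ lam κ : ℂ, -lam.im ∈ S → κ ^ 2 + lam ^ 2 = (ω : ℂ) ^ 2 →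
      |lam.re| ≤ 2 * ω → charFun lam κ = 0 → ∃ i, pairing (a i) (b i) (fundU ω κ) (fundV lam κ) ≠ 0) :
    ∃ K, ∀ ω ∈ T, ∀ s ∈ S, LineBound ω s K a b := by
  obtain ⟨W, hW⟩ := hT.isBounded.exists_norm_le
  obtain ⟨A, hA⟩ : ∃ A, 0 ≤ A ∧ ∀ i, ∀ x ∈ Icc (0 : ℝ) 1, ‖a i x‖ ≤ A ∧ ‖b i x‖ ≤ A := by
    obtain ⟨C, hC⟩ := isCompact_Icc.exists_bound_of_continuousOn (s := Icc (0 : ℝ) 1)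
      (f := fun x i => (a i x, b i x)) (by fun_prop)
    refine ⟨C, (norm_nonneg _).trans (hC 0 (by simp)), fun i x hx => ?_⟩
    have := (norm_le_pi_norm (fun i => (a i x, b i x)) i).trans (hC x hx)
    exact ⟨(norm_fst_le _).trans this, (norm_snd_le _).trans this⟩
  set L := 2 * W + γ with hL
  set B := W + L + 1 with hB
  set Z : Set (ℝ × ℂ × ℂ) := {p | p.1 ∈ T ∧ -p.2.1.im ∈ S ∧ |p.2.1.re| ≤ 2 * p.1 ∧
    p.2.2 ^ 2 + p.2.1 ^ 2 = (p.1 : ℂ) ^ 2} with hZ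
  have bounds : ∀ p ∈ Z, |p.1| ≤ B ∧ ‖p.2.1‖ ≤ B ∧ ‖p.2.2‖ ≤ B := by
    rintro ⟨ω, lam, κ⟩ ⟨h1, h2, h3, h4⟩
    dsimp only at h1 h2 h3 h4 ⊢
    have e1 : |ω| ≤ W := hW ω h1
    have e2 : |lam.im| ≤ γ := by rw [← abs_neg]; exact hSγ _ h2
    have e3 := (Complex.norm_le_abs_re_add_abs_im lam)
    have e4 : ‖lam‖ ≤ L := by linarith [le_abs_self ω]
    have e5 := norm_nonneg lam
    have e6 := abs_nonneg ω
    refine ⟨by linarith, by linarith, ?_⟩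
    have e7 : κ ^ 2 = (ω : ℂ) ^ 2 - lam ^ 2 := by linear_combination h4
    have e8 : ‖κ‖ ^ 2 ≤ W ^ 2 + L ^ 2 := by
      rw [← norm_pow, e7]
      refine (norm_sub_le _ _).trans ?_
      rw [norm_pow, norm_pow, norm_real, norm_eq_abs]
      gcongr
    refine le_of_sq_le_sq (e8.trans ?_) (by linarith)
    nlinarith
  have cZ : IsCompact Z := by
    refine Metric.isCompact_of_isClosed_isBounded ?_ ?_
    · refine (hT.isClosed.preimage continuous_fst).inter ((hS.isClosed.preimage
        (f := fun p : ℝ × ℂ × ℂ => -p.2.1.im) (by fun_prop)).inter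
        ((isClosed_le (f := fun p : ℝ × ℂ × ℂ => |p.2.1.re|) (by fun_prop) (by fun_prop)).inter
        (isClosed_eq (by fun_prop) (by fun_prop))))
    · refine (Metric.isBounded_closedBall (x := (0 : ℝ × ℂ × ℂ)) (r := B)).subset fun p hp => ?_
      obtain ⟨h1, h2, h3⟩ := bounds p hp
      rw [mem_closedBall_zero_iff]
      exact norm_prod_le_iff.2 ⟨h1, norm_prod_le_iff.2 ⟨h2, h3⟩⟩
  set Φ : ℝ × ℂ × ℂ → ℝ := fun p => ‖charFun p.2.1 p.2.2‖ +
    ∑ i, ‖pairing (a i) (b i) (fundU p.1 p.2.2) (fundV p.2.1 p.2.2)‖ with hΦ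
  have cΦ : Continuous Φ := by
    refine ((continuous_charFun.comp continuous_snd).norm).add
      (continuous_finsetSum _ fun i _ => (continuous_pairing_fund (ha i) (hb i)).norm)
  obtain ⟨c, c0, hc⟩ : ∃ c, 0 < c ∧ ∀ p ∈ Z, c ≤ Φ p := by
    rcases Z.eq_empty_or_nonempty with he | hne
    · exact ⟨1, one_pos, fun p hp => by simp [he] at hp⟩
    · obtain ⟨p, hp, hm⟩ := cZ.exists_isMinOn hne cΦ.continuousOn
      refine ⟨Φ p, ?_, fun q hq => hm hq⟩
      by_cases h : charFun p.2.1 p.2.2 = 0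
      · obtain ⟨i, hi⟩ := hz p.1 hp.1 p.2.1 p.2.2 hp.2.1 hp.2.2.2 hp.2.2.1 h
        refine add_pos_of_nonneg_of_pos (norm_nonneg _) (Finset.sum_pos' (fun i _ => norm_nonneg _)
          ⟨i, Finset.mem_univ i, norm_pos_iff.2 hi⟩)
      · exact add_pos_of_pos_of_nonneg (norm_pos_iff.2 h)
          (Finset.sum_nonneg fun i _ => norm_nonneg _)
  obtain ⟨K, K0, hK⟩ := crossSection_bound_near (ι := ι) (B := B) hA.1 c0
  refine ⟨K + 64 / (ω₀ - 1) ^ 2, fun ω hω s hs => ⟨by positivity, ha, hb,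
    fun lam hl u v F₁ F₂ hcs => ?_⟩⟩
  have n0 : 0 ≤ ∑ i, ‖pairing (a i) (b i) u v‖ ^ 2 := Finset.sum_nonneg fun i _ => by positivity
  have n1 := sqNorm_nonneg F₁ F₂
  have hω0 := hT0 ω hω
  have him : -lam.im ∈ S := by rw [hl, neg_neg]; exact hs
  rcases le_or_gt (2 * ω) |lam.re| with h | h
  · have e1 : |lam.im| ≤ (ω - 1) / 40 := by
      have := hSγ _ him
      rw [abs_neg] at this
      linarith
    refine (crossSection_bound_far (by linarith) h e1 hcs).trans ?_
    have e2 : 64 / (ω - 1) ^ 2 ≤ 64 / (ω₀ - 1) ^ 2 := by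
      have : 0 < ω₀ - 1 := by linarith
      gcongr
    refine mul_le_mul (e2.trans (by linarith)) (by linarith) n1 (by positivity)
  · obtain ⟨κ, hκ⟩ := IsAlgClosed.exists_pow_nat_eq ((ω : ℂ) ^ 2 - lam ^ 2) two_pos
    have hk : κ ^ 2 + lam ^ 2 = (ω : ℂ) ^ 2 := by rw [hκ]; ring
    have hp : ((ω, lam, κ) : ℝ × ℂ × ℂ) ∈ Z := ⟨hω, him, h.le, hk⟩
    obtain ⟨h1, h2, h3⟩ : |ω| ≤ B ∧ ‖lam‖ ≤ B ∧ ‖κ‖ ≤ B := bounds _ hp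
    have h4 := hc (ω, lam, κ) hp
    simp only [hΦ] at h4
    have h5 := hK ω lam κ a b hk h3 h2 h1 ha hb (fun i x hx => (hA.2 i x hx).1)
      (fun i x hx => (hA.2 i x hx).2) h4 u v F₁ F₂ hcs
    refine h5.trans ?_
    have : 0 ≤ 64 / (ω₀ - 1) ^ 2 := by positivity
    gcongr
    linarith

/-! ### Systems of waves built from modes -/

lemma sinOver_neg (κ : ℂ) : sinOver (-κ) = sinOver κ := by
  ext t
  unfold sinOver
  by_cases h : κ = 0
  · simp [h]
  · rw [if_neg h, if_neg (neg_ne_zero.2 h), neg_mul, Complex.sin_neg, neg_div_neg_eq]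

lemma fundU_neg (ω : ℝ) (κ : ℂ) : fundU ω (-κ) = fundU ω κ := by
  ext x; rw [fundU, fundU, sinOver_neg]

lemma fundV_neg (lam κ : ℂ) : fundV lam (-κ) = fundV lam κ := by
  ext x; rw [fundV, fundV, sinOver_neg, cosAt, cosAt, neg_mul, Complex.cos_neg]

/-- The profile of a mode is proportional to the solution with initial value `(0, 1)`. -/
lemma IsMode.profile_eq {ω : ℝ} {j : ℕ} {lam κ : ℂ} (h : IsMode ω j lam κ) (hκ : κ ≠ 0) (x : ℝ) :
    profU κ x = -(I * κ / ω) * fundU ω κ x ∧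
      profV j κ x = -(I * κ / ω) * fundV lam κ x := by
  have hω : (ω : ℂ) ≠ 0 := ofReal_ne_zero.2 h.energy_ne
  constructor
  · rw [profU, fundU, sinOver, if_neg hκ]
    field_simp
    linear_combination Complex.sin (κ * x) * I_sq
  · have e : Complex.sin (κ * ((x : ℂ) - 1)) =
        Complex.sin (κ * x) * Complex.cos κ - Complex.cos (κ * x) * Complex.sin κ := by
      rw [mul_sub, mul_one, Complex.sin_sub]
    have h1 : (-1) ^ (j + 1) * Complex.cos κ = lam / ω := by
      rw [eq_div_iff hω]
      linear_combination ((-1) ^ (j + 1) : ℂ) * h.cos_eq + lam * sign_mul_self j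
    have h2 : (-1) ^ (j + 1) * Complex.sin κ = κ / ω := by
      rw [eq_div_iff hω]
      linear_combination ((-1) ^ (j + 1) : ℂ) * h.sin_eq + κ * sign_mul_self j
    have h3 : profV j κ x = I * (Complex.sin (κ * x) * ((-1) ^ (j + 1) * Complex.cos κ) -
        Complex.cos (κ * x) * ((-1) ^ (j + 1) * Complex.sin κ)) := by
      rw [profV, e]; ring
    rw [h3, h1, h2, fundV, sinOver, if_neg hκ, cosAt]
    field_simp
    ring

/-- The functional `q(·, f)` for the profile `f` of a mode. -/
lemma pairing_fund_ne_zero {ω : ℝ} {j : ℕ} {lam κ κ' : ℂ} (h : IsMode ω j lam κ) (hκ : κ ≠ 0)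
    (h1 : lam ≠ 1) (h' : κ' ^ 2 + lam ^ 2 = (ω : ℂ) ^ 2) :
    pairing (fun x => -conj (profV j (conj κ) x))
      (fun x => conj (profU (conj κ) x)) (fundU ω κ') (fundV lam κ') ≠ 0 := by
  have hω : (ω : ℂ) ≠ 0 := ofReal_ne_zero.2 h.energy_ne
  have e : fundU ω κ' = fundU ω κ ∧ fundV lam κ' = fundV lam κ := by
    have : κ' ^ 2 = κ ^ 2 := by linear_combination h' - h.sq_add_sq
    rcases sq_eq_sq_iff_eq_or_eq_neg.1 this with rfl | rfl
    · exact ⟨rfl, rfl⟩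
    · exact ⟨fundU_neg _ _, fundV_neg _ _⟩
  rw [e.1, e.2]
  intro h0
  have h2 := qProf_conj h hκ
  have h3 : qProf j κ j (conj κ) = -(I * κ / ω) *
      pairing (fun x => -conj (profV j (conj κ) x))
      (fun x => conj (profU (conj κ) x)) (fundU ω κ) (fundV lam κ) := by
    rw [qProf, pairing, ← intervalIntegral.integral_neg, ← intervalIntegral.integral_const_mul]
    refine intervalIntegral.integral_congr fun x _ => ?_
    rw [(h.profile_eq hκ x).1, (h.profile_eq hκ x).2]
    ring
  rw [h0, mul_zero, h2] at h3
  have : I * (lam - 1) / ω ≠ 0 :=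
    div_ne_zero (mul_ne_zero Complex.I_ne_zero (sub_ne_zero.2 h1)) hω
  exact this h3

section

variable {ι : Type} [Fintype ι]

lemma continuous_comb {e : ι → Field2} (h : ∀ m, Continuous (e m)) (a : ι → ℂ) :
    Continuous (comb e a) :=
  continuous_finsetSum _ fun m _ => (h m).const_smul (a m)

lemma qY_comb_comb {e f : ι → Field2} (he : ∀ m, Continuous (e m)) (hf : ∀ m, Continuous (f m))
    (a b : ι → ℂ) (y : ℝ) : qY (comb e a) (comb f b) y =
      ∑ m, ∑ n, a m * conj (b n) * qY (e m) (f n) y := by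
  have se : ∀ m, SliceL2 (e m) y := fun m => sliceL2_of_continuous (he m) y
  have sf : ∀ m, SliceL2 (f m) y := fun m => sliceL2_of_continuous (hf m) y
  refine (qY_sum_left se (slice_comb sf b) a).trans (Finset.sum_congr rfl fun m _ => ?_)
  have := qY_sum_left sf (se m) b
  change a m * qY (e m) (comb f b) y = _
  rw [qY_conj (comb f b) (e m)]
  change qY (comb f b) (e m) y = _ at this
  rw [this, map_sum, ← Finset.sum_neg_distrib, Finset.mul_sum]
  refine Finset.sum_congr rfl fun n _ => ?_
  rw [qY_conj (f n) (e m), map_mul]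
  ring

variable [DecidableEq ι]

/-- A system of waves `w` given by the matrix `A` of its coefficients with respect to modes with
wave vectors `lam`. The waves are real in the sense that the coefficients with respect to the
conjugate modes are the conjugate ones. -/
structure ModeFrame (ω γ : ℝ) (τ : ι → Bool) (w : ι → Field2) (j : ι → ℕ) (lam κ : ι → ℂ)
    (A : Matrix ι ι ℂ) : Prop where
  mode : ∀ m, IsMode ω (j m) (lam m) (κ m)
  kappa_ne : ∀ m, κ m ≠ 0
  lam_inj : Function.Injective lam
  lam_ne_one : ∀ m, lam m ≠ 1
  im_lt : ∀ m, |(lam m).im| < γ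
  gram : ∀ c c', ∑ m, A c m * A c' m * (I * (lam m - 1) / ω) =
    if c = c' then (if τ c then I else -I) else 0
  wave_eq : ∀ c, w c = comb (fun m => expWave (j m) (lam m) (κ m)) (A c)
  wave_eq_conj : ∀ c, w c =
    comb (fun m => expWave (j m) (conj (lam m)) (conj (κ m)))
      (fun m => conj (A c m))

namespace ModeFrame

variable {ω γ : ℝ} {τ : ι → Bool} {w : ι → Field2} {j : ι → ℕ} {lam κ : ι → ℂ}
  {A : Matrix ι ι ℂ}

lemma qY_modes (h : ModeFrame ω γ τ w j lam κ A) (m n : ι) (y : ℝ) :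
    qY (expWave (j m) (lam m) (κ m))
      (expWave (j n) (conj (lam n)) (conj (κ n))) y =
      if m = n then I * (lam m - 1) / ω else 0 := by
  rw [qY_expWave_eq, conj_conj]
  split_ifs with hmn
  · subst hmn
    rw [sub_self, mul_zero, zero_mul, Complex.exp_zero, one_mul, qProf_conj (h.mode m)
      (h.kappa_ne m)]
  · rw [qProf_eq_zero (h.mode m) (h.mode n).conj, mul_zero]
    rw [conj_conj]
    exact fun e => hmn (h.lam_inj e)

lemma qY_comb_mode (h : ModeFrame ω γ τ w j lam κ A) (k : ι → ℂ) (n : ι) (y : ℝ) :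
    qY (comb (fun m => expWave (j m) (lam m) (κ m)) k)
      (expWave (j n) (conj (lam n)) (conj (κ n))) y =
      k n * (I * (lam n - 1) / ω) := by
  refine (qY_sum_left (fun m => sliceL2_of_continuous (continuous_expWave _ _ _) y)
    (sliceL2_of_continuous (continuous_expWave _ _ _) y) k).trans ?_
  simp only [h.qY_modes, mul_ite, mul_zero, Finset.sum_ite_eq', Finset.mem_univ, if_true]

lemma comb_wave (h : ModeFrame ω γ τ w j lam κ A) (a : ι → ℂ) :
    comb w a = comb (fun m => expWave (j m) (lam m) (κ m)) (vecMul a A) := by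
  ext p : 1
  simp only [comb, h.wave_eq, Finset.smul_sum, vecMul, dotProduct, Finset.sum_smul, mul_smul]
  exact Finset.sum_comm

lemma isUnit_matrix (h : ModeFrame ω γ τ w j lam κ A) : IsUnit A := by
  set D : Matrix ι ι ℂ := Matrix.diagonal fun m => I * (lam m - 1) / ω with hD
  set J : Matrix ι ι ℂ := Matrix.diagonal fun c => if τ c then -I else I with hJ
  have key : A * (D * A.transpose * J) = 1 := by
    have e : A * D * A.transpose =
        Matrix.diagonal fun c => if τ c then I else -I := by
      ext c c'
      rw [Matrix.mul_apply, Matrix.diagonal_apply, ← h.gram c c']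
      refine Finset.sum_congr rfl fun m _ => ?_
      rw [hD, Matrix.mul_diagonal, Matrix.transpose_apply]
      ring
    rw [← Matrix.mul_assoc, ← Matrix.mul_assoc, e, hJ, Matrix.diagonal_mul_diagonal,
      ← Matrix.diagonal_one]
    congr 1; ext c
    cases τ c <;> simp
  exact IsUnit.of_mul_eq_one _ key

lemma exists_bound (h : ModeFrame ω γ τ w j lam κ A) (hγ : 0 < γ) : ∃ γ', 0 ≤ γ' ∧ γ' < γ ∧
    ∀ m, |(lam m).im| ≤ γ' := by
  obtain ⟨o, ho⟩ := Finite.exists_max fun o : Option ι => o.elim 0 fun m => |(lam m).im|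
  refine ⟨_, ho none, ?_, fun m => ho (some m)⟩
  cases o
  exacts [hγ, h.im_lt _]

lemma waveSystem (h : ModeFrame ω γ τ w j lam κ A) (hγ : 0 < γ) : WaveSystem ω γ τ w where
  cont c := by
    rw [h.wave_eq c]
    exact continuous_comb (fun m => continuous_expWave _ _ _) _
  dirac c := by
    rw [h.wave_eq c]
    have l : ∀ m, LocL2 (expWave (j m) (lam m) (κ m)) := fun m =>
      locL2_of_continuous (continuous_expWave _ _ _)
    refine (DiracEq.sum (s := Finset.univ) (fun m _ => ((h.mode m).diracEq).const_smul (A c m))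
      (fun m _ => (l m).const_smul _) (fun m _ => ((l m).const_smul _).const_smul _)).congr
      (.of_forall fun p => rfl) (.of_forall fun p => ?_)
    simp only [comb, Finset.smul_sum, smul_comm (ω : ℂ)]
  bound := by
    obtain ⟨γ', h0, h1, h2⟩ := h.exists_bound hγ
    choose C hC0 hC using fun m => exists_profile_bound (j m) (lam m) (κ m)
    refine ⟨∑ c, ∑ m, ‖A c m‖ * C m, γ', Finset.sum_nonneg fun c _ => Finset.sum_nonneg fun m _ =>
      mul_nonneg (norm_nonneg _) (hC0 m), h0, h1, fun c p hp => ?_⟩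
    rw [h.wave_eq c, comb]
    calc ‖∑ m, A c m • expWave (j m) (lam m) (κ m) p‖
        ≤ ∑ m, ‖A c m‖ * C m * exp (γ' * |p.2|) := by
          refine (norm_sum_le _ _).trans (Finset.sum_le_sum fun m _ => ?_)
          rw [norm_smul, mul_assoc]
          gcongr
          refine (hC m p hp).trans ?_
          have : (lam m).im * p.2 ≤ γ' * |p.2| := by
            refine (le_abs_self _).trans ?_
            rw [abs_mul]
            exact mul_le_mul_of_nonneg_right (h2 m) (abs_nonneg _)
          have := hC0 m
          gcongr
      _ ≤ _ := by
          rw [← Finset.sum_mul]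
          refine mul_le_mul_of_nonneg_right ?_ (Real.exp_pos _).le
          exact Finset.single_le_sum (f := fun c => ∑ m, ‖A c m‖ * C m)
            (fun c _ => Finset.sum_nonneg fun m _ => mul_nonneg (norm_nonneg _) (hC0 m))
            (Finset.mem_univ c)
  flux c c' y := by
    rw [← h.gram c c', h.wave_eq c, h.wave_eq_conj c', qY_comb_comb
      (fun m => continuous_expWave _ _ _) (fun m => continuous_expWave _ _ _)]
    refine Finset.sum_congr rfl fun m _ => ?_
    simp only [h.qY_modes, mul_ite, mul_zero, Finset.sum_ite_eq, Finset.mem_univ, if_true,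
      conj_conj]

/-- The bounds on all lines, using the fluxes against the modes as functionals. -/
lemma symbolBounds_all (h : ModeFrame ω γ τ w j lam κ A) (h1 : 1 < ω)
    (hγ' : γ ≤ (ω - 1) / 40)
    (hz : ∀ l k : ℂ, |l.im| ≤ γ → k ^ 2 + l ^ 2 = (ω : ℂ) ^ 2 → |l.re| ≤ 2 * ω →
      charFun l k = 0 → ∃ m, l = lam m) :
    ∃ (K' : ℝ) (α β : ι → ℝ → ℂ), (∀ s, |s| ≤ γ → LineBound ω s K' α β) ∧
      ∀ i y, ∃ t : ι → ℂ, ∀ x, α i x = ∑ c, t c * -conj (w c (x, y)).2 ∧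
        β i x = ∑ c, t c * conj (w c (x, y)).1 := by
  set α : ι → ℝ → ℂ := fun i x => -conj (profV (j i) (conj (κ i)) x) with hα
  set β : ι → ℝ → ℂ := fun i x => conj (profU (conj (κ i)) x) with hβ
  have cα : ∀ i, Continuous (α i) := fun i =>
    (Complex.continuous_conj.comp (continuous_profV _ _)).neg
  have cβ : ∀ i, Continuous (β i) := fun i => Complex.continuous_conj.comp (continuous_profU _)
  obtain ⟨K, hK⟩ := exists_lineBound (T := {ω}) (S := Icc (-γ) γ) (γ := γ) isCompact_singleton
    isCompact_Icc h1 (fun ω' e => (mem_singleton_iff.1 e).ge) (fun s hs => abs_le.2 hs) hγ' cα cβ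
    (by
      rintro ω' rfl l k hl hk hr hc
      obtain ⟨m, rfl⟩ := hz l k (by rw [← abs_neg]; exact abs_le.2 hl) hk hr hc
      exact ⟨m, pairing_fund_ne_zero (h.mode m) (h.kappa_ne m) (h.lam_ne_one m) hk⟩)
  refine ⟨K, α, β, fun s hs => hK ω rfl s (abs_le.1 hs), fun i y => ?_⟩
  -- the conjugate modes are combinations of the waves, by the inverse matrix
  obtain ⟨B, hB⟩ := h.isUnit_matrix.exists_left_inv
  set E : ℂ := Complex.exp (-I * conj (lam i) * y) with hE
  have E0 : conj E ≠ 0 := (map_ne_zero _).2 (Complex.exp_ne_zero _)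
  have inv : ∀ p, expWave (j i) (conj (lam i)) (conj (κ i)) p =
      ∑ c, conj (B i c) • w c p := by
    intro p
    have e : ∀ m, ∑ c, B i c * A c m = if i = m then 1 else 0 := fun m => by
      rw [← Matrix.mul_apply, hB, Matrix.one_apply]
    simp only [h.wave_eq_conj, comb, Finset.smul_sum, smul_smul, ← map_mul]
    rw [Finset.sum_comm]
    simp only [← Finset.sum_smul, ← map_sum, e]
    simp [apply_ite]
  refine ⟨fun c => B i c / conj E, fun x => ?_⟩
  have i1 := inv (x, y)
  rw [expWave_apply] at i1
  have i2 := congrArg Prod.fst i1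
  have i3 := congrArg Prod.snd i1
  simp only [Prod.fst_sum, Prod.snd_sum, Prod.smul_fst, Prod.smul_snd, smul_eq_mul] at i2 i3
  constructor
  · have := congrArg (starRingEnd ℂ) i3
    simp only [map_mul, map_sum, conj_conj] at this
    simp only [hα, div_mul_eq_mul_div, mul_neg]
    rw [Finset.sum_neg_distrib, ← Finset.sum_div, ← this, hE, mul_div_cancel_left₀ _ E0]
  · have := congrArg (starRingEnd ℂ) i2
    simp only [map_mul, map_sum, conj_conj] at this
    simp only [hβ, div_mul_eq_mul_div]
    rw [← Finset.sum_div, ← this, hE, mul_div_cancel_left₀ _ E0]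

end ModeFrame

end

section

variable {ι : Type} [Fintype ι] [DecidableEq ι] {ω γ : ℝ} {τ : ι → Bool} {w : ι → Field2}
  {j : ι → ℕ} {lam κ : ι → ℂ} {A : Matrix ι ι ℂ}

/-- At an end of the ribbon, a combination of waves is square integrable if and only if it has no
contribution from the modes that do not decay there. -/
lemma ModeFrame.memLp_end_iff (h : ModeFrame ω γ τ w j lam κ A) {U : Set ℝ}
    (mU : MeasurableSet U) (vU : volume U = ⊤) {θ : ℝ} (hθ : ∀ y ∈ U, y = θ * |y|) (a : ι → ℂ) :
    MemLp (comb w a) 2 (volume.restrict (slab U)) ↔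
      ∀ m, 0 ≤ (lam m).im * θ → vecMul a A m = 0 := by
  rw [h.comb_wave]
  constructor
  · intro hm m hpos
    obtain ⟨C, hC0, hC⟩ := exists_profile_bound (j m) (conj (lam m))
      (conj (κ m))
    have key := qY_const_eq_zero (s := 0) (C := C) mU vU (by simpa using hm) (fun p hp => by
      refine (hC p (slab_subset_strip _ hp)).trans (mul_le_mul_of_nonneg_left
        (Real.exp_le_exp.2 ?_) hC0)
      rw [hθ p.2 hp.2, conj_im]
      nlinarith [mul_nonneg hpos (abs_nonneg p.2)])
      (.of_forall fun y _ => h.qY_comb_mode (vecMul a A) m y)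
    refine (mul_eq_zero.1 key).resolve_right (div_ne_zero (mul_ne_zero Complex.I_ne_zero
      (sub_ne_zero.2 (h.lam_ne_one m))) (ofReal_ne_zero.2 (h.mode m).energy_ne))
  · intro hk
    refine memLp_finsetSum Finset.univ fun m _ => ?_
    by_cases hm : 0 ≤ (lam m).im * θ
    · simp [hk m hm]
    · obtain ⟨C, hC0, hC⟩ := exists_profile_bound (j m) (lam m) (κ m)
      suffices h2 : MemLp (expWave (j m) (lam m) (κ m)) 2 (volume.restrict (slab U)) from
        h2.const_smul (vecMul a A m)
      refine ((memLp_exp_decay (k := -((lam m).im * θ)) (by linarith)).mono_measure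
        (Measure.restrict_mono (slab_subset_strip U) le_rfl)).of_le_mul (c := C)
        (continuous_expWave _ _ _).aestronglyMeasurable ?_
      filter_upwards [ae_restrict_mem (measurableSet_slab mU)] with p hp
      refine (hC p (slab_subset_strip _ hp)).trans (mul_le_mul_of_nonneg_left ?_ hC0)
      rw [norm_eq_abs, Real.abs_exp, Real.exp_le_exp]
      nth_rewrite 1 [hθ p.2 hp.2]
      linarith

lemma ModeFrame.memLp_right_iff (h : ModeFrame ω γ τ w j lam κ A) {R : ℝ} (hR : 0 < R)
    (a : ι → ℂ) : MemLp (comb w a) 2 (volume.restrict (slab (Ioi R))) ↔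
      ∀ m, 0 ≤ (lam m).im → vecMul a A m = 0 := by
  have := h.memLp_end_iff (θ := 1) measurableSet_Ioi Real.volume_Ioi
    (fun y hy => by rw [one_mul, abs_of_pos (hR.trans hy)]) a (U := Ioi R)
  simpa only [mul_one] using this

lemma ModeFrame.memLp_left_iff (h : ModeFrame ω γ τ w j lam κ A) {R : ℝ} (hR : 0 < R)
    (a : ι → ℂ) : MemLp (comb w a) 2 (volume.restrict (slab (Iio (-R)))) ↔
      ∀ m, (lam m).im ≤ 0 → vecMul a A m = 0 := by
  have := h.memLp_end_iff (θ := -1) measurableSet_Iio Real.volume_Iio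
    (fun y hy => by
      have : y < -R := hy
      rw [abs_of_neg (by linarith)]; ring) a (U := Iio (-R))
  simpa only [mul_neg, mul_one, Left.nonneg_neg_iff] using this

end

/-! ### The thresholds -/

lemma hasDerivAt_sinc {x : ℝ} (hx : x ≠ 0) :
    HasDerivAt sinc ((x * Real.cos x - Real.sin x) / x ^ 2) x := by
  have h1 : HasDerivAt (fun t => Real.sin t / t) ((Real.cos x * x - Real.sin x * 1) / x ^ 2) x :=
    (Real.hasDerivAt_sin x).div (hasDerivAt_id x) hx
  have h2 : sinc =ᶠ[𝓝 x] fun t => Real.sin t / t := by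
    filter_upwards [isOpen_ne.mem_nhds hx] with t ht using sinc_of_ne_zero ht
  refine (h1.congr_of_eventuallyEq h2).congr_deriv ?_
  ring

lemma sign_mul_sin_pos {n : ℕ} {x : ℝ} (h1 : n * π < x) (h2 : x < (n + 1) * π) :
    0 < (-1 : ℝ) ^ n * Real.sin x := by
  rw [← Real.sin_sub_nat_mul_pi]
  exact Real.sin_pos_of_pos_of_lt_pi (by linarith) (by linarith)

lemma neg_one_pow_mul_self (n : ℕ) : ((-1 : ℝ) ^ n) * (-1) ^ n = 1 := by
  rw [← mul_pow]; simp

lemma sin_nat_add_one_mul_pi (n : ℕ) : Real.sin ((n + 1) * π) = 0 := by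
  have := Real.sin_nat_mul_pi (n + 1)
  push_cast at this
  exact this

lemma cos_nat_add_one_mul_pi (n : ℕ) : Real.cos ((n + 1) * π) = (-1) ^ (n + 1) := by
  have := Real.cos_nat_mul_pi (n + 1)
  push_cast at this
  exact this

/-- The properties of the point `κ_j`: on the band the function `sinc` (up to a sign) increases to a
single peak and then decreases. -/
structure BandPeak (j : ℕ) (K : ℝ) : Prop where
  left_le : ((j : ℝ) - 1) * π ≤ K
  lt_right : K < j * π
  left_lt : 2 ≤ j → ((j : ℝ) - 1) * π < K
  crit : K * Real.cos K = Real.sin K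
  mono : StrictMonoOn (fun x => (-1 : ℝ) ^ (j + 1) * sinc x) (Icc (((j : ℝ) - 1) * π) K)
  anti : StrictAntiOn (fun x => (-1 : ℝ) ^ (j + 1) * sinc x) (Icc K (j * π))
  pos : 0 < (-1 : ℝ) ^ (j + 1) * sinc K
  crit_unique : ∀ x ∈ Icc (((j : ℝ) - 1) * π) (j * π),
    x * Real.cos x = Real.sin x → x = K

lemma cast_add_one_sub_one (n : ℕ) : ((n + 1 : ℕ) : ℝ) - 1 = n := by push_cast; ring

lemma neg_one_pow_add_two (n : ℕ) : (-1 : ℝ) ^ (n + 1 + 1) = (-1) ^ n := by ring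

/-- The numerator `x cos x - sin x` of the derivative of `sinc` is monotone on a band, so it
vanishes at a single point. -/
lemma exists_band_peak (n : ℕ) : ∃ K, BandPeak (n + 1) K := by
  have pi0 := pi_pos
  have n0 : (0 : ℝ) ≤ n * π := by positivity
  have nn := neg_one_pow_mul_self n
  have hab : n * π ≤ (n + 1) * π := by nlinarith
  set f : ℝ → ℝ := fun x => (-1) ^ n * (x * Real.cos x - Real.sin x) with hf
  have df : ∀ x, HasDerivAt f ((-1) ^ n * (-(x * Real.sin x))) x := by
    intro x
    refine ((((hasDerivAt_id x).mul (Real.hasDerivAt_cos x)).sub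
      (Real.hasDerivAt_sin x)).const_mul ((-1 : ℝ) ^ n)).congr_deriv ?_
    simp only [id]
    ring
  have cf : Continuous f := continuous_iff_continuousAt.2 fun x => (df x).continuousAt
  have anti : StrictAntiOn f (Icc (n * π) ((n + 1) * π)) := by
    refine strictAntiOn_of_deriv_neg (convex_Icc _ _) cf.continuousOn fun x hx => ?_
    rw [interior_Icc] at hx
    rw [(df x).deriv]
    nlinarith [mul_pos (n0.trans_lt hx.1) (sign_mul_sin_pos hx.1 hx.2)]
  have fa : f (n * π) = n * π := by
    simp only [hf, Real.cos_nat_mul_pi, Real.sin_nat_mul_pi]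
    linear_combination (n * π) * nn
  have fb : f ((n + 1) * π) = -((n + 1) * π) := by
    simp only [hf, cos_nat_add_one_mul_pi, sin_nat_add_one_mul_pi, pow_succ]
    linear_combination (-(n + 1) * π) * nn
  obtain ⟨K, hK, hK0⟩ := intermediate_value_Icc' hab cf.continuousOn
    (show (0 : ℝ) ∈ Icc (f ((n + 1) * π)) (f (n * π)) by
      rw [fa, fb]; constructor <;> nlinarith)
  have hKb : K < (n + 1) * π := lt_of_le_of_ne hK.2 fun e => by
    rw [e, fb] at hK0; nlinarith
  have hKa : 1 ≤ n → n * π < K := fun hn => lt_of_le_of_ne hK.1 fun e => by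
    rw [← e, fa] at hK0
    have : (1 : ℝ) ≤ n := by exact_mod_cast hn
    nlinarith
  have crit : K * Real.cos K = Real.sin K := by
    have : (-1 : ℝ) ^ n ≠ 0 := pow_ne_zero _ (by norm_num)
    exact sub_eq_zero.1 ((mul_eq_zero.1 hK0).resolve_left this)
  have ds : ∀ x, 0 < x → HasDerivAt (fun x => (-1 : ℝ) ^ n * sinc x) (f x / x ^ 2) x :=
    fun x hx => ((hasDerivAt_sinc hx.ne').const_mul _).congr_deriv (by rw [hf]; ring)
  have cs : Continuous fun x => (-1 : ℝ) ^ n * sinc x :=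
    Real.continuous_sinc.const_mul _
  refine ⟨K, ?_⟩
  constructor <;> try simp only [Nat.cast_add_one, add_sub_cancel_right, neg_one_pow_add_two]
  · exact hK.1
  · exact hKb
  · exact fun h => hKa (by omega)
  · exact crit
  · refine strictMonoOn_of_deriv_pos (convex_Icc _ _) cs.continuousOn fun x hx => ?_
    rw [interior_Icc] at hx
    have x0 := n0.trans_lt hx.1
    rw [(ds x x0).deriv]
    have : f K < f x := anti ⟨hx.1.le, hx.2.le.trans hK.2⟩ hK hx.2
    rw [hK0] at this
    positivity
  · refine strictAntiOn_of_deriv_neg (convex_Icc _ _) cs.continuousOn fun x hx => ?_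
    rw [interior_Icc] at hx
    have x0 := n0.trans_lt (hK.1.trans_lt hx.1)
    rw [(ds x x0).deriv]
    have : f x < f K := anti hK ⟨hK.1.trans hx.1.le, hx.2.le⟩ hx.1
    rw [hK0] at this
    exact div_neg_of_neg_of_pos this (by positivity)
  · rcases Nat.eq_zero_or_pos n with rfl | hn
    · have : K = 0 := by
        by_contra hne
        have hpos : 0 < K := lt_of_le_of_ne (by simpa using hK.1) (Ne.symm hne)
        have := anti (left_mem_Icc.2 hab) hK (by simpa using hpos)
        rw [fa, hK0] at this
        simp at this
      simp [this]
    · have h1 := hKa hn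
      rw [sinc_of_ne_zero (n0.trans_lt h1).ne', ← mul_div_assoc]
      exact div_pos (sign_mul_sin_pos h1 hKb) (n0.trans_lt h1)
  · exact fun x hx e => anti.injOn hx hK (by rw [hK0]; simp only [hf, e, sub_self, mul_zero])

lemma sinc_nat_mul_pi {n : ℕ} (hn : n ≠ 0) : sinc (n * π) = 0 := by
  rw [sinc_of_ne_zero (mul_ne_zero (Nat.cast_ne_zero.2 hn) pi_pos.ne'), Real.sin_nat_mul_pi,
    zero_div]

lemma sinc_band_nonneg {j : ℕ} (hj : 1 ≤ j) {x : ℝ} (hx : x ∈ band j) :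
    0 ≤ (-1 : ℝ) ^ (j + 1) * sinc x := by
  obtain ⟨n, rfl⟩ := Nat.exists_eq_add_of_le' hj
  obtain ⟨h1, h2⟩ := hx
  rw [cast_add_one_sub_one] at h1
  rw [Nat.cast_add_one] at h2
  rw [neg_one_pow_add_two]
  have n0 : (0 : ℝ) ≤ n * π := by have := pi_pos; positivity
  rcases eq_or_lt_of_le h1 with rfl | h
  · rcases eq_or_ne n 0 with rfl | hn
    · simp
    · simp [sinc_nat_mul_pi hn]
  · rw [sinc_of_ne_zero (n0.trans_lt h).ne', ← mul_div_assoc]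
    exact (div_pos (sign_mul_sin_pos h h2) (n0.trans_lt h)).le

lemma BandPeak.lt_peak {j : ℕ} {K x : ℝ} (h : BandPeak j K) (hx : x ∈ band j) (hne : x ≠ K) :
    (-1 : ℝ) ^ (j + 1) * sinc x < (-1 : ℝ) ^ (j + 1) * sinc K := by
  rcases lt_or_gt_of_ne hne with h1 | h1
  · exact h.mono ⟨hx.1, h1.le⟩ (right_mem_Icc.2 h.left_le) h1
  · exact h.anti (left_mem_Icc.2 h.lt_right.le) ⟨h1.le, hx.2.le⟩ h1

lemma bandPeak_kappaThr {j : ℕ} (hj : 1 ≤ j) : BandPeak j (kappaThr j) := by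
  obtain ⟨K, hK⟩ : ∃ K, BandPeak j K := by
    obtain ⟨n, rfl⟩ := Nat.exists_eq_add_of_le' hj
    exact exists_band_peak n
  have memK : K ∈ band j := ⟨hK.left_le, hK.lt_right⟩
  have sq : ∀ x, sinc x ^ 2 = ((-1 : ℝ) ^ (j + 1) * sinc x) ^ 2 := fun x => by
    rw [mul_pow, ← pow_mul, mul_comm (j + 1), pow_mul]; simp
  have e : {κ | κ ∈ band j ∧ IsMaxOn (fun t => sinc t ^ 2) (band j) κ} = {K} := by
    ext x
    constructor
    · rintro ⟨hx, hm⟩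
      by_contra hne
      have h1 := hm memK
      have h2 := hK.lt_peak hx hne
      have h3 := sinc_band_nonneg hj hx
      simp only [mem_ofPred_eq, sq] at h1
      nlinarith
    · rintro rfl
      refine ⟨memK, fun y hy => ?_⟩
      simp only [mem_ofPred_eq, sq]
      have h3 := sinc_band_nonneg hj hy
      by_cases hy' : y = x
      · rw [hy']
      · have h2 := hK.lt_peak hy hy'
        gcongr
  rw [kappaThr, e, csSup_singleton]
  exact hK

lemma omegaThr_inv {j : ℕ} (hj : 1 ≤ j) :
    (omegaThr j)⁻¹ = (-1 : ℝ) ^ (j + 1) * sinc (kappaThr j) := by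
  have h := (bandPeak_kappaThr hj).pos
  rw [omegaThr, inv_inv, ← abs_of_pos h, abs_mul, abs_pow, abs_neg, abs_one, one_pow, one_mul]

lemma omegaThr_pos {j : ℕ} (hj : 1 ≤ j) : 0 < omegaThr j := by
  rw [← inv_pos, omegaThr_inv hj]
  exact (bandPeak_kappaThr hj).pos

lemma kappaThr_nonneg {j : ℕ} (hj : 1 ≤ j) : 0 ≤ kappaThr j := by
  refine le_trans ?_ (bandPeak_kappaThr hj).left_le
  have : (1 : ℝ) ≤ j := by exact_mod_cast hj
  exact mul_nonneg (by linarith) pi_pos.le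

lemma omegaThr_cos {j : ℕ} (hj : 1 ≤ j) :
    omegaThr j * Real.cos (kappaThr j) = (-1) ^ (j + 1) ∧
      omegaThr j * Real.sin (kappaThr j) = (-1) ^ (j + 1) * kappaThr j := by
  have h := bandPeak_kappaThr hj
  have h0 := omegaThr_pos hj
  have e : sinc (kappaThr j) = Real.cos (kappaThr j) := by
    by_cases hk : kappaThr j = 0
    · simp [hk]
    · rw [sinc_of_ne_zero hk, ← h.crit, mul_div_cancel_left₀ _ hk]
  have h1 := omegaThr_inv hj
  rw [e] at h1
  have h2 := neg_one_pow_mul_self (j + 1)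
  have h3 : omegaThr j * Real.cos (kappaThr j) = (-1) ^ (j + 1) := by
    have : omegaThr j * (omegaThr j)⁻¹ = 1 := mul_inv_cancel₀ h0.ne'
    rw [h1] at this
    linear_combination ((-1 : ℝ) ^ (j + 1)) * this - omegaThr j * Real.cos (kappaThr j) * h2
  refine ⟨h3, ?_⟩
  rw [← h.crit]
  linear_combination kappaThr j * h3

lemma omegaThr_sq {j : ℕ} (hj : 1 ≤ j) : omegaThr j ^ 2 = 1 + kappaThr j ^ 2 := by
  obtain ⟨h1, h2⟩ := omegaThr_cos hj
  have h3 := neg_one_pow_mul_self (j + 1)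
  calc omegaThr j ^ 2 = (omegaThr j * Real.cos (kappaThr j)) ^ 2 +
        (omegaThr j * Real.sin (kappaThr j)) ^ 2 := by
        have := Real.sin_sq_add_cos_sq (kappaThr j)
        linear_combination -(omegaThr j ^ 2) * this
    _ = 1 + kappaThr j ^ 2 := by
        rw [h1, h2]
        linear_combination (1 + kappaThr j ^ 2) * h3

lemma omegaThr_strictMono {i j : ℕ} (hi : 1 ≤ i) (hij : i < j) : omegaThr i < omegaThr j := by
  have h1 := (bandPeak_kappaThr hi).lt_right
  have h2 := (bandPeak_kappaThr (hi.trans hij.le)).left_le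
  have h3 : (i : ℝ) + 1 ≤ j := by exact_mod_cast hij
  have h4 : kappaThr i < kappaThr j := by nlinarith [pi_pos]
  have h5 := kappaThr_nonneg hi
  have := omegaThr_sq hi
  have := omegaThr_sq (hi.trans hij.le)
  refine lt_of_pow_lt_pow_left₀ 2 (omegaThr_pos (hi.trans hij.le)).le ?_
  nlinarith

lemma kappaThr_gt_pi {j : ℕ} (hj : 2 ≤ j) : π < kappaThr j := by
  have h := (bandPeak_kappaThr (by omega : 1 ≤ j)).left_lt hj
  have : (2 : ℝ) ≤ j := by exact_mod_cast hj
  nlinarith [pi_pos]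

/-! ### The oscillatory modes -/

/-- The defining property of `κ_j^±`. -/
def IsOsc (ω : ℝ) (j : ℕ) (t : Bool) (x : ℝ) : Prop :=
  (if t then ((j : ℝ) - 1) * π < x ∧ x < kappaThr j
    else kappaThr j < x ∧ x < j * π) ∧ sinc x = (-1) ^ (j + 1) / ω

lemma sinc_eq_iff {ω x : ℝ} {j : ℕ} :
    sinc x = (-1) ^ (j + 1) / ω ↔ (-1 : ℝ) ^ (j + 1) * sinc x = ω⁻¹ := by
  have h3 := neg_one_pow_mul_self (j + 1)
  constructor
  · intro h
    rw [h, div_eq_mul_inv]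
    linear_combination ω⁻¹ * h3
  · intro h
    rw [div_eq_mul_inv, ← h]
    linear_combination -sinc x * h3

lemma IsOsc.unique {ω x x' : ℝ} {j : ℕ} {t : Bool} (hj : 1 ≤ j) (h : IsOsc ω j t x)
    (h' : IsOsc ω j t x') : x = x' := by
  have hb := bandPeak_kappaThr hj
  obtain ⟨h1, h⟩ := h
  obtain ⟨h2, h'⟩ := h'
  have e := (sinc_eq_iff.1 h).trans (sinc_eq_iff.1 h').symm
  cases t
  · exact hb.anti.injOn ⟨le_of_lt h1.1, le_of_lt h1.2⟩ ⟨le_of_lt h2.1, le_of_lt h2.2⟩ e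
  · exact hb.mono.injOn ⟨le_of_lt h1.1, le_of_lt h1.2⟩ ⟨le_of_lt h2.1, le_of_lt h2.2⟩ e

lemma exists_isOsc {ω : ℝ} {j : ℕ} {t : Bool} (hj : 1 ≤ j) (hω : omegaThr j < ω)
    (ht : t = true → 2 ≤ j) : ∃ x, IsOsc ω j t x := by
  have hb := bandPeak_kappaThr hj
  have ω0 : 0 < ω := (omegaThr_pos hj).trans hω
  have hlt : ω⁻¹ < (-1 : ℝ) ^ (j + 1) * sinc (kappaThr j) := by
    rw [← omegaThr_inv hj]
    exact inv_strictAnti₀ (omegaThr_pos hj) hω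
  have i0 : 0 < ω⁻¹ := inv_pos.2 ω0
  have cs : Continuous fun x => (-1 : ℝ) ^ (j + 1) * sinc x :=
    Real.continuous_sinc.const_mul _
  cases t
  · have end0 : (-1 : ℝ) ^ (j + 1) * sinc (j * π) = 0 := by
      rw [sinc_nat_mul_pi (by omega), mul_zero]
    obtain ⟨x, hx, he⟩ := intermediate_value_Icc' hb.lt_right.le cs.continuousOn
      (show ω⁻¹ ∈ Icc _ _ from ⟨by rw [end0]; exact i0.le, hlt.le⟩)
    refine ⟨x, ?_, sinc_eq_iff.2 he⟩
    refine ⟨lt_of_le_of_ne hx.1 fun e => ?_, lt_of_le_of_ne hx.2 fun e => ?_⟩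
    · dsimp only at he; rw [← e] at he; linarith
    · dsimp only at he; rw [e, end0] at he; linarith
  · have end0 : (-1 : ℝ) ^ (j + 1) * sinc (((j : ℝ) - 1) * π) = 0 := by
      have := sinc_nat_mul_pi (n := j - 1) (by have := ht rfl; omega)
      rw [Nat.cast_sub hj, Nat.cast_one] at this
      rw [this, mul_zero]
    obtain ⟨x, hx, he⟩ := intermediate_value_Icc hb.left_le cs.continuousOn
      (show ω⁻¹ ∈ Icc _ _ from ⟨by rw [end0]; exact i0.le, hlt.le⟩)
    refine ⟨x, ?_, sinc_eq_iff.2 he⟩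
    refine ⟨lt_of_le_of_ne hx.1 fun e => ?_, lt_of_le_of_ne hx.2 fun e => ?_⟩
    · dsimp only at he; rw [← e, end0] at he; linarith
    · dsimp only at he; rw [e] at he; linarith

lemma isOsc_kappaOsc {ω : ℝ} {j : ℕ} {t : Bool} (hj : 1 ≤ j) (hω : omegaThr j < ω)
    (ht : t = true → 2 ≤ j) : IsOsc ω j t (kappaOsc ω j t) := by
  obtain ⟨x, hx⟩ := exists_isOsc hj hω ht
  have e : {κ | IsOsc ω j t κ} = {x} :=
    eq_singleton_iff_unique_mem.2 ⟨hx, fun y hy => IsOsc.unique hj hy hx⟩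
  suffices h : kappaOsc ω j t = x by rw [h]; exact hx
  cases t <;> simp only [IsOsc, if_true, Bool.false_eq_true, if_false, and_assoc] at e <;>
    simp only [kappaOsc, e, csSup_singleton, csInf_singleton]

lemma IsOsc.mem_Ioo {ω x : ℝ} {j : ℕ} {t : Bool} (hj : 1 ≤ j) (h : IsOsc ω j t x) :
    ((j : ℝ) - 1) * π < x ∧ x < j * π := by
  have hb := bandPeak_kappaThr hj
  have h1 := h.1
  cases t
  · exact ⟨hb.left_le.trans_lt h1.1, h1.2⟩
  · exact ⟨h1.1, lt_trans h1.2 hb.lt_right⟩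

lemma IsOsc.pos {ω x : ℝ} {j : ℕ} {t : Bool} (hj : 1 ≤ j) (h : IsOsc ω j t x) : 0 < x := by
  refine lt_of_le_of_lt ?_ (h.mem_Ioo hj).1
  have : (1 : ℝ) ≤ j := by exact_mod_cast hj
  exact mul_nonneg (by linarith) pi_pos.le

/-- Every real root belongs to one of the families. -/
lemma exists_isOsc_of_sinc {N : ℕ} (hN : 1 ≤ N) {ω x : ℝ} (hω : 0 < ω)
    (hlow : ∀ j, 1 ≤ j → j < N → omegaThr j < ω) (hωN : ω ≤ omegaThr N) (hx : 0 ≤ x)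
    (h : |sinc x| = ω⁻¹) :
    (ω = omegaThr N ∧ x = kappaThr N) ∨
      ∃ j t, 1 ≤ j ∧ j < N ∧ (t = true → 2 ≤ j) ∧ IsOsc ω j t x := by
  have pi0 := pi_pos
  set n := ⌊x / π⌋₊ with hn
  have h1 : (n : ℝ) * π ≤ x := (le_div_iff₀ pi0).1 (Nat.floor_le (by positivity))
  have h2 : x < (n + 1) * π := (div_lt_iff₀ pi0).1 (Nat.lt_floor_add_one _)
  have hj : 1 ≤ n + 1 := by omega
  have hb := bandPeak_kappaThr hj
  have mem : x ∈ band (n + 1) := by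
    rw [band]; push_cast; simpa using ⟨h1, h2⟩
  have s0 := sinc_band_nonneg hj mem
  have e : (-1 : ℝ) ^ (n + 1 + 1) * sinc x = ω⁻¹ := by
    rw [← h, ← abs_of_nonneg s0, abs_mul, abs_pow, abs_neg, abs_one, one_pow, one_mul]
  have i0 : 0 < ω⁻¹ := by positivity
  by_cases hx' : x = kappaThr (n + 1)
  · have e2 : omegaThr (n + 1) = ω := by
      rw [hx', ← omegaThr_inv hj] at e
      exact inv_injective e
    rcases lt_trichotomy (n + 1) N with h3 | h3 | h3
    · exact absurd (hlow _ hj h3) (by rw [e2]; exact lt_irrefl _)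
    · left; rw [← h3]; exact ⟨e2.symm, hx'⟩
    · have := omegaThr_strictMono hN h3
      linarith
  · have h3 : ω⁻¹ < (omegaThr (n + 1))⁻¹ := by
      rw [omegaThr_inv hj, ← e]
      exact hb.lt_peak mem hx'
    have h4 : omegaThr (n + 1) < ω := by
      rwa [inv_lt_inv₀ hω (omegaThr_pos hj)] at h3
    have h5 : n + 1 < N := by
      by_contra hge
      rcases Nat.eq_or_lt_of_le (not_lt.1 hge) with h6 | h6
      · rw [← h6] at h4; linarith
      · have := omegaThr_strictMono hN h6
        linarith
    right
    rcases lt_or_gt_of_ne hx' with h6 | h6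
    · -- on the first band the peak is at the left end
      have n0 : n ≠ 0 := fun h0 => by
        have := hb.crit_unique 0 (by rw [h0]; constructor <;> simp [pi0.le]) (by simp)
        linarith
      have hleft : (((n + 1 : ℕ) : ℝ) - 1) * π < x := by
        refine lt_of_le_of_ne mem.1 fun h7 => i0.ne ?_
        rw [← e, ← h7, cast_add_one_sub_one, sinc_nat_mul_pi n0, mul_zero]
      exact ⟨n + 1, true, hj, h5, fun _ => by omega, ⟨hleft, h6⟩, sinc_eq_iff.2 e⟩
    · exact ⟨n + 1, false, hj, h5, by simp, ⟨h6, mem.2⟩, sinc_eq_iff.2 e⟩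

/-! ### The roots near a threshold -/

lemma csinc_of_ne {κ : ℂ} (h : κ ≠ 0) : csinc κ = Complex.sin κ / κ := if_neg h

lemma csinc_neg (κ : ℂ) : csinc (-κ) = csinc κ := by
  unfold csinc
  by_cases h : κ = 0
  · simp [h]
  · rw [if_neg h, if_neg (neg_ne_zero.2 h), Complex.sin_neg, neg_div_neg_eq]

lemma csinc_conj (κ : ℂ) : csinc (conj κ) = conj (csinc κ) := by
  unfold csinc
  by_cases h : κ = 0
  · simp [h]
  · rw [if_neg h, if_neg ((map_ne_zero _).2 h), Complex.sin_conj, map_div₀]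

lemma csinc_ofReal (x : ℝ) : csinc x = (sinc x : ℂ) := by
  unfold csinc sinc
  by_cases h : x = 0
  · simp [h]
  · rw [if_neg h, if_neg (ofReal_ne_zero.2 h)]
    push_cast
    rfl

lemma hasDerivAt_csinc {κ : ℂ} (h : κ ≠ 0) :
    HasDerivAt csinc ((Complex.cos κ - csinc κ) / κ) κ := by
  have h1 := (Complex.hasDerivAt_sin κ).div (hasDerivAt_id κ) h
  have h2 : csinc =ᶠ[𝓝 κ] fun t => Complex.sin t / t := by
    filter_upwards [isOpen_ne.mem_nhds h] with t ht using csinc_of_ne ht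
  refine (h1.congr_of_eventuallyEq h2).congr_deriv ?_
  rw [csinc_of_ne h]
  simp only [id]
  field_simp

/-- Near a nonzero critical point with nonzero value, `1 - csinc κ / csinc K` is the square of a
local coordinate. -/
lemma exists_local_coordinate {K : ℂ} (hK : K ≠ 0) (h0 : csinc K ≠ 0)
    (hd : Complex.cos K = csinc K) : ∃ (h : ℂ → ℂ) (h' : ℂ), h K = 0 ∧ h' ≠ 0 ∧
      HasStrictDerivAt h h' K ∧ ∀ κ, h κ ^ 2 = 1 - csinc κ / csinc K := by
  set f1 := dslope csinc K with hf1
  set m := dslope f1 K with hm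
  have df1 : Differentiable ℂ f1 := by
    rw [← differentiableOn_univ, hf1, Complex.differentiableOn_dslope univ_mem]
    exact differentiable_csinc.differentiableOn
  have dm : Differentiable ℂ m := by
    rw [← differentiableOn_univ, hm, Complex.differentiableOn_dslope univ_mem]
    exact df1.differentiableOn
  have fK : f1 K = 0 := by
    rw [hf1, dslope_same, (hasDerivAt_csinc hK).deriv, hd, sub_self, zero_div]
  have fac : ∀ κ, csinc κ - csinc K = (κ - K) ^ 2 * m κ := by
    intro κ
    have e1 : (κ - K) • f1 κ = csinc κ - csinc K := sub_smul_dslope _ _ _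
    have e2 : (κ - K) • m κ = f1 κ - f1 K := sub_smul_dslope _ _ _
    rw [fK, sub_zero] at e2
    rw [← e1, ← e2, smul_eq_mul, smul_eq_mul]
    ring
  have mK : m K = -csinc K / 2 := by
    have d2 : HasDerivAt (fun κ => (Complex.cos κ - csinc κ) / κ) (-csinc K) K := by
      refine (((Complex.hasDerivAt_cos K).sub (hasDerivAt_csinc hK)).div
        (hasDerivAt_id K) hK).congr_deriv ?_
      simp only [id, Pi.sub_apply, hd, sub_self]
      rw [csinc_of_ne hK]
      field_simp
      ring
    have lim1 := hasDerivAt_iff_tendsto_slope.1 d2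
    have lim2 : Tendsto (fun κ => 2 * m κ + (κ - K) * deriv m κ) (𝓝[≠] K) (𝓝 (2 * m K)) := by
      have c : Continuous (fun κ => 2 * m κ + (κ - K) * deriv m κ) := by
        have := dm.continuous
        have := (dm.contDiff (n := 1)).continuous_deriv le_rfl
        fun_prop
      have := (c.tendsto K).mono_left (nhdsWithin_le_nhds (s := {K}ᶜ))
      simpa using this
    have eq : slope (fun κ => (Complex.cos κ - csinc κ) / κ) K =ᶠ[𝓝[≠] K]
        fun κ => 2 * m κ + (κ - K) * deriv m κ := by
      filter_upwards [self_mem_nhdsWithin, nhdsWithin_le_nhds (isOpen_ne.mem_nhds hK)]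
        with κ hκ hκ0
      have hne : κ - K ≠ 0 := sub_ne_zero.2 hκ
      have e1 : HasDerivAt csinc (2 * (κ - K) * m κ + (κ - K) ^ 2 * deriv m κ) κ := by
        have e2 : csinc = fun κ => csinc K + (κ - K) ^ 2 * m κ := by
          ext t; rw [← fac t]; ring
        rw [e2]
        refine ((((hasDerivAt_id κ).sub_const K).pow 2).mul
          (dm κ).hasDerivAt).const_add _ |>.congr_deriv ?_
        simp
      have e3 := (hasDerivAt_csinc hκ0).unique e1
      rw [slope_def_field, hd, sub_self, zero_div, sub_zero, e3]
      field_simp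
    have := tendsto_nhds_unique (lim1.congr' eq) lim2
    linear_combination -(1 / 2 : ℂ) * this
  set r : ℂ → ℂ := fun κ => -m κ / csinc K with hr
  have rK : r K = (1 / 2 : ℝ) := by
    simp only [hr, mK]
    push_cast
    field_simp
  have slit : r K ∈ Complex.slitPlane := by
    rw [rK]; exact Complex.ofReal_mem_slitPlane.2 (by norm_num)
  have ar : AnalyticAt ℂ r K := (dm.analyticAt K).neg.div_const
  have ah : AnalyticAt ℂ (fun κ => (κ - K) * r κ ^ (1 / 2 : ℂ)) K :=
    (analyticAt_id.sub analyticAt_const).mul (ar.cpow analyticAt_const slit)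
  refine ⟨fun κ => (κ - K) * r κ ^ (1 / 2 : ℂ), r K ^ (1 / 2 : ℂ), by simp, ?_, ?_, fun κ => ?_⟩
  · rw [rK]
    exact (Complex.cpow_ne_zero_iff_of_exponent_ne_zero (by norm_num)).2 (by norm_num)
  · have hs := ah.hasStrictDerivAt
    have : HasDerivAt (fun κ => (κ - K) * r κ ^ (1 / 2 : ℂ)) (r K ^ (1 / 2 : ℂ)) K := by
      refine (((hasDerivAt_id K).sub_const K).mul
        (ar.cpow analyticAt_const slit).differentiableAt.hasDerivAt).congr_deriv ?_
      simp
    rwa [this.deriv] at hs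
  · have e : (r κ ^ (1 / 2 : ℂ)) ^ 2 = r κ := by
      have := Complex.cpow_nat_inv_pow (r κ) (two_ne_zero)
      rw [one_div]
      exact_mod_cast this
    rw [mul_pow, e]
    simp only [hr]
    have := fac κ
    field_simp
    linear_combination this

lemma omegaEps_inv (N : ℕ) (ε : ℝ) : (omegaEps N ε)⁻¹ = (omegaThr N)⁻¹ + ε := inv_inv _

lemma omegaEps_pos {N : ℕ} (hN : 1 ≤ N) {ε : ℝ} (hε : 0 ≤ ε) : 0 < omegaEps N ε :=
  inv_pos.2 (add_pos_of_pos_of_nonneg (inv_pos.2 (omegaThr_pos hN)) hε)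

lemma omegaEps_lt {N : ℕ} (hN : 1 ≤ N) {ε : ℝ} (hε : 0 < ε) : omegaEps N ε < omegaThr N := by
  have h := omegaThr_pos hN
  rw [← inv_lt_inv₀ h (omegaEps_pos hN hε.le), omegaEps_inv]
  linarith

lemma tendsto_omegaEps {N : ℕ} (hN : 1 ≤ N) :
    Tendsto (omegaEps N) (𝓝 0) (𝓝 (omegaThr N)) := by
  have h := omegaThr_pos hN
  have : ContinuousAt (omegaEps N) 0 := by
    unfold omegaEps
    refine ContinuousAt.inv₀ (by fun_prop) ?_
    rw [add_zero]
    exact (inv_pos.2 h).ne'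
  have h2 := this.tendsto
  rwa [show omegaEps N 0 = omegaThr N by rw [omegaEps, add_zero, inv_inv]] at h2

lemma csinc_kappaThr {N : ℕ} (hN : 1 ≤ N) :
    csinc (kappaThr N) = (-1) ^ (N + 1) / (omegaThr N : ℂ) := by
  rw [csinc_ofReal, sinc_eq_iff.2 (omegaThr_inv hN).symm]
  push_cast
  rfl

/-- The transversal wave numbers of the modes near the threshold. -/
lemma exists_threshold_roots {N : ℕ} (hN : 2 ≤ N) : ∃ r : ℝ, 0 < r ∧ r ≤ 1 ∧
    (∀ κ : ℂ, ‖κ - kappaThr N‖ < r → csinc κ = csinc (kappaThr N) → κ = kappaThr N) ∧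
    ∀ s : ℝ, 0 < s →
    ∀ᶠ ε in 𝓝[>] (0 : ℝ), ∃ k : ℂ, ‖k - kappaThr N‖ < s ∧ k ≠ conj k ∧
      csinc k = (-1) ^ (N + 1) / (omegaEps N ε : ℂ) ∧
      ∀ κ : ℂ, ‖κ - kappaThr N‖ < r → csinc κ = (-1) ^ (N + 1) / (omegaEps N ε : ℂ) →
        κ = k ∨ κ = conj k := by
  have hN1 : 1 ≤ N := by omega
  set K := kappaThr N with hK
  have Kpi : π < K := kappaThr_gt_pi hN
  have pi3 := Real.pi_gt_three
  have hb := bandPeak_kappaThr hN1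
  have ω0 := omegaThr_pos hN1
  have ωc : (omegaThr N : ℂ) ≠ 0 := ofReal_ne_zero.2 ω0.ne'
  have sg : ((-1 : ℂ) ^ (N + 1)) ≠ 0 := pow_ne_zero _ (by norm_num)
  have cK := csinc_kappaThr hN1
  have cK0 : csinc K ≠ 0 := by rw [cK]; exact div_ne_zero sg ωc
  have Kc : (K : ℂ) ≠ 0 := ofReal_ne_zero.2 (by linarith)
  have cosK : Complex.cos K = csinc K := by
    rw [csinc_of_ne Kc, eq_div_iff Kc, mul_comm]
    exact_mod_cast hb.crit
  obtain ⟨h, h', hK0, h'0, hs, hsq⟩ := exists_local_coordinate Kc cK0 cosK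
  set g := hs.localInverse h h' K h'0 with hg
  have left : ∀ᶠ x in 𝓝 (K : ℂ), g (h x) = x := hs.eventually_left_inverse h'0
  have right : ∀ᶠ y in 𝓝 (0 : ℂ), h (g y) = y := by
    have := hs.eventually_right_inverse h'0
    rwa [hK0] at this
  have gt : Tendsto g (𝓝 0) (𝓝 (K : ℂ)) := by
    have h1 : ContinuousAt g (h K) := (hs.to_localInverse h'0).hasDerivAt.continuousAt
    have h2 : g (h K) = K := left.self_of_nhds
    have := h1.tendsto
    rwa [h2, hK0] at this
  obtain ⟨r₁, r₁0, hr₁⟩ := Metric.eventually_nhds_iff_ball.1 left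
  set r := min (min r₁ 1) (min (K - ((N : ℝ) - 1) * π) (N * π - K)) with hr
  have r0 : 0 < r := by
    have := hb.left_lt hN
    have := hb.lt_right
    refine lt_min (lt_min r₁0 one_pos) (lt_min (by linarith) (by linarith))
  have inj : ∀ x y : ℂ, ‖x - K‖ < r → ‖y - K‖ < r → h x = h y → x = y := by
    intro x y hx hy e
    have h1 := hr₁ x (by rw [mem_ball_iff_norm]; exact hx.trans_le ((min_le_left _ _).trans
      (min_le_left _ _)))
    have h2 := hr₁ y (by rw [mem_ball_iff_norm]; exact hy.trans_le ((min_le_left _ _).trans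
      (min_le_left _ _)))
    rw [← h1, ← h2, e]
  refine ⟨r, r0, (min_le_left _ _).trans (min_le_right _ _), fun κ hκ e => ?_,
    fun s s0 => ?_⟩
  · refine inj _ _ hκ (by simpa using r0) ?_
    have := hsq κ
    rw [e, div_self cK0, sub_self] at this
    rw [hK0, pow_eq_zero_iff two_ne_zero |>.1 this]
  set T : ℝ → ℂ := fun ε => I * ((√(omegaThr N * ε) : ℝ) : ℂ) with hT
  have Tt : Tendsto T (𝓝[>] 0) (𝓝 0) := by
    have : Continuous T := by fun_prop
    have h2 := (this.tendsto 0).mono_left (nhdsWithin_le_nhds (s := Ioi 0))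
    simpa [hT] using h2
  have Tt' : Tendsto (fun ε => -T ε) (𝓝[>] 0) (𝓝 0) := by simpa using Tt.neg
  have near : ∀ᶠ z : ℂ in 𝓝 (K : ℂ), ‖z - (K : ℂ)‖ < min s r := by
    filter_upwards [Metric.ball_mem_nhds (K : ℂ) (lt_min s0 r0)] with z hz
    rwa [mem_ball_iff_norm] at hz
  filter_upwards [Tt.eventually right, Tt'.eventually right, Tt.eventually (gt.eventually near),
    Tt'.eventually (gt.eventually near), self_mem_nhdsWithin] with ε e1 e2 e3 e4 hε
  have hε : 0 < ε := hε
  have ωε := omegaEps_pos hN1 hε.le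
  have root : ∀ κ : ℂ, csinc κ = (-1) ^ (N + 1) / (omegaEps N ε : ℂ) ↔ h κ ^ 2 = T ε ^ 2 := by
    intro κ
    have hT2 : T ε ^ 2 = 1 - (omegaThr N : ℂ) * ((omegaThr N : ℂ)⁻¹ + ε) := by
      simp only [hT]
      rw [mul_pow, I_sq, ← Complex.ofReal_pow, Real.sq_sqrt (by positivity)]
      push_cast
      field_simp
      ring
    have hinv : ((omegaThr N : ℂ)⁻¹ + ε) = (omegaEps N ε : ℂ)⁻¹ := by
      rw [← Complex.ofReal_inv, ← Complex.ofReal_inv, omegaEps_inv]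
      push_cast
      rfl
    rw [hsq, hT2, hinv, sub_right_inj, div_eq_iff cK0, cK, div_eq_mul_inv]
    constructor
    · intro e
      rw [e]
      field_simp
    · intro e
      rw [e]
      field_simp
  have real_no : ∀ x : ℝ, ‖(x : ℂ) - K‖ < r → csinc x ≠ (-1) ^ (N + 1) / (omegaEps N ε : ℂ) := by
    intro x hx e
    have hx' : |x - K| < r := by
      rwa [← Complex.ofReal_sub, norm_real, norm_eq_abs] at hx
    have h1 : |x - K| < K - ((N : ℝ) - 1) * π :=
      hx'.trans_le ((min_le_right _ _).trans (min_le_left _ _))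
    have h2 : |x - K| < N * π - K :=
      hx'.trans_le ((min_le_right _ _).trans (min_le_right _ _))
    rw [abs_lt] at h1 h2
    have mem : x ∈ band N := ⟨by linarith [h1.1], by linarith [h2.2]⟩
    have e3 : sinc x = (-1) ^ (N + 1) / omegaEps N ε := by
      rw [csinc_ofReal] at e
      exact_mod_cast e
    have e4 := sinc_eq_iff.1 e3
    have h5 : (-1 : ℝ) ^ (N + 1) * sinc x ≤ (omegaThr N)⁻¹ := by
      rw [omegaThr_inv hN1]
      by_cases hxK : x = K
      · rw [hxK]
      · exact (hb.lt_peak mem hxK).le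
    rw [e4, omegaEps_inv] at h5
    linarith
  set k := g (T ε) with hk
  have kr : ‖k - K‖ < r := e3.trans_le (min_le_right _ _)
  have kc : csinc k = (-1) ^ (N + 1) / (omegaEps N ε : ℂ) := (root k).2 (by rw [e1])
  have kreal : k ≠ conj k := by
    intro e
    have e5 := (Complex.conj_eq_iff_real.1 e.symm)
    obtain ⟨x, hx⟩ := e5
    rw [hx] at kr kc
    exact real_no x kr kc
  have all : ∀ κ : ℂ, ‖κ - K‖ < r → csinc κ = (-1) ^ (N + 1) / (omegaEps N ε : ℂ) →
      κ = k ∨ κ = g (-T ε) := by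
    intro κ h1 h2
    rcases sq_eq_sq_iff_eq_or_eq_neg.1 ((root κ).1 h2) with h3 | h3
    · exact Or.inl (inj _ _ h1 kr (by rw [h3, e1]))
    · exact Or.inr (inj _ _ h1 (e4.trans_le (min_le_right _ _)) (by rw [h3, e2]))
  have conj_root : conj k = g (-T ε) := by
    refine (all _ ?_ ?_).resolve_left (Ne.symm kreal)
    · rw [← conj_ofReal K, ← map_sub, RCLike.norm_conj]
      exact kr
    · rw [csinc_conj, kc]
      simp
  exact ⟨k, e3.trans_le (min_le_left _ _), kreal, kc, fun κ h1 h2 => by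
    rw [conj_root]; exact all κ h1 h2⟩

lemma kappaOf_sq (N : ℕ) (ε : ℝ) (lam : ℂ) :
    kappaOf N ε lam ^ 2 = (omegaEps N ε : ℂ) ^ 2 - lam ^ 2 := by
  have := Complex.cpow_nat_inv_pow ((omegaEps N ε : ℂ) ^ 2 - lam ^ 2) (two_ne_zero)
  rw [kappaOf, one_div]
  exact_mod_cast this

lemma gFun_eq (N : ℕ) (ε : ℝ) (lam : ℂ) : gFun N ε lam = csinc (kappaOf N ε lam) := rfl

lemma gFun_eq_of_sq {N : ℕ} {ε : ℝ} {lam κ : ℂ}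
    (h : κ ^ 2 + lam ^ 2 = (omegaEps N ε : ℂ) ^ 2) : gFun N ε lam = csinc κ := by
  have : kappaOf N ε lam ^ 2 = κ ^ 2 := by rw [kappaOf_sq]; linear_combination -h
  rw [gFun_eq]
  rcases sq_eq_sq_iff_eq_or_eq_neg.1 this with e | e <;> rw [e]
  exact csinc_neg κ

lemma isMode_of_csinc {ω : ℝ} {j : ℕ} {k : ℂ} (hω : ω ≠ 0) (hk : k ≠ 0)
    (h : csinc k = (-1) ^ (j + 1) / (ω : ℂ)) :
    IsMode ω j ((-1) ^ (j + 1) * ω * Complex.cos k) k where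
  sin_eq := by
    have hc : (ω : ℂ) ≠ 0 := ofReal_ne_zero.2 hω
    rw [csinc_of_ne hk, div_eq_div_iff hk hc] at h
    linear_combination h
  cos_eq := by
    linear_combination (-(ω : ℂ) * Complex.cos k) * sign_mul_self j
  energy_ne := hω

lemma IsMode.csinc_eq {ω : ℝ} {j : ℕ} {lam κ : ℂ} (h : IsMode ω j lam κ) (hκ : κ ≠ 0) :
    csinc κ = (-1) ^ (j + 1) / (ω : ℂ) := by
  have hc : (ω : ℂ) ≠ 0 := ofReal_ne_zero.2 h.energy_ne
  rw [csinc_of_ne hκ, div_eq_div_iff hκ hc]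
  linear_combination h.sin_eq

/-- The pair of nonreal modes near the threshold, with the information that is needed about
it. -/
structure ThresholdMode (N : ℕ) (ε a' : ℝ) (lam : ℂ) : Prop where
  dist_lam : ‖lam - 1‖ < a'
  dist_kappa : ‖kappaOf N ε lam - kappaThr N‖ < a'
  mode : IsMode (omegaEps N ε) N lam (kappaOf N ε lam)
  kappa_conj : kappaOf N ε (conj lam) = conj (kappaOf N ε lam)
  slit : (omegaEps N ε : ℂ) ^ 2 - lam ^ 2 ∈ Complex.slitPlane
  im_pos : 0 < lam.im

/-- A nonreal root `κ` near `κ_N` gives the wave vector `±ω cos κ` near `1`. Conversely a wave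
vector near `1` has its `kappaOf` near `κ_N`, by continuity of the principal branch. -/
lemma exists_isLambdaPlus {N : ℕ} (hN : 2 ≤ N) : ∃ a : ℝ, 0 < a ∧ ∀ a' : ℝ, 0 < a' →
    ∀ᶠ ε in 𝓝[>] (0 : ℝ), ∃ lam, IsLambdaPlus N ε a lam ∧ ThresholdMode N ε a' lam := by
  have hN1 : 1 ≤ N := by omega
  have Kpi : π < kappaThr N := kappaThr_gt_pi hN
  have pi3 := Real.pi_gt_three
  obtain ⟨r, r0, r1, -, hr⟩ := exists_threshold_roots hN
  set K := kappaThr N with hK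
  have tω : ContinuousAt (omegaEps N) 0 := by
    have := tendsto_omegaEps hN1
    rwa [ContinuousAt, show omegaEps N 0 = omegaThr N by rw [omegaEps, add_zero, inv_inv]]
  have ω0 : omegaEps N 0 = omegaThr N := by rw [omegaEps, add_zero, inv_inv]
  have base0 : (omegaEps N 0 : ℂ) ^ 2 - 1 ^ 2 = ((K ^ 2 : ℝ) : ℂ) := by
    have := omegaThr_sq hN1
    rw [ω0]
    rw [show K ^ 2 = omegaThr N ^ 2 - 1 by rw [this]; ring]
    push_cast; ring
  have slit0 : (omegaEps N 0 : ℂ) ^ 2 - 1 ^ 2 ∈ Complex.slitPlane := by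
    rw [base0]
    have K0 : 0 < K := by linarith
    exact Complex.ofReal_mem_slitPlane.2 (by positivity)
  have cω : ContinuousAt (fun p : ℝ × ℂ => (omegaEps N p.1 : ℂ)) (0, 1) :=
    Complex.continuous_ofReal.continuousAt.comp (ContinuousAt.comp (g := omegaEps N)
      (f := Prod.fst) (x := ((0, 1) : ℝ × ℂ)) tω continuousAt_fst)
  have cbase : ContinuousAt (fun p : ℝ × ℂ => (omegaEps N p.1 : ℂ) ^ 2 - p.2 ^ 2) (0, 1) :=
    (cω.pow 2).sub (continuousAt_snd.pow 2)
  have ck : ContinuousAt (fun p : ℝ × ℂ => kappaOf N p.1 p.2) (0, 1) :=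
    cbase.cpow continuousAt_const slit0
  have k01 : kappaOf N 0 1 = K := by
    rw [kappaOf, base0, Complex.ofReal_pow, one_div]
    have := Complex.pow_cpow_nat_inv (x := (K : ℂ)) (n := 2) two_ne_zero
      (by rw [Complex.arg_ofReal_of_nonneg (by linarith)]; have := pi_pos; simp; linarith)
      (by rw [Complex.arg_ofReal_of_nonneg (by linarith)]; positivity)
    exact_mod_cast this
  -- the wave vector as a function of the transversal wave number
  set c : ℝ × ℂ → ℂ := fun p => (-1) ^ (N + 1) * omegaEps N p.1 * Complex.cos p.2 with hc
  have cc : ContinuousAt c (0, (K : ℂ)) := by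
    have h1 : ContinuousAt (fun p : ℝ × ℂ => (omegaEps N p.1 : ℂ)) (0, (K : ℂ)) :=
      Complex.continuous_ofReal.continuousAt.comp
        (ContinuousAt.comp (g := omegaEps N) (f := Prod.fst) (x := ((0, (K : ℂ)) : ℝ × ℂ)) tω
          continuousAt_fst)
    exact (continuousAt_const.mul h1).mul
      (Complex.continuous_cos.continuousAt.comp continuousAt_snd)
  have c01 : c (0, (K : ℂ)) = 1 := by
    have h1 := (omegaThr_cos hN1).1
    have h2 : (omegaThr N : ℂ) * Complex.cos K = (-1) ^ (N + 1) := by exact_mod_cast h1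
    simp only [hc, ω0]
    rw [mul_assoc, h2, sign_mul_self]
  have near_c : ∀ b : ℝ, 0 < b → ∃ s, 0 < s ∧ ∀ (ε : ℝ) (κ : ℂ), |ε| < s → ‖κ - K‖ < s →
      ‖c (ε, κ) - 1‖ < b := by
    intro b b0
    obtain ⟨s, s0, hs⟩ := Metric.continuousAt_iff.1 cc b b0
    refine ⟨s, s0, fun ε κ h1 h2 => ?_⟩
    have := @hs (ε, κ) (by
      rw [Prod.dist_eq, max_lt_iff, Real.dist_eq, sub_zero, dist_eq_norm]; exact ⟨h1, h2⟩)
    rwa [c01, dist_eq_norm] at this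
  obtain ⟨r₂, r₂0, hr₂⟩ := near_c (1 / 2) (by norm_num)
  set ρ := min r r₂ with hρ
  have ρ0 : 0 < ρ := lt_min r0 r₂0
  obtain ⟨a₀, a₀0, ha₀⟩ : ∃ a₀ : ℝ, 0 < a₀ ∧ ∀ (ε : ℝ) (z : ℂ), |ε| < a₀ → ‖z - 1‖ < a₀ →
      ‖kappaOf N ε z - K‖ < ρ ∧ (omegaEps N ε : ℂ) ^ 2 - z ^ 2 ∈ Complex.slitPlane := by
    have h1 : ∀ᶠ p in 𝓝 ((0, 1) : ℝ × ℂ), ‖kappaOf N p.1 p.2 - K‖ < ρ ∧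
        (omegaEps N p.1 : ℂ) ^ 2 - p.2 ^ 2 ∈ Complex.slitPlane := by
      refine Filter.Eventually.and ?_ (cbase.eventually_mem (Complex.isOpen_slitPlane.mem_nhds slit0))
      have h2 := ck.eventually_mem (Metric.ball_mem_nhds _ ρ0)
      filter_upwards [h2] with p hp
      rw [mem_ball_iff_norm] at hp
      rwa [k01] at hp
    obtain ⟨a₀, a₀0, h2⟩ := Metric.eventually_nhds_iff.1 h1
    refine ⟨a₀, a₀0, fun ε z h3 h4 => @h2 (ε, z) ?_⟩
    rw [Prod.dist_eq, max_lt_iff, Real.dist_eq, sub_zero, dist_eq_norm]; exact ⟨h3, h4⟩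
  set a := min (a₀ / 2) (1 / 2) with ha
  have a0 : 0 < a := lt_min (by linarith) (by norm_num)
  refine ⟨a, a0, fun a' a'0 => ?_⟩
  obtain ⟨s₁, s₁0, hs₁⟩ := near_c (min a a') (lt_min a0 a'0)
  set s := min (min s₁ ρ) a' with hs
  have s0 : 0 < s := lt_min (lt_min s₁0 ρ0) a'0
  have e0 : ∀ᶠ ε in 𝓝[>] (0 : ℝ), |ε| < min (min s₁ r₂) a₀ := by
    have : ∀ᶠ ε in 𝓝 (0 : ℝ), |ε| < min (min s₁ r₂) a₀ := by
      have h1 := Metric.ball_mem_nhds (0 : ℝ) (lt_min (lt_min s₁0 r₂0) a₀0)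
      filter_upwards [h1] with ε hε
      rwa [mem_ball_zero_iff, norm_eq_abs] at hε
    exact this.filter_mono nhdsWithin_le_nhds
  filter_upwards [hr s s0, e0, self_mem_nhdsWithin] with ε hk eε hε
  obtain ⟨k, ks, kreal, kc, kall⟩ := hk
  have ωε := omegaEps_pos hN1 (le_of_lt (show 0 < ε from hε))
  have es₁ : |ε| < s₁ := eε.trans_le ((min_le_left _ _).trans (min_le_left _ _))
  have er₂ : |ε| < r₂ := eε.trans_le ((min_le_left _ _).trans (min_le_right _ _))
  have ea₀ : |ε| < a₀ := eε.trans_le (min_le_right _ _)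
  have aa : a < a₀ := (min_le_left _ _).trans_lt (by linarith)
  have ne0 : ∀ κ : ℂ, ‖κ - K‖ < 1 → κ ≠ 0 := by
    rintro κ hκ rfl
    rw [zero_sub, norm_neg, norm_real, norm_eq_abs, abs_of_pos (by linarith)] at hκ
    linarith
  -- the branch of the root
  have branch : ∀ z κ : ℂ, ‖z - 1‖ ≤ a → ‖κ - K‖ < ρ → IsMode (omegaEps N ε) N z κ →
      kappaOf N ε z = κ := by
    intro z κ hz hκ hm
    have h1 : kappaOf N ε z ^ 2 = κ ^ 2 := by
      rw [kappaOf_sq, ← hm.sq_add_sq]; ring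
    refine (sq_eq_sq_iff_eq_or_eq_neg.1 h1).resolve_right fun h2 => ?_
    have h3 := (ha₀ ε z ea₀ (hz.trans_lt aa)).1
    rw [h2] at h3
    have h4 : ‖((2 * K : ℝ) : ℂ)‖ ≤ ‖-κ - K‖ + ‖κ - K‖ := by
      rw [← norm_neg (-κ - (K : ℂ))]
      have : ((2 * K : ℝ) : ℂ) = -(-κ - K) - (κ - K) := by push_cast; ring
      rw [this]
      exact norm_sub_le _ _
    rw [norm_real, norm_eq_abs, abs_of_pos (by linarith)] at h4
    have : ρ ≤ 1 := (min_le_left _ _).trans r1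
    linarith
  have conjK : ∀ κ : ℂ, ‖conj κ - K‖ = ‖κ - K‖ := fun κ => by
    conv_lhs => rw [← conj_ofReal K, ← map_sub, RCLike.norm_conj]
  have conj1 : ∀ z : ℂ, ‖conj z - 1‖ = ‖z - 1‖ := fun z => by
    conv_lhs => rw [← map_one (starRingEnd ℂ), ← map_sub, RCLike.norm_conj]
  have kρ : ‖k - K‖ < ρ := ks.trans_le ((min_le_left _ _).trans (min_le_right _ _))
  have k0 : k ≠ 0 := ne0 k (kρ.trans_le ((min_le_left _ _).trans r1))
  set l : ℂ := c (ε, k) with hl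
  have ml : IsMode (omegaEps N ε) N l k := isMode_of_csinc ωε.ne' k0 kc
  have l1 : ‖l - 1‖ < min a a' :=
    hs₁ ε k es₁ (ks.trans_le ((min_le_left _ _).trans (min_le_left _ _)))
  have la : ‖l - 1‖ ≤ a := (l1.trans_le (min_le_left _ _)).le
  have kl : kappaOf N ε l = k := branch l k la kρ ml
  have kl' : kappaOf N ε (conj l) = conj k :=
    branch _ _ (by rw [conj1]; exact la) (by rw [conjK]; exact kρ) ml.conj
  have roots : ∀ z : ℂ, ‖z - 1‖ ≤ a → (gFun N ε z = (-1) ^ (N + 1) / (omegaEps N ε : ℂ) ↔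
      z = l ∨ z = conj l) := by
    intro z hz
    have hzρ := (ha₀ ε z ea₀ (hz.trans_lt aa)).1
    rw [gFun_eq]
    constructor
    · intro e
      have zk : kappaOf N ε z ≠ 0 := ne0 _ (hzρ.trans_le ((min_le_left _ _).trans r1))
      -- the wave vector is determined by the transversal wave number
      have det : z = c (ε, kappaOf N ε z) := by
        have h1 := (isMode_of_csinc ωε.ne' zk e).sq_add_sq
        have h2 : z ^ 2 = c (ε, kappaOf N ε z) ^ 2 := by
          have h3 := kappaOf_sq N ε z
          simp only [hc]
          linear_combination h3 - h1
        refine (sq_eq_sq_iff_eq_or_eq_neg.1 h2).resolve_right fun h3 => ?_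
        have h4 := hr₂ ε _ er₂ (hzρ.trans_le (min_le_right _ _))
        have h5 : ‖(2 : ℂ)‖ ≤ ‖z - 1‖ + ‖c (ε, kappaOf N ε z) - 1‖ := by
          rw [← norm_neg (z - 1)]
          have : (2 : ℂ) = -(z - 1) - (c (ε, kappaOf N ε z) - 1) := by
            linear_combination h3
          rw [this]
          exact norm_sub_le _ _
        rw [Complex.norm_ofNat] at h5
        have : a ≤ 1 / 2 := min_le_right _ _
        linarith
      rcases kall _ (hzρ.trans_le (min_le_left _ _)) e with h1 | h1
      · left; rw [det, h1]
      · right; rw [det, h1, hl]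
        simp only [hc, map_mul, conj_sign, conj_ofReal, Complex.cos_conj]
    · rintro (rfl | rfl)
      · rw [kl, kc]
      · rw [kl', csinc_conj, kc]; simp
  have lim : l.im ≠ 0 := by
    intro e
    have : conj l = l := Complex.conj_eq_iff_im.2 e
    rw [this, kl] at kl'
    exact kreal kl'
  have build : ∀ z κ : ℂ, ‖z - 1‖ = ‖l - 1‖ → kappaOf N ε z = κ → ‖κ - K‖ = ‖k - K‖ →
      IsMode (omegaEps N ε) N z κ → kappaOf N ε (conj z) = conj κ →
      0 < z.im → ThresholdMode N ε a' z := by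
    intro z κ h1 h2 h3 h4 h5 h6
    exact ⟨by rw [h1]; exact l1.trans_le (min_le_right _ _),
      by rw [h2, h3]; exact ks.trans_le (min_le_right _ _), by rw [h2]; exact h4,
      by rw [h5, h2], (ha₀ ε z ea₀ (by rw [h1]; exact la.trans_lt aa)).2, h6⟩
  rcases lt_or_gt_of_ne lim with h | h
  · have him : 0 < (conj l).im := by rw [conj_im]; linarith
    refine ⟨conj l, ⟨him, by rw [conj1]; exact la, fun z hz => ?_⟩,
      build _ _ (conj1 l) kl' (conjK k) ml.conj (by rw [conj_conj, conj_conj, kl])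
      him⟩
    rw [roots z hz, conj_conj, or_comm]
  · exact ⟨l, ⟨h, la, roots⟩, build l k rfl kl rfl ml kl' h⟩

/-! ### The threshold waves -/

lemma cosh_le_one_add_sq {y : ℝ} (hy : |y| ≤ 1) : Real.cosh y ≤ 1 + y ^ 2 := by
  have h2 : y ^ 2 ≤ 1 := by rw [← sq_abs]; nlinarith [abs_nonneg y]
  refine (Real.cosh_le_exp_half_sq y).trans ((Real.exp_bound_div_one_sub_of_interval
    (by positivity) (by linarith)).trans ?_)
  rw [div_le_iff₀ (by linarith)]
  nlinarith [sq_nonneg y]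

/-- For nonreal wave vectors, the real part deviates from the threshold value by a quantity of
second order only. -/
lemma IsMode.re_sub_one_le {ω : ℝ} {j : ℕ} {lam κ : ℂ} (h : IsMode ω j lam κ)
    (him : lam.im ≠ 0) (hx : 2 ≤ κ.re) (hy : |κ.im| ≤ 1) :
    (lam - 1).re ≤ ‖lam - 1‖ ^ 2 := by
  set x := κ.re with hxd
  set y := κ.im with hyd
  obtain ⟨s, hs, hs2⟩ : ∃ s : ℝ, ((s : ℝ) : ℂ) = (-1) ^ (j + 1) ∧ s * s = 1 :=
    ⟨(-1) ^ (j + 1), by push_cast; rfl, neg_one_pow_mul_self _⟩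
  have hκ : κ = (x : ℂ) + (y : ℂ) * I := (Complex.re_add_im κ).symm
  have e1 := h.sin_eq
  have e2 := h.cos_eq
  rw [← hs, hκ, Complex.sin_add_mul_I, ← Complex.ofReal_sin, ← Complex.ofReal_cos,
    ← Complex.ofReal_cosh, ← Complex.ofReal_sinh] at e1
  rw [← hs, hκ, Complex.cos_add_mul_I, ← Complex.ofReal_sin, ← Complex.ofReal_cos,
    ← Complex.ofReal_cosh, ← Complex.ofReal_sinh] at e2
  set sh := Real.sinh y with hsh
  set ch := Real.cosh y with hch
  set sn := Real.sin x with hsn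
  set cs := Real.cos x with hcs
  have i1 := congrArg Complex.im e1
  have r1 := congrArg Complex.re e1
  have i2 := congrArg Complex.im e2
  have r2 := congrArg Complex.re e2
  simp only [Complex.mul_im, Complex.mul_re, Complex.add_im, Complex.add_re, Complex.sub_im,
    Complex.sub_re, Complex.ofReal_im, Complex.ofReal_re, Complex.I_im, Complex.I_re, mul_zero,
    zero_mul, mul_one, add_zero, zero_add, sub_zero, zero_sub] at i1 r1 i2 r2
  have f1 : lam.re * sh = y * ch := by
    linear_combination (-(s * sh)) * r2 + (s * ch) * i1 + (y * ch - lam.re * sh) * hs2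
  have f2 : lam.im * ch = -(x * sh) := by
    linear_combination (-(s * ch)) * i2 - (s * sh) * r1 - (x * sh + lam.im * ch) * hs2
  have c1 := Real.one_le_cosh y
  have c2 := cosh_le_one_add_sq hy
  have y0 : y ≠ 0 := by
    intro y0
    rw [hsh, hch, y0, Real.sinh_zero, Real.cosh_zero, mul_zero, mul_one, neg_zero] at f2
    exact him f2
  have y2 : y ^ 2 ≤ 1 := by rw [← sq_abs]; nlinarith [abs_nonneg y]
  have g1 : y ^ 2 ≤ y * Real.sinh y := by
    rcases lt_or_gt_of_ne y0 with hn | hp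
    · have := Real.sinh_le_self_iff.2 hn.le
      nlinarith
    · have := Real.self_le_sinh_iff.2 hp.le
      nlinarith
  have g2 : y ^ 2 ≤ Real.sinh y ^ 2 := by
    have := sq_nonneg (Real.sinh y - y)
    nlinarith
  have yy : 0 < y ^ 2 := by positivity
  have re_le : lam.re - 1 ≤ y ^ 2 := by
    have g3 : lam.re * (y * Real.sinh y) = y ^ 2 * Real.cosh y := by
      linear_combination y * f1
    by_contra! hc
    nlinarith
  have im_ge : y ^ 2 ≤ lam.im ^ 2 := by
    have g5 : lam.im ^ 2 * Real.cosh y ^ 2 = x ^ 2 * Real.sinh y ^ 2 := by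
      linear_combination (lam.im * Real.cosh y - x * Real.sinh y) * f2
    have g6 : Real.cosh y ^ 2 ≤ x ^ 2 := by nlinarith
    refine le_of_mul_le_mul_right (a := Real.cosh y ^ 2) ?_ (by positivity)
    rw [g5, mul_comm]
    gcongr
  rw [← Complex.normSq_eq_norm_sq, Complex.normSq_apply]
  simp only [Complex.sub_re, Complex.one_re, Complex.sub_im, Complex.one_im, sub_zero]
  nlinarith [mul_self_nonneg (lam.re - 1)]

/-- The second order expansion deciding the signs of the fluxes of the threshold waves. -/
lemma flux_signs {A : ℝ} (hA : 1 ≤ A) {μ : ℂ} (μ0 : μ ≠ 0) (hμ : ‖μ‖ ≤ 1 / 50)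
    (hre : μ.re ≤ ‖μ‖ ^ 2) :
    ((((A : ℂ) + 1 - (1 + μ) ^ 2) / (1 + μ)) ^ 2 / μ).re < 0 ∧
      0 < ((((A : ℂ) + 1 - (1 + μ) ^ 2) / (1 + μ)) ^ 2).re := by
  have n1 : (49 / 50 : ℝ) ≤ ‖1 + μ‖ := by
    have : ‖(1 : ℂ)‖ ≤ ‖1 + μ‖ + ‖μ‖ := by
      have := norm_sub_le (1 + μ) μ
      rwa [add_sub_cancel_right] at this
    rw [norm_one] at this
    linarith
  have ne : 1 + μ ≠ 0 := fun h => by rw [h, norm_zero] at n1; norm_num at n1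
  set ν := (1 + μ)⁻¹ with hν
  have nν : ‖ν‖ ≤ 2 := by
    rw [hν, norm_inv]
    refine inv_le_of_inv_le₀ (by norm_num) ?_
    linarith
  set e : ℂ := ((A : ℂ) + 2) ^ 2 + 2 * A * (A + 1) * ν - 2 * (A + 2) * (A + 1) * μ * ν +
    ((A : ℂ) + 1) ^ 2 * μ ^ 2 * ν ^ 2 with he
  have exp : (((A : ℂ) + 1 - (1 + μ) ^ 2) / (1 + μ)) ^ 2 =
      A ^ 2 - 2 * A * (A + 2) * μ + e * μ ^ 2 := by
    have h1 : ((A : ℂ) + 1 - (1 + μ) ^ 2) / (1 + μ) = A - (A + 2) * μ + (A + 1) * μ ^ 2 * ν := by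
      rw [hν]
      field_simp
      ring
    rw [h1, he]
    ring
  have nA : ∀ c : ℝ, 0 ≤ c → ‖(A : ℂ) + c‖ = A + c := fun c hc => by
    rw [← Complex.ofReal_add, norm_real, norm_eq_abs, abs_of_nonneg (by linarith)]
  have nA0 : ‖(A : ℂ)‖ = A := by simpa using nA 0 le_rfl
  have nA1 : ‖(A : ℂ) + 1‖ = A + 1 := by simpa using nA 1 (by norm_num)
  have nA2 : ‖(A : ℂ) + 2‖ = A + 2 := by simpa using nA 2 (by norm_num)
  have m0 := norm_nonneg μ
  have v0 := norm_nonneg ν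
  have ne6 : ‖e‖ ≤ 6 * (A + 2) ^ 2 := by
    have t1 : ‖((A : ℂ) + 2) ^ 2‖ = (A + 2) ^ 2 := by rw [norm_pow, nA2]
    have t2 : ‖2 * (A : ℂ) * (A + 1) * ν‖ ≤ 4 * (A + 2) ^ 2 := by
      rw [norm_mul, norm_mul, norm_mul, nA0, nA1, Complex.norm_ofNat]
      calc 2 * A * (A + 1) * ‖ν‖ ≤ 2 * A * (A + 1) * 2 := by gcongr
        _ ≤ _ := by nlinarith
    have t3 : ‖2 * ((A : ℂ) + 2) * (A + 1) * μ * ν‖ ≤ (1 / 2) * (A + 2) ^ 2 := by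
      rw [norm_mul, norm_mul, norm_mul, norm_mul, nA2, nA1, Complex.norm_ofNat]
      calc 2 * (A + 2) * (A + 1) * ‖μ‖ * ‖ν‖ ≤ 2 * (A + 2) * (A + 1) * (1 / 50) * 2 := by gcongr
        _ ≤ _ := by nlinarith
    have t4 : ‖((A : ℂ) + 1) ^ 2 * μ ^ 2 * ν ^ 2‖ ≤ (1 / 2) * (A + 2) ^ 2 := by
      rw [norm_mul, norm_mul, norm_pow, norm_pow, norm_pow, nA1]
      calc (A + 1) ^ 2 * ‖μ‖ ^ 2 * ‖ν‖ ^ 2 ≤ (A + 1) ^ 2 * (1 / 50) ^ 2 * 2 ^ 2 := by gcongr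
        _ ≤ _ := by nlinarith
    calc ‖e‖ ≤ ‖((A : ℂ) + 2) ^ 2‖ + ‖2 * (A : ℂ) * (A + 1) * ν‖ +
          ‖2 * ((A : ℂ) + 2) * (A + 1) * μ * ν‖ + ‖((A : ℂ) + 1) ^ 2 * μ ^ 2 * ν ^ 2‖ :=
          (norm_add_le _ _).trans (add_le_add_left ((norm_sub_le _ _).trans
            (add_le_add_left (norm_add_le _ _) _)) _)
      _ ≤ 6 * (A + 2) ^ 2 := by rw [t1]; linarith
  rw [exp]
  constructor
  · have h1 : ((A : ℂ) ^ 2 - 2 * A * (A + 2) * μ + e * μ ^ 2) / μ =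
        ((A ^ 2 : ℝ) : ℂ) * μ⁻¹ - ((2 * A * (A + 2) : ℝ) : ℂ) + e * μ := by
      push_cast
      field_simp
    rw [h1, Complex.add_re, Complex.sub_re, Complex.re_ofReal_mul, Complex.ofReal_re,
      Complex.inv_re, Complex.normSq_eq_norm_sq]
    have mpos : 0 < ‖μ‖ ^ 2 := by positivity
    have h2 : μ.re / ‖μ‖ ^ 2 ≤ 1 := (div_le_one mpos).2 hre
    have h3 : (e * μ).re ≤ 6 * (A + 2) ^ 2 * (1 / 50) := by
      refine (Complex.re_le_norm _).trans ?_
      rw [norm_mul]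
      gcongr
    nlinarith [mul_le_mul_of_nonneg_left h2 (sq_nonneg A)]
  · have h1 : (A : ℂ) ^ 2 - 2 * A * (A + 2) * μ + e * μ ^ 2 =
        ((A ^ 2 : ℝ) : ℂ) - (((2 * A * (A + 2) : ℝ) : ℂ) * μ - e * μ ^ 2) := by
      push_cast; ring
    rw [h1, Complex.sub_re, Complex.ofReal_re]
    have h3 : (((2 * A * (A + 2) : ℝ) : ℂ) * μ - e * μ ^ 2).re ≤
        2 * A * (A + 2) * (1 / 50) + 6 * (A + 2) ^ 2 * (1 / 50) ^ 2 := by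
      refine (Complex.re_le_norm _).trans ((norm_sub_le _ _).trans ?_)
      rw [norm_mul, norm_mul, norm_pow, norm_real, norm_eq_abs,
        abs_of_nonneg (by positivity)]
      gcongr
    nlinarith

/-- The derivative of the dispersion relation. -/
lemma gammaCoef_eq {N : ℕ} {ε : ℝ} {lam : ℂ}
    (hm : IsMode (omegaEps N ε) N lam (kappaOf N ε lam)) (hk : kappaOf N ε lam ≠ 0)
    (hs : (omegaEps N ε : ℂ) ^ 2 - lam ^ 2 ∈ Complex.slitPlane) :
    gammaCoef N ε lam = -((-1) ^ (N + 1) * omegaEps N ε * kappaOf N ε lam ^ 2 /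
      (lam * (lam - 1))) := by
  set ω := omegaEps N ε with hω
  set κ := kappaOf N ε lam with hκ
  have ωc : (ω : ℂ) ≠ 0 := ofReal_ne_zero.2 hm.energy_ne
  have d1 : HasDerivAt (kappaOf N ε) (-lam / κ) lam := by
    have h1 : HasDerivAt (fun z : ℂ => (ω : ℂ) ^ 2 - z ^ 2) (-(2 * lam)) lam := by
      simpa using ((hasDerivAt_id lam).pow 2).const_sub ((ω : ℂ) ^ 2)
    have h2 := h1.cpow_const (c := (1 / 2 : ℂ)) hs
    have h3 : ((ω : ℂ) ^ 2 - lam ^ 2) ^ ((1 / 2 : ℂ) - 1) = κ⁻¹ := by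
      have hb : (ω : ℂ) ^ 2 - lam ^ 2 ≠ 0 := Complex.slitPlane_ne_zero hs
      have h4 : κ * ((ω : ℂ) ^ 2 - lam ^ 2) ^ ((1 / 2 : ℂ) - 1) = 1 := by
        rw [hκ, kappaOf, ← Complex.cpow_add _ _ hb]
        norm_num
      exact (eq_inv_of_mul_eq_one_right h4)
    refine h2.congr_deriv ?_
    rw [h3]
    field_simp
  have d2 := (hasDerivAt_csinc hk).comp lam d1
  have d3 : deriv (gFun N ε) lam = (Complex.cos κ - csinc κ) / κ * (-lam / κ) := d2.deriv
  have c1 := hm.csinc_eq hk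
  have c2 : Complex.cos κ = (-1) ^ (N + 1) * lam / ω := by
    rw [eq_div_iff ωc, mul_comm]; exact hm.cos_eq
  have sg : ((-1 : ℂ) ^ (N + 1)) ≠ 0 := pow_ne_zero _ (by norm_num)
  have e : (Complex.cos κ - csinc κ) / κ * (-lam / κ) =
      -((-1) ^ (N + 1) * (lam * (lam - 1)) / (ω * κ ^ 2)) := by
    rw [c1, c2]
    field_simp
  have s1 : ((-1 : ℂ) ^ (N + 1))⁻¹ = (-1) ^ (N + 1) :=
    inv_eq_of_mul_eq_one_left (sign_mul_self N)
  rw [gammaCoef, d3, e, inv_neg, inv_div, mul_comm ((-1 : ℂ) ^ (N + 1)) (lam * (lam - 1)),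
    ← div_div, div_eq_mul_inv _ ((-1 : ℂ) ^ (N + 1)), s1]
  ring

/-- The combination of the two threshold modes with coefficients `z` and `conj z`. -/
def twin (N : ℕ) (ε : ℝ) (lam z : ℂ) : Field2 :=
  z • thrWave N ε lam + conj z • thrWave N ε (conj lam)

lemma twin_add_smul (N : ℕ) (ε : ℝ) (lam z z' : ℂ) (t : ℝ) :
    twin N ε lam z + (t : ℂ) • twin N ε lam z' = twin N ε lam (z + t * z') := by
  simp only [twin, map_add, map_mul, conj_ofReal, smul_add, smul_smul, add_smul]
  abel

lemma smul_twin (N : ℕ) (ε : ℝ) (lam z : ℂ) (t : ℝ) :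
    (t : ℂ) • twin N ε lam z = twin N ε lam (t * z) := by
  simp only [twin, map_mul, conj_ofReal, smul_add, smul_smul]

lemma ThresholdMode.kappa_ne {N : ℕ} (hN : 2 ≤ N) {ε a' : ℝ} {lam : ℂ} (ha : a' ≤ 1 / 50)
    (h : ThresholdMode N ε a' lam) : kappaOf N ε lam ≠ 0 := by
  intro e
  have h1 := h.dist_kappa
  have := kappaThr_gt_pi hN
  have := Real.pi_gt_three
  rw [e, zero_sub, norm_neg, norm_real, norm_eq_abs, abs_of_pos (by linarith)] at h1
  linarith

/-- A threshold mode has flux only against the other one of the pair. -/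
lemma ThresholdMode.qForm_twin {N : ℕ} (hN : 2 ≤ N) {ε a' : ℝ} {lam : ℂ} (ha : a' ≤ 1 / 50)
    (h : ThresholdMode N ε a' lam) (z z' : ℂ) :
    qForm (twin N ε lam z) (twin N ε lam z') =
      I * ((2 * (z * z' * ((lam - 1) / omegaEps N ε)).re : ℝ) : ℂ) := by
  set e : Bool → Field2 := fun b => if b then thrWave N ε lam else
    thrWave N ε (conj lam) with he
  have tw : ∀ z, twin N ε lam z = comb e (fun b => if b then z else (starRingEnd ℂ) z) := by
    intro z
    ext p : 1
    simp [comb, he, twin]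
  have ce : ∀ b, Continuous (e b) := by
    intro b
    cases b <;> exact continuous_expWave _ _ _
  have hm := h.mode
  have hk := h.kappa_ne hN ha
  have hm' := hm.conj
  rw [← h.kappa_conj] at hm'
  have nr : lam ≠ conj lam := fun e =>
    h.im_pos.ne' (Complex.conj_eq_iff_im.1 e.symm)
  have q1 : qY (e true) (e true) 0 = 0 := by
    simp only [he, if_true, thrWave]
    rw [qY_expWave_eq, qProf_eq_zero hm hm nr, mul_zero]
  have q2 : qY (e false) (e false) 0 = 0 := by
    simp only [he, Bool.false_eq_true, if_false, thrWave]
    rw [qY_expWave_eq, qProf_eq_zero hm' hm' (by rw [conj_conj]; exact nr.symm), mul_zero]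
  have q3 : qY (e true) (e false) 0 = I * ((lam - 1) / omegaEps N ε) := by
    simp only [he, Bool.false_eq_true, if_false, if_true, thrWave]
    rw [qY_expWave_eq, h.kappa_conj, qProf_conj hm hk]
    simp
    ring
  have q4 : qY (e false) (e true) 0 =
      I * conj ((lam - 1) / omegaEps N ε) := by
    rw [qY_conj, q3]
    simp
  change qY (twin N ε lam z) (twin N ε lam z') 0 = _
  rw [tw z, tw z', qY_comb_comb ce ce]
  simp only [Fintype.sum_bool, q1, q2, q3, q4, if_true, Bool.false_eq_true, if_false,
    conj_conj, mul_zero, zero_add, add_zero]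
  have := Complex.add_conj (z * z' * ((lam - 1) / omegaEps N ε))
  push_cast
  push_cast at this
  rw [← this]
  simp only [map_mul]
  ring

/-- The coefficients of the normalized threshold waves. -/
structure ThresholdCoefs (N : ℕ) (ε : ℝ) (lam : ℂ) : Prop where
  wave_true : thrWaveNormalized N ε lam true = twin N ε lam (alpha1 N ε lam)
  wave_false : thrWaveNormalized N ε lam false = twin N ε lam (alpha2 N ε lam)
  flux_true : (alpha1 N ε lam * alpha1 N ε lam * ((lam - 1) / omegaEps N ε)).re = 1 / 2
  flux_false : (alpha2 N ε lam * alpha2 N ε lam * ((lam - 1) / omegaEps N ε)).re = -(1 / 2)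
  flux_mixed : (alpha1 N ε lam * alpha2 N ε lam * ((lam - 1) / omegaEps N ε)).re = 0

/-- With `γ = γ_+`, `μ = λ_+ - 1`, `p = γ² μ / ω`, the form `iq` on the threshold waves is `-2` times
the real parts `P`, `B`, `C` of `p`, `pμ`, `pμ²`. The wave `𝐰⁺` has the sign `P < 0`, and `α = -P / B` makes
the second wave orthogonal to it, of the opposite sign since `B² - PC = |p|² (Im μ)² > 0`. -/
lemma thresholdCoefs {N : ℕ} (hN : 2 ≤ N) {ε a' : ℝ} {lam : ℂ} (ha : a' ≤ 1 / 50)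
    (hε : 0 ≤ ε) (hω : 2 ≤ omegaEps N ε ^ 2) (h : ThresholdMode N ε a' lam) :
    ThresholdCoefs N ε lam := by
  have hm := h.mode
  have hk := h.kappa_ne hN ha
  have hm' := hm.conj
  rw [← h.kappa_conj] at hm'
  have ωpos := omegaEps_pos (by omega : 1 ≤ N) hε
  have ωc : (omegaEps N ε : ℂ) ≠ 0 := ofReal_ne_zero.2 ωpos.ne'
  set ω := omegaEps N ε with hωd
  set κ := kappaOf N ε lam with hκ
  set μ := lam - 1 with hμ
  have lam_eq : lam = 1 + μ := by rw [hμ]; ring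
  have μim : μ.im ≠ 0 := by simp [hμ, h.im_pos.ne']
  have μ0 : μ ≠ 0 := fun e => μim (by rw [e]; rfl)
  have l0 : lam ≠ 0 := fun e => h.im_pos.ne' (by rw [e]; rfl)
  have Kpi := kappaThr_gt_pi hN
  have pi3 := Real.pi_gt_three
  have hre : μ.re ≤ ‖μ‖ ^ 2 := by
    have h1 := Complex.abs_re_le_norm (κ - kappaThr N)
    have h2 := Complex.abs_im_le_norm (κ - kappaThr N)
    have h3 := h.dist_kappa
    simp only [Complex.sub_re, Complex.ofReal_re, Complex.sub_im, Complex.ofReal_im,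
      sub_zero] at h1 h2
    refine hm.re_sub_one_le h.im_pos.ne' ?_ (by linarith)
    linarith [(abs_le.1 h1).1]
  obtain ⟨s1, s2⟩ := flux_signs (A := ω ^ 2 - 1) (by linarith) μ0 (h.dist_lam.le.trans ha) hre
  have κsq : ((ω ^ 2 - 1 : ℝ) : ℂ) + 1 - (1 + μ) ^ 2 = κ ^ 2 := by
    rw [← lam_eq, hκ, kappaOf_sq]
    push_cast
    ring
  rw [κsq, ← lam_eq] at s1 s2
  -- the conjugate coefficient
  have slit' : (ω : ℂ) ^ 2 - conj lam ^ 2 ∈ Complex.slitPlane := by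
    have h1 : (ω : ℂ) ^ 2 - conj lam ^ 2 =
        conj ((ω : ℂ) ^ 2 - lam ^ 2) := by simp
    have h2 := h.slit
    rw [h1]
    rw [Complex.mem_slitPlane_iff] at h2 ⊢
    rwa [Complex.conj_re, conj_im, neg_ne_zero]
  set g := gammaCoef N ε lam with hg
  have ge : g = -((-1) ^ (N + 1) * ω * κ ^ 2 / (lam * μ)) := gammaCoef_eq hm hk h.slit
  have gconj : gammaCoef N ε (conj lam) = conj g := by
    rw [gammaCoef_eq hm' (by rw [h.kappa_conj]; exact (map_ne_zero _).2 hk) slit', ge,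
      h.kappa_conj]
    simp only [map_neg, map_div₀, map_mul, map_pow, map_one, conj_ofReal, hμ, map_sub]
    rfl
  have wp : waveEpsPlus N ε lam = twin N ε lam g := by rw [waveEpsPlus, twin, gconj]
  have wm : waveEpsMinus N ε lam = twin N ε lam (g * μ) := by
    rw [waveEpsMinus, twin, gconj, map_mul, hμ, map_sub, map_one]
  set p := g * g * (μ / ω) with hp
  have p_eq : p = ω * ((κ ^ 2 / lam) ^ 2 / μ) := by
    rw [hp, ge]
    have := sign_mul_self N
    field_simp
    linear_combination this
  set P := p.re with hP
  set B := (p * μ).re with hB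
  set C := (p * μ * μ).re with hC
  have P0 : P < 0 := by
    rw [hP, p_eq, Complex.re_ofReal_mul]
    exact mul_neg_of_pos_of_neg ωpos s1
  have B0 : 0 < B := by
    have : p * μ = ω * (κ ^ 2 / lam) ^ 2 := by
      rw [p_eq]; field_simp
    rw [hB, this, Complex.re_ofReal_mul]
    exact mul_pos ωpos s2
  have disc : 0 < B ^ 2 - P * C := by
    have e : B ^ 2 - P * C = Complex.normSq p * μ.im ^ 2 := by
      simp only [hB, hP, hC, Complex.mul_re, Complex.mul_im, Complex.normSq_apply]
      ring
    rw [e]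
    have p0 : p ≠ 0 := fun e => P0.ne (by rw [hP, e]; rfl)
    exact mul_pos (Complex.normSq_pos.2 p0) (by positivity)
  have Q := h.qForm_twin hN ha
  have I2 := Complex.I_mul_I
  have alpha : alphaEps N ε lam = ((-(P / B) : ℝ) : ℂ) := by
    have Bc : (B : ℂ) ≠ 0 := ofReal_ne_zero.2 B0.ne'
    have e2 : g * (g * μ) * (μ / ω) = p * μ := by rw [hp]; ring
    rw [alphaEps, wp, wm, Q, Q, e2]
    change I * (I * ((2 * P : ℝ) : ℂ)) /
      (-I * (I * ((2 * B : ℝ) : ℂ))) = _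
    rw [← mul_assoc, ← mul_assoc, neg_mul, I2]
    push_cast
    field_simp
  set t := -(P / B) with ht
  have wt : waveEpsPlus N ε lam + alphaEps N ε lam • waveEpsMinus N ε lam =
      twin N ε lam (g * (1 + t * μ)) := by
    rw [wp, wm, alpha, twin_add_smul]
    congr 1; ring
  have lin : ∀ (r : ℝ) (w : ℂ), ((r : ℂ) * w).re = r * w.re := Complex.re_ofReal_mul
  have tB : t * B = -P := by rw [ht]; field_simp
  have mixed : (g * (1 + t * μ) * g * (μ / ω)).re = 0 := by
    have : g * (1 + t * μ) * g * (μ / ω) = p + t * (p * μ) := by rw [hp]; ring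
    rw [this, Complex.add_re, lin]
    change P + t * B = 0
    linarith
  set n := (g * (1 + t * μ) * (g * (1 + t * μ)) * (μ / ω)).re with hn
  have n0 : 0 < n := by
    have e1 : g * (1 + t * μ) * (g * (1 + t * μ)) * (μ / ω) =
        p + t * (2 * (p * μ)) + ((t * t : ℝ) : ℂ) * (p * μ * μ) := by
      rw [hp]; push_cast; ring
    have e2 : n = P + t * (2 * B) + t * t * C := by
      rw [hn, e1, Complex.add_re, Complex.add_re, lin, lin]
      have : (2 * (p * μ)).re = 2 * B := by
        rw [show (2 : ℂ) = ((2 : ℝ) : ℂ) by norm_num, lin]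
      rw [this]
    have e3 : n * B ^ 2 = -P * (B ^ 2 - P * C) := by
      rw [e2]
      linear_combination (2 * B ^ 2 + t * B * C - P * C) * tB
    have : 0 < n * B ^ 2 := by rw [e3]; exact mul_pos (by linarith) disc
    exact pos_of_mul_pos_left this (by positivity)
  have N1 : norm1 N ε lam = √(2 * n) := by
    rw [norm1, wt, Q, ← mul_assoc, neg_mul, I2, neg_neg, one_mul, Complex.ofReal_re]
  have N2 : norm2 N ε lam = √(2 * -P) := by
    rw [norm2, wp, Q, ← mul_assoc, I2, neg_one_mul, ← Complex.ofReal_neg, Complex.ofReal_re]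
    congr 1
    rw [hP, hp]; ring
  have N1pos : 0 < norm1 N ε lam := by rw [N1]; exact Real.sqrt_pos.2 (by linarith)
  have N2pos : 0 < norm2 N ε lam := by rw [N2]; exact Real.sqrt_pos.2 (by linarith)
  have N1sq : norm1 N ε lam * norm1 N ε lam = 2 * n := by
    rw [N1, Real.mul_self_sqrt (by linarith)]
  have N2sq : norm2 N ε lam * norm2 N ε lam = 2 * -P := by
    rw [N2, Real.mul_self_sqrt (by linarith)]
  have a1 : alpha1 N ε lam = ((norm1 N ε lam)⁻¹ : ℝ) * (g * (1 + t * μ)) := by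
    rw [alpha1, alpha, div_eq_mul_inv, mul_comm, Complex.ofReal_inv]
  have a2 : alpha2 N ε lam = ((norm2 N ε lam)⁻¹ : ℝ) * g := by
    rw [alpha2, div_eq_mul_inv, mul_comm, Complex.ofReal_inv]
  have quad : ∀ (r s : ℝ) (z w : ℂ), (((r : ℂ) * z) * ((s : ℂ) * w) * (μ / ω)).re =
      r * s * (z * w * (μ / ω)).re := by
    intro r s z w
    rw [← lin]
    congr 1
    push_cast
    ring
  refine ⟨?_, ?_, ?_, ?_, ?_⟩
  · rw [thrWaveNormalized, wt, ← Complex.ofReal_inv, smul_twin, a1]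
  · rw [thrWaveNormalized, wp, ← Complex.ofReal_inv, smul_twin, a2]
  · rw [a1, quad]
    change (norm1 N ε lam)⁻¹ * (norm1 N ε lam)⁻¹ * n = 1 / 2
    rw [← mul_inv, N1sq]
    field_simp
  · rw [a2, quad]
    change (norm2 N ε lam)⁻¹ * (norm2 N ε lam)⁻¹ * P = -(1 / 2)
    rw [← mul_inv, N2sq]
    have := P0.ne
    field_simp
  · rw [a1, a2, quad, mixed, mul_zero]

lemma ThresholdCoefs.alpha_ne {N : ℕ} {ε : ℝ} {lam : ℂ} (h : ThresholdCoefs N ε lam) :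
    alpha1 N ε lam ≠ 0 ∧ alpha2 N ε lam ≠ 0 := by
  constructor
  · intro e
    have := h.flux_true
    rw [e] at this
    norm_num at this
  · intro e
    have := h.flux_false
    rw [e] at this
    norm_num at this

/-- The ratio of the coefficients has modulus one. -/
lemma ThresholdCoefs.norm_dCoef {N : ℕ} {ε : ℝ} {lam : ℂ} (h : ThresholdCoefs N ε lam) :
    ‖dCoef N ε lam‖ = 1 := by
  have a2 := h.alpha_ne.2
  set d := dCoef N ε lam with hd
  set u := alpha2 N ε lam * alpha2 N ε lam * ((lam - 1) / omegaEps N ε) with hu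
  have e1 : alpha1 N ε lam = d * alpha2 N ε lam := by rw [hd, dCoef, div_mul_cancel₀ _ a2]
  have h1 := h.flux_true
  have h2 := h.flux_false
  have h3 := h.flux_mixed
  have f1 : alpha1 N ε lam * alpha1 N ε lam * ((lam - 1) / omegaEps N ε) = d * d * u := by
    rw [e1, hu]; ring
  have f3 : alpha1 N ε lam * alpha2 N ε lam * ((lam - 1) / omegaEps N ε) = d * u := by
    rw [e1, hu]; ring
  rw [f1] at h1
  rw [f3] at h3
  -- `d u` is purely imaginary, and `Re (d² u) = -Re u`
  rw [← hu] at h2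
  have key : Complex.normSq d = 1 := by
    rw [Complex.normSq_apply]
    simp only [Complex.mul_re, Complex.mul_im] at h1 h3
    linear_combination 2 * h1 + 2 * (d.re * d.re + d.im * d.im) * h2 - 4 * d.re * h3
  rw [Complex.norm_def, key, Real.sqrt_one]

/-! ### The wave vectors near the real axis -/

lemma csinc_of_charFun {ω : ℝ} {lam κ : ℂ} (h : κ ^ 2 + lam ^ 2 = (ω : ℂ) ^ 2)
    (h0 : charFun lam κ = 0) : (ω * csinc κ) ^ 2 = 1 := by
  have h1 : Complex.cos κ = lam * csinc κ := sub_eq_zero.1 h0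
  have h2 : Complex.sin κ = κ * csinc κ := by
    by_cases hk : κ = 0
    · simp [hk]
    · rw [csinc_of_ne hk, mul_div_cancel₀ _ hk]
  have h3 := Complex.sin_sq_add_cos_sq κ
  rw [h1, h2] at h3
  rw [mul_pow, ← h, ← h3]
  ring

lemma one_le_norm_csinc_of_re {κ : ℂ} (h : κ.re = 0) : 1 ≤ ‖csinc κ‖ := by
  by_cases hk : κ = 0
  · simp [hk, csinc]
  have e : κ = (κ.im : ℂ) * I := by
    conv_lhs => rw [← Complex.re_add_im κ, h]
    simp
  rw [csinc_of_ne hk, e, Complex.sin_mul_I, norm_div, norm_mul, norm_mul, Complex.norm_I, mul_one,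
    mul_one, ← Complex.ofReal_sinh, norm_real, norm_real, norm_eq_abs,
    norm_eq_abs, Real.abs_sinh]
  have : 0 < |κ.im| := abs_pos.2 fun h' => hk (Complex.ext h h')
  rw [one_le_div this]
  exact Real.self_le_sinh_iff.2 this.le

/-- Real zeros at the threshold energy. -/
lemma exists_real_of_charFun {ω ℓ : ℝ} {κ : ℂ} (hω : 1 < ω) (h : κ ^ 2 + (ℓ : ℂ) ^ 2 = (ω : ℂ) ^ 2)
    (h0 : charFun ℓ κ = 0) (hre : 0 ≤ κ.re) : ∃ x : ℝ, 0 < x ∧ κ = x ∧ |sinc x| = ω⁻¹ := by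
  have h1 := csinc_of_charFun h h0
  have hn : ‖csinc κ‖ = ω⁻¹ := by
    have := congrArg norm h1
    rw [norm_pow, norm_mul, norm_one, norm_real, norm_eq_abs,
      abs_of_pos (by linarith)] at this
    refine eq_inv_of_mul_eq_one_right ?_
    exact (pow_eq_one_iff_of_nonneg (by positivity) two_ne_zero).1 this
  have hr : κ.re ≠ 0 := fun e => by
    have := one_le_norm_csinc_of_re e
    rw [hn] at this
    exact absurd (inv_lt_one_of_one_lt₀ hω) this.not_gt
  have him : κ.im = 0 := by
    have := congrArg Complex.im h
    simp only [pow_two, Complex.add_im, Complex.mul_im, Complex.ofReal_re, Complex.ofReal_im] at this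
    have : κ.re * κ.im = 0 := by linarith
    exact (mul_eq_zero.1 this).resolve_left hr
  have e : κ = (κ.re : ℂ) := Complex.ext rfl (by simp [him])
  refine ⟨κ.re, lt_of_le_of_ne hre hr.symm, e, ?_⟩
  rw [← hn, e, csinc_ofReal, norm_real, norm_eq_abs, Complex.ofReal_re]

/-- The conclusion on a zero `(lam, κ)` of the characteristic function at an energy `ω` slightly
below the `N`-th threshold. -/
def NearThreshold (N : ℕ) (a ω : ℝ) (lam κ : ℂ) : Prop :=
  (∃ j t, 1 ≤ j ∧ j < N ∧ (t = true → 2 ≤ j) ∧ lam = lamOsc ω j t) ∨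
    ‖lam - 1‖ ≤ a ∧ csinc κ = (-1) ^ (N + 1) / (ω : ℂ) ∧ (ω = omegaThr N → lam.im = 0)

/-- Zeros satisfy `csinc κ = ±1 / ω`; by continuity the sign is locally constant. -/
lemma eventually_csinc_eq {W : ℝ} (hW : 1 < W) {j : ℕ} {κ₀ : ℂ} {l₀ : ℂ}
    (h : csinc κ₀ = (-1) ^ (j + 1) / (W : ℂ)) : ∀ᶠ p in 𝓝 ((W, l₀, κ₀) : ℝ × ℂ × ℂ),
      p.2.2 ^ 2 + p.2.1 ^ 2 = (p.1 : ℂ) ^ 2 → charFun p.2.1 p.2.2 = 0 →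
        csinc p.2.2 = (-1) ^ (j + 1) / (p.1 : ℂ) := by
  have W0 : 0 < W := by linarith
  have c1 : ContinuousAt (fun p : ℝ × ℂ × ℂ => csinc p.2.2) (W, l₀, κ₀) :=
    (continuous_csinc.comp (continuous_snd.comp continuous_snd)).continuousAt
  filter_upwards [c1.eventually_mem (Metric.ball_mem_nhds _ (inv_pos.2 W0)),
    continuousAt_fst.eventually_mem (lt_mem_nhds hW)] with p h1 hp h2 h3
  have hp1 : 1 < p.1 := hp
  have ω0 : (p.1 : ℂ) ≠ 0 := ofReal_ne_zero.2 (by linarith)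
  have h4 := csinc_of_charFun h2 h3
  have h5 : (p.1 * csinc p.2.2) ^ 2 = ((-1 : ℂ) ^ (j + 1)) ^ 2 := by
    rw [h4, pow_two, sign_mul_self]
  rw [eq_div_iff ω0, mul_comm]
  refine (sq_eq_sq_iff_eq_or_eq_neg.1 h5).resolve_right fun h6 => ?_
  have h7 : csinc p.2.2 = -((-1) ^ (j + 1) / (p.1 : ℂ)) := by
    rw [← neg_div, eq_div_iff ω0, mul_comm, h6]
  rw [mem_ball_iff_norm, h, h7] at h1
  have h8 : -((-1) ^ (j + 1) / (p.1 : ℂ)) - (-1) ^ (j + 1) / (W : ℂ) =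
      -((-1) ^ (j + 1) * ((p.1⁻¹ + W⁻¹ : ℝ) : ℂ)) := by push_cast; ring
  have h9 : 0 < p.1⁻¹ := inv_pos.2 (by linarith)
  rw [h8, norm_neg, norm_mul, norm_pow, norm_neg, norm_one, one_pow, one_mul, norm_real,
    norm_eq_abs, abs_of_pos (by have := inv_pos.2 W0; linarith)] at h1
  linarith

lemma eq_of_charFun {lam κ : ℂ} (h : charFun lam κ = 0) (hc : csinc κ ≠ 0) :
    lam = Complex.cos κ / csinc κ := by
  rw [eq_div_iff hc]; exact (sub_eq_zero.1 h).symm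

lemma IsOsc.cos_ne {ω x : ℝ} {j : ℕ} {t : Bool} (hj : 1 ≤ j) (h : IsOsc ω j t x) :
    x * Real.cos x ≠ Real.sin x := by
  intro e
  have hx := h.mem_Ioo hj
  have := (bandPeak_kappaThr hj).crit_unique x ⟨hx.1.le, hx.2.le⟩ e
  have h1 := h.1
  subst this
  cases t <;> simp at h1

/-- Simple real roots persist as real roots. -/
lemma eventually_eq_lamOsc {W : ℝ} {j : ℕ} {t : Bool} {x : ℝ} {l₀ : ℂ} (hW : 1 < W) (hj : 1 ≤ j)
    (hjW : omegaThr j < W) (ht : t = true → 2 ≤ j) (h : IsOsc W j t x) :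
    ∀ᶠ p in 𝓝 ((W, l₀, (x : ℂ)) : ℝ × ℂ × ℂ),
      p.2.2 ^ 2 + p.2.1 ^ 2 = (p.1 : ℂ) ^ 2 → charFun p.2.1 p.2.2 = 0 →
        p.2.1 = (lamOsc p.1 j t : ℂ) := by
  have x0 := h.pos hj
  have xc : (x : ℂ) ≠ 0 := ofReal_ne_zero.2 x0.ne'
  have hcx : csinc x = (-1) ^ (j + 1) / (W : ℂ) := by rw [csinc_ofReal, h.2]; push_cast; rfl
  have sd : HasStrictDerivAt csinc ((Complex.cos x - csinc x) / x) (x : ℂ) := by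
    have := (differentiable_csinc.analyticAt (x : ℂ)).hasStrictDerivAt
    rwa [(hasDerivAt_csinc xc).deriv] at this
  have hne : (Complex.cos x - csinc x) / (x : ℂ) ≠ 0 := by
    refine div_ne_zero (fun e => h.cos_ne hj ?_) xc
    rw [csinc_of_ne xc, sub_eq_zero, eq_div_iff xc, mul_comm] at e
    exact_mod_cast e
  obtain ⟨r, r0, hr⟩ := Metric.eventually_nhds_iff.1 (sd.eventually_left_inverse hne)
  have half : ∀ᶠ y in 𝓝 x, if t then ((j : ℝ) - 1) * π < y ∧ y < kappaThr j
      else kappaThr j < y ∧ y < j * π := by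
    have h1 := h.1
    cases t
    · simp only [Bool.false_eq_true, if_false] at h1 ⊢
      exact Ioo_mem_nhds h1.1 h1.2
    · simp only [if_true] at h1 ⊢
      exact Ioo_mem_nhds h1.1 h1.2
  have half' : ∀ᶠ p in 𝓝 ((W, l₀, (x : ℂ)) : ℝ × ℂ × ℂ), if t then
      ((j : ℝ) - 1) * π < p.2.2.re ∧ p.2.2.re < kappaThr j
      else kappaThr j < p.2.2.re ∧ p.2.2.re < j * π :=
    ((Complex.continuous_re.comp (continuous_snd.comp continuous_snd)).tendsto' _ _
      (by simp)).eventually half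
  filter_upwards [eventually_csinc_eq hW hcx, half',
    (continuous_snd.comp continuous_snd).continuousAt.eventually_mem (Metric.ball_mem_nhds _ r0),
    continuousAt_fst.eventually_mem (lt_mem_nhds hjW)] with ⟨ω, l, κ⟩ h1 h2 h3 h4 h5 h6
  dsimp only at h1 h2 h3 h4 h5 h6 ⊢
  have hc := h1 h5 h6
  have hω : omegaThr j < ω := h4
  have ω0 := (omegaThr_pos hj).trans hω
  have h3' : dist κ x < r := h3
  have hreal : conj κ = κ := by
    have e1 := hr h3'
    have e2 := @hr (conj κ) (by
      rw [← conj_ofReal x, Complex.dist_conj_conj]; exact h3')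
    rw [csinc_conj, hc] at e2
    rw [hc] at e1
    rw [← e2, ← e1]
    simp
  have eκ : κ = (κ.re : ℂ) := (Complex.conj_eq_iff_re.1 hreal).symm
  set y := κ.re with hy
  rw [eκ] at h6 hc
  have ho : IsOsc ω j t y := ⟨h2, by
    rw [csinc_ofReal] at hc; exact_mod_cast hc⟩
  have ey := ho.unique hj (isOsc_kappaOsc hj hω ht)
  have y0 := ho.pos hj
  have yc : (y : ℂ) ≠ 0 := ofReal_ne_zero.2 y0.ne'
  rw [eq_of_charFun h6 (by
    rw [hc]; exact div_ne_zero (pow_ne_zero _ (by norm_num)) (ofReal_ne_zero.2 ω0.ne')),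
    csinc_of_ne yc, lamOsc, ← ey]
  push_cast
  rw [div_div_eq_mul_div]
  ring

/-- At the threshold energy itself the double root `κ_N` is the only one nearby. -/
lemma eventually_near_one {N : ℕ} (hN : 2 ≤ N) {a : ℝ} (ha : 0 < a) {l₀ : ℂ}
    (hl : charFun l₀ (kappaThr N) = 0) :
    ∀ᶠ p in 𝓝 ((omegaThr N, l₀, (kappaThr N : ℂ)) : ℝ × ℂ × ℂ),
      p.2.2 ^ 2 + p.2.1 ^ 2 = (p.1 : ℂ) ^ 2 → charFun p.2.1 p.2.2 = 0 →
        ‖p.2.1 - 1‖ ≤ a ∧ csinc p.2.2 = (-1) ^ (N + 1) / (p.1 : ℂ) ∧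
          (p.1 = omegaThr N → p.2.1.im = 0) := by
  have hN1 : 1 ≤ N := by omega
  have hK := kappaThr_gt_pi hN
  have pi3 := Real.pi_gt_three
  have W1 : 1 < omegaThr N := by
    have := omegaThr_sq hN1
    nlinarith [omegaThr_pos hN1]
  have c0 : csinc (kappaThr N) ≠ 0 := by
    rw [csinc_kappaThr hN1]
    exact div_ne_zero (pow_ne_zero _ (by norm_num)) (ofReal_ne_zero.2 (by linarith))
  have hcc : Complex.cos (kappaThr N) = csinc (kappaThr N) := by
    have Kc : (kappaThr N : ℂ) ≠ 0 := ofReal_ne_zero.2 (by linarith)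
    rw [csinc_of_ne Kc, eq_div_iff Kc, mul_comm]
    exact_mod_cast (bandPeak_kappaThr hN1).crit
  have l1 : l₀ = 1 := by rw [eq_of_charFun hl c0, hcc, div_self c0]
  obtain ⟨r, r0, -, hr, -⟩ := exists_threshold_roots hN
  filter_upwards [eventually_csinc_eq W1 (csinc_kappaThr hN1) (l₀ := l₀),
    (continuous_snd.comp continuous_snd).continuousAt.eventually_mem (Metric.ball_mem_nhds _ r0),
    (continuous_fst.comp continuous_snd).continuousAt.eventually_mem
      (Metric.ball_mem_nhds _ ha)] with ⟨ω, l, κ⟩ h1 h2 h3 h4 h5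
  dsimp only [Function.comp] at h1 h2 h3 h4 h5 ⊢
  rw [mem_ball_iff_norm] at h2 h3
  rw [l1] at h3
  refine ⟨h3.le, h1 h4 h5, fun e => ?_⟩
  have hκ := hr κ h2 (by rw [h1 h4 h5, csinc_kappaThr hN1, e])
  rw [hκ] at h5
  rw [eq_of_charFun h5 c0, hcc, div_self c0, Complex.one_im]

/-- Compactness turns the local statements into a uniform one in a thin strip around the real
axis. -/
lemma exists_nearThreshold {N : ℕ} (hN : 2 ≤ N) {a : ℝ} (ha : 0 < a) : ∃ η : ℝ, 0 < η ∧
    ∀ ω : ℝ, omegaThr N - η < ω → ω ≤ omegaThr N → ∀ lam κ : ℂ, |lam.im| < η →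
      |lam.re| ≤ 2 * ω → κ ^ 2 + lam ^ 2 = (ω : ℂ) ^ 2 → charFun lam κ = 0 →
        NearThreshold N a ω lam κ := by
  have hN1 : 1 ≤ N := by omega
  have hK := kappaThr_gt_pi hN
  have pi3 := Real.pi_gt_three
  set W := omegaThr N with hW
  have W1 : 1 < W := by
    have := omegaThr_sq hN1
    nlinarith [omegaThr_pos hN1]
  set B := 4 * W + 2 with hB
  set L : Set (ℝ × ℂ) := Icc (-(2 * W)) (2 * W) ×ˢ (Metric.closedBall 0 B ∩ {κ | 0 ≤ κ.re}) with hL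
  have cL : IsCompact L := isCompact_Icc.prod ((isCompact_closedBall _ _).inter_right
    (isClosed_le continuous_const Complex.continuous_re))
  have key := cL.eventually_forall_of_forall_eventually (x₀ := ((W, 0) : ℝ × ℝ))
    (P := fun x y => x.1 ≤ W → y.2 ^ 2 + ((y.1 : ℂ) + x.2 * I) ^ 2 = (x.1 : ℂ) ^ 2 →
      charFun ((y.1 : ℂ) + x.2 * I) y.2 = 0 →
      NearThreshold N a x.1 ((y.1 : ℂ) + x.2 * I) y.2) (by
    rintro ⟨ℓ, κ⟩ ⟨-, -, hre⟩
    have hre' : 0 ≤ κ.re := hre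
    have tend : Tendsto (fun z : (ℝ × ℝ) × ℝ × ℂ =>
        ((z.1.1, (z.2.1 : ℂ) + z.1.2 * I, z.2.2) : ℝ × ℂ × ℂ)) (𝓝 ((W, 0), ℓ, κ))
        (𝓝 (W, (ℓ : ℂ), κ)) := by
      have : Continuous fun z : (ℝ × ℝ) × ℝ × ℂ =>
        ((z.1.1, (z.2.1 : ℂ) + z.1.2 * I, z.2.2) : ℝ × ℂ × ℂ) := by fun_prop
      exact this.tendsto' _ _ (by simp)
    suffices h : ∀ᶠ p in 𝓝 ((W, (ℓ : ℂ), κ) : ℝ × ℂ × ℂ),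
        p.2.2 ^ 2 + p.2.1 ^ 2 = (p.1 : ℂ) ^ 2 → charFun p.2.1 p.2.2 = 0 →
          NearThreshold N a p.1 p.2.1 p.2.2 by
      filter_upwards [tend.eventually h] with z hz _ using hz
    by_cases h1 : κ ^ 2 + (ℓ : ℂ) ^ 2 = (W : ℂ) ^ 2
    swap
    · have c : Continuous fun p : ℝ × ℂ × ℂ => p.2.2 ^ 2 + p.2.1 ^ 2 - (p.1 : ℂ) ^ 2 := by fun_prop
      filter_upwards [c.continuousAt.eventually_ne (sub_ne_zero.2 h1)] with p hp e
      exact absurd (sub_eq_zero.2 e) hp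
    by_cases h2 : charFun ℓ κ = 0
    swap
    · have c : Continuous fun p : ℝ × ℂ × ℂ => charFun p.2.1 p.2.2 := by
        unfold charFun
        have := continuous_csinc
        fun_prop
      filter_upwards [c.continuousAt.eventually_ne h2] with p hp _ e
      exact absurd e hp
    obtain ⟨x, x0, rfl, hx⟩ := exists_real_of_charFun W1 h1 h2 hre'
    rcases exists_isOsc_of_sinc hN1 (by linarith) (fun j hj hjN => omegaThr_strictMono hj hjN)
      le_rfl x0.le hx with ⟨-, rfl⟩ | ⟨j, t, hj, hjN, ht, ho⟩
    · filter_upwards [eventually_near_one hN ha h2] with p hp e1 e2 using Or.inr (hp e1 e2)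
    · filter_upwards [eventually_eq_lamOsc (l₀ := ℓ) W1 hj (omegaThr_strictMono hj hjN) ht ho]
        with p hp e1 e2 using Or.inl ⟨j, t, hj, hjN, ht, hp e1 e2⟩)
  obtain ⟨η, η0, hη⟩ := Metric.eventually_nhds_iff.1 key
  refine ⟨min η 1, lt_min η0 one_pos, fun ω h1 h2 lam κ h3 h4 h5 h6 => ?_⟩
  have hη1 := min_le_left η 1
  have hη2 := min_le_right η 1
  have h4' := abs_le.1 h4
  have e : (lam.re : ℂ) + lam.im * I = lam := Complex.re_add_im lam
  have bound : ‖κ‖ ≤ B := by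
    have e1 : ‖κ‖ ^ 2 ≤ ω ^ 2 + ‖lam‖ ^ 2 := by
      have : κ ^ 2 = (ω : ℂ) ^ 2 - lam ^ 2 := by linear_combination h5
      rw [← norm_pow, this]
      refine (norm_sub_le _ _).trans_eq ?_
      rw [norm_pow, norm_pow, norm_real, norm_eq_abs, sq_abs]
    have e2 : ‖lam‖ ≤ |lam.re| + |lam.im| := Complex.norm_le_abs_re_add_abs_im lam
    have e3 : ‖lam‖ ≤ 2 * W + 1 := by linarith
    have : 0 ≤ ω := by linarith [(abs_nonneg lam.re).trans h4]
    refine le_of_sq_le_sq (by nlinarith [norm_nonneg lam]) (by linarith)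
  have main : ∀ κ' : ℂ, ‖κ'‖ ≤ B → 0 ≤ κ'.re → κ' ^ 2 + lam ^ 2 = (ω : ℂ) ^ 2 →
      charFun lam κ' = 0 → NearThreshold N a ω lam κ' := by
    intro κ' k1 k2 k3 k4
    have := @hη (ω, lam.im) (by
      rw [Prod.dist_eq, max_lt_iff, Real.dist_eq, Real.dist_eq, sub_zero, abs_lt]
      exact ⟨⟨by linarith, by linarith⟩, h3.trans_le hη1⟩) (lam.re, κ')
      ⟨⟨by linarith, by linarith⟩, by simpa using k1, k2⟩ h2
    simp only [e] at this
    exact this k3 k4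
  rcases le_total 0 κ.re with h | h
  · exact main κ bound h h5 h6
  · have := main (-κ) (by rwa [norm_neg]) (by simpa using h) (by rwa [neg_sq])
      (by rw [← h6]; simp only [charFun, csinc_neg, Complex.cos_neg])
    simpa only [NearThreshold, csinc_neg] using this

/-! ### The waves of the channels -/

lemma isMode_osc {ω : ℝ} {j : ℕ} {t : Bool} (hj : 1 ≤ j) (hω : omegaThr j < ω)
    (ht : t = true → 2 ≤ j) : IsMode ω j (lamOsc ω j t) (kappaOsc ω j t) := by
  have h := isOsc_kappaOsc hj hω ht
  have ω0 : ω ≠ 0 := ((omegaThr_pos hj).trans hω).ne'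
  have k0 := (h.pos hj).ne'
  have h2 := h.2
  have h3 := neg_one_pow_mul_self (j + 1)
  rw [sinc_of_ne_zero k0, div_eq_div_iff k0 ω0] at h2
  have s0 : Real.sin (kappaOsc ω j t) ≠ 0 := fun e => by
    rw [e, zero_mul, zero_eq_mul] at h2
    exact h2.elim (pow_ne_zero _ (by norm_num)) k0
  refine ⟨?_, ?_, ω0⟩
  · rw [mul_comm]; exact_mod_cast h2
  · have : ω * Real.cos (kappaOsc ω j t) = (-1) ^ (j + 1) * lamOsc ω j t := by
      rw [lamOsc]
      field_simp
      linear_combination Real.cos (kappaOsc ω j t) * h2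
    exact_mod_cast this

/-- The direction of propagation of a wave is read off from the sign of `λ - 1`. -/
lemma sign_lamOsc {ω : ℝ} {j : ℕ} {t : Bool} (hj : 1 ≤ j) (hω : omegaThr j < ω)
    (ht : t = true → 2 ≤ j) : 0 < (if t then 1 else -1) * (lamOsc ω j t - 1) := by
  have h := isOsc_kappaOsc hj hω ht
  have hb := bandPeak_kappaThr hj
  have hm := isMode_osc hj hω ht
  have ω0 : 0 < ω := (omegaThr_pos hj).trans hω
  have k0 := h.pos hj
  set k := kappaOsc ω j t with hk
  set l := lamOsc ω j t with hl
  have e1 : ω * Real.sin k = (-1) ^ (j + 1) * k := by exact_mod_cast hm.sin_eq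
  have e2 : ω * Real.cos k = (-1) ^ (j + 1) * l := by exact_mod_cast hm.cos_eq
  have hd := (hasDerivAt_sinc k0.ne').const_mul ((-1 : ℝ) ^ (j + 1))
  have ed : ((-1 : ℝ) ^ (j + 1)) * ((k * Real.cos k - Real.sin k) / k ^ 2) = (l - 1) / (ω * k) := by
    have h3 := neg_one_pow_mul_self (j + 1)
    field_simp
    linear_combination (-1) ^ (j + 1) * (k * e2 - e1) + k * (l - 1) * h3
  rw [ed] at hd
  have hne : l - 1 ≠ 0 := fun e => h.cos_ne hj (mul_left_cancel₀ ω0.ne'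
    (by linear_combination k * e2 - e1 + (-1) ^ (j + 1) * k * e))
  have pos : 0 < ω * k := mul_pos ω0 k0
  have h1 := h.1
  cases t
  · simp only [Bool.false_eq_true, if_false] at h1 ⊢
    have := hb.anti.antitoneOn.derivWithin_nonpos (x := k)
    rw [hd.hasDerivWithinAt.derivWithin (uniqueDiffOn_Icc hb.lt_right k ⟨h1.1.le, h1.2.le⟩)] at this
    have := lt_of_le_of_ne (nonpos_of_mul_nonpos_left (by rwa [div_eq_mul_inv] at this)
      (inv_pos.2 pos)) hne
    linarith
  · simp only [if_true] at h1 ⊢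
    have := hb.mono.monotoneOn.derivWithin_nonneg (x := k)
    rw [hd.hasDerivWithinAt.derivWithin (uniqueDiffOn_Icc (hb.left_lt (ht rfl)) k
      ⟨h1.1.le, h1.2.le⟩)] at this
    have := lt_of_le_of_ne (nonneg_of_mul_nonneg_left (by rwa [div_eq_mul_inv] at this)
      (inv_pos.2 pos)) hne.symm
    linarith

lemma lamOsc_injective {ω : ℝ} {i j : ℕ} {s t : Bool} (hi : 1 ≤ i) (hiω : omegaThr i < ω)
    (hs : s = true → 2 ≤ i) (hj : 1 ≤ j) (hjω : omegaThr j < ω) (ht : t = true → 2 ≤ j)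
    (h : lamOsc ω i s = lamOsc ω j t) : i = j ∧ s = t := by
  have h1 := isOsc_kappaOsc hi hiω hs
  have h2 := isOsc_kappaOsc hj hjω ht
  have e : kappaOsc ω i s = kappaOsc ω j t := by
    have e1 := (isMode_osc hi hiω hs).sq_add_sq
    have e2 := (isMode_osc hj hjω ht).sq_add_sq
    rw [h] at e1
    have e3 : kappaOsc ω i s ^ 2 = kappaOsc ω j t ^ 2 := by
      exact_mod_cast (show (kappaOsc ω i s : ℂ) ^ 2 = (kappaOsc ω j t : ℂ) ^ 2 by
        linear_combination e1 - e2)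
    exact (pow_left_inj₀ (h1.pos hi).le (h2.pos hj).le two_ne_zero).1 e3
  have b1 := h1.mem_Ioo hi
  have b2 := h2.mem_Ioo hj
  rw [e] at b1
  have pi0 := pi_pos
  have ij : i = j := by
    have c1 : (i : ℝ) - 1 < j := lt_of_mul_lt_mul_right (b1.1.trans b2.2) pi0.le
    have c2 : (j : ℝ) - 1 < i := lt_of_mul_lt_mul_right (b2.1.trans b1.2) pi0.le
    have c3 : i < j + 1 := by exact_mod_cast (by linarith : (i : ℝ) < j + 1)
    have c4 : j < i + 1 := by exact_mod_cast (by linarith : (j : ℝ) < i + 1)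
    omega
  refine ⟨ij, ?_⟩
  subst ij
  have g1 := sign_lamOsc hi hiω hs
  have g2 := sign_lamOsc hi hjω ht
  rw [h] at g1
  cases s <;> cases t <;> simp_all <;> linarith

section

variable {N : ℕ}

lemma Channel.spec (c : Channel N) : 1 ≤ c.1.1 ∧ c.1.1 ≤ N ∧ (c.1.2 = true → 2 ≤ c.1.1) := by
  have h := c.2
  rw [Finset.mem_erase, Finset.mem_product, Finset.mem_Icc] at h
  refine ⟨h.2.1.1, h.2.1.2, fun e => ?_⟩
  have : c.1.1 ≠ 1 := fun e' => h.1 (Prod.ext e' e)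
  have := h.2.1.1
  omega

lemma Channel.exists_eq {j : ℕ} {t : Bool} (hj : 1 ≤ j) (hjN : j ≤ N) (ht : t = true → 2 ≤ j) :
    ∃ c : Channel N, c.1 = (j, t) := by
  refine ⟨⟨(j, t), ?_⟩, rfl⟩
  rw [Finset.mem_erase, Finset.mem_product, Finset.mem_Icc]
  refine ⟨fun e => ?_, ⟨hj, hjN⟩, Finset.mem_univ _⟩
  have := ht (congrArg Prod.snd e)
  have : j = 1 := congrArg Prod.fst e
  omega

lemma Channel.dagger_cases (hN : 2 ≤ N) (c : Channel N) :
    c = daggerChannel hN 0 ∨ c = daggerChannel hN 1 ∨ c.1.1 ≠ N := by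
  by_cases h : c.1.1 = N
  · rcases ht : c.1.2 with _ | _
    · exact Or.inr (Or.inl (Subtype.ext (Prod.ext h ht)))
    · exact Or.inl (Subtype.ext (Prod.ext h ht))
  · exact Or.inr (Or.inr h)

lemma daggerChannel_ne (hN : 2 ≤ N) : daggerChannel hN 0 ≠ daggerChannel hN 1 := fun e =>
  absurd (congrArg (fun c => c.1.2) e) (by simp [daggerChannel])

lemma sum_channel {M : Type*} [AddCommMonoid M] (hN : 2 ≤ N) (f : Channel N → M)
    (hf : ∀ c, c.1.1 ≠ N → f c = 0) :
    ∑ c, f c = f (daggerChannel hN 0) + f (daggerChannel hN 1) :=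
  Fintype.sum_eq_add _ _ (daggerChannel_ne hN) fun c hc =>
    hf c (((Channel.dagger_cases hN c).resolve_left hc.1).resolve_left hc.2)

/-- The wave vector of the mode attached to a channel: `λ_j^±` for `j < N`, and `λ_±` for the
channels `(N, ±)`. -/
def modeLam (ε : ℝ) (lam : ℂ) (c : Channel N) : ℂ :=
  if c.1.1 = N then (if c.1.2 then lam else (starRingEnd ℂ) lam)
  else lamOsc (omegaEps N ε) c.1.1 c.1.2

/-- The transversal wave number of the mode attached to a channel. -/
def modeKappa (ε : ℝ) (lam : ℂ) (c : Channel N) : ℂ :=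
  if c.1.1 = N then (if c.1.2 then kappaOf N ε lam else (starRingEnd ℂ) (kappaOf N ε lam))
  else kappaOsc (omegaEps N ε) c.1.1 c.1.2

/-- The normalizing factor of an oscillatory wave. -/
def oscFactor (ω : ℝ) (j : ℕ) (t : Bool) : ℝ := √ω / √|lamOsc ω j t - 1|

/-- The coefficient of `w_N⁺` in the wave `𝐰_N^±`. -/
def thrCoef (N : ℕ) (ε : ℝ) (lam : ℂ) (t : Bool) : ℂ :=
  if t then alpha1 N ε lam else alpha2 N ε lam

/-- The coefficients of the waves of the channels with respect to the modes. -/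
def modeCoef (ε : ℝ) (lam : ℂ) : Matrix (Channel N) (Channel N) ℂ := fun c m =>
  if c.1.1 = N then (if m.1.1 = N then
    (if m.1.2 then thrCoef N ε lam c.1.2 else (starRingEnd ℂ) (thrCoef N ε lam c.1.2)) else 0)
  else if c = m then (oscFactor (omegaEps N ε) c.1.1 c.1.2 : ℂ) else 0

lemma modeCoef_thr (hN : 2 ≤ N) {ε : ℝ} {lam : ℂ} {c : Channel N} (h : c.1.1 = N) :
    modeCoef ε lam c (daggerChannel hN 0) = thrCoef N ε lam c.1.2 ∧
    modeCoef ε lam c (daggerChannel hN 1) = conj (thrCoef N ε lam c.1.2) ∧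
    ∀ m : Channel N, m.1.1 ≠ N → modeCoef ε lam c m = 0 := by
  refine ⟨by simp [modeCoef, h, daggerChannel], by simp [modeCoef, h, daggerChannel],
    fun m hm => by simp [modeCoef, h, hm]⟩

lemma modeCoef_osc {ε : ℝ} {lam : ℂ} {c : Channel N} (h : c.1.1 ≠ N) (m : Channel N) :
    modeCoef ε lam c m = if c = m then (oscFactor (omegaEps N ε) c.1.1 c.1.2 : ℂ) else 0 :=
  if_neg h

lemma mode_dagger (hN : 2 ≤ N) (ε : ℝ) (lam : ℂ) :
    modeLam ε lam (daggerChannel hN 0) = lam ∧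
    modeLam ε lam (daggerChannel hN 1) = conj lam ∧
    modeKappa ε lam (daggerChannel hN 0) = kappaOf N ε lam ∧
    modeKappa ε lam (daggerChannel hN 1) = conj (kappaOf N ε lam) := by
  simp [modeLam, modeKappa, daggerChannel]

lemma oscFactor_sq {ω : ℝ} (hω : 0 < ω) {j : ℕ} {t : Bool}
    (h : 0 < (if t then 1 else -1) * (lamOsc ω j t - 1)) :
    oscFactor ω j t * oscFactor ω j t * ((lamOsc ω j t - 1) / ω) = if t then 1 else -1 := by
  have h0 : lamOsc ω j t - 1 ≠ 0 := fun e => by simp [e] at h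
  have h1 : 0 < |lamOsc ω j t - 1| := abs_pos.2 h0
  rw [oscFactor, div_mul_div_comm, Real.mul_self_sqrt hω.le, Real.mul_self_sqrt h1.le]
  cases t
  · simp only [Bool.false_eq_true, if_false] at h ⊢
    rw [abs_of_neg (by linarith)]
    field_simp
  · simp only [if_true] at h ⊢
    rw [abs_of_pos (by linarith)]
    field_simp

/-- The modes attached to the channels form a frame for the waves of the channels. -/
lemma modeFrame (hN : 2 ≤ N) {ε γ a' : ℝ} {lam : ℂ} (hε : 0 ≤ ε) (ha : a' ≤ 1 / 50)
    (haγ : a' ≤ γ) (hlow : ∀ j, 1 ≤ j → j < N → omegaThr j < omegaEps N ε)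
    (h : ThresholdMode N ε a' lam) (hc : ThresholdCoefs N ε lam) :
    ModeFrame (omegaEps N ε) γ channelSign (channelWave N ε lam) (fun c => c.1.1)
      (modeLam ε lam) (modeKappa ε lam) (modeCoef ε lam) := by
  have ω0 := omegaEps_pos (by omega : 1 ≤ N) hε
  have hk := h.kappa_ne hN ha
  have low : ∀ c : Channel N, c.1.1 ≠ N → omegaThr c.1.1 < omegaEps N ε := fun c hcN =>
    hlow _ c.spec.1 (lt_of_le_of_ne c.spec.2.1 hcN)
  have osc : ∀ c : Channel N, c.1.1 ≠ N →
      modeLam ε lam c = lamOsc (omegaEps N ε) c.1.1 c.1.2 ∧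
      modeKappa ε lam c = kappaOsc (omegaEps N ε) c.1.1 c.1.2 := fun c hcN =>
    ⟨if_neg hcN, if_neg hcN⟩
  have sgn : ∀ c : Channel N, c.1.1 ≠ N → _ := fun c hcN =>
    sign_lamOsc c.spec.1 (low c hcN) c.spec.2.2
  obtain ⟨l0, l1, k0, k1⟩ := mode_dagger hN ε lam
  have hγ : |lam.im| < γ := by
    have : |lam.im| ≤ ‖lam - 1‖ := by simpa using Complex.abs_im_le_norm (lam - 1)
    linarith [h.dist_lam]
  have wosc : ∀ c : Channel N, c.1.1 ≠ N → channelWave N ε lam c =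
      (oscFactor (omegaEps N ε) c.1.1 c.1.2 : ℂ) • expWave c.1.1 (modeLam ε lam c)
        (modeKappa ε lam c) := fun c hcN => by
    rw [channelWave, if_neg hcN, oscWave, (osc c hcN).1, (osc c hcN).2, oscFactor]
  have wthr : ∀ c : Channel N, c.1.1 = N →
      channelWave N ε lam c = twin N ε lam (thrCoef N ε lam c.1.2) := fun c hcN => by
    rw [channelWave, if_pos hcN]
    rcases c.1.2 with _ | _
    · exact hc.wave_false
    · exact hc.wave_true
  constructor
  · intro c
    rcases Channel.dagger_cases hN c with rfl | rfl | hcN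
    · rw [l0, k0]; exact h.mode
    · rw [l1, k1]; exact h.mode.conj
    · rw [(osc c hcN).1, (osc c hcN).2]
      exact isMode_osc c.spec.1 (low c hcN) c.spec.2.2
  · intro c
    rcases Channel.dagger_cases hN c with rfl | rfl | hcN
    · rwa [k0]
    · rw [k1]; exact (map_ne_zero _).2 hk
    · rw [(osc c hcN).2]
      exact ofReal_ne_zero.2
        ((isOsc_kappaOsc c.spec.1 (low c hcN) c.spec.2.2).pos c.spec.1).ne'
  · have him := h.im_pos
    have r : ∀ c : Channel N, c.1.1 ≠ N → (modeLam ε lam c).im = 0 := fun c hcN => by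
      rw [(osc c hcN).1, Complex.ofReal_im]
    intro c c' e
    have ei := congrArg Complex.im e
    rcases Channel.dagger_cases hN c with rfl | rfl | hcN <;>
      rcases Channel.dagger_cases hN c' with rfl | rfl | hcN' <;>
      (try have z1 := r c hcN) <;> (try have z2 := r c' hcN') <;>
      (try simp only [l0, l1, conj_im] at ei) <;> try first | rfl | (exfalso; linarith)
    rw [(osc c hcN).1, (osc c' hcN').1] at e
    have := lamOsc_injective c.spec.1 (low c hcN) c.spec.2.2 c'.spec.1 (low c' hcN') c'.spec.2.2
      (Complex.ofReal_injective e)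
    exact Subtype.ext (Prod.ext this.1 this.2)
  · intro c e
    have ei := congrArg Complex.im e
    have him := h.im_pos
    rcases Channel.dagger_cases hN c with rfl | rfl | hcN
    · rw [l0, Complex.one_im] at ei; linarith
    · rw [l1, Complex.one_im, conj_im] at ei; linarith
    · rw [(osc c hcN).1] at e
      have := sgn c hcN
      rw [show lamOsc (omegaEps N ε) c.1.1 c.1.2 = 1 by exact_mod_cast e] at this
      simp at this
  · intro c
    rcases Channel.dagger_cases hN c with rfl | rfl | hcN
    · rwa [l0]
    · rwa [l1, conj_im, abs_neg]
    · rw [(osc c hcN).1, Complex.ofReal_im, abs_zero]; exact (abs_nonneg _).trans_lt hγ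
  · have gosc : ∀ c c' : Channel N, c.1.1 ≠ N → ∑ m, modeCoef ε lam c m * modeCoef ε lam c' m *
        (I * (modeLam ε lam m - 1) / omegaEps N ε) =
        if c = c' then (if channelSign c then I else -I) else 0 := by
      intro c c' hcN
      simp only [modeCoef_osc hcN, ite_mul, zero_mul, Finset.sum_ite_eq, Finset.mem_univ, if_true]
      by_cases e : c = c'
      · subst e
        have t := congrArg (fun r : ℝ => (r : ℂ)) (oscFactor_sq ω0 (sgn c hcN))
        rw [modeCoef_osc hcN, if_pos rfl, if_pos rfl, (osc c hcN).1, channelSign]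
        cases hs : c.1.2 <;> simp only [hs, if_true, Bool.false_eq_true, if_false] at t ⊢ <;>
          push_cast at t <;> linear_combination I * t
      · rw [if_neg e]
        by_cases hc'N : c'.1.1 = N
        · rw [(modeCoef_thr hN hc'N).2.2 c hcN, mul_zero, zero_mul]
        · rw [modeCoef_osc hc'N, if_neg (Ne.symm e), mul_zero, zero_mul]
    intro c c'
    by_cases hcN : c.1.1 = N
    swap
    · exact gosc c c' hcN
    by_cases hcN' : c'.1.1 = N
    swap
    · rw [Finset.sum_congr rfl fun m _ => by rw [mul_comm (modeCoef ε lam c m)], gosc c' c hcN']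
      have : c ≠ c' := fun e => hcN' (e ▸ hcN)
      rw [if_neg this, if_neg this.symm]
    obtain ⟨a0, a1, a2⟩ := modeCoef_thr hN (ε := ε) (lam := lam) hcN
    obtain ⟨b0, b1, -⟩ := modeCoef_thr hN (ε := ε) (lam := lam) hcN'
    rw [sum_channel hN _ fun m hm => by rw [a2 m hm, zero_mul, zero_mul], a0, a1, b0, b1, l0, l1]
    have key : ∀ z z' : ℂ, z * z' * (I * (lam - 1) / omegaEps N ε) +
        conj z * conj z' *
          (I * (conj lam - 1) / omegaEps N ε) =
        I * ((2 * (z * z' * ((lam - 1) / omegaEps N ε)).re : ℝ) : ℂ) := by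
      intro z z'
      rw [← Complex.add_conj]
      simp only [map_mul, map_div₀, map_sub, map_one, conj_ofReal]
      ring
    rw [key]
    have cc' : c = c' ↔ c.1.2 = c'.1.2 :=
      ⟨fun e => by rw [e], fun e => Subtype.ext (Prod.ext (hcN.trans hcN'.symm) e)⟩
    have f1 := hc.flux_true
    have f2 := hc.flux_false
    have f3 := hc.flux_mixed
    have fin : ∀ t t' : Bool, I * ((2 * (thrCoef N ε lam t * thrCoef N ε lam t' *
        ((lam - 1) / omegaEps N ε)).re : ℝ) : ℂ) =
        if t = t' then (if t then I else -I) else 0 := by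
      rintro (_ | _) (_ | _) <;>
        simp only [thrCoef, Bool.false_eq_true, Bool.true_eq_false, if_true, if_false]
      · rw [f2]; push_cast; ring
      · rw [mul_comm (alpha2 N ε lam), f3]; simp
      · rw [f3]; simp
      · rw [f1]; push_cast; ring
    rw [fin]
    by_cases e : c = c'
    · rw [if_pos e, if_pos (cc'.1 e)]; rfl
    · rw [if_neg e, if_neg fun e' => e (cc'.2 e')]
  · intro c
    by_cases hcN : c.1.1 = N
    · obtain ⟨a0, a1, a2⟩ := modeCoef_thr hN (ε := ε) (lam := lam) hcN
      ext p : 1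
      rw [wthr c hcN, comb, sum_channel hN _ fun m hm => by rw [a2 m hm, zero_smul], a0, a1, l0, l1,
        k0, k1]
      simp only [twin, Pi.add_apply, Pi.smul_apply, thrWave, h.kappa_conj]
      rfl
    · ext p : 1
      rw [wosc c hcN]
      simp only [comb, modeCoef_osc hcN, ite_smul, zero_smul, Finset.sum_ite_eq, Finset.mem_univ,
        if_true, Pi.smul_apply]
  · intro c
    by_cases hcN : c.1.1 = N
    · obtain ⟨a0, a1, a2⟩ := modeCoef_thr hN (ε := ε) (lam := lam) hcN
      ext p : 1
      rw [wthr c hcN, comb, sum_channel hN _ fun m hm => by rw [a2 m hm, map_zero, zero_smul], a0,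
        a1, l0, l1, k0, k1, add_comm]
      simp only [twin, Pi.add_apply, Pi.smul_apply, thrWave, h.kappa_conj, conj_conj]
      rfl
    · ext p : 1
      rw [wosc c hcN]
      simp only [comb, modeCoef_osc hcN, apply_ite (starRingEnd ℂ), map_zero, conj_ofReal,
        ite_smul, zero_smul, Finset.sum_ite_eq, Finset.mem_univ, if_true, Pi.smul_apply,
        (osc c hcN).1, (osc c hcN).2]

end

/-! ### The criterion for trapped modes -/

section

variable {N : ℕ}

lemma daggerChannel_val (hN : 2 ≤ N) : channelSign (daggerChannel hN 0) = true ∧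
    channelSign (daggerChannel hN 1) = false ∧ (daggerChannel hN 0).1.1 = N ∧
    (daggerChannel hN 1).1.1 = N := ⟨rfl, rfl, rfl, rfl⟩

/-- The amplitudes of the modes in a combination of waves: an oscillatory wave is a multiple of a
single mode, the threshold waves share the two modes of `λ_±`. -/
lemma vecMul_modeCoef (hN : 2 ≤ N) {ε : ℝ} {lam : ℂ} (hε : 0 ≤ ε)
    (hlow : ∀ j, 1 ≤ j → j < N → omegaThr j < omegaEps N ε) (a : Channel N → ℂ) :
    (∀ m, m.1.1 ≠ N → (vecMul a (modeCoef ε lam) m = 0 ↔ a m = 0)) ∧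
    vecMul a (modeCoef ε lam) (daggerChannel hN 0) =
      a (daggerChannel hN 0) * alpha1 N ε lam + a (daggerChannel hN 1) * alpha2 N ε lam ∧
    vecMul a (modeCoef ε lam) (daggerChannel hN 1) =
      a (daggerChannel hN 0) * conj (alpha1 N ε lam) +
        a (daggerChannel hN 1) * conj (alpha2 N ε lam) := by
  have ω0 := omegaEps_pos (by omega : 1 ≤ N) hε
  obtain ⟨a0, a1, -⟩ := modeCoef_thr hN (ε := ε) (lam := lam) (daggerChannel_val hN).2.2.1
  obtain ⟨b0, b1, -⟩ := modeCoef_thr hN (ε := ε) (lam := lam) (daggerChannel_val hN).2.2.2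
  have z : ∀ i, ∀ c : Channel N, c.1.1 ≠ N →
      a c * modeCoef ε lam c (daggerChannel hN i) = 0 := fun i c hc => by
    rw [modeCoef_osc hc, if_neg, mul_zero]
    rintro rfl
    exact hc (by fin_cases i <;> rfl)
  refine ⟨fun m hm => ?_, ?_, ?_⟩
  · have e : vecMul a (modeCoef ε lam) m =
        a m * (oscFactor (omegaEps N ε) m.1.1 m.1.2 : ℂ) := by
      rw [vecMul, dotProduct, Finset.sum_eq_single m]
      · rw [modeCoef_osc hm, if_pos rfl]
      · intro c _ hcm
        by_cases hc : c.1.1 = N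
        · rw [(modeCoef_thr hN hc).2.2 m hm, mul_zero]
        · rw [modeCoef_osc hc, if_neg hcm, mul_zero]
      · exact fun h => absurd (Finset.mem_univ m) h
    have hs := sign_lamOsc m.spec.1 (hlow _ m.spec.1 (lt_of_le_of_ne m.spec.2.1 hm)) m.spec.2.2
    have h0 : lamOsc (omegaEps N ε) m.1.1 m.1.2 - 1 ≠ 0 := fun e => by simp [e] at hs
    have : oscFactor (omegaEps N ε) m.1.1 m.1.2 ≠ 0 :=
      div_ne_zero (Real.sqrt_pos.2 ω0).ne' (Real.sqrt_pos.2 (abs_pos.2 h0)).ne'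
    rw [e, mul_eq_zero, or_iff_left (ofReal_ne_zero.2 this)]
  · rw [vecMul, dotProduct, sum_channel hN _ (z 0), a0, b0]; rfl
  · rw [vecMul, dotProduct, sum_channel hN _ (z 1), a1, b1]; rfl

/-- Linear algebra of the criterion: a trapped mode involves only the waves of the channels
`(N, ±)`, since by conservation of energy the incoming and outgoing amplitudes have the same
norm. -/
lemma exists_amplitude_iff (hN : 2 ≤ N) {ε : ℝ} {lam : ℂ} (hε : 0 ≤ ε)
    (hlow : ∀ j, 1 ≤ j → j < N → omegaThr j < omegaEps N ε) (him : 0 < lam.im)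
    (h2 : alpha2 N ε lam ≠ 0) (hd : ‖dCoef N ε lam‖ = 1)
    {S : Matrix (Channel N) (Channel N) ℂ}
    (hS : ∀ x : Channel N → ℂ, ∑ c, ‖x c‖ ^ 2 = ∑ c, ‖vecMul x S c‖ ^ 2) :
    (∃ x : Channel N → ℂ, x ≠ 0 ∧
      (∀ m : Channel N, 0 ≤ (modeLam ε lam m).im → vecMul (fun c =>
        if channelSign c then x c else vecMul x S c) (modeCoef ε lam) m = 0) ∧
      (∀ m : Channel N, (modeLam ε lam m).im ≤ 0 → vecMul (fun c =>
        if channelSign c then vecMul x S c else x c) (modeCoef ε lam) m = 0)) ↔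
    (daggerBlock hN S + dCoef N ε lam • swapMatrix).det = 0 := by
  set d := dCoef N ε lam with hdd
  set p := daggerChannel hN 0 with hp
  set q := daggerChannel hN 1 with hq
  obtain ⟨sp, sq, -, -⟩ := daggerChannel_val hN
  obtain ⟨lp, lq, -, -⟩ := mode_dagger hN ε lam
  have hα : alpha1 N ε lam = d * alpha2 N ε lam := by rw [hdd, dCoef, div_mul_cancel₀ _ h2]
  have dd : d * conj d = 1 := by
    rw [Complex.mul_conj, Complex.normSq_eq_norm_sq, hd]; simp
  have d0 : d ≠ 0 := left_ne_zero_of_mul_eq_one dd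
  have loscim : ∀ m : Channel N, m.1.1 ≠ N → (modeLam ε lam m).im = 0 := fun m hm => by
    rw [modeLam, if_neg hm, Complex.ofReal_im]
  -- the conditions at the two ends
  have right : ∀ a : Channel N → ℂ,
      (∀ m, 0 ≤ (modeLam ε lam m).im → vecMul a (modeCoef ε lam) m = 0) ↔
        (∀ m, m.1.1 ≠ N → a m = 0) ∧ a p * d + a q = 0 := by
    intro a
    obtain ⟨h3, h4, -⟩ := vecMul_modeCoef hN (lam := lam) hε hlow a
    rw [hα] at h4
    constructor
    · intro h
      refine ⟨fun m hm => (h3 m hm).1 (h m (loscim m hm).ge), ?_⟩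
      have := h p (by rw [lp]; exact him.le)
      rw [h4] at this
      exact (mul_eq_zero.1 (by linear_combination this)).resolve_right h2
    · rintro ⟨h5, h6⟩ m hm
      rcases Channel.dagger_cases hN m with rfl | rfl | hmN
      · rw [h4]; linear_combination alpha2 N ε lam * h6
      · rw [lq, conj_im] at hm; linarith
      · exact (h3 m hmN).2 (h5 m hmN)
  have left : ∀ a : Channel N → ℂ,
      (∀ m, (modeLam ε lam m).im ≤ 0 → vecMul a (modeCoef ε lam) m = 0) ↔
        (∀ m, m.1.1 ≠ N → a m = 0) ∧ a p + d * a q = 0 := by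
    intro a
    obtain ⟨h3, -, h4⟩ := vecMul_modeCoef hN (lam := lam) hε hlow a
    rw [hα, map_mul] at h4
    have c0 : conj (alpha2 N ε lam) ≠ 0 := (map_ne_zero _).2 h2
    constructor
    · intro h
      refine ⟨fun m hm => (h3 m hm).1 (h m (loscim m hm).le), ?_⟩
      have := h q (by rw [lq, conj_im]; linarith)
      rw [h4] at this
      refine (mul_eq_zero.1 (?_ : (a p + d * a q) * conj (alpha2 N ε lam) = 0)).resolve_right
        c0
      linear_combination d * this - a p * conj (alpha2 N ε lam) * dd
    · rintro ⟨h5, h6⟩ m hm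
      rcases Channel.dagger_cases hN m with rfl | rfl | hmN
      · rw [lp] at hm; linarith
      · rw [h4]
        linear_combination (starRingEnd ℂ) d * conj (alpha2 N ε lam) * h6 -
          a q * conj (alpha2 N ε lam) * dd
      · exact (h3 m hmN).2 (h5 m hmN)
  have osc : ∀ {f g : Channel N → ℂ},
      ((∀ m, m.1.1 ≠ N → (if channelSign m then f m else g m) = 0) ∧
        ∀ m, m.1.1 ≠ N → (if channelSign m then g m else f m) = 0) ↔
      ∀ m, m.1.1 ≠ N → f m = 0 ∧ g m = 0 := by
    intro f g
    refine ⟨fun h m hm => ?_, fun h => ⟨fun m hm => ?_, fun m hm => ?_⟩⟩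
    · have e1 := h.1 m hm
      have e2 := h.2 m hm
      split_ifs at e1 e2 with hs
      · exact ⟨e1, e2⟩
      · exact ⟨e2, e1⟩
    all_goals have := h m hm; split_ifs <;> tauto
  -- in terms of the amplitudes in the channels `(N, ±)`
  have block : ∀ x : Channel N → ℂ, (∀ m, m.1.1 ≠ N → x m = 0) → ∀ c,
      vecMul x S c = x p * S p c + x q * S q c := fun x hx c => by
    rw [vecMul, dotProduct, sum_channel hN _ fun m hm => by rw [hx m hm, zero_mul]]
  have vm : ∀ v : Fin 2 → ℂ, vecMul v (daggerBlock hN S + d • swapMatrix) =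
      ![v 0 * S p p + v 1 * S q p + d * v 1, v 0 * S p q + v 1 * S q q + d * v 0] := by
    intro v
    ext i
    fin_cases i <;> simp [vecMul, dotProduct, Fin.sum_univ_two, daggerBlock, swapMatrix,
      hp, hq] <;> ring
  rw [← Matrix.exists_vecMul_eq_zero_iff]
  constructor
  · rintro ⟨x, x0, h3, h4⟩
    obtain ⟨h3, h5⟩ := (right _).1 h3
    obtain ⟨h4, h6⟩ := (left _).1 h4
    have ho := osc.1 ⟨h3, h4⟩
    simp only [sp, sq, hp, hq, if_true, Bool.false_eq_true, if_false] at h5 h6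
    rw [← hp, ← hq, block x (fun m hm => (ho m hm).1)] at h5 h6
    refine ⟨![x p, x q], fun e => x0 (funext fun c => ?_), ?_⟩
    · rcases Channel.dagger_cases hN c with rfl | rfl | hc
      · exact congrFun e 0
      · exact congrFun e 1
      · exact (ho c hc).1
    · rw [vm]
      ext i
      fin_cases i
      · exact h6
      · exact (by linear_combination h5 : x p * S p q + x q * S q q + d * x p = 0)
  · rintro ⟨v, v0, hv⟩
    rw [vm] at hv
    have e0 : v 0 * S p p + v 1 * S q p + d * v 1 = 0 := congrFun hv 0
    have e1 : v 0 * S p q + v 1 * S q q + d * v 0 = 0 := congrFun hv 1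
    have qp : q ≠ p := (daggerChannel_ne hN).symm
    set x : Channel N → ℂ := fun c => if c = p then v 0 else if c = q then v 1 else 0 with hx
    have xp : x p = v 0 := if_pos rfl
    have xq : x q = v 1 := by simp [hx, qp]
    have xo : ∀ m, m.1.1 ≠ N → x m = 0 := fun m hm => by
      simp only [hx]
      rw [if_neg, if_neg] <;> rintro rfl <;> exact hm rfl
    have yp : vecMul x S p = -(d * v 1) := by
      rw [block x xo, xp, xq]; linear_combination e0
    have yq : vecMul x S q = -(d * v 0) := by
      rw [block x xo, xp, xq]; linear_combination e1
    -- no energy is left for the other outgoing waves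
    have yo : ∀ m, m.1.1 ≠ N → vecMul x S m = 0 := by
      have h3 := hS x
      rw [sum_channel hN _ fun m hm => by rw [xo m hm, norm_zero]; norm_num] at h3
      have h4 := Finset.sum_erase_eq_sub (f := fun c => ‖vecMul x S c‖ ^ 2)
        (Finset.mem_univ p)
      have h5 := Finset.sum_erase_eq_sub (f := fun c => ‖vecMul x S c‖ ^ 2)
        (Finset.mem_erase.2 ⟨qp, Finset.mem_univ q⟩)
      rw [h4, ← h3, ← hp, ← hq, xp, xq, yp, yq, norm_neg, norm_neg, norm_mul, norm_mul, hd] at h5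
      have h6 := (Finset.sum_eq_zero_iff_of_nonneg fun c _ => sq_nonneg _).1 (h5.trans (by ring))
      intro m hm
      have := h6 m (Finset.mem_erase.2 ⟨by rintro rfl; exact hm rfl,
        Finset.mem_erase.2 ⟨by rintro rfl; exact hm rfl, Finset.mem_univ m⟩⟩)
      exact norm_eq_zero.1 (pow_eq_zero_iff two_ne_zero |>.1 this)
    have ho := osc.2 fun m hm => ⟨xo m hm, yo m hm⟩
    refine ⟨x, fun e => v0 ?_, (right _).2 ⟨ho.1, ?_⟩, (left _).2 ⟨ho.2, ?_⟩⟩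
    · ext i
      fin_cases i
      · exact xp.symm.trans (congrFun e p)
      · exact xq.symm.trans (congrFun e q)
    · simp only [hp, hq, sp, sq, if_true, Bool.false_eq_true, if_false]
      rw [← hp, ← hq, xp, yq]; ring
    · simp only [hp, hq, sp, sq, if_true, Bool.false_eq_true, if_false]
      rw [← hp, ← hq, xq, yp]; ring

/-- Near the real axis, the modes attached to the channels are the only ones. -/
lemma NearThreshold.exists_mode (hN : 2 ≤ N) {a ε : ℝ} {lam l κ : ℂ}
    (h : NearThreshold N a (omegaEps N ε) l κ) (hl : IsLambdaPlus N ε a lam)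
    (hsq : κ ^ 2 + l ^ 2 = (omegaEps N ε : ℂ) ^ 2) : ∃ m : Channel N, l = modeLam ε lam m := by
  rcases h with ⟨j, t, hj, hjN, ht, rfl⟩ | ⟨h1, h2, -⟩
  · obtain ⟨c, hc⟩ := Channel.exists_eq hj hjN.le ht
    refine ⟨c, ?_⟩
    rw [modeLam, if_neg (by rw [hc]; exact hjN.ne), hc]
  · obtain ⟨lp, lq, -, -⟩ := mode_dagger hN ε lam
    rcases (hl.roots l h1).1 (by rw [gFun_eq_of_sq hsq, h2]) with e | e
    · exact ⟨_, e.trans lp.symm⟩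
    · exact ⟨_, e.trans lq.symm⟩

/-- The bounds on the lines `Im λ = ∓γ`, uniform up to the threshold. -/
lemma exists_lineBound_threshold {a η γ ε₀ : ℝ} (hN : 2 ≤ N) (hγ : 0 < γ) (hγη : γ < η)
    (hγW : γ ≤ (omegaEps N ε₀ - 1) / 40) (h1 : 1 < omegaEps N ε₀) (hε₀ : 0 ≤ ε₀)
    (hη : ∀ ω : ℝ, omegaThr N - η < ω → ω ≤ omegaThr N → ∀ lam κ : ℂ, |lam.im| < η →
      |lam.re| ≤ 2 * ω → κ ^ 2 + lam ^ 2 = (ω : ℂ) ^ 2 → charFun lam κ = 0 →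
        NearThreshold N a ω lam κ)
    (hηε : omegaThr N - η < omegaEps N ε₀)
    (hroot : ∀ ε, 0 < ε → ε ≤ ε₀ → ∃ lam, IsLambdaPlus N ε a lam ∧ |lam.im| < γ) :
    ∃ K, ∀ ε, 0 < ε → ε ≤ ε₀ → ∀ s ∈ ({γ, -γ} : Set ℝ),
      LineBound (ι := Empty) (omegaEps N ε) s K isEmptyElim isEmptyElim := by
  have hN1 : 1 ≤ N := by omega
  have W0 := omegaThr_pos hN1
  obtain ⟨K, hK⟩ := exists_lineBound (ι := Empty) (T := Icc (omegaEps N ε₀) (omegaThr N))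
    (S := {γ, -γ}) (ω₀ := omegaEps N ε₀) (γ := γ) (a := isEmptyElim) (b := isEmptyElim) isCompact_Icc
    (Set.toFinite _).isCompact h1 (fun ω h => h.1)
    (by rintro s (rfl | rfl) <;> simp [abs_of_pos hγ]) hγW (fun i => i.elim) (fun i => i.elim) (by
      intro ω hω l κ hl hsq hre hc
      exfalso
      have him : |l.im| = γ := by
        rcases hl with h | h
        · rw [← abs_neg, h, abs_of_pos hγ]
        · rw [← abs_neg, h, abs_neg, abs_of_pos hγ]
      have ω0 : 0 < ω := (zero_lt_one.trans h1).trans_le hω.1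
      rcases hη ω (hηε.trans_le hω.1) hω.2 l κ (by rwa [him]) hre hsq hc with
        ⟨j, t, -, -, -, rfl⟩ | ⟨h2, h3, h4⟩
      · rw [Complex.ofReal_im, abs_zero] at him; linarith
      rcases hω.2.eq_or_lt with e | hlt
      · rw [h4 e, abs_zero] at him; linarith
      · set ε := ω⁻¹ - (omegaThr N)⁻¹ with hε
        have eω : omegaEps N ε = ω := by rw [omegaEps, hε, add_sub_cancel, inv_inv]
        have ε0 : 0 < ε := sub_pos.2 (inv_strictAnti₀ ω0 hlt)
        have εle : ε ≤ ε₀ := by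
          have := inv_anti₀ (zero_lt_one.trans h1) hω.1
          rw [omegaEps_inv] at this
          rw [hε]; linarith
        obtain ⟨lam, hlam, him'⟩ := hroot ε ε0 εle
        rw [← eω] at h3 hsq
        rcases (hlam.roots l h2).1 (by rw [gFun_eq_of_sq hsq, h3]) with rfl | rfl
        · linarith
        · rw [conj_im, abs_neg] at him; linarith)
  refine ⟨K, fun ε h2 h3 s hs => hK _ ⟨?_, (omegaEps_lt hN1 h2).le⟩ s hs⟩
  rw [← inv_le_inv₀ (omegaEps_pos hN1 h2.le) (omegaEps_pos hN1 hε₀), omegaEps_inv, omegaEps_inv]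
  linarith

end

end ZigzagRibbon

open ZigzagRibbon in
theorem mainTheorem3 (N : ℕ) (hN : 2 ≤ N) :
    ∃ a : ℝ, 0 < a ∧ ∃ γ₀ : ℝ, 0 < γ₀ ∧ ∀ γ : ℝ, 0 < γ → γ ≤ γ₀ →
      ∃ ε₀ : ℝ, 0 < ε₀ ∧ ∃ δ₀ : ℝ, 0 < δ₀ ∧ ∀ ε : ℝ, 0 < ε → ε ≤ ε₀ →
        ∃ lam : ℂ, ZigzagRibbon.IsLambdaPlus N ε a lam ∧
          ‖ZigzagRibbon.dCoef N ε lam‖ = 1 ∧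
          ∀ (R₀ : ℝ) (P : ℝ × ℝ → ℝ) (χ : Bool → ℝ → ℝ) (δ : ℝ), 0 < R₀ →
            ZigzagRibbon.IsPotential R₀ P → ZigzagRibbon.IsCutoffPair R₀ χ → |δ| ≤ δ₀ →
            ∃ S : Matrix (ZigzagRibbon.Channel N) (ZigzagRibbon.Channel N) ℂ,
              ZigzagRibbon.IsScatteringMatrix N ε lam γ δ P χ S ∧
              (∀ S', ZigzagRibbon.IsScatteringMatrix N ε lam γ δ P χ S' → S' = S) ∧
              ((∃ w, ZigzagRibbon.IsTrappedMode (ZigzagRibbon.omegaEps N ε) δ P w) ↔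
                (ZigzagRibbon.daggerBlock hN S +
                  ZigzagRibbon.dCoef N ε lam • ZigzagRibbon.swapMatrix).det = 0) := by
  have hN1 : 1 ≤ N := by omega
  have W0 := omegaThr_pos hN1
  have pi3 := Real.pi_gt_three
  have Kpi := kappaThr_gt_pi hN
  have W9 : 3 < omegaThr N := by
    have := omegaThr_sq hN1
    nlinarith
  obtain ⟨a, a0, ha⟩ := exists_isLambdaPlus hN
  obtain ⟨η, η0, hη⟩ := exists_nearThreshold hN a0
  refine ⟨a, a0, min (η / 2) (1 / 40), lt_min (by linarith) (by norm_num), fun γ hγ hγ0 => ?_⟩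
  have γη : γ < η := by linarith [hγ0.trans (min_le_left _ _)]
  have γ40 : γ ≤ 1 / 40 := hγ0.trans (min_le_right _ _)
  -- `λ_±` inside the strip `|Im λ| < γ`, and close enough to `1` for the signs of the fluxes
  set a' := min γ (1 / 50) with ha'
  have a'0 : 0 < a' := lt_min hγ (by norm_num)
  have tω := (tendsto_omegaEps hN1).mono_left (nhdsWithin_le_nhds (s := Ioi 0))
  have evlow : ∀ᶠ ε in 𝓝[>] (0 : ℝ), ∀ j ∈ Finset.Ico 1 N, omegaThr j < omegaEps N ε :=
    (Finset.eventually_all _).2 fun j hj =>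
      tω.eventually (lt_mem_nhds (omegaThr_strictMono (Finset.mem_Ico.1 hj).1
        (Finset.mem_Ico.1 hj).2))
  have ev := (ha a' a'0).and (evlow.and ((tω.eventually (lt_mem_nhds W9)).and
    (tω.eventually (lt_mem_nhds (by linarith : omegaThr N - η < omegaThr N)))))
  obtain ⟨e, e0, he⟩ := mem_nhdsGT_iff_exists_Ioc_subset.1 ev
  have hε₀ : ∀ ε, 0 < ε → ε ≤ e → _ := fun ε h1 h2 => he ⟨h1, h2⟩
  have im_lt : ∀ ε lam, ThresholdMode N ε a' lam → |lam.im| < γ := fun ε lam h => by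
    have : |lam.im| ≤ ‖lam - 1‖ := by simpa using Complex.abs_im_le_norm (lam - 1)
    linarith [h.dist_lam, min_le_left γ (1 / 50)]
  obtain ⟨-, -, ω3, ωη⟩ := hε₀ e e0 le_rfl
  obtain ⟨K, hK⟩ := exists_lineBound_threshold (a := a) (η := η) hN hγ γη (by linarith)
    (by linarith) (le_of_lt e0) hη ωη fun ε h1 h2 => by
      obtain ⟨⟨lam, h3, h4⟩, -⟩ := hε₀ ε h1 h2
      exact ⟨lam, h3, im_lt _ _ h4⟩
  have sq0 := sqrt_nonneg (2 * K)
  -- this bound on `δ` makes the potential a contraction relative to the resolvent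
  refine ⟨e, e0, (√(2 * K) + 1)⁻¹, by positivity, fun ε ε0 εe => ?_⟩
  obtain ⟨⟨lam, hl, hm⟩, hlow, ω3, ωη⟩ := hε₀ ε ε0 εe
  have hc := thresholdCoefs hN (min_le_right _ _) ε0.le (by nlinarith) hm
  have low : ∀ j, 1 ≤ j → j < N → omegaThr j < omegaEps N ε := fun j h1 h2 =>
    hlow j (Finset.mem_Ico.2 ⟨h1, h2⟩)
  have F := modeFrame hN ε0.le (min_le_right _ _) (min_le_left _ _) low hm hc
  have H := F.waveSystem hγ
  have B : SymbolBounds (omegaEps N ε) γ K (channelWave N ε lam) := {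
    plus := hK ε ε0 εe γ (by simp)
    minus := hK ε ε0 εe (-γ) (by simp)
    all := F.symbolBounds_all (by linarith) (by linarith) fun l k h1 h2 h3 h4 =>
      (hη _ ωη (omegaEps_lt hN1 ε0).le l k (h1.trans_lt γη) h3 h2 h4).exists_mode hN hl h2 }
  refine ⟨lam, hl, hc.norm_dCoef, fun R₀ P χ δ hR hP hχ hδ => ?_⟩
  have hd : √(2 * K) * |δ| < 1 := by
    have h1 : √(2 * K) * |δ| ≤ √(2 * K) * (√(2 * K) + 1)⁻¹ := mul_le_mul_of_nonneg_left hδ sq0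
    refine h1.trans_lt ?_
    rw [← div_eq_mul_inv, div_lt_one (by linarith)]
    linarith
  have hV := hP.isPot (δ := δ) hR
  obtain ⟨S, hS⟩ := exists_isScatMatrix H B hV hd
  refine ⟨S, (isScatteringMatrix_iff H hP hχ hR S).2 hS, fun S' hS' =>
    IsScatMatrix.unique H hV ((isScatteringMatrix_iff H hP hχ hR S').1 hS') hS, ?_⟩
  simp only [isTrappedMode_iff hP hR]
  rw [exists_trapped_iff H B hV hd hS]
  simp only [F.memLp_right_iff hR, F.memLp_left_iff hR]
  exact exists_amplitude_iff hN ε0.le low hm.im_pos hc.alpha_ne.2 hc.norm_dCoef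
    (hS.norm_eq H hV)

end
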